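/- Let $n\in\mathbb N$ and consider the PDE-ODE system, for $t\ge 0$, $z\in[0,1]$, $$\dot\xi=F\xi+b\,x_1(0,t),\quad x_2(0,t)=q_0x_1(0,t)+c^\top\xi(t),\quad \partial_t x=\Lambda(z)\partial_z x+A(z)x,\quad x_1(1,t)=q_1x_2(1,t)+u(t)\tag{S}$$ with $\xi(t)\in\mathbb R^n$, $x(z,t)\in\mathbb R^2$, $\Lambda=\mathrm{diag}(\lambda_1,-\lambda_2)$, where $\lambda_1,\lambda_2:[0,1]\to(0,\infty)$ are continuous (for instance, piecewise continuously differentiable) and $A_{ij}\in C([0,1])$. Assume (A1) that $(F,b)$ is controllable, i.e. $M_c=[b,Fb,\dots,F^{n-1}b]$ has rank $n$, and (A2) that $q_0\ne0$. Put $\phi_i(z)=\int_0^z\frac{d\zeta}{\lambda_i(\zeta)}$, $\tau_i=\phi_i(1)$, $\alpha_i(z)=\int_0^z\frac{A_{ii}}{\lambda_i}d\zeta$, $\tilde x=(e^{\alpha_1}x_1,e^{-\alpha_2}x_2)^\top$, $\tilde A_{12}=A_{12}e^{\alpha_1+\alpha_2}$, $\tilde A_{21}=A_{21}e^{-\alpha_1-\alpha_2}$,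 $\tilde A_{11}=\tilde A_{22}=0$, $\bar q_1=q_1e^{\alpha_1(1)+\alpha_2(1)}$, $h^\top=e_n^\top M_c^{-1}$, and let $T_c$ be the matrix with rows $h^\top,h^\top F,\dots,h^\top F^{n-1}$. Then there is a continuous kernel $K(z,\zeta)\in\mathbb R^{2\times2}$ on $0\le\zeta\le z\le1$ that solves, along characteristic curves, the kernel equations $\Lambda(z)\partial_zK+\partial_\zeta(K\Lambda(\zeta))=K\tilde A(\zeta)$, $K_{11}(z,0)=\frac{q_0\lambda_2(0)}{\lambda_1(0)}K_{12}(z,0)$, $K_{12}(z,z)=-\frac{\tilde A_{12}(z)}{\lambda_1(z)+\lambda_2(z)}$, $K_{21}(z,z)=\frac{\tilde A_{21}(z)}{\lambda_1(z)+\lambda_2(z)}$, $K_{22}(z,0)=\frac{\lambda_1(0)}{q_0\lambda_2(0)}K_{21}(z,0)$. For every such $K$ put $\bar x(z)=\tilde x(z)-\int_0^zK(z,\zeta)\tilde x(\zeta)d\zeta$, $C(z)=K(z,0)\Lambda(0)e_2c^\top$ and $\bar u=e^{\alpha_1(1)}u+\int_0^1(\bar q_1e_2^\top-e_1^\top)K(1,z)\tilde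 x(z)\,dz$. Let a state $(\xi,x)$ of (S) be a vector and a piecewise continuous profile on $[0,1]$ with $x_2(0)=q_0x_1(0)+c^\top\xi$, and let a state $(\eta,\eta_{n+1})$, $\eta=(\eta_1,\dots,\eta_n)$, be a vector and a piecewise continuous profile on $[-\tau_2,\tau_1]$. Given $(\eta,\eta_{n+1})$, set for $\tau\in[-\tau_2,\tau_1]$ $$y_i(\tau)=\sum_{k=i}^{n-1}\frac{(\tau+\tau_2)^{k-i}}{(k-i)!}\eta_{k+1}+\int_{-\tau_2}^{\tau}\frac{(\tau-\sigma)^{n-i-1}}{(n-i-1)!}\eta_{n+1}(\sigma)\,d\sigma\quad(0\le i<n),$$ $\hat\xi(\tau)=T_c^{-1}(y_0,\dots,y_{n-1})^\top(\tau)$, $\hat v_1(\tau)=\eta_{n+1}(\tau)-h^\top F^n\hat\xi(\tau)$, $\hat v_2=q_0\hat v_1+c^\top\hat\xi$. The two states correspond if $\xi=\hat\xi(0)$ and, for all $z\in[0,1]$, $$\bar x_1(z)=\hat v_1(\phi_1(z))-\int_0^z\frac{e_1^\top C(\zeta)}{\lambda_1(\zeta)}\hat\xi(\phi_1(z)-\phi_1(\zeta))d\zeta,\qquad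 \bar x_2(z)=\hat v_2(-\phi_2(z))+\int_0^z\frac{e_2^\top C(\zeta)}{\lambda_2(\zeta)}\hat\xi(\phi_2(\zeta)-\phi_2(z))d\zeta.$$ Then this correspondence is a bijection between the states $(\xi,x)$ and the states $(\eta,\eta_{n+1})$, and there are real numbers $a_0,\dots,a_n$ and a continuous function $a:[-\tau_2,\tau_1]\to\mathbb R$ such that the hyperbolic controller canonical form $$\dot\eta_i=\eta_{i+1}(t)\ (1\le i<n),\quad\dot\eta_n=\eta_{n+1}(-\tau_2,t),\quad\partial_t\eta_{n+1}(\tau,t)=\partial_\tau\eta_{n+1}(\tau,t),$$ $$\eta_{n+1}(\tau_1,t)=-\int_{-\tau_2}^{\tau_1}a(\tau)\eta_{n+1}(\tau,t)d\tau-\sum_{i=1}^na_{i-1}\eta_i(t)-a_n\eta_{n+1}(-\tau_2,t)+\bar u(t)\tag{H}$$ is an equivalent representation of (S): whenever $(\xi(t),x(\cdot,t))$ and $(\eta(t),\eta_{n+1}(\cdot,t))$ correspond, and $u(t)$ and $\bar u(t)$ are related as above, for every $t\ge0$, then $(\xi,x,u)$ is a solution of (S) on $[0,\infty)$ if and only if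 $(\eta,\eta_{n+1},\bar u)$ is a solution of (H) on $[0,\infty)$. (The ODEs are understood in integrated form, the transport equations integrated along all characteristic curves; profiles are piecewise continuous at each time, $\xi$ and $\eta$ are continuous in $t$, and $x$ is measurable and locally bounded in $(z,t)$.) In that case, with the flat output $y=h^\top\xi$ (and $y=x_1(0,\cdot)$ if $n=0$), the state of (H) is $$\eta_i(t)=y^{(i-1)}(t-\tau_2)\ (i=1,\dots,n,\ t\ge\tau_2),\qquad \eta_{n+1}(\tau,t)=y^{(n)}(t+\tau)\ (\tau\in[-\tau_2,\tau_1],\ t+\tau\ge0),$$ where $y$ is $n-1$ times continuously differentiable if $n\ge1$, and where for each $t\ge 0$ the last equation (with existence of the derivative) holds up to finitely many $\tau$. -/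

import Mathlib

open Set Filter Topology Matrix
open scoped Nat

/-- `f` is piecewise continuous on `[a, b]`: continuous up to finitely many points,
with finite one-sided limits everywhere. -/
def PiecewiseContinuousOn (f : ℝ → ℝ) (a b : ℝ) : Prop :=
  (∃ S : Set ℝ, S.Finite ∧ ∀ z ∈ Icc a b \ S, ContinuousWithinAt f (Icc a b) z) ∧
  (∀ z ∈ Ico a b, ∃ l, Tendsto f (𝓝[>] z) (𝓝 l)) ∧
  (∀ z ∈ Ioc a b, ∃ l, Tendsto f (𝓝[<] z) (𝓝 l))

/-- The data of a linear heterodirectional hyperbolic PDE-ODE system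
`ξ' = F ξ + b x₁(0,t)`, `x₂(0,t) = q₀ x₁(0,t) + cᵀ ξ`,
`∂ₜ x = Λ(z) ∂_z x + A(z) x`, `x₁(1,t) = q₁ x₂(1,t) + u(t)`, where `Λ = diag(λ₁, -λ₂)`.
The index `0 : Fin 2` stands for the first component `x₁`, the index `1 : Fin 2` for `x₂`. -/
structure PDEODESystem (n : ℕ) where
  F : Matrix (Fin n) (Fin n) ℝ
  b : Fin n → ℝ
  c : Fin n → ℝ
  q0 : ℝ
  q1 : ℝ
  lam : Fin 2 → ℝ → ℝ
  A : ℝ → Matrix (Fin 2) (Fin 2) ℝ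
  lam_continuousOn : ∀ i, ContinuousOn (lam i) (Icc 0 1)
  lam_pos : ∀ i, ∀ z ∈ Icc (0 : ℝ) 1, 0 < lam i z
  A_continuousOn : ∀ i j, ContinuousOn (fun z => A z i j) (Icc 0 1)

namespace PDEODESystem

noncomputable section

variable {n : ℕ} (P : PDEODESystem n)

/-! ### Travel times, controllability, flat output -/

/-- `φ_i(z) = ∫₀ᶻ dζ / λ_i(ζ)`. -/
def phi (i : Fin 2) (z : ℝ) : ℝ := ∫ ζ in (0 : ℝ)..z, 1 / P.lam i ζ

/-- The delay `τ₁ = φ₁(1)`. -/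
def tau1 : ℝ := P.phi 0 1

/-- The delay `τ₂ = φ₂(1)`. -/
def tau2 : ℝ := P.phi 1 1

/-- `Λ(z) = diag(λ₁(z), -λ₂(z))`, given by its diagonal. -/
def Lam (z : ℝ) : Fin 2 → ℝ := ![P.lam 0 z, -P.lam 1 z]

/-- The Kalman controllability matrix `M_c = [b, F b, …, F^(n-1) b]`. -/
def ctrbMatrix : Matrix (Fin n) (Fin n) ℝ :=
  Matrix.of fun i k => ((P.F ^ (k : ℕ)) *ᵥ P.b) i

/-- The pair `(F, b)` is controllable. -/
def Controllable : Prop := P.ctrbMatrix.rank = n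

/-- `hᵀ = e_nᵀ M_c⁻¹`, the last row of `M_c⁻¹`. -/
def h (j : Fin n) : ℝ :=
  P.ctrbMatrix⁻¹ ⟨n - 1, Nat.sub_lt (Nat.lt_of_le_of_lt (Nat.zero_le _) j.isLt) Nat.one_pos⟩ j

/-- `T_c`, with the rows `hᵀ, hᵀ F, …, hᵀ F^(n-1)`. -/
def Tc : Matrix (Fin n) (Fin n) ℝ :=
  Matrix.of fun i j => (P.h ᵥ* (P.F ^ (i : ℕ))) j

/-- The flat output `y(t) = hᵀ ξ(t)` (and `y(t) = x₁(0,t)` if there is no ODE). -/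
def flatOutput (ξ : ℝ → Fin n → ℝ) (x : ℝ → ℝ → Fin 2 → ℝ) (t : ℝ) : ℝ :=
  if n = 0 then x t 0 0 else P.h ⬝ᵥ ξ t

/-! ### The PDE-ODE system -/

/-- Admissible states `(ξ, x)` of the PDE-ODE system: `x` is a piecewise continuous profile on
`[0, 1]`, whose value at `z = 0` satisfies the boundary condition there. -/
structure IsState (ξ : Fin n → ℝ) (x : ℝ → Fin 2 → ℝ) : Prop where
  pc : ∀ i, PiecewiseContinuousOn (fun z => x z i) 0 1
  bc0 : x 0 1 = P.q0 * x 0 0 + P.c ⬝ᵥ ξ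

/-- `(ξ, x, u)` is a solution of the PDE-ODE system for `t ≥ 0`; `x t z i` is `x_{i+1}(z, t)`.
The ODE is integrated in time, and the two transport equations are integrated along all of their
characteristic curves `φ₁(ζ) + s = const`, `φ₂(ζ) - s = const` (`s` being the time), so that
profiles with jumps are admitted. -/
structure IsSolution (ξ : ℝ → Fin n → ℝ) (x : ℝ → ℝ → Fin 2 → ℝ) (u : ℝ → ℝ) : Prop where
  xi_continuousOn : ContinuousOn ξ (Ici 0)
  pc : ∀ t, 0 ≤ t → ∀ i, PiecewiseContinuousOn (fun z => x t z i) 0 1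
  measurable : ∀ i, Measurable fun p : Icc (0 : ℝ) 1 × Ici (0 : ℝ) => x p.2 p.1 i
  locally_bounded : ∀ T : ℝ, ∃ M : ℝ, ∀ t ∈ Icc 0 T, ∀ z ∈ Icc (0 : ℝ) 1, ∀ i, |x t z i| ≤ M
  ode : ∀ t, 0 ≤ t → ∀ i,
    ξ t i = ξ 0 i + ∫ s in (0 : ℝ)..t, ((P.F *ᵥ ξ s) i + P.b i * x s 0 0)
  bc0 : ∀ t, 0 ≤ t → x t 0 1 = P.q0 * x t 0 0 + P.c ⬝ᵥ ξ t
  pde1 : ∀ t, 0 ≤ t → ∀ z z', 0 ≤ z → z ≤ z' → z' ≤ 1 →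
    x (t + (P.phi 0 z' - P.phi 0 z)) z 0 = x t z' 0 +
      ∫ ζ in z..z', (P.A ζ *ᵥ x (t + (P.phi 0 z' - P.phi 0 ζ)) ζ) 0 / P.lam 0 ζ
  pde2 : ∀ t, 0 ≤ t → ∀ z z', 0 ≤ z → z ≤ z' → z' ≤ 1 →
    x (t + (P.phi 1 z' - P.phi 1 z)) z' 1 = x t z 1 +
      ∫ ζ in z..z', (P.A ζ *ᵥ x (t + (P.phi 1 ζ - P.phi 1 z)) ζ) 1 / P.lam 1 ζ
  bc1 : ∀ t, 0 ≤ t → x t 1 0 = P.q1 * x t 1 1 + u t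

/-! ### The preliminary transformations -/

/-- `α_i(z) = ∫₀ᶻ A_ii(ζ) / λ_i(ζ) dζ`. -/
def alpha (i : Fin 2) (z : ℝ) : ℝ := ∫ ζ in (0 : ℝ)..z, P.A ζ i i / P.lam i ζ

/-- `x̃(z) = E(z) x(z)` with `E(z) = diag(exp(α₁(z)), exp(-α₂(z)))`. -/
def scaled (x : ℝ → Fin 2 → ℝ) (z : ℝ) : Fin 2 → ℝ :=
  ![Real.exp (P.alpha 0 z) * x z 0, Real.exp (-P.alpha 1 z) * x z 1]

/-- The coupling matrix `Ã(z)` of the scaled system. -/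
def Atilde (z : ℝ) : Matrix (Fin 2) (Fin 2) ℝ :=
  !![0, P.A z 0 1 * Real.exp (P.alpha 0 z + P.alpha 1 z);
     P.A z 1 0 * Real.exp (-P.alpha 0 z - P.alpha 1 z), 0]

/-- `q̄₁ = q₁ exp(α₁(1) + α₂(1))`. -/
def q1bar : ℝ := P.q1 * Real.exp (P.alpha 0 1 + P.alpha 1 1)

/-- `K` is a continuous solution, on the triangle `0 ≤ ζ ≤ z ≤ 1`, of the kernel equations
`Λ(z) ∂_z K + ∂_ζ (K Λ(ζ)) = K Ã(ζ)` with their four boundary conditions. The equation for the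
entry `(i, j)`, multiplied by `Λ_j(ζ)`, is the differential equation of `K_ij Λ_j` along the
characteristic curves `z' = Λ_i(z)`, `ζ' = Λ_j(ζ)`, and is imposed in this form, because `K` need
not have partial derivatives. -/
structure IsKernel (K : ℝ → ℝ → Matrix (Fin 2) (Fin 2) ℝ) : Prop where
  continuousOn : ContinuousOn (fun p : ℝ × ℝ => K p.1 p.2) {p | 0 ≤ p.2 ∧ p.2 ≤ p.1 ∧ p.1 ≤ 1}
  pde : ∀ (i j : Fin 2) (r₀ r₁ : ℝ) (γ δ : ℝ → ℝ),
    (∀ r ∈ Icc r₀ r₁, 0 ≤ δ r ∧ δ r ≤ γ r ∧ γ r ≤ 1 ∧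
      HasDerivWithinAt γ (P.Lam (γ r) i) (Icc r₀ r₁) r ∧
      HasDerivWithinAt δ (P.Lam (δ r) j) (Icc r₀ r₁) r) →
    ∀ r ∈ Icc r₀ r₁,
      HasDerivWithinAt (fun r => K (γ r) (δ r) i j * P.Lam (δ r) j)
        (P.Lam (δ r) j * (K (γ r) (δ r) * P.Atilde (δ r)) i j) (Icc r₀ r₁) r
  bc11 : ∀ z ∈ Icc (0 : ℝ) 1, K z 0 0 0 = P.q0 * P.lam 1 0 / P.lam 0 0 * K z 0 0 1
  bc12 : ∀ z ∈ Icc (0 : ℝ) 1, K z z 0 1 = -(P.Atilde z 0 1 / (P.lam 0 z + P.lam 1 z))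
  bc21 : ∀ z ∈ Icc (0 : ℝ) 1, K z z 1 0 = P.Atilde z 1 0 / (P.lam 0 z + P.lam 1 z)
  bc22 : ∀ z ∈ Icc (0 : ℝ) 1, K z 0 1 1 = P.lam 0 0 / (P.q0 * P.lam 1 0) * K z 0 1 0

/-- The transformed profile `x̄(z) = x̃(z) - ∫₀ᶻ K(z,ζ) x̃(ζ) dζ`. -/
def xbar (K : ℝ → ℝ → Matrix (Fin 2) (Fin 2) ℝ) (x : ℝ → Fin 2 → ℝ) (z : ℝ) : Fin 2 → ℝ :=
  fun i => P.scaled x z i - ∫ ζ in (0 : ℝ)..z, (K z ζ *ᵥ P.scaled x ζ) i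

/-- The new input `ū = exp(α₁(1)) u + ∫₀¹ (q̄₁ e₂ᵀ - e₁ᵀ) K(1,z) x̃(z) dz`. -/
def inputTransform (K : ℝ → ℝ → Matrix (Fin 2) (Fin 2) ℝ) (x : ℝ → Fin 2 → ℝ) (u : ℝ) : ℝ :=
  Real.exp (P.alpha 0 1) * u +
    ∫ z in (0 : ℝ)..1,
      (P.q1bar * (K 1 z *ᵥ P.scaled x z) 1 - (K 1 z *ᵥ P.scaled x z) 0)

/-- `C(z) = K(z,0) Λ(0) e₂ cᵀ`. -/
def Cmat (K : ℝ → ℝ → Matrix (Fin 2) (Fin 2) ℝ) (z : ℝ) : Matrix (Fin 2) (Fin n) ℝ :=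
  Matrix.of fun i j => K z 0 i 1 * P.Lam 0 1 * P.c j

/-! ### The hyperbolic controller canonical form -/

/-- Admissible states `(η, η_{n+1})` of the canonical form: `η_{n+1}` is a piecewise continuous
profile on `[-τ₂, τ₁]`. -/
def IsHCCFState (_η : Fin n → ℝ) (ηd : ℝ → ℝ) : Prop :=
  PiecewiseContinuousOn ηd (-P.tau2) P.tau1

/-- `(η, η_{n+1}, ū)` is a solution of the hyperbolic controller canonical form for `t ≥ 0`, with
coefficients `a₀, …, a_n` and coefficient function `a(τ)`; `η t i` is `η_{i+1}(t)` and `ηd t τ` is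
`η_{n+1}(τ, t)`. The integrator chain is integrated in time and the transport equation
`∂ₜ η_{n+1} = ∂_τ η_{n+1}` along all of its characteristic curves. -/
structure IsHCCFSolution (a : Fin (n + 1) → ℝ) (ad : ℝ → ℝ)
    (η : ℝ → Fin n → ℝ) (ηd : ℝ → ℝ → ℝ) (ubar : ℝ → ℝ) : Prop where
  eta_continuousOn : ContinuousOn η (Ici 0)
  pc : ∀ t, 0 ≤ t → PiecewiseContinuousOn (ηd t) (-P.tau2) P.tau1
  chain : ∀ t, 0 ≤ t → ∀ i : Fin n,
    η t i = η 0 i +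
      ∫ s in (0 : ℝ)..t, (if hi : (i : ℕ) + 1 < n then η s ⟨i + 1, hi⟩ else ηd s (-P.tau2))
  transport : ∀ t, 0 ≤ t → ∀ s, 0 ≤ s → ∀ τ, -P.tau2 ≤ τ → τ + s ≤ P.tau1 →
    ηd (t + s) τ = ηd t (τ + s)
  bc : ∀ t, 0 ≤ t → ηd t P.tau1 =
    -(∫ τ in (-P.tau2)..P.tau1, ad τ * ηd t τ) - ∑ i : Fin n, a i.castSucc * η t i
      - a (Fin.last n) * ηd t (-P.tau2) + ubar t

/-! ### The state transformation

For a fixed time `t`, the canonical state `η_i = y^(i-1)(t-τ₂)`, `η_{n+1}(τ) = y^(n)(t+τ)` gives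
the derivatives `y^(i)(t+τ)`, and then the state of the system by the flatness-based
parametrization. Below, `τ ∈ [-τ₂, τ₁]` is the time relative to `t`. -/

/-- `y^(i)(t+τ)`, `i < n`, by Taylor's formula at `t - τ₂`. -/
def yDer (η : Fin n → ℝ) (ηd : ℝ → ℝ) (τ : ℝ) (i : Fin n) : ℝ :=
  (∑ k : Fin n, if i ≤ k then
      (τ + P.tau2) ^ ((k : ℕ) - (i : ℕ)) / (((k : ℕ) - (i : ℕ))! : ℝ) * η k else 0) +
    ∫ σ in (-P.tau2)..τ, (τ - σ) ^ (n - 1 - (i : ℕ)) / ((n - 1 - (i : ℕ))! : ℝ) * ηd σ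

/-- `ξ(t+τ) = T_c⁻¹ [y, …, y^(n-1)](t+τ)`. -/
def xiPar (η : Fin n → ℝ) (ηd : ℝ → ℝ) (τ : ℝ) : Fin n → ℝ :=
  P.Tc⁻¹ *ᵥ P.yDer η ηd τ

/-- `x̄₁(0,t+τ) = y^(n)(t+τ) - e_nᵀ T_c F T_c⁻¹ [y, …, y^(n-1)](t+τ)`, where
`e_nᵀ T_c F = hᵀ Fⁿ`. -/
def x10Par (η : Fin n → ℝ) (ηd : ℝ → ℝ) (τ : ℝ) : ℝ :=
  ηd τ - (P.h ᵥ* P.F ^ n) ⬝ᵥ P.xiPar η ηd τ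

/-- `x̄₂(0,t+τ) = q₀ x̄₁(0,t+τ) + cᵀ ξ(t+τ)`. -/
def x20Par (η : Fin n → ℝ) (ηd : ℝ → ℝ) (τ : ℝ) : ℝ :=
  P.q0 * P.x10Par η ηd τ + P.c ⬝ᵥ P.xiPar η ηd τ

/-- The parametrization of the profile `x̄(z,t)`:
`x̄₁(z,t) = x̄₁(0,t+φ₁(z)) - ∫₀ᶻ e₁ᵀ C(ζ)/λ₁(ζ) ξ(t+φ₁(z)-φ₁(ζ)) dζ` and
`x̄₂(z,t) = x̄₂(0,t-φ₂(z)) + ∫₀ᶻ e₂ᵀ C(ζ)/λ₂(ζ) ξ(t-φ₂(z)+φ₂(ζ)) dζ`. -/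
def xbarPar (K : ℝ → ℝ → Matrix (Fin 2) (Fin 2) ℝ) (η : Fin n → ℝ) (ηd : ℝ → ℝ) (z : ℝ) :
    Fin 2 → ℝ :=
  ![P.x10Par η ηd (P.phi 0 z) -
      ∫ ζ in (0 : ℝ)..z,
        (P.Cmat K ζ *ᵥ P.xiPar η ηd (P.phi 0 z - P.phi 0 ζ)) 0 / P.lam 0 ζ,
    P.x20Par η ηd (-P.phi 1 z) +
      ∫ ζ in (0 : ℝ)..z,
        (P.Cmat K ζ *ᵥ P.xiPar η ηd (-P.phi 1 z + P.phi 1 ζ)) 1 / P.lam 1 ζ]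

/-- `(ξ, x)` and `(η, η_{n+1})` are the states, at the same time, of the PDE-ODE system and of the
canonical form. -/
structure Corresponds (K : ℝ → ℝ → Matrix (Fin 2) (Fin 2) ℝ)
    (ξ : Fin n → ℝ) (x : ℝ → Fin 2 → ℝ) (η : Fin n → ℝ) (ηd : ℝ → ℝ) : Prop where
  isState : P.IsState ξ x
  isHCCFState : P.IsHCCFState η ηd
  xi_eq : ξ = P.xiPar η ηd 0
  xbar_eq : ∀ z ∈ Icc (0 : ℝ) 1, P.xbar K x z = P.xbarPar K η ηd z

/-- `Corresponds` is (the graph of) a bijection between the admissible states of the system and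
those of the canonical form, where profiles are identified if they agree on their interval. -/
def CorrespondsBijectively (K : ℝ → ℝ → Matrix (Fin 2) (Fin 2) ℝ) : Prop :=
  (∀ ξ x, P.IsState ξ x → ∃ η ηd, P.Corresponds K ξ x η ηd) ∧
  (∀ η ηd, P.IsHCCFState η ηd → ∃ ξ x, P.Corresponds K ξ x η ηd) ∧
  (∀ ξ x η ηd ξ' x' η' ηd', P.Corresponds K ξ x η ηd → P.Corresponds K ξ' x' η' ηd' →
    ((ξ = ξ' ∧ EqOn x x' (Icc 0 1)) ↔ (η = η' ∧ EqOn ηd ηd' (Icc (-P.tau2) P.tau1))))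

/-- `η_i(t) = y^(i-1)(t-τ₂)` and `η_{n+1}(τ,t) = y^(n)(t+τ)` for a function `y` on `[0, ∞)`, at all
times `t - τ₂ ≥ 0` and `t + τ ≥ 0`. Here `y` is `n - 1` times continuously differentiable, and the
`n`-th derivative exists and has the asserted value up to finitely many `τ ∈ [-τ₂, τ₁]`, for
each `t`. -/
structure IsFlatState (y : ℝ → ℝ) (η : ℝ → Fin n → ℝ) (ηd : ℝ → ℝ → ℝ) : Prop where
  contDiffOn : ∀ i : ℕ, i < n → ContDiffOn ℝ i y (Ici 0)
  eta_eq : ∀ t, P.tau2 ≤ t → ∀ i : Fin n, η t i = iteratedDerivWithin i y (Ici 0) (t - P.tau2)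
  etad_eq : ∀ t, 0 ≤ t → {τ ∈ Icc (-P.tau2) P.tau1 | 0 ≤ t + τ ∧
    ¬ ((0 < n → DifferentiableWithinAt ℝ (iteratedDerivWithin (n - 1) y (Ici 0)) (Ici 0) (t + τ)) ∧
      ηd t τ = iteratedDerivWithin n y (Ici 0) (t + τ))}.Finite

end

end PDEODESystem

/-! The system is flat: `h · ξ` and its derivatives determine everything, and the canonical form
records this one scalar function on a moving window of length `τ₁ + τ₂`.

Scaling by integrating factors removes the diagonal coupling terms. The scaled transport equations
can then be solved with `z` as evolution variable, from the boundary values `v₁`, `v₂` at `z = 0`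
prescribed for all times (`exists_isStripSolution`). Multiplying by the kernel and applying the
product rule along characteristics (`RowData.integral_kernel`) shows that `x̄` is pure transport of
these boundary values with a source proportional to `v₂ - q₀ v₁`, that is, to `c · ξ`
(`IsKernel.backstepping₀`, `IsKernel.backstepping₁`). Hence `x̄` at time `t` is an explicit
functional `parX` of the trajectory `(ξ, v)` of the ODE on `[t - τ₂, t + τ₁]`. The kernel exists
because each of its rows is a Goursat problem, solved by a contraction in a weighted norm.

Conversely, `ξ(t)` and `x̄` determine the trajectory on the window: `x̄₁` drives the future half
and, since `q₀ ≠ 0`, `x̄₂` drives the past half in reversed time, each through a linear Volterra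
equation (`IsTrajectory.unique`, `exists_trajectory_of_profile`). By controllability `T_c ξ` is an
integrator chain with input `v + h · Fⁿ ξ`, so trajectories on the window are the same as canonical
states. With the invertibility of the Volterra transformation `x̃ ↦ x̄` this is the bijection
`correspondsBijectively`.

For the dynamics, the window trajectories at all times `t ≥ 0` must be restrictions of one
trajectory on `[-τ₂, ∞)`, an `IsHistory`. The canonical equations give one by gluing the shifted
profiles. The system equations give one by prefixing the past encoded in the initial state; that the
profiles agree with it is a uniqueness theorem on a domain of dependence (`eq_zero_of_transport`)
followed by uniqueness of window trajectories. A history and the boundary condition at the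
controlled end give back both sets of equations. The two boundary conditions agree because `x̄₁(1) -
q̄₁ x̄₂(1)` is, in canonical coordinates, a combination of two point values of the profile and a
functional with continuous density (`IsKernel.exists_coefficients`). Reading the integrator chain
along a history yields the statement on the derivatives of the flat output. -/

/-! ### Product rule for primitives, and contractions in exponentially weighted norms. -/

section Tools
open MeasureTheory

/-- Product rule for primitives of integrable functions. -/
theorem mul_eq_add_integral_of_primitive {F G f g : ℝ → ℝ} {a b : ℝ}
    (hf : IntervalIntegrable f volume a b) (hg : IntervalIntegrable g volume a b)
    (hF : ∀ x ∈ uIcc a b, F x = F a + ∫ y in a..x, f y)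
    (hG : ∀ x ∈ uIcc a b, G x = G a + ∫ y in a..x, g y) :
    F b * G b = F a * G a + ∫ x in a..b, (f x * G x + F x * g x) := by
  -- Primitives of integrable functions are absolutely continuous, so integration by parts is
  -- available although they are differentiable only almost everywhere.
  have acF := ((hf.absolutelyContinuousOnInterval_intervalIntegral (c := a) (by simp)))
  have acG := ((hg.absolutelyContinuousOnInterval_intervalIntegral (c := a) (by simp)))
  have acc : ∀ c : ℝ, AbsolutelyContinuousOnInterval (fun _ : ℝ => c) a b := fun c =>
    (LipschitzWith.const c).lipschitzOnWith.absolutelyContinuousOnInterval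
  have h := ((acc (F a)).fun_add acF).integral_deriv_mul_eq_sub ((acc (G a)).fun_add acG)
  have hb : b ∈ uIcc a b := by simp
  have ha : a ∈ uIcc a b := by simp
  have key : ∫ x in a..b, (f x * G x + F x * g x) = F b * G b - F a * G a := by
    rw [hF b hb, hG b hb]
    simp only [intervalIntegral.integral_same, add_zero] at h
    rw [← h]
    apply intervalIntegral.integral_congr_ae
    filter_upwards [hf.ae_hasDerivAt_integral, hg.ae_hasDerivAt_integral] with x h1 h2 hx
    have hx' : x ∈ uIcc a b := uIoc_subset_uIcc hx
    have d1 := ((h1 hx' a ha).const_add (F a)).deriv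
    have d2 := ((h2 hx' a ha).const_add (G a)).deriv
    rw [d1, d2, ← hF x hx', ← hG x hx']
  linarith

/-- Integrating against the weight `exp (L ζ)` gains a factor `1 / L`. For large `L` this makes
Volterra operators contractive on intervals of any length. -/
theorem abs_integral_exp_le {f : ℝ → ℝ} {C L z : ℝ} (hL : 0 < L) (hz : 0 ≤ z) (hC : 0 ≤ C)
    (h : ∀ ζ ∈ Icc 0 z, |f ζ| ≤ C * Real.exp (L * ζ)) :
    |∫ ζ in (0 : ℝ)..z, f ζ| ≤ C / L * Real.exp (L * z) := by
  have h1 : ‖∫ ζ in (0 : ℝ)..z, f ζ‖ ≤ ∫ ζ in (0 : ℝ)..z, C * Real.exp (L * ζ) := by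
    apply intervalIntegral.norm_integral_le_of_norm_le hz
    · exact Eventually.of_forall fun t ht => h t ⟨ht.1.le, ht.2⟩
    · exact (by fun_prop : Continuous fun ζ => C * Real.exp (L * ζ)).intervalIntegrable _ _
  have h2 : ∫ ζ in (0 : ℝ)..z, C * Real.exp (L * ζ) = C / L * (Real.exp (L * z) - 1) := by
    rw [intervalIntegral.integral_const_mul, intervalIntegral.integral_comp_mul_left _ hL.ne']
    simp [integral_exp]
    ring
  rw [h2] at h1
  rw [← Real.norm_eq_abs]
  have : 0 ≤ C / L := by positivity
  nlinarith

/-- A map that halves a weighted supremum distance on a class of functions closed under uniform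
limits has a fixed point in that class. -/
theorem exists_fixedPoint_of_weighted_contraction {S V : Type*} [NormedAddCommGroup V]
    [CompleteSpace V] (w : S → ℝ) (M : ℝ) (hw : ∀ s, 0 ≤ w s) (hM : ∀ s, w s ≤ M)
    (A : Set (S → V))
    (closed : ∀ (f : ℕ → S → V) (g : S → V), (∀ k, f k ∈ A) → TendstoUniformly f g atTop → g ∈ A)
    (Op : (S → V) → S → V) (maps : ∀ f ∈ A, Op f ∈ A)
    (contr : ∀ f ∈ A, ∀ g ∈ A, ∀ b, 0 ≤ b → (∀ s, ‖f s - g s‖ ≤ b * w s) →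
      ∀ s, ‖Op f s - Op g s‖ ≤ b / 2 * w s)
    (f₀ : S → V) (hf₀ : f₀ ∈ A) (b₀ : ℝ) (hb₀ : 0 ≤ b₀) (h₀ : ∀ s, ‖Op f₀ s - f₀ s‖ ≤ b₀ * w s) :
    ∃ f ∈ A, Op f = f ∧ ∀ s, ‖f s - f₀ s‖ ≤ 2 * b₀ * w s := by
  set F : ℕ → S → V := fun k => Op^[k] f₀ with hF
  have hFs : ∀ k, F (k + 1) = Op (F k) := fun k => Function.iterate_succ_apply' Op k f₀
  have hFA : ∀ k, F k ∈ A := by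
    intro k
    induction k with
    | zero => simpa [hF] using hf₀
    | succ k ih => rw [hFs]; exact maps _ ih
  have step : ∀ k s, ‖F (k + 1) s - F k s‖ ≤ b₀ / 2 ^ k * w s := by
    intro k
    induction k with
    | zero => intro s; rw [hFs]; simpa [hF] using h₀ s
    | succ k ih =>
      intro s
      have := contr _ (hFA (k + 1)) _ (hFA k) (b₀ / 2 ^ k) (by positivity) ih s
      rw [hFs (k + 1)]
      rw [← hFs] at this
      rw [← hFs]
      have e : b₀ / 2 ^ (k + 1) = b₀ / 2 ^ k / 2 := by rw [pow_succ]; field_simp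
      rw [e]
      simpa [hFs] using this
  -- The factor `1 - 1 / 2 ^ m` is the exact geometric sum; the weaker bound without it would not
  -- survive the induction on `m`.
  have far : ∀ k m s, ‖F (k + m) s - F k s‖ ≤ 2 * b₀ / 2 ^ k * (1 - 1 / 2 ^ m) * w s := by
    intro k m s
    induction m with
    | zero => simp
    | succ m ih =>
      have h1 := step (k + m) s
      have h2 : F (k + (m + 1)) s - F k s
          = (F (k + m + 1) s - F (k + m) s) + (F (k + m) s - F k s) := by
        rw [← add_assoc]; abel
      rw [h2]
      refine (norm_add_le _ _).trans ((add_le_add h1 ih).trans (le_of_eq ?_))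
      rw [pow_add, pow_succ]
      field_simp
      ring
  have far' : ∀ k m s, ‖F (k + m) s - F k s‖ ≤ 2 * b₀ / 2 ^ k * w s := by
    intro k m s
    refine (far k m s).trans (mul_le_mul_of_nonneg_right ?_ (hw s))
    have : (0 : ℝ) ≤ 1 / 2 ^ m := by positivity
    have h2 : 0 ≤ 2 * b₀ / 2 ^ k := by positivity
    nlinarith
  have hlim0 : Tendsto (fun k : ℕ => 2 * b₀ / 2 ^ k) atTop (𝓝 0) := by
    have := tendsto_pow_atTop_nhds_zero_of_lt_one (r := (1 / 2 : ℝ)) (by norm_num) (by norm_num)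
    have h := this.const_mul (2 * b₀)
    simp only [mul_zero] at h
    refine h.congr fun k => ?_
    rw [one_div, inv_pow]; rfl
  have hcs : ∀ s, CauchySeq fun k => F k s := by
    intro s
    refine cauchySeq_of_le_tendsto_0 (fun k => 2 * (2 * b₀ / 2 ^ k * w s)) ?_ ?_
    · intro n m N hn hm
      obtain ⟨p, rfl⟩ := Nat.exists_eq_add_of_le hn
      obtain ⟨q, rfl⟩ := Nat.exists_eq_add_of_le hm
      have h1 := far' N p s
      have h2 := far' N q s
      rw [dist_eq_norm]
      have : F (N + p) s - F (N + q) s = (F (N + p) s - F N s) - (F (N + q) s - F N s) := by abel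
      rw [this]
      refine (norm_sub_le _ _).trans ?_
      linarith
    · simpa using (hlim0.mul_const (w s)).const_mul 2
  choose f hf using fun s => cauchySeq_tendsto_of_complete (hcs s)
  have hfar : ∀ k s, ‖f s - F k s‖ ≤ 2 * b₀ / 2 ^ k * w s := by
    intro k s
    have : Tendsto (fun m => ‖F (k + m) s - F k s‖) atTop (𝓝 ‖f s - F k s‖) := by
      refine ((Tendsto.sub ?_ tendsto_const_nhds).norm)
      have h := (tendsto_add_atTop_iff_nat k).2 (hf s)
      exact h.congr fun m => by rw [add_comm]
    exact le_of_tendsto' this fun m => far' k m s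
  have hunif : TendstoUniformly F f atTop := by
    rw [Metric.tendstoUniformly_iff]
    intro ε hε
    have h := (hlim0.mul_const M)
    rw [zero_mul] at h
    filter_upwards [h.eventually (gt_mem_nhds hε)] with k hk s
    rw [dist_eq_norm]
    refine (hfar k s).trans_lt (lt_of_le_of_lt ?_ hk)
    exact mul_le_mul_of_nonneg_left (hM s) (by positivity)
  have hfA : f ∈ A := closed F f hFA hunif
  refine ⟨f, hfA, ?_, ?_⟩
  · funext s
    -- Closedness has put the limit into `A`, so the contraction estimate may compare it with the
    -- iterates.
    have h1 : ∀ k, ‖Op f s - F (k + 1) s‖ ≤ (2 * b₀ / 2 ^ k) / 2 * w s := by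
      intro k
      rw [hFs]
      exact contr f hfA _ (hFA k) _ (by positivity) (hfar k) s
    have h2 : Tendsto (fun k => ‖Op f s - F (k + 1) s‖) atTop (𝓝 0) := by
      refine squeeze_zero (fun k => norm_nonneg _) h1 ?_
      simpa using (hlim0.div_const 2).mul_const (w s)
    have h3 : Tendsto (fun k => ‖Op f s - F (k + 1) s‖) atTop (𝓝 ‖Op f s - f s‖) :=
      (Tendsto.sub tendsto_const_nhds ((tendsto_add_atTop_iff_nat 1).2 (hf s))).norm
    have := tendsto_nhds_unique h2 h3
    exact sub_eq_zero.1 (norm_eq_zero.1 this.symm)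
  · intro s
    simpa [hF] using hfar 0 s

/-- The uniqueness counterpart: a bound that can be halved indefinitely is zero. Only the size `e`
of a difference enters, so no function space is needed. -/
theorem eq_zero_of_weighted_contraction {S : Type*} (e : S → ℝ) (w : S → ℝ)
    (b₀ : ℝ) (hb₀ : 0 ≤ b₀) (h₀ : ∀ s, e s ≤ b₀ * w s)
    (contr : ∀ b, 0 ≤ b → (∀ s, e s ≤ b * w s) → ∀ s, e s ≤ b / 2 * w s) :
    ∀ s, e s ≤ 0 := by
  intro s
  have h : ∀ k : ℕ, ∀ s, e s ≤ b₀ / 2 ^ k * w s := by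
    intro k
    induction k with
    | zero => simpa using h₀
    | succ k ih =>
      intro s
      have := contr _ (by positivity) ih s
      have e' : b₀ / 2 ^ (k + 1) = b₀ / 2 ^ k / 2 := by rw [pow_succ]; field_simp
      rwa [e']
  have hlim0 : Tendsto (fun k : ℕ => b₀ / 2 ^ k * w s) atTop (𝓝 0) := by
    have := tendsto_pow_atTop_nhds_zero_of_lt_one (r := (1 / 2 : ℝ)) (by norm_num) (by norm_num)
    have h := (this.const_mul b₀).mul_const (w s)
    simp only [mul_zero, zero_mul] at h
    refine h.congr fun k => ?_
    rw [one_div, inv_pow]; rfl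
  exact ge_of_tendsto' hlim0 fun k => h k s

end Tools

/-! ### Piecewise continuous functions. -/

section PiecewiseContinuity
open MeasureTheory

namespace PiecewiseContinuousOn

variable {f g : ℝ → ℝ} {a b c d : ℝ}

theorem of_continuousOn (hf : ContinuousOn f (Icc a b)) : PiecewiseContinuousOn f a b := by
  refine ⟨⟨∅, finite_empty, fun z hz => hf z hz.1⟩, fun z hz => ⟨f z, ?_⟩, fun z hz => ⟨f z, ?_⟩⟩
  · have h := hf z ⟨hz.1, hz.2.le⟩
    refine h.mono_left ?_
    rw [← nhdsWithin_Ioo_eq_nhdsGT hz.2]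
    exact nhdsWithin_mono _ fun y hy => ⟨hz.1.trans hy.1.le, hy.2.le⟩
  · have h := hf z ⟨hz.1.le, hz.2⟩
    refine h.mono_left ?_
    rw [← nhdsWithin_Ioo_eq_nhdsLT hz.1]
    exact nhdsWithin_mono _ fun y hy => ⟨hy.1.le, hy.2.le.trans hz.2⟩

theorem congr (hf : PiecewiseContinuousOn f a b) (h : EqOn g f (Icc a b)) :
    PiecewiseContinuousOn g a b := by
  obtain ⟨⟨S, hS, hc⟩, hr, hl⟩ := hf
  refine ⟨⟨S, hS, fun z hz => (hc z hz).congr (fun y hy => h hy) (h hz.1)⟩, fun z hz => ?_,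
    fun z hz => ?_⟩
  · obtain ⟨l, hl⟩ := hr z hz
    refine ⟨l, hl.congr' ?_⟩
    filter_upwards [Ioo_mem_nhdsGT hz.2] with y hy
    exact (h ⟨hz.1.trans hy.1.le, hy.2.le⟩).symm
  · obtain ⟨l, hl⟩ := hl z hz
    refine ⟨l, hl.congr' ?_⟩
    filter_upwards [Ioo_mem_nhdsLT hz.1] with y hy
    exact (h ⟨hy.1.le, hy.2.le.trans hz.2⟩).symm

theorem add (hf : PiecewiseContinuousOn f a b) (hg : PiecewiseContinuousOn g a b) :
    PiecewiseContinuousOn (fun z => f z + g z) a b := by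
  obtain ⟨⟨S, hS, hc⟩, hr, hl⟩ := hf
  obtain ⟨⟨S', hS', hc'⟩, hr', hl'⟩ := hg
  refine ⟨⟨S ∪ S', hS.union hS', fun z hz => (hc z ⟨hz.1, fun h => hz.2 (.inl h)⟩).add
    (hc' z ⟨hz.1, fun h => hz.2 (.inr h)⟩)⟩, fun z hz => ?_, fun z hz => ?_⟩
  · obtain ⟨l, h⟩ := hr z hz
    obtain ⟨l', h'⟩ := hr' z hz
    exact ⟨l + l', h.add h'⟩
  · obtain ⟨l, h⟩ := hl z hz
    obtain ⟨l', h'⟩ := hl' z hz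
    exact ⟨l + l', h.add h'⟩

theorem mul (hf : PiecewiseContinuousOn f a b) (hg : PiecewiseContinuousOn g a b) :
    PiecewiseContinuousOn (fun z => f z * g z) a b := by
  obtain ⟨⟨S, hS, hc⟩, hr, hl⟩ := hf
  obtain ⟨⟨S', hS', hc'⟩, hr', hl'⟩ := hg
  refine ⟨⟨S ∪ S', hS.union hS', fun z hz => (hc z ⟨hz.1, fun h => hz.2 (.inl h)⟩).mul
    (hc' z ⟨hz.1, fun h => hz.2 (.inr h)⟩)⟩, fun z hz => ?_, fun z hz => ?_⟩
  · obtain ⟨l, h⟩ := hr z hz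
    obtain ⟨l', h'⟩ := hr' z hz
    exact ⟨l * l', h.mul h'⟩
  · obtain ⟨l, h⟩ := hl z hz
    obtain ⟨l', h'⟩ := hl' z hz
    exact ⟨l * l', h.mul h'⟩

theorem sub (hf : PiecewiseContinuousOn f a b) (hg : PiecewiseContinuousOn g a b) :
    PiecewiseContinuousOn (fun z => f z - g z) a b := by
  have := hf.add ((of_continuousOn (continuousOn_const (c := (-1 : ℝ)))).mul hg)
  exact this.congr fun z _ => by ring

/-- The one-sided limits bound the function on each side of every point, the value at the point is
one more number, and compactness does the rest. -/
theorem exists_bound (hf : PiecewiseContinuousOn f a b) : ∃ M, ∀ z ∈ Icc a b, |f z| ≤ M := by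
  obtain ⟨-, hr, hl⟩ := hf
  refine isCompact_Icc.induction_on (p := fun s => ∃ M, ∀ z ∈ s, |f z| ≤ M) ⟨0, by simp⟩ ?_ ?_ ?_
  · rintro s t hst ⟨M, hM⟩
    exact ⟨M, fun z hz => hM z (hst hz)⟩
  · rintro s t ⟨M, hM⟩ ⟨M', hM'⟩
    refine ⟨max M M', fun z hz => ?_⟩
    rcases hz with hz | hz
    · exact (hM z hz).trans (le_max_left _ _)
    · exact (hM' z hz).trans (le_max_right _ _)
  · intro z hz
    have h1 : ∃ M, ∀ᶠ y in 𝓝[>] z, y ∈ Icc a b → |f y| ≤ M := by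
      rcases hz.2.lt_or_eq with h | h
      · obtain ⟨l, hl⟩ := hr z ⟨hz.1, h⟩
        refine ⟨|l| + 1, ?_⟩
        filter_upwards [hl.abs.eventually (gt_mem_nhds (lt_add_one |l|))] with y hy _ using hy.le
      -- At the right end no point of the interval lies further right, so any bound serves.
      · refine ⟨0, ?_⟩
        filter_upwards [self_mem_nhdsWithin] with y hy hy'
        exact absurd hy'.2 (not_le.2 (h ▸ hy))
    have h2 : ∃ M, ∀ᶠ y in 𝓝[<] z, y ∈ Icc a b → |f y| ≤ M := by
      rcases hz.1.lt_or_eq with h | h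
      · obtain ⟨l, hl⟩ := hl z ⟨h, hz.2⟩
        refine ⟨|l| + 1, ?_⟩
        filter_upwards [hl.abs.eventually (gt_mem_nhds (lt_add_one |l|))] with y hy _ using hy.le
      · refine ⟨0, ?_⟩
        filter_upwards [self_mem_nhdsWithin] with y hy hy'
        exact absurd hy'.1 (not_le.2 (h ▸ hy))
    obtain ⟨M, hM⟩ := h1
    obtain ⟨M', hM'⟩ := h2
    set N := max (max M M') |f z|
    refine ⟨{y | |f y| ≤ N}, ?_, N, fun y hy => hy⟩
    rw [mem_nhdsWithin_iff_eventually, ← nhdsLT_sup_nhdsGE, ← Ioi_insert, nhdsWithin_insert]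
    refine eventually_sup.2 ⟨?_, eventually_sup.2 ⟨?_, ?_⟩⟩
    · filter_upwards [hM'] with y hy hy'
      exact (hy hy').trans ((le_max_right _ _).trans (le_max_left _ _))
    · exact eventually_pure.2 fun _ => le_max_right (max M M') |f z|
    · filter_upwards [hM] with y hy hy'
      exact (hy hy').trans ((le_max_left _ _).trans (le_max_left _ _))

/-- Off the finite exceptional set the function is continuous on a Borel set; on a finite set every
function is measurable. -/
theorem measurable_indicator (hf : PiecewiseContinuousOn f a b) :
    Measurable ((Icc a b).indicator f) := by
  obtain ⟨⟨S, hS, hc⟩, -, -⟩ := hf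
  have hSm : MeasurableSet S := hS.measurableSet
  have h1 : Measurable ((Icc a b \ S).indicator f) := by
    classical
    have hcont : ContinuousOn f (Icc a b \ S) := fun z hz => (hc z hz).mono sdiff_subset
    have := hcont.measurable_piecewise (g := 0) continuousOn_const
      (measurableSet_Icc.diff hSm)
    rwa [← Set.piecewise_eq_indicator]
  refine measurable_of_restrict_of_restrict_compl hSm ?_ ?_
  · have := hS.to_subtype
    exact measurable_of_finite _
  · have : Sᶜ.domRestrict ((Icc a b).indicator f) = Sᶜ.domRestrict ((Icc a b \ S).indicator f) := by
      funext z
      have hz : (z : ℝ) ∉ S := z.2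
      by_cases h : (z : ℝ) ∈ Icc a b
      · simp [Set.domRestrict, hz, h.1, h.2]
      · have h' : (z : ℝ) ∉ Icc a b \ S := fun h'' => h h''.1
        rw [Set.domRestrict_apply, Set.domRestrict_apply, indicator_of_notMem h,
          indicator_of_notMem h']
    rw [this]
    exact h1.comp measurable_subtype_coe

/-- Strict monotonicity keeps the preimage of the exceptional set finite and maps one-sided
neighbourhoods to the same side, so one-sided limits are inherited. -/
theorem comp_strictMonoOn (hf : PiecewiseContinuousOn f c d) (hg : ContinuousOn g (Icc a b))
    (hm : StrictMonoOn g (Icc a b)) (hmap : MapsTo g (Icc a b) (Icc c d)) :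
    PiecewiseContinuousOn (fun z => f (g z)) a b := by
  obtain ⟨⟨S, hS, hc⟩, hr, hl⟩ := hf
  refine ⟨⟨Icc a b ∩ g ⁻¹' S, ?_, fun z hz => ?_⟩, fun z hz => ?_, fun z hz => ?_⟩
  · refine Set.Finite.of_finite_image (f := g) (hS.subset ?_) (hm.injOn.mono inter_subset_left)
    rintro _ ⟨z, hz, rfl⟩
    exact hz.2
  · exact (hc (g z) ⟨hmap hz.1, fun h => hz.2 ⟨hz.1, h⟩⟩).comp (hg z hz.1) hmap
  · have hz' : z ∈ Icc a b := ⟨hz.1, hz.2.le⟩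
    have hb : b ∈ Icc a b := ⟨hz.1.trans hz.2.le, le_rfl⟩
    obtain ⟨l, h⟩ := hr (g z) ⟨(hmap hz').1, (hm hz' hb hz.2).trans_le (hmap hb).2⟩
    refine ⟨l, h.comp (tendsto_nhdsWithin_iff.2 ⟨?_, ?_⟩)⟩
    · refine (hg z hz').mono_left ?_
      rw [← nhdsWithin_Ioo_eq_nhdsGT hz.2]
      exact nhdsWithin_mono _ fun y hy => ⟨hz.1.trans hy.1.le, hy.2.le⟩
    · filter_upwards [Ioo_mem_nhdsGT hz.2] with y hy
      exact hm hz' ⟨hz.1.trans hy.1.le, hy.2.le⟩ hy.1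
  · have hz' : z ∈ Icc a b := ⟨hz.1.le, hz.2⟩
    have ha : a ∈ Icc a b := ⟨le_rfl, hz.1.le.trans hz.2⟩
    obtain ⟨l, h⟩ := hl (g z) ⟨(hmap ha).1.trans_lt (hm ha hz' hz.1), (hmap hz').2⟩
    refine ⟨l, h.comp (tendsto_nhdsWithin_iff.2 ⟨?_, ?_⟩)⟩
    · refine (hg z hz').mono_left ?_
      rw [← nhdsWithin_Ioo_eq_nhdsLT hz.1]
      exact nhdsWithin_mono _ fun y hy => ⟨hy.1.le, hy.2.le.trans hz.2⟩
    · filter_upwards [Ioo_mem_nhdsLT hz.1] with y hy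
      exact hm ⟨hy.1.le, hy.2.le.trans hz.2⟩ hz' hy.2

theorem comp_neg (hf : PiecewiseContinuousOn f a b) :
    PiecewiseContinuousOn (fun z => f (-z)) (-b) (-a) := by
  obtain ⟨⟨S, hS, hc⟩, hr, hl⟩ := hf
  have hmap : MapsTo (fun z : ℝ => -z) (Icc (-b) (-a)) (Icc a b) :=
    fun z hz => ⟨by linarith [hz.2], by linarith [hz.1]⟩
  refine ⟨⟨(fun z : ℝ => -z) ⁻¹' S, hS.preimage neg_injective.injOn, fun z hz => ?_⟩,
    fun z hz => ?_, fun z hz => ?_⟩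
  · exact (hc (-z) ⟨hmap hz.1, hz.2⟩).comp continuous_neg.continuousWithinAt hmap
  · obtain ⟨l, h⟩ := hl (-z) ⟨by linarith [hz.2], by linarith [hz.1]⟩
    exact ⟨l, h.comp (tendsto_nhdsWithin_iff.2 ⟨(continuous_neg.tendsto z).mono_left
      nhdsWithin_le_nhds, eventually_mem_nhdsWithin.mono fun y (hy : _ < _) => by simpa using hy⟩)⟩
  · obtain ⟨l, h⟩ := hr (-z) ⟨by linarith [hz.2], by linarith [hz.1]⟩
    exact ⟨l, h.comp (tendsto_nhdsWithin_iff.2 ⟨(continuous_neg.tendsto z).mono_left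
      nhdsWithin_le_nhds, eventually_mem_nhdsWithin.mono fun y (hy : _ < _) => by simpa using hy⟩)⟩

theorem mono (hf : PiecewiseContinuousOn f a b) (hac : a ≤ c) (hdb : d ≤ b) :
    PiecewiseContinuousOn f c d :=
  hf.comp_strictMonoOn (g := id) continuousOn_id (strictMono_id.strictMonoOn _)
    (Icc_subset_Icc hac hdb)

theorem glue (hf : PiecewiseContinuousOn f a b) (hf' : PiecewiseContinuousOn f b c) :
    PiecewiseContinuousOn f a c := by
  obtain ⟨⟨S, hS, hc⟩, hr, hl⟩ := hf
  obtain ⟨⟨S', hS', hc'⟩, hr', hl'⟩ := hf'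
  refine ⟨⟨S ∪ S' ∪ {b}, (hS.union hS').union (finite_singleton b), fun z hz => ?_⟩,
    fun z hz => ?_, fun z hz => ?_⟩
  · obtain ⟨hz1, hz2⟩ := hz
    simp only [mem_union, mem_singleton_iff, not_or] at hz2
    rcases lt_or_gt_of_ne hz2.2 with h | h
    · refine (hc z ⟨⟨hz1.1, h.le⟩, hz2.1.1⟩).mono_of_mem_nhdsWithin ?_
      filter_upwards [mem_nhdsWithin_of_mem_nhds (Iio_mem_nhds h), self_mem_nhdsWithin] with y h1 h2
      exact ⟨h2.1, le_of_lt h1⟩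
    · refine (hc' z ⟨⟨h.le, hz1.2⟩, hz2.1.2⟩).mono_of_mem_nhdsWithin ?_
      filter_upwards [mem_nhdsWithin_of_mem_nhds (Ioi_mem_nhds h), self_mem_nhdsWithin] with y h1 h2
      exact ⟨le_of_lt h1, h2.2⟩
  · rcases lt_or_ge z b with h | h
    · exact hr z ⟨hz.1, h⟩
    · exact hr' z ⟨h, hz.2⟩
  · rcases le_or_gt z b with h | h
    · exact hl z ⟨hz.1, h⟩
    · exact hl' z ⟨h, hz.2⟩

end PiecewiseContinuousOn

end PiecewiseContinuity

/-! ### Transport speeds and travel time as a coordinate. -/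

section Speeds
open MeasureTheory

/-- A continuous transport speed on the real line with positive bounds. -/
structure Speed where
  l : ℝ → ℝ
  continuous_l : Continuous l
  lo : ℝ
  hi : ℝ
  lo_pos : 0 < lo
  lo_le : ∀ z, lo ≤ l z
  le_hi : ∀ z, l z ≤ hi

namespace Speed

noncomputable section

variable (c : Speed)

theorem pos (z : ℝ) : 0 < c.l z := c.lo_pos.trans_le (c.lo_le z)

theorem ne_zero (z : ℝ) : c.l z ≠ 0 := (c.pos z).ne'

theorem hi_pos : 0 < c.hi := (c.pos 0).trans_le (c.le_hi 0)

theorem continuous_inv : Continuous fun z => 1 / c.l z :=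
  continuous_const.div c.continuous_l c.ne_zero

/-- The travel time from `0` to `z`. -/
def phi (z : ℝ) : ℝ := ∫ ζ in (0 : ℝ)..z, 1 / c.l ζ

@[simp] theorem phi_zero : c.phi 0 = 0 := by simp [phi]

theorem hasDerivAt_phi (z : ℝ) : HasDerivAt c.phi (1 / c.l z) z :=
  intervalIntegral.integral_hasDerivAt_right (c.continuous_inv.intervalIntegrable _ _)
    (c.continuous_inv.stronglyMeasurableAtFilter _ _) c.continuous_inv.continuousAt

theorem strictMono_phi : StrictMono c.phi :=
  strictMono_of_hasDerivAt_pos c.hasDerivAt_phi fun z => one_div_pos.2 (c.pos z)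

theorem continuous_phi : Continuous c.phi :=
  continuous_iff_continuousAt.2 fun z => (c.hasDerivAt_phi z).continuousAt

/-- The upper bound on the speed makes travel time grow at least linearly; hence it tends to
infinity in both directions and is a bijection of the real line. -/
theorem phi_sub_le {z z' : ℝ} (h : z ≤ z') : (z' - z) / c.hi ≤ c.phi z' - c.phi z := by
  have hm : Monotone fun z => c.phi z - z / c.hi := by
    have hd : ∀ z, HasDerivAt (fun z => c.phi z - z / c.hi) (1 / c.l z - 1 / c.hi) z := fun z =>
      (c.hasDerivAt_phi z).sub ((hasDerivAt_id z).div_const c.hi)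
    refine monotone_of_deriv_nonneg (fun z => (hd z).differentiableAt) fun z => ?_
    rw [(hd z).deriv]
    exact sub_nonneg.2 (one_div_le_one_div_of_le (c.pos z) (c.le_hi z))
  have := hm h
  simp only at this
  rw [sub_div]
  linarith

theorem surjective_phi : Function.Surjective c.phi := by
  refine c.continuous_phi.surjective ?_ ?_
  · refine tendsto_atTop_mono' _ (f₁ := fun z => z / c.hi) ?_
      (tendsto_id.atTop_div_const c.hi_pos)
    filter_upwards [eventually_ge_atTop 0] with z hz
    simpa using c.phi_sub_le hz
  · refine tendsto_atBot_mono' _ (f₂ := c.phi) (f₁ := fun z => z / c.hi) ?_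
      (tendsto_id.atBot_div_const c.hi_pos)
    filter_upwards [eventually_le_atBot 0] with z hz
    have := c.phi_sub_le hz
    simp only [zero_sub, phi_zero, neg_div] at this
    linarith

/-- The position reached from `0` at time `r`. -/
def psi : ℝ → ℝ := (c.strictMono_phi.orderIsoOfSurjective c.phi c.surjective_phi).symm

@[simp] theorem phi_psi (r : ℝ) : c.phi (c.psi r) = r :=
  (c.strictMono_phi.orderIsoOfSurjective c.phi c.surjective_phi).apply_symm_apply r

@[simp] theorem psi_phi (z : ℝ) : c.psi (c.phi z) = z :=
  (c.strictMono_phi.orderIsoOfSurjective c.phi c.surjective_phi).symm_apply_apply z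

theorem strictMono_psi : StrictMono c.psi :=
  (c.strictMono_phi.orderIsoOfSurjective c.phi c.surjective_phi).symm.strictMono

@[fun_prop] theorem continuous_psi : Continuous c.psi :=
  (c.strictMono_phi.orderIsoOfSurjective c.phi c.surjective_phi).symm.continuous

@[simp] theorem psi_zero : c.psi 0 = 0 := by
  conv_lhs => rw [← c.phi_zero]
  exact c.psi_phi 0

theorem hasDerivAt_psi (r : ℝ) : HasDerivAt c.psi (c.l (c.psi r)) r := by
  have h := (c.hasDerivAt_phi (c.psi r)).of_local_left_inverse (c.continuous_psi.continuousAt)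
    (one_div_pos.2 (c.pos _)).ne' (Eventually.of_forall c.phi_psi)
  simpa using h

theorem phi_nonneg {z : ℝ} (hz : 0 ≤ z) : 0 ≤ c.phi z := by
  simpa using c.strictMono_phi.monotone hz

theorem psi_nonneg {z : ℝ} (hz : 0 ≤ z) : 0 ≤ c.psi z := by
  simpa using c.strictMono_psi.monotone hz

theorem psi_le_iff {r z : ℝ} : c.psi r ≤ z ↔ r ≤ c.phi z := by
  rw [← c.strictMono_phi.le_iff_le, phi_psi]

theorem le_psi_iff {r z : ℝ} : z ≤ c.psi r ↔ c.phi z ≤ r := by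
  rw [← c.strictMono_phi.le_iff_le, phi_psi]

/-- Integration in travel time. -/
theorem integral_comp_psi (g : ℝ → ℝ) (a b : ℝ) :
    ∫ σ in a..b, g (c.psi σ) * c.l (c.psi σ) = ∫ ζ in (c.psi a)..(c.psi b), g ζ :=
  intervalIntegral.integral_comp_mul_deriv_of_deriv_nonneg (g := g)
    c.continuous_psi.continuousOn (fun x _ => c.hasDerivAt_psi x) fun _ _ => (c.pos _).le

theorem integral_eq_integral_psi (g : ℝ → ℝ) (z : ℝ) :
    ∫ ζ in (0 : ℝ)..z, g ζ = ∫ σ in (0 : ℝ)..c.phi z, g (c.psi σ) * c.l (c.psi σ) := by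
  rw [c.integral_comp_psi, psi_zero, psi_phi]

theorem integral_div_eq_integral_psi (g : ℝ → ℝ) (z : ℝ) :
    ∫ ζ in (0 : ℝ)..z, g ζ / c.l ζ = ∫ σ in (0 : ℝ)..c.phi z, g (c.psi σ) := by
  rw [c.integral_eq_integral_psi]
  simp [div_mul_cancel₀ _ (c.ne_zero _)]

/-- The speed whose travel time is the sum of two travel times. -/
def harmonic (d : Speed) : Speed where
  l z := c.l z * d.l z / (c.l z + d.l z)
  continuous_l := (c.continuous_l.mul d.continuous_l).div (c.continuous_l.add d.continuous_l)
    fun z => (add_pos (c.pos z) (d.pos z)).ne'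
  lo := 1 / (1 / c.lo + 1 / d.lo)
  hi := 1 / (1 / c.hi + 1 / d.hi)
  lo_pos := by have := c.lo_pos; have := d.lo_pos; positivity
  lo_le z := by
    have h1 := c.lo_pos
    have h2 := d.lo_pos
    have h3 := c.pos z
    have h4 := d.pos z
    have e : c.l z * d.l z / (c.l z + d.l z) = 1 / (1 / c.l z + 1 / d.l z) := by
      field_simp; ring
    rw [e]
    have := one_div_le_one_div_of_le h1 (c.lo_le z)
    have := one_div_le_one_div_of_le h2 (d.lo_le z)
    exact one_div_le_one_div_of_le (by positivity) (by linarith)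
  le_hi z := by
    have h1 := c.hi_pos
    have h2 := d.hi_pos
    have h3 := c.pos z
    have h4 := d.pos z
    have e : c.l z * d.l z / (c.l z + d.l z) = 1 / (1 / c.l z + 1 / d.l z) := by
      field_simp; ring
    rw [e]
    have := one_div_le_one_div_of_le h3 (c.le_hi z)
    have := one_div_le_one_div_of_le h4 (d.le_hi z)
    exact one_div_le_one_div_of_le (by positivity) (by linarith)

theorem phi_harmonic (d : Speed) (z : ℝ) : (c.harmonic d).phi z = c.phi z + d.phi z := by
  unfold phi
  rw [← intervalIntegral.integral_add (c.continuous_inv.intervalIntegrable _ _)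
    (d.continuous_inv.intervalIntegrable _ _)]
  refine intervalIntegral.integral_congr fun ζ _ => ?_
  have h3 := c.pos ζ
  have h4 := d.pos ζ
  simp only [harmonic]
  field_simp; ring

/-- Curves with velocity `l` advance linearly in travel time. -/
theorem phi_eq_of_hasDerivWithinAt {γ : ℝ → ℝ} {ε r₀ r₁ : ℝ}
    (h : ∀ r ∈ Icc r₀ r₁, HasDerivWithinAt γ (ε * c.l (γ r)) (Icc r₀ r₁) r) {r : ℝ}
    (hr : r ∈ Icc r₀ r₁) : c.phi (γ r) = c.phi (γ r₀) + ε * (r - r₀) := by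
  have hd : ∀ r ∈ Icc r₀ r₁, HasDerivWithinAt (fun r => c.phi (γ r) - ε * r) 0 (Icc r₀ r₁) r := by
    intro r hr
    have h1 := (c.hasDerivAt_phi (γ r)).comp_hasDerivWithinAt r (h r hr)
    have h2 := h1.sub ((hasDerivWithinAt_id r (Icc r₀ r₁)).const_mul ε)
    convert! h2 using 1
    have := c.ne_zero (γ r)
    field_simp
    ring
  have := constant_of_derivWithin_zero (fun r hr => (hd r hr).differentiableWithinAt)
    (fun r hr => (hd r ⟨hr.1, hr.2.le⟩).derivWithin
      (uniqueDiffOn_Icc (hr.1.trans_lt hr.2) r ⟨hr.1, hr.2.le⟩)) r hr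
  linarith

end

end Speed

attribute [fun_prop] Speed.continuous_l Speed.continuous_phi

end Speeds

/-! ### The Goursat problem of one kernel row as a fixed point equation. -/

section Goursat
open MeasureTheory

/-- The projection of the real line to `[0, 1]`. -/
noncomputable def clampUnit (z : ℝ) : ℝ := max 0 (min 1 z)

@[fun_prop] theorem continuous_clampUnit : Continuous clampUnit := by
  unfold clampUnit; fun_prop

theorem clampUnit_mem (z : ℝ) : clampUnit z ∈ Icc (0 : ℝ) 1 :=
  ⟨le_max_left _ _, max_le zero_le_one (min_le_left _ _)⟩

theorem clampUnit_eq {z : ℝ} (hz : z ∈ Icc (0 : ℝ) 1) : clampUnit z = z := by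
  rw [clampUnit, min_eq_right hz.2, max_eq_right hz.1]

theorem ContinuousOn.exists_nonneg_bound_unit {f : ℝ → ℝ} (hf : ContinuousOn f (Icc 0 1)) :
    ∃ M, 0 ≤ M ∧ ∀ z ∈ Icc (0 : ℝ) 1, |f z| ≤ M := by
  obtain ⟨M, hM⟩ := isCompact_Icc.exists_bound_of_continuousOn hf
  exact ⟨M, (norm_nonneg _).trans (hM 0 (by simp)), hM⟩

/-- The variant for integration backwards along a characteristic, where the weight decays from its
value at the starting point. -/
theorem abs_integral_exp_sub_le {f : ℝ → ℝ} {C L s R : ℝ} (hL : 0 < L) (hR : 0 ≤ R) (hC : 0 ≤ C)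
    (h : ∀ r ∈ Icc 0 R, |f r| ≤ C * Real.exp (L * (s - r))) :
    |∫ r in (0 : ℝ)..R, f r| ≤ C / L * Real.exp (L * s) := by
  have h1 : ‖∫ ζ in (0 : ℝ)..R, f ζ‖ ≤ ∫ r in (0 : ℝ)..R, C * Real.exp (L * (s - r)) := by
    apply intervalIntegral.norm_integral_le_of_norm_le hR
    · exact Eventually.of_forall fun t ht => h t ⟨ht.1.le, ht.2⟩
    · exact (by fun_prop : Continuous fun r => C * Real.exp (L * (s - r))).intervalIntegrable _ _
  have h2 : ∫ r in (0 : ℝ)..R, C * Real.exp (L * (s - r))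
      = C / L * (Real.exp (L * s) - Real.exp (L * (s - R))) := by
    rw [intervalIntegral.integral_const_mul,
      intervalIntegral.integral_comp_sub_left (fun r => Real.exp (L * r)),
      intervalIntegral.integral_comp_mul_left _ hL.ne']
    simp [integral_exp]
    ring
  rw [h2] at h1
  rw [← Real.norm_eq_abs]
  have h3 : 0 ≤ C / L := by positivity
  have := Real.exp_pos (L * (s - R))
  nlinarith

namespace Goursat

noncomputable section

variable (c d : Speed) (p q G : ℝ → ℝ) (κ : ℝ)

/-- The abscissa at which the `V`-characteristic through `x` meets the diagonal. -/
def meet (x : ℝ × ℝ) : ℝ := (c.harmonic d).psi (c.phi x.1 + d.phi x.2)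

/-- The integrated equation of `V`. -/
def opV (f : ℝ × ℝ → ℝ × ℝ) (x : ℝ × ℝ) : ℝ :=
  G (meet c d x) + ∫ r in (0 : ℝ)..(c.phi x.1 - c.phi (meet c d x)),
    q (d.psi (d.phi x.2 + r)) * (f (c.psi (c.phi x.1 - r), d.psi (d.phi x.2 + r))).1

/-- The integrated equation of `U`. -/
def opU (f : ℝ × ℝ → ℝ × ℝ) (x : ℝ × ℝ) : ℝ :=
  κ * opV c d q G f (c.psi (c.phi x.1 - c.phi x.2), 0) + ∫ r in (0 : ℝ)..(c.phi x.2),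
    p (c.psi (c.phi x.2 - r)) * (f (c.psi (c.phi x.1 - r), c.psi (c.phi x.2 - r))).2

/-- The projection of the plane to the triangle. -/
def toTriangle (x : ℝ × ℝ) : ℝ × ℝ := (clampUnit x.1, min (clampUnit x.2) (clampUnit x.1))

theorem toTriangle_eq {z ζ : ℝ} (h0 : 0 ≤ ζ) (h1 : ζ ≤ z) (h2 : z ≤ 1) :
    toTriangle (z, ζ) = (z, ζ) := by
  rw [toTriangle, clampUnit_eq ⟨h0.trans h1, h2⟩, clampUnit_eq ⟨h0, h1.trans h2⟩, min_eq_left h1]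

theorem toTriangle_mem (x : ℝ × ℝ) :
    0 ≤ (toTriangle x).2 ∧ (toTriangle x).2 ≤ (toTriangle x).1 ∧ (toTriangle x).1 ≤ 1 :=
  ⟨le_min (clampUnit_mem _).1 (clampUnit_mem _).1, min_le_right _ _, (clampUnit_mem _).2⟩

@[fun_prop] theorem continuous_toTriangle : Continuous toTriangle := by
  unfold toTriangle; fun_prop

@[fun_prop] theorem continuous_meet : Continuous (meet c d) := by
  unfold meet; fun_prop

theorem phi_meet (x : ℝ × ℝ) :
    c.phi (meet c d x) + d.phi (meet c d x) = c.phi x.1 + d.phi x.2 := by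
  rw [← c.phi_harmonic d, meet, Speed.phi_psi]

theorem meet_self (z : ℝ) : meet c d (z, z) = z := by
  rw [meet, ← c.phi_harmonic d, Speed.psi_phi]

theorem le_meet {x : ℝ × ℝ} (h : x.2 ≤ x.1) : x.2 ≤ meet c d x := by
  rw [meet, Speed.le_psi_iff, Speed.phi_harmonic]
  linarith [c.strictMono_phi.monotone h]

theorem meet_le {x : ℝ × ℝ} (h : x.2 ≤ x.1) : meet c d x ≤ x.1 := by
  rw [meet, Speed.psi_le_iff, Speed.phi_harmonic]
  linarith [d.strictMono_phi.monotone h]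

variable {c d p q G κ}

theorem continuous_opV (hq : Continuous q) (hG : Continuous G) {f : ℝ × ℝ → ℝ × ℝ}
    (hf : Continuous f) : Continuous (opV c d q G f) := by
  unfold opV
  refine (hG.comp (continuous_meet c d)).add ?_
  apply intervalIntegral.continuous_parametric_intervalIntegral_of_continuous
  · simp only [Function.uncurry_def]
    fun_prop
  · fun_prop

theorem continuous_opU (hp : Continuous p) (hq : Continuous q) (hG : Continuous G)
    {f : ℝ × ℝ → ℝ × ℝ} (hf : Continuous f) : Continuous (opU c d p q G κ f) := by
  unfold opU
  have := continuous_opV (c := c) (d := d) hq hG hf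
  refine (by fun_prop : Continuous _).add ?_
  apply intervalIntegral.continuous_parametric_intervalIntegral_of_continuous
  · simp only [Function.uncurry_def]
    fun_prop
  · fun_prop

/-- The weight is exponential in the travel time of the first coordinate. That travel time falls at
unit rate when the characteristic is followed back to the diagonal, so the integral gains `1 / L`.
-/
theorem abs_opV_sub_le (hq : Continuous q) {f g : ℝ × ℝ → ℝ × ℝ} (hf : Continuous f)
    (hg : Continuous g) {b L Q : ℝ} (hb : 0 ≤ b) (hL : 0 < L)
    (hQ : ∀ z ∈ Icc (0 : ℝ) 1, |q z| ≤ Q)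
    (h : ∀ x, ‖f x - g x‖ ≤ b * Real.exp (L * c.phi (clampUnit x.1)))
    {x : ℝ × ℝ} (h0 : 0 ≤ x.2) (h1 : x.2 ≤ x.1) (h2 : x.1 ≤ 1) :
    |opV c d q G f x - opV c d q G g x| ≤ Q * b / L * Real.exp (L * c.phi x.1) := by
  have hm1 := le_meet c d h1
  have hm2 := meet_le c d h1
  have hQ0 : 0 ≤ Q := (abs_nonneg _).trans (hQ 0 (by simp))
  unfold opV
  rw [add_sub_add_left_eq_sub, ← intervalIntegral.integral_sub]
  rotate_left
  · exact Continuous.intervalIntegrable (by fun_prop) _ _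
  · exact Continuous.intervalIntegrable (by fun_prop) _ _
  refine abs_integral_exp_sub_le hL (by linarith [c.strictMono_phi.monotone hm2])
    (by positivity) fun r hr => ?_
  have hr2 : c.phi (meet c d x) ≤ c.phi x.1 - r := by linarith [hr.2]
  have e1 : c.psi (c.phi x.1 - r) ∈ Icc (0 : ℝ) 1 := by
    refine ⟨h0.trans (hm1.trans ?_), le_trans ?_ h2⟩
    · rwa [Speed.le_psi_iff]
    · rw [Speed.psi_le_iff]; linarith [hr.1]
  have e2 : d.psi (d.phi x.2 + r) ∈ Icc (0 : ℝ) 1 := by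
    refine ⟨h0.trans ?_, le_trans ?_ (hm2.trans h2)⟩
    · rw [Speed.le_psi_iff]; linarith [hr.1]
    · rw [Speed.psi_le_iff]; linarith [phi_meet c d x]
  rw [← mul_sub, abs_mul]
  have h3 := (norm_fst_le _).trans (h (c.psi (c.phi x.1 - r), d.psi (d.phi x.2 + r)))
  rw [clampUnit_eq e1, Speed.phi_psi, Prod.fst_sub, Real.norm_eq_abs] at h3
  rw [mul_assoc]
  exact mul_le_mul (hQ _ e2) h3 (abs_nonneg _) hQ0

/-- The boundary term of `opU` is `κ` times `opV`, not `κ` times the second component of `f`: in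
this form it carries the factor `1 / L` as well, and no smallness of `κ` is needed. -/
theorem abs_opU_sub_le (hp : Continuous p) (hq : Continuous q) {f g : ℝ × ℝ → ℝ × ℝ}
    (hf : Continuous f) (hg : Continuous g) {b L P Q : ℝ} (hb : 0 ≤ b) (hL : 0 < L)
    (hP : ∀ z ∈ Icc (0 : ℝ) 1, |p z| ≤ P) (hQ : ∀ z ∈ Icc (0 : ℝ) 1, |q z| ≤ Q)
    (h : ∀ x, ‖f x - g x‖ ≤ b * Real.exp (L * c.phi (clampUnit x.1)))
    {x : ℝ × ℝ} (h0 : 0 ≤ x.2) (h1 : x.2 ≤ x.1) (h2 : x.1 ≤ 1) :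
    |opU c d p q G κ f x - opU c d p q G κ g x|
      ≤ (|κ| * Q + P) * b / L * Real.exp (L * c.phi x.1) := by
  have hQ0 : 0 ≤ Q := (abs_nonneg _).trans (hQ 0 (by simp))
  have hP0 : 0 ≤ P := (abs_nonneg _).trans (hP 0 (by simp))
  have hz0 : c.psi (c.phi x.1 - c.phi x.2) ≤ x.1 := by
    rw [Speed.psi_le_iff]; linarith [c.phi_nonneg h0]
  have hz1 : 0 ≤ c.psi (c.phi x.1 - c.phi x.2) := by
    rw [Speed.le_psi_iff, Speed.phi_zero]; linarith [c.strictMono_phi.monotone h1]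
  have hV := abs_opV_sub_le (c := c) (d := d) (G := G) hq hf hg hb hL hQ h
    (x := (c.psi (c.phi x.1 - c.phi x.2), 0)) le_rfl hz1 (hz0.trans h2)
  have hV' : |opV c d q G f (c.psi (c.phi x.1 - c.phi x.2), 0)
      - opV c d q G g (c.psi (c.phi x.1 - c.phi x.2), 0)|
      ≤ Q * b / L * Real.exp (L * c.phi x.1) := by
    refine hV.trans (mul_le_mul_of_nonneg_left (Real.exp_le_exp.2 ?_) (by positivity))
    exact mul_le_mul_of_nonneg_left (c.strictMono_phi.monotone hz0) hL.le
  have hI : |(∫ r in (0 : ℝ)..(c.phi x.2),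
        p (c.psi (c.phi x.2 - r)) * (f (c.psi (c.phi x.1 - r), c.psi (c.phi x.2 - r))).2)
      - ∫ r in (0 : ℝ)..(c.phi x.2),
        p (c.psi (c.phi x.2 - r)) * (g (c.psi (c.phi x.1 - r), c.psi (c.phi x.2 - r))).2|
      ≤ P * b / L * Real.exp (L * c.phi x.1) := by
    rw [← intervalIntegral.integral_sub]
    rotate_left
    · exact Continuous.intervalIntegrable (by fun_prop) _ _
    · exact Continuous.intervalIntegrable (by fun_prop) _ _
    refine abs_integral_exp_sub_le hL (c.phi_nonneg h0) (by positivity) fun r hr => ?_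
    have e1 : c.psi (c.phi x.1 - r) ∈ Icc (0 : ℝ) 1 := by
      refine ⟨?_, le_trans ?_ h2⟩
      · rw [Speed.le_psi_iff, Speed.phi_zero]; linarith [hr.2, c.strictMono_phi.monotone h1]
      · rw [Speed.psi_le_iff]; linarith [hr.1]
    have e2 : c.psi (c.phi x.2 - r) ∈ Icc (0 : ℝ) 1 := by
      refine ⟨?_, le_trans ?_ (h1.trans h2)⟩
      · rw [Speed.le_psi_iff, Speed.phi_zero]; linarith [hr.2]
      · rw [Speed.psi_le_iff]; linarith [hr.1]
    rw [← mul_sub, abs_mul]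
    have h3 := (norm_snd_le _).trans (h (c.psi (c.phi x.1 - r), c.psi (c.phi x.2 - r)))
    rw [clampUnit_eq e1, Speed.phi_psi, Prod.snd_sub, Real.norm_eq_abs] at h3
    rw [mul_assoc]
    exact mul_le_mul (hP _ e2) h3 (abs_nonneg _) hP0
  unfold opU
  rw [add_sub_add_comm, ← mul_sub]
  refine (abs_add_le _ _).trans ((add_le_add ((abs_mul _ _).le.trans
    (mul_le_mul_of_nonneg_left hV' (abs_nonneg κ))) hI).trans (le_of_eq ?_))
  ring

/-- Composing the operators with the projection to the triangle makes them act on continuous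
functions on the whole plane, with bounds that come from a compact set. On the triangle the
projection is the identity, and the fixed point satisfies the original equations there. -/
theorem exists_fixed (hp : Continuous p) (hq : Continuous q) (hG : Continuous G) :
    ∃ f : ℝ × ℝ → ℝ × ℝ, Continuous f ∧ ∀ x : ℝ × ℝ, 0 ≤ x.2 → x.2 ≤ x.1 → x.1 ≤ 1 →
      (f x).1 = opU c d p q G κ f x ∧ (f x).2 = opV c d q G f x := by
  obtain ⟨P, hP0, hP⟩ := hp.continuousOn.exists_nonneg_bound_unit
  obtain ⟨Q, hQ0, hQ⟩ := hq.continuousOn.exists_nonneg_bound_unit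
  -- Twice the sum of both Lipschitz constants, so that either of them divided by `L` is at most one
  -- half.
  set L : ℝ := 2 * (|κ| * Q + P + Q) + 1 with hL
  have hL0 : 0 < L := by positivity
  set Op : (ℝ × ℝ → ℝ × ℝ) → ℝ × ℝ → ℝ × ℝ := fun f x =>
    (opU c d p q G κ f (toTriangle x), opV c d q G f (toTriangle x)) with hOp
  have hcont : ∀ f, Continuous f → Continuous (Op f) := fun f hf =>
    ((continuous_opU hp hq hG hf).comp continuous_toTriangle).prodMk
      ((continuous_opV hq hG hf).comp continuous_toTriangle)
  have hexp : ∀ x : ℝ × ℝ, 1 ≤ Real.exp (L * c.phi (clampUnit x.1)) := fun x =>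
    Real.one_le_exp (mul_nonneg hL0.le (c.phi_nonneg (clampUnit_mem _).1))
  have hbound : ∃ b, 0 ≤ b ∧ ∀ x, ‖Op 0 x - (0 : ℝ × ℝ → ℝ × ℝ) x‖ ≤ b := by
    have hK : IsCompact ((Icc (0 : ℝ) 1) ×ˢ (Icc (0 : ℝ) 1)) := isCompact_Icc.prod isCompact_Icc
    obtain ⟨b, hb⟩ := hK.exists_bound_of_continuousOn (f := Op 0)
      (hcont 0 continuous_zero).continuousOn
    have key : ∀ x, ‖Op 0 x‖ ≤ b := by
      intro x
      have h := toTriangle_mem x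
      have hmem : toTriangle x ∈ (Icc (0 : ℝ) 1) ×ˢ (Icc (0 : ℝ) 1) :=
        ⟨⟨h.1.trans h.2.1, h.2.2⟩, ⟨h.1, h.2.1.trans h.2.2⟩⟩
      have := hb _ hmem
      have e : toTriangle (toTriangle x) = toTriangle x := toTriangle_eq h.1 h.2.1 h.2.2
      simpa only [hOp, e] using this
    exact ⟨b, (norm_nonneg _).trans (key 0), fun x => by simpa using key x⟩
  obtain ⟨b₀, hb₀, hb⟩ := hbound
  obtain ⟨f, hf, hfix, -⟩ := exists_fixedPoint_of_weighted_contraction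
    (w := fun x : ℝ × ℝ => Real.exp (L * c.phi (clampUnit x.1))) (M := Real.exp (L * c.phi 1))
    (fun x => (Real.exp_pos _).le)
    (fun x => Real.exp_le_exp.2 (mul_le_mul_of_nonneg_left
      (c.strictMono_phi.monotone (clampUnit_mem _).2) hL0.le))
    (A := {f | Continuous f})
    (fun F g hF hFg => hFg.continuous (Frequently.of_forall hF))
    Op hcont
    (fun f hf g hg b hb h x => by
      have ht := toTriangle_mem x
      have h1 := abs_opU_sub_le (κ := κ) (d := d) (G := G) hp hq hf hg hb hL0 hP hQ h
        ht.1 ht.2.1 ht.2.2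
      have h2 := abs_opV_sub_le (d := d) (G := G) hq hf hg hb hL0 hQ h ht.1 ht.2.1 ht.2.2
      have e : (toTriangle x).1 = clampUnit x.1 := rfl
      rw [e] at h1 h2
      refine norm_prod_le_iff.2 ⟨h1.trans ?_, h2.trans ?_⟩
      · refine mul_le_mul_of_nonneg_right ?_ (Real.exp_pos _).le
        rw [div_le_div_iff₀ hL0 two_pos]
        nlinarith [mul_nonneg hQ0 hb]
      · refine mul_le_mul_of_nonneg_right ?_ (Real.exp_pos _).le
        rw [div_le_div_iff₀ hL0 two_pos]
        nlinarith [mul_nonneg (mul_nonneg (abs_nonneg κ) hQ0) hb, mul_nonneg hP0 hb])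
    0 continuous_zero b₀ hb₀
    (fun x => (hb x).trans (le_mul_of_one_le_right hb₀ (hexp x)))
  refine ⟨f, hf, fun x h0 h1 h2 => ?_⟩
  have := congrFun hfix x
  have e : toTriangle x = x := toTriangle_eq (z := x.1) (ζ := x.2) h0 h1 h2
  rw [← this]
  simp [hOp, e]

end

end Goursat

end Goursat

/-! ### Goursat solutions differentiated along characteristic curves. -/

section GoursatCharacteristics
open MeasureTheory

theorem hasDerivAt_integral_of_continuous {H : ℝ → ℝ} (hH : Continuous H) (a r : ℝ) :
    HasDerivAt (fun r => ∫ s in a..r, H s) (H r) r :=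
  intervalIntegral.integral_hasDerivAt_right (hH.intervalIntegrable _ _)
    (hH.stronglyMeasurableAtFilter _ _) hH.continuousAt

/-- Continuous solutions of the Goursat problem `U' = p V` on the curves `γ' = c`, `δ' = c` and
`V' = q U` on the curves `γ' = c`, `δ' = -d`, with data on `ζ = 0` and on the diagonal. -/
theorem exists_goursat_solution (c d : Speed) {p q G : ℝ → ℝ} (κ : ℝ) (hp : Continuous p)
    (hq : Continuous q) (hG : Continuous G) :
    ∃ U V : ℝ × ℝ → ℝ, Continuous U ∧ Continuous V ∧
      (∀ z ∈ Icc (0 : ℝ) 1, U (z, 0) = κ * V (z, 0)) ∧ (∀ z ∈ Icc (0 : ℝ) 1, V (z, z) = G z) ∧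
      (∀ (r₀ r₁ : ℝ) (γ δ : ℝ → ℝ), (∀ r ∈ Icc r₀ r₁, 0 ≤ δ r ∧ δ r ≤ γ r ∧ γ r ≤ 1 ∧
          HasDerivWithinAt γ (c.l (γ r)) (Icc r₀ r₁) r ∧
          HasDerivWithinAt δ (c.l (δ r)) (Icc r₀ r₁) r) → ∀ r ∈ Icc r₀ r₁,
        HasDerivWithinAt (fun r => U (γ r, δ r)) (p (δ r) * V (γ r, δ r)) (Icc r₀ r₁) r) ∧
      (∀ (r₀ r₁ : ℝ) (γ δ : ℝ → ℝ), (∀ r ∈ Icc r₀ r₁, 0 ≤ δ r ∧ δ r ≤ γ r ∧ γ r ≤ 1 ∧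
          HasDerivWithinAt γ (c.l (γ r)) (Icc r₀ r₁) r ∧
          HasDerivWithinAt δ (-d.l (δ r)) (Icc r₀ r₁) r) → ∀ r ∈ Icc r₀ r₁,
        HasDerivWithinAt (fun r => V (γ r, δ r)) (q (δ r) * U (γ r, δ r)) (Icc r₀ r₁) r) := by
  obtain ⟨f, hf, hfix⟩ := Goursat.exists_fixed (c := c) (d := d) (κ := κ) hp hq hG
  refine ⟨fun x => (f x).1, fun x => (f x).2, by fun_prop, by fun_prop, ?_, ?_, ?_, ?_⟩
  · intro z hz
    have h1 := (hfix (z, 0) le_rfl hz.1 hz.2).1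
    have h2 := (hfix (z, 0) le_rfl hz.1 hz.2).2
    simp only [Goursat.opU, Speed.phi_zero, sub_zero, Speed.psi_phi,
      intervalIntegral.integral_same, add_zero] at h1
    change (f (z, 0)).1 = κ * (f (z, 0)).2
    rw [h1, h2]
  · intro z hz
    have h2 := (hfix (z, z) hz.1 le_rfl hz.2).2
    simp only [Goursat.opV, Goursat.meet_self, sub_self, intervalIntegral.integral_same,
      add_zero] at h2
    exact h2
  · intro r₀ r₁ γ δ h
    have hγ : ∀ r ∈ Icc r₀ r₁, c.phi (γ r) = c.phi (γ r₀) + (r - r₀) := fun r hr => by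
      simpa using c.phi_eq_of_hasDerivWithinAt (ε := 1)
        (fun r hr => by simpa using (h r hr).2.2.2.1) hr
    have hδ : ∀ r ∈ Icc r₀ r₁, c.phi (δ r) = c.phi (δ r₀) + (r - r₀) := fun r hr => by
      simpa using c.phi_eq_of_hasDerivWithinAt (ε := 1)
        (fun r hr => by simpa using (h r hr).2.2.2.2) hr
    set A := c.phi (γ r₀) - r₀ with hA
    set D := c.phi (δ r₀) - r₀ with hD
    set H : ℝ → ℝ := fun r => p (c.psi (D + r)) * (f (c.psi (A + r), c.psi (D + r))).2 with hH
    have hHc : Continuous H := by fun_prop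
    -- In travel times the curve is `(A + r, D + r)`. All its points share the foot on `ζ = 0`, so
    -- after a shift of the variable only the upper limit of the integral depends on `r`.
    have key : ∀ r ∈ Icc r₀ r₁, (f (γ r, δ r)).1
        = κ * Goursat.opV c d q G f (c.psi (A - D), 0) + ∫ s in (-D)..r, H s := by
      intro r hr
      have hr' := h r hr
      rw [(hfix (γ r, δ r) hr'.1 hr'.2.1 hr'.2.2.1).1, Goursat.opU]
      have e1 : c.phi (γ r) = A + r := by rw [hγ r hr, hA]; ring
      have e2 : c.phi (δ r) = D + r := by rw [hδ r hr, hD]; ring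
      simp only [e1, e2]
      have e3 : (A + r) - (D + r) = A - D := by ring
      rw [e3]
      have e4 := intervalIntegral.integral_comp_sub_left (a := 0) (b := D + r) H r
      have e5 : r - (D + r) = -D := by ring
      rw [e5, sub_zero] at e4
      rw [← e4]
      simp only [hH, add_sub_assoc]
    intro r hr
    have hr' := h r hr
    have e1 : c.psi (A + r) = γ r := by
      have : c.phi (γ r) = A + r := by rw [hγ r hr, hA]; ring
      rw [← this, Speed.psi_phi]
    have e2 : c.psi (D + r) = δ r := by
      have : c.phi (δ r) = D + r := by rw [hδ r hr, hD]; ring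
      rw [← this, Speed.psi_phi]
    have hd := ((hasDerivAt_integral_of_continuous hHc (-D) r).const_add
      (κ * Goursat.opV c d q G f (c.psi (A - D), 0))).hasDerivWithinAt (s := Icc r₀ r₁)
    have e3 : H r = p (δ r) * (f (γ r, δ r)).2 := by simp only [hH, e1, e2]
    rw [e3] at hd
    exact hd.congr key (key r hr)
  · intro r₀ r₁ γ δ h
    have hγ : ∀ r ∈ Icc r₀ r₁, c.phi (γ r) = c.phi (γ r₀) + (r - r₀) := fun r hr => by
      simpa using c.phi_eq_of_hasDerivWithinAt (ε := 1)
        (fun r hr => by simpa using (h r hr).2.2.2.1) hr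
    have hδ : ∀ r ∈ Icc r₀ r₁, d.phi (δ r) = d.phi (δ r₀) - (r - r₀) := fun r hr => by
      have := d.phi_eq_of_hasDerivWithinAt (ε := -1)
        (fun r hr => by simpa using (h r hr).2.2.2.2) hr
      linarith
    set A := c.phi (γ r₀) - r₀ with hA
    set D := d.phi (δ r₀) + r₀ with hD
    -- The sum of the two travel times is constant along these curves, hence so is the point where
    -- they meet the diagonal.
    set m := (c.harmonic d).psi (A + D) with hm
    set H : ℝ → ℝ := fun r => q (d.psi (D - r)) * (f (c.psi (A + r), d.psi (D - r))).1 with hH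
    have hHc : Continuous H := by fun_prop
    have key : ∀ r ∈ Icc r₀ r₁, (f (γ r, δ r)).2 = G m + ∫ s in (c.phi m - A)..r, H s := by
      intro r hr
      have hr' := h r hr
      have e1 : c.phi (γ r) = A + r := by rw [hγ r hr, hA]; ring
      have e2 : d.phi (δ r) = D - r := by rw [hδ r hr, hD]; ring
      have e0 : Goursat.meet c d (γ r, δ r) = m := by
        rw [Goursat.meet, hm, e1, e2]
        congr 1
        ring
      rw [(hfix (γ r, δ r) hr'.1 hr'.2.1 hr'.2.2.1).2, Goursat.opV]
      simp only [e0, e1, e2]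
      have e4 := intervalIntegral.integral_comp_sub_left (a := 0) (b := A + r - c.phi m) H r
      have e5 : r - (A + r - c.phi m) = c.phi m - A := by ring
      rw [e5, sub_zero] at e4
      rw [← e4]
      simp only [hH, add_sub_assoc, sub_sub_eq_add_sub, sub_add_eq_add_sub]
    intro r hr
    have hr' := h r hr
    have e1 : c.psi (A + r) = γ r := by
      have : c.phi (γ r) = A + r := by rw [hγ r hr, hA]; ring
      rw [← this, Speed.psi_phi]
    have e2 : d.psi (D - r) = δ r := by
      have : d.phi (δ r) = D - r := by rw [hδ r hr, hD]; ring
      rw [← this, Speed.psi_phi]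
    have hd := ((hasDerivAt_integral_of_continuous hHc (c.phi m - A) r).const_add
      (G m)).hasDerivWithinAt (s := Icc r₀ r₁)
    have e3 : H r = q (δ r) * (f (γ r, δ r)).1 := by simp only [hH, e1, e2]
    rw [e3] at hd
    exact hd.congr key (key r hr)

end GoursatCharacteristics

/-! ### Existence of the backstepping kernel. -/

section KernelExistence
open MeasureTheory

/-- Serves to run the characteristics of the second kernel row backwards, where the first coordinate
has the negative velocity `-λ₂`. -/
theorem HasDerivWithinAt.comp_neg_Icc {f : ℝ → ℝ} {f' r₀ r₁ r : ℝ}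
    (h : HasDerivWithinAt f f' (Icc r₀ r₁) (-r)) :
    HasDerivWithinAt (fun r => f (-r)) (-f') (Icc (-r₁) (-r₀)) r := by
  have h1 : HasDerivWithinAt (fun r : ℝ => -r) (-1) (Icc (-r₁) (-r₀)) r :=
    (hasDerivAt_neg r).hasDerivWithinAt
  have h2 : HasDerivWithinAt (fun r => f (-r)) (f' * -1) (Icc (-r₁) (-r₀)) r :=
    HasDerivWithinAt.comp r h h1 (fun x hx => ⟨by linarith [hx.2], by linarith [hx.1]⟩)
  rwa [mul_neg_one] at h2

namespace PDEODESystem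

noncomputable section

variable {n : ℕ} (P : PDEODESystem n)

/-- The speed `λ_i`, extended to the real line by constants. -/
def speed (i : Fin 2) : Speed :=
  have hmin := isCompact_Icc.exists_isMinOn (nonempty_Icc.2 zero_le_one) (P.lam_continuousOn i)
  have hmax := isCompact_Icc.exists_isMaxOn (nonempty_Icc.2 zero_le_one) (P.lam_continuousOn i)
  { l := fun z => P.lam i (clampUnit z)
    continuous_l := (P.lam_continuousOn i).comp_continuous continuous_clampUnit clampUnit_mem
    lo := P.lam i hmin.choose
    hi := P.lam i hmax.choose
    lo_pos := P.lam_pos i _ hmin.choose_spec.1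
    lo_le := fun z => hmin.choose_spec.2 (clampUnit_mem z)
    le_hi := fun z => hmax.choose_spec.2 (clampUnit_mem z) }

theorem speed_l (i : Fin 2) {z : ℝ} (hz : z ∈ Icc (0 : ℝ) 1) : (P.speed i).l z = P.lam i z := by
  change P.lam i (clampUnit z) = _
  rw [clampUnit_eq hz]

theorem uIcc_zero_subset_unit {z : ℝ} (hz : z ∈ Icc (0 : ℝ) 1) : uIcc 0 z ⊆ Icc (0 : ℝ) 1 := by
  rw [uIcc_of_le hz.1]
  exact Icc_subset_Icc le_rfl hz.2

theorem speed_phi (i : Fin 2) {z : ℝ} (hz : z ∈ Icc (0 : ℝ) 1) : (P.speed i).phi z = P.phi i z :=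
  intervalIntegral.integral_congr fun ζ hζ => by
    simp only [P.speed_l i (uIcc_zero_subset_unit hz hζ)]

theorem continuousOn_alpha (i : Fin 2) : ContinuousOn (P.alpha i) (Icc 0 1) := by
  have h : ContinuousOn (fun ζ => P.A ζ i i / P.lam i ζ) (Icc 0 1) :=
    (P.A_continuousOn i i).div (P.lam_continuousOn i) fun z hz => (P.lam_pos i z hz).ne'
  have := intervalIntegral.continuousOn_primitive_interval (a := 0) (b := 1) (μ := volume)
    (f := fun ζ => P.A ζ i i / P.lam i ζ) (by
      rw [uIcc_of_le zero_le_one]; exact h.integrableOn_Icc)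
  rwa [uIcc_of_le zero_le_one] at this

theorem continuousOn_Atilde (i j : Fin 2) : ContinuousOn (fun z => P.Atilde z i j) (Icc 0 1) := by
  have h0 := P.continuousOn_alpha 0
  have h1 := P.continuousOn_alpha 1
  have hA := P.A_continuousOn 0 1
  have hA' := P.A_continuousOn 1 0
  fin_cases i <;> fin_cases j <;> simp [Atilde]
  · exact continuousOn_const
  · fun_prop
  · fun_prop
  · exact continuousOn_const

/-- The coupling matrix `Ã`, extended to the real line by constants. -/
def coupling (i j : Fin 2) (z : ℝ) : ℝ := P.Atilde (clampUnit z) i j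

@[fun_prop] theorem continuous_coupling (i j : Fin 2) : Continuous (P.coupling i j) :=
  (P.continuousOn_Atilde i j).comp_continuous continuous_clampUnit clampUnit_mem

theorem coupling_eq (i j : Fin 2) {z : ℝ} (hz : z ∈ Icc (0 : ℝ) 1) :
    P.coupling i j z = P.Atilde z i j := by rw [coupling, clampUnit_eq hz]

/-- Since `Ã` has zero diagonal, right multiplication by it couples only the two entries of a row.
Each row is thus a Goursat problem: the off-diagonal entry is given on the diagonal, and the two
entries are proportional on `ζ = 0`. The proportionality in the second row needs `q₀ ≠ 0`. -/
theorem exists_isKernel (hq : P.q0 ≠ 0) : ∃ K, P.IsKernel K := by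
  set c := P.speed 0 with hc
  set d := P.speed 1 with hd
  have cc := c.continuous_l
  have dc := d.continuous_l
  have c0 := c.ne_zero
  have d0 := d.ne_zero
  have cd0 : ∀ z, c.l z + d.l z ≠ 0 := fun z => (add_pos (c.pos z) (d.pos z)).ne'
  -- First row: `U₁ = K₁₁ λ₁` and `V₁ = K₁₂ λ₂` with the speeds taken at `ζ`. For these products the
  -- kernel equations are ordinary differential equations along characteristics.
  obtain ⟨U₁, V₁, hU₁, hV₁, hb₁, hg₁, hu₁, hv₁⟩ := exists_goursat_solution c d
    (p := fun z => c.l z / d.l z * P.coupling 1 0 z)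
    (q := fun z => d.l z / c.l z * P.coupling 0 1 z)
    (G := fun z => -(P.coupling 0 1 z * d.l z / (c.l z + d.l z))) P.q0
    (by fun_prop (disch := assumption)) (by fun_prop (disch := assumption))
    (by fun_prop (disch := assumption))
  -- Second row: `U₂ = K₂₂ λ₂` and `V₂ = K₂₁ λ₁`. The speeds exchange roles and the curves are run
  -- backwards, whence the minus signs in `p` and `q`.
  obtain ⟨U₂, V₂, hU₂, hV₂, hb₂, hg₂, hu₂, hv₂⟩ := exists_goursat_solution d c
    (p := fun z => -(d.l z / c.l z * P.coupling 0 1 z))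
    (q := fun z => -(c.l z / d.l z * P.coupling 1 0 z))
    (G := fun z => P.coupling 1 0 z * c.l z / (c.l z + d.l z)) (1 / P.q0)
    (by fun_prop (disch := assumption)) (by fun_prop (disch := assumption))
    (by fun_prop (disch := assumption))
  have h01 : (0 : ℝ) ∈ Icc (0 : ℝ) 1 := by simp
  refine ⟨fun z ζ => !![U₁ (z, ζ) / c.l ζ, V₁ (z, ζ) / d.l ζ; V₂ (z, ζ) / c.l ζ, U₂ (z, ζ) / d.l ζ],
    ?_, ?_, ?_, ?_, ?_, ?_⟩
  · refine Continuous.continuousOn (continuous_matrix fun i j => ?_)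
    fin_cases i <;> fin_cases j <;> simp
    · exact hU₁.div (cc.comp continuous_snd) fun _ => c0 _
    · exact hV₁.div (dc.comp continuous_snd) fun _ => d0 _
    · exact hV₂.div (cc.comp continuous_snd) fun _ => c0 _
    · exact hU₂.div (dc.comp continuous_snd) fun _ => d0 _
  · intro i j r₀ r₁ γ δ h r hr
    have hγ1 : ∀ r ∈ Icc r₀ r₁, γ r ∈ Icc (0 : ℝ) 1 := fun r hr =>
      ⟨(h r hr).1.trans (h r hr).2.1, (h r hr).2.2.1⟩
    have hδ1 : ∀ r ∈ Icc r₀ r₁, δ r ∈ Icc (0 : ℝ) 1 := fun r hr =>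
      ⟨(h r hr).1, (h r hr).2.1.trans (h r hr).2.2.1⟩
    have hl : ∀ r ∈ Icc r₀ r₁, P.lam 0 (γ r) = c.l (γ r) ∧ P.lam 1 (γ r) = d.l (γ r) ∧
        P.lam 0 (δ r) = c.l (δ r) ∧ P.lam 1 (δ r) = d.l (δ r) := fun r hr =>
      ⟨(P.speed_l 0 (hγ1 r hr)).symm, (P.speed_l 1 (hγ1 r hr)).symm,
        (P.speed_l 0 (hδ1 r hr)).symm, (P.speed_l 1 (hδ1 r hr)).symm⟩
    have hneg : ∀ r ∈ Icc (-r₁) (-r₀), -r ∈ Icc r₀ r₁ := fun r hr =>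
      ⟨by linarith [hr.2], by linarith [hr.1]⟩
    have hr' : -r ∈ Icc (-r₁) (-r₀) := ⟨by linarith [hr.2], by linarith [hr.1]⟩
    have e10 := P.coupling_eq 1 0 (hδ1 r hr)
    have e01 := P.coupling_eq 0 1 (hδ1 r hr)
    have a00 : P.Atilde (δ r) 0 0 = 0 := rfl
    have a11 : P.Atilde (δ r) 1 1 = 0 := rfl
    have back : ∀ {f : ℝ → ℝ} {f' : ℝ}, HasDerivWithinAt (fun r => f (-r)) f'
        (Icc (-r₁) (-r₀)) (-r) → HasDerivWithinAt f (-f') (Icc r₀ r₁) r := by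
      intro f f' hf
      simpa using hf.comp_neg_Icc
    fin_cases i <;> fin_cases j <;>
      simp only [Fin.zero_eta, Fin.mk_one, Lam, Matrix.cons_val_zero, Matrix.cons_val_one,
        Matrix.of_apply, Matrix.cons_val_fin_one, Matrix.mul_apply, Fin.sum_univ_two,
        a00, a11] at h ⊢
    · have := hu₁ r₀ r₁ γ δ (fun r hr => by
        obtain ⟨h1, h2, h3, h4⟩ := hl r hr
        have := h r hr
        rwa [h1, h3] at this) r hr
      refine (this.congr_deriv ?_).congr_of_mem (fun r hr => ?_) hr
      · rw [(hl r hr).2.2.1, ← e10]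
        field_simp [c0 (δ r), d0 (δ r)]
        ring
      · rw [(hl r hr).2.2.1]
        field_simp [c0 (δ r)]
    · have := hv₁ r₀ r₁ γ δ (fun r hr => by
        obtain ⟨h1, h2, h3, h4⟩ := hl r hr
        have := h r hr
        rwa [h1, h4] at this) r hr
      refine (this.neg.congr_deriv ?_).congr_of_mem (fun r hr => ?_) hr
      · rw [(hl r hr).2.2.2, ← e01]
        field_simp [c0 (δ r), d0 (δ r)]
        ring
      · rw [(hl r hr).2.2.2]
        simp only [Pi.neg_apply]
        field_simp [d0 (δ r)]
    · have := back (f := fun r => V₂ (γ r, δ r)) (hv₂ (-r₁) (-r₀) (fun r => γ (-r)) (fun r => δ (-r))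
        (fun r hr => by
          obtain ⟨h1, h2, h3, h4⟩ := hl (-r) (hneg r hr)
          have := h (-r) (hneg r hr)
          rw [h2, h3] at this
          refine ⟨this.1, this.2.1, this.2.2.1, ?_, ?_⟩
          · simpa using this.2.2.2.1.comp_neg_Icc
          · simpa using this.2.2.2.2.comp_neg_Icc) (-r) hr')
      refine (this.congr_deriv ?_).congr_of_mem (fun r hr => ?_) hr
      · rw [(hl r hr).2.2.1, ← e10, neg_neg]
        field_simp [c0 (δ r), d0 (δ r)]
        ring
      · rw [(hl r hr).2.2.1]
        field_simp [c0 (δ r)]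
    · have := back (f := fun r => U₂ (γ r, δ r)) (hu₂ (-r₁) (-r₀) (fun r => γ (-r)) (fun r => δ (-r))
        (fun r hr => by
          obtain ⟨h1, h2, h3, h4⟩ := hl (-r) (hneg r hr)
          have := h (-r) (hneg r hr)
          rw [h2, h4] at this
          refine ⟨this.1, this.2.1, this.2.2.1, ?_, ?_⟩
          · simpa using this.2.2.2.1.comp_neg_Icc
          · simpa using this.2.2.2.2.comp_neg_Icc) (-r) hr')
      refine (this.neg.congr_deriv ?_).congr_of_mem (fun r hr => ?_) hr
      · rw [(hl r hr).2.2.2, ← e01, neg_neg]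
        field_simp [c0 (δ r), d0 (δ r)]
        ring
      · rw [(hl r hr).2.2.2]
        simp only [Pi.neg_apply]
        field_simp [d0 (δ r)]
  · intro z hz
    simp only [Matrix.of_apply, Matrix.cons_val_zero, Matrix.cons_val_one, Matrix.cons_val_fin_one,
      hb₁ z hz, ← P.speed_l _ h01, ← hc, ← hd]
    field_simp [c0 0, d0 0]
  · intro z hz
    simp only [Matrix.of_apply, Matrix.cons_val_zero, Matrix.cons_val_one, Matrix.cons_val_fin_one,
      hg₁ z hz, ← P.speed_l _ hz, ← hc, ← hd, ← P.coupling_eq 0 1 hz]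
    field_simp [d0 z, cd0 z]
  · intro z hz
    simp only [Matrix.of_apply, Matrix.cons_val_zero, Matrix.cons_val_one, Matrix.cons_val_fin_one,
      hg₂ z hz, ← P.speed_l _ hz, ← hc, ← hd, ← P.coupling_eq 1 0 hz]
    field_simp [c0 z, cd0 z]
  · intro z hz
    simp only [Matrix.of_apply, Matrix.cons_val_zero, Matrix.cons_val_one, Matrix.cons_val_fin_one,
      hb₂ z hz, ← P.speed_l _ h01, ← hc, ← hd]
    field_simp [c0 0, d0 0]

end

end PDEODESystem

end KernelExistence

/-! ### Measurable locally bounded functions and integration over curved regions. -/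

section LocallyBounded
open MeasureTheory

/-- Measurable functions that are bounded on compact sets. -/
structure LocBdd {X : Type*} [TopologicalSpace X] [MeasurableSpace X] (f : X → ℝ) : Prop where
  meas : Measurable f
  bdd : ∀ K : Set X, IsCompact K → ∃ C, ∀ x ∈ K, |f x| ≤ C

namespace LocBdd

variable {X Y : Type*} [TopologicalSpace X] [MeasurableSpace X] [TopologicalSpace Y]
  [MeasurableSpace Y] {f g : X → ℝ}

theorem of_continuous [OpensMeasurableSpace X] (hf : Continuous f) : LocBdd f :=
  ⟨hf.measurable, fun _ hK => hK.exists_bound_of_continuousOn hf.continuousOn⟩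

theorem of_bound (hf : Measurable f) {C : ℝ} (hC : ∀ x, |f x| ≤ C) : LocBdd f :=
  ⟨hf, fun _ _ => ⟨C, fun x _ => hC x⟩⟩

theorem add (hf : LocBdd f) (hg : LocBdd g) : LocBdd fun x => f x + g x := by
  refine ⟨hf.meas.add hg.meas, fun K hK => ?_⟩
  obtain ⟨C, hC⟩ := hf.bdd K hK
  obtain ⟨D, hD⟩ := hg.bdd K hK
  exact ⟨C + D, fun x hx => (abs_add_le _ _).trans (add_le_add (hC x hx) (hD x hx))⟩

theorem mul (hf : LocBdd f) (hg : LocBdd g) : LocBdd fun x => f x * g x := by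
  refine ⟨hf.meas.mul hg.meas, fun K hK => ?_⟩
  obtain ⟨C, hC⟩ := hf.bdd K hK
  obtain ⟨D, hD⟩ := hg.bdd K hK
  refine ⟨C * D, fun x hx => ?_⟩
  rw [abs_mul]
  exact mul_le_mul (hC x hx) (hD x hx) (abs_nonneg _) ((abs_nonneg _).trans (hC x hx))

theorem neg (hf : LocBdd f) : LocBdd fun x => -f x :=
  ⟨hf.meas.neg, fun K hK => by simpa using hf.bdd K hK⟩

theorem ite (hf : LocBdd f) {p : X → Prop} [DecidablePred p] (hp : MeasurableSet {x | p x}) :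
    LocBdd fun x => if p x then f x else 0 := by
  refine ⟨Measurable.ite hp hf.meas measurable_const, fun K hK => ?_⟩
  obtain ⟨C, hC⟩ := hf.bdd K hK
  refine ⟨C, fun x hx => ?_⟩
  split_ifs
  · exact hC x hx
  · simpa using (abs_nonneg _).trans (hC x hx)

theorem comp [OpensMeasurableSpace Y] [BorelSpace X] (hf : LocBdd f) {k : Y → X}
    (hk : Continuous k) : LocBdd fun y => f (k y) := by
  refine ⟨hf.meas.comp hk.measurable, fun K hK => ?_⟩
  obtain ⟨C, hC⟩ := hf.bdd _ (hK.image hk)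
  exact ⟨C, fun y hy => hC _ (mem_image_of_mem _ hy)⟩

theorem intervalIntegrable {f : ℝ → ℝ} (hf : LocBdd f) (a b : ℝ) :
    IntervalIntegrable f volume a b := by
  rw [intervalIntegrable_iff]
  obtain ⟨C, hC⟩ := hf.bdd (uIcc a b) isCompact_uIcc
  refine Measure.integrableOn_of_bounded (M := C) (by simp) hf.meas.aestronglyMeasurable ?_
  filter_upwards [ae_restrict_mem measurableSet_uIoc] with z hz
  exact hC z (uIoc_subset_uIcc hz)

theorem integral_param {F : X × ℝ → ℝ} (hF : LocBdd F) {a b : ℝ} (hab : a ≤ b) :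
    LocBdd fun x => ∫ y in a..b, F (x, y) := by
  refine ⟨?_, fun K hK => ?_⟩
  · simp only [intervalIntegral.integral_of_le hab]
    exact (hF.meas.stronglyMeasurable.integral_prod_right').measurable
  · obtain ⟨C, hC⟩ := hF.bdd (K ×ˢ Icc a b) (hK.prod isCompact_Icc)
    refine ⟨C * |b - a|, fun x hx => ?_⟩
    refine intervalIntegral.norm_integral_le_of_norm_le_const (f := fun y => F (x, y))
      fun y hy => hC (x, y) ⟨hx, ?_⟩
    rw [uIoc_of_le hab] at hy
    exact ⟨hy.1.le, hy.2⟩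

theorem integral_swap {F : ℝ × ℝ → ℝ} (hF : LocBdd F) {a b c d : ℝ} (hab : a ≤ b) (hcd : c ≤ d) :
    ∫ x in a..b, ∫ y in c..d, F (x, y) = ∫ y in c..d, ∫ x in a..b, F (x, y) := by
  simp only [intervalIntegral.integral_of_le hab, intervalIntegral.integral_of_le hcd]
  refine integral_integral_swap (f := fun x y => F (x, y)) ?_
  rw [Measure.prod_restrict]
  obtain ⟨C, hC⟩ := hF.bdd (Icc a b ×ˢ Icc c d) (isCompact_Icc.prod isCompact_Icc)
  refine Measure.integrableOn_of_bounded (M := C) ?_ hF.meas.aestronglyMeasurable ?_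
  · simp [Measure.prod_prod, ENNReal.mul_ne_top]
  · filter_upwards [ae_restrict_mem (measurableSet_Ioc.prod measurableSet_Ioc)] with x hx
    exact hC x ⟨Ioc_subset_Icc_self hx.1, Ioc_subset_Icc_self hx.2⟩

end LocBdd

/-- Trades a variable limit of integration for an indicator on a fixed interval, so that Fubini's
theorem and measurability in parameters apply. -/
theorem integral_ite_lt {f : ℝ → ℝ} {c m d : ℝ} (hcm : c ≤ m) (hmd : m ≤ d) :
    ∫ y in c..d, (if m < y then f y else 0) = ∫ y in m..d, f y := by
  rw [intervalIntegral.integral_of_le (hcm.trans hmd), intervalIntegral.integral_of_le hmd]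
  have : (fun y => if m < y then f y else 0) = (Ioi m).indicator f := rfl
  rw [this, setIntegral_indicator measurableSet_Ioi, Ioc_inter_Ioi, max_eq_right hcm]

theorem integral_ite_gt {f : ℝ → ℝ} {c m d : ℝ} (hcm : c ≤ m) (hmd : m ≤ d) :
    ∫ y in c..d, (if y < m then f y else 0) = ∫ y in c..m, f y := by
  rw [intervalIntegral.integral_of_le (hcm.trans hmd), intervalIntegral.integral_of_le hcm]
  have : (fun y => if y < m then f y else 0) = (Iio m).indicator f := rfl
  rw [this, setIntegral_indicator measurableSet_Iio, integral_Ioc_eq_integral_Ioo]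
  congr 2
  ext y
  constructor
  · exact fun h => ⟨h.1.1, h.2⟩
  · exact fun h => ⟨⟨h.1, h.2.le.trans hmd⟩, h.2⟩

/-- Integration over the region between the curve `θ = B ρ` and the axis `θ = 0`, first along
the lines of constant `θ`. -/
theorem integral_sweep {B B' m : ℝ → ℝ} (hB : ∀ r, HasDerivAt B (B' r) r) (hB' : ∀ r, 0 ≤ B' r)
    (hB0 : B 0 = 0) (hm : ∀ ρ θ, m θ < ρ ↔ θ < B ρ)
    (hm' : ∀ ρ θ, m θ ≤ ρ ↔ θ ≤ B ρ) {R : ℝ × ℝ → ℝ} (hR : LocBdd R) {g : ℝ → ℝ}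
    (hg : LocBdd g) {r : ℝ} (hr : 0 ≤ r) :
    ∫ θ in (0 : ℝ)..B r, (g θ + ∫ ρ in m θ..r, R (ρ, θ)) =
      (∫ ρ in (0 : ℝ)..r, g (B ρ) * B' ρ) + ∫ ρ in (0 : ℝ)..r, ∫ θ in (0 : ℝ)..B ρ, R (ρ, θ) := by
  have hBc : Continuous B := continuous_iff_continuousAt.2 fun x => (hB x).continuousAt
  have hBm : Monotone B := monotone_of_deriv_nonneg (fun x => (hB x).differentiableAt) fun x => by
    rw [(hB x).deriv]; exact hB' x
  have hBr : 0 ≤ B r := hB0 ▸ hBm hr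
  have hms : MeasurableSet {x : ℝ × ℝ | x.2 < B x.1} :=
    measurableSet_lt measurable_snd (hBc.measurable.comp measurable_fst)
  -- Extension by zero to the rectangle `[0, r] × [0, B r]`, where the order of integration may be
  -- exchanged. By `hm` the condition `m θ < ρ` describes the same region.
  set F : ℝ × ℝ → ℝ := fun x => if x.2 < B x.1 then R x else 0 with hF
  have hFl : LocBdd F := hR.ite hms
  have hsw := hFl.integral_swap hr hBr
  have e1 : ∀ ρ ∈ uIcc 0 r, ∫ θ in (0 : ℝ)..B r, F (ρ, θ) = ∫ θ in (0 : ℝ)..B ρ, R (ρ, θ) := by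
    intro ρ hρ
    rw [uIcc_of_le hr] at hρ
    exact integral_ite_gt (f := fun θ => R (ρ, θ)) (hB0 ▸ hBm hρ.1) (hBm hρ.2)
  have e2 : ∀ θ ∈ uIcc 0 (B r), ∫ ρ in (0 : ℝ)..r, F (ρ, θ) = ∫ ρ in m θ..r, R (ρ, θ) := by
    intro θ hθ
    rw [uIcc_of_le hBr] at hθ
    simp only [hF, ← hm]
    refine integral_ite_lt (f := fun ρ => R (ρ, θ)) ?_ ((hm' r θ).2 hθ.2)
    by_contra h
    have := (hm 0 θ).1 (not_le.1 h)
    rw [hB0] at this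
    exact absurd hθ.1 (not_le.2 this)
  rw [intervalIntegral.integral_congr e1, intervalIntegral.integral_congr e2] at hsw
  rw [intervalIntegral.integral_add (hg.intervalIntegrable _ _), hsw]
  · congr 1
    -- The part with `g` is carried to the variable `ρ` by the substitution `θ = B ρ`.
    have := intervalIntegral.integral_comp_mul_deriv_of_deriv_nonneg (a := 0) (b := r) (g := g)
      hBc.continuousOn (fun x _ => hB x) (fun x _ => hB' x)
    rw [hB0] at this
    exact this.symm
  · have := (LocBdd.integral_param (F := fun x : ℝ × ℝ => F (x.2, x.1))
      (hFl.comp continuous_swap) hr).intervalIntegrable 0 (B r)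
    rw [intervalIntegrable_congr]
    · exact this
    · intro θ hθ
      exact (e2 θ (uIoc_subset_uIcc hθ)).symm

end LocallyBounded

/-! ### One kernel row against the transport equations: cancellation along characteristics. -/

section RowIdentity
open MeasureTheory

theorem eq_add_integral_of_hasDerivWithinAt {f f' : ℝ → ℝ} {a b : ℝ}
    (h : ∀ x ∈ Icc a b, HasDerivWithinAt f (f' x) (Icc a b) x)
    (hi : IntervalIntegrable f' volume a b) {x : ℝ} (hx : x ∈ Icc a b) :
    f x = f a + ∫ y in a..x, f' y := by
  have := intervalIntegral.integral_eq_sub_of_hasDerivAt_of_le (f := f) (f' := f') hx.1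
    (fun y hy => ((h y ⟨hy.1, hy.2.trans hx.2⟩).continuousWithinAt).mono
      (Icc_subset_Icc le_rfl hx.2))
    (fun y hy => (h y ⟨hy.1.le, hy.2.le.trans hx.2⟩).hasDerivAt
      (Icc_mem_nhds hy.1 (hy.2.trans_le hx.2)))
    (hi.mono_set (by
      rw [uIcc_of_le hx.1, uIcc_of_le (hx.1.trans hx.2)]; exact Icc_subset_Icc le_rfl hx.2))
  rw [this]; ring

/-- One row of the kernel equations, with the two transport equations it is coupled to. The pair
`a`, `e` propagates with the speeds `c` (towards `0`) and `d` (away from `0`). -/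
structure RowData (c d : Speed) (ka kb : ℝ × ℝ → ℝ) (β ω : ℝ → ℝ) (a e : ℝ × ℝ → ℝ)
    (va vb : ℝ → ℝ) : Prop where
  ka_cont : Continuous ka
  kb_cont : Continuous kb
  β_cont : Continuous β
  ω_cont : Continuous ω
  a_locBdd : LocBdd a
  e_locBdd : LocBdd e
  transport_a : ∀ t, ∀ z ∈ Icc (0 : ℝ) 1,
    a (t - c.phi z, z) = va t - ∫ ζ in (0 : ℝ)..z, β ζ * e (t - c.phi ζ, ζ) / c.l ζ
  transport_e : ∀ t, ∀ z ∈ Icc (0 : ℝ) 1,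
    e (t + d.phi z, z) = vb t + ∫ ζ in (0 : ℝ)..z, ω ζ * a (t + d.phi ζ, ζ) / d.l ζ
  kernel_a : ∀ (r₀ r₁ : ℝ) (γ δ : ℝ → ℝ), (∀ r ∈ Icc r₀ r₁, 0 ≤ δ r ∧ δ r ≤ γ r ∧ γ r ≤ 1 ∧
      HasDerivWithinAt γ (c.l (γ r)) (Icc r₀ r₁) r ∧
      HasDerivWithinAt δ (c.l (δ r)) (Icc r₀ r₁) r) → ∀ r ∈ Icc r₀ r₁,
    HasDerivWithinAt (fun r => ka (γ r, δ r) * c.l (δ r))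
      (c.l (δ r) * (kb (γ r, δ r) * ω (δ r))) (Icc r₀ r₁) r
  kernel_b : ∀ (r₀ r₁ : ℝ) (γ δ : ℝ → ℝ), (∀ r ∈ Icc r₀ r₁, 0 ≤ δ r ∧ δ r ≤ γ r ∧ γ r ≤ 1 ∧
      HasDerivWithinAt γ (c.l (γ r)) (Icc r₀ r₁) r ∧
      HasDerivWithinAt δ (-d.l (δ r)) (Icc r₀ r₁) r) → ∀ r ∈ Icc r₀ r₁,
    HasDerivWithinAt (fun r => kb (γ r, δ r) * d.l (δ r))
      (d.l (δ r) * (ka (γ r, δ r) * β (δ r))) (Icc r₀ r₁) r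
  diag : ∀ z ∈ Icc (0 : ℝ) 1, kb (z, z) * (c.l z + d.l z) = -β z

namespace RowData

variable {c d : Speed} {ka kb : ℝ × ℝ → ℝ} {β ω : ℝ → ℝ} {a e : ℝ × ℝ → ℝ} {va vb : ℝ → ℝ}

theorem va_eq (D : RowData c d ka kb β ω a e va vb) (t : ℝ) : va t = a (t, 0) := by
  have := D.transport_a t 0 (by simp)
  simpa using this.symm

theorem vb_eq (D : RowData c d ka kb β ω a e va vb) (t : ℝ) : vb t = e (t, 0) := by
  have := D.transport_e t 0 (by simp)
  simpa using this.symm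

/-- The density of `∫ ka a` along the characteristics of `a`. -/
theorem integral_a (D : RowData c d ka kb β ω a e va vb) (t : ℝ) {r : ℝ} (hr0 : 0 ≤ r)
    (hr1 : c.psi r ≤ 1) :
    ∫ ζ in (0 : ℝ)..c.psi r, ka (c.psi r, ζ) * a (t - r, ζ) =
      (∫ ρ in (0 : ℝ)..r, ka (c.psi ρ, 0) * c.l 0 * va (t - ρ)) +
      ∫ ρ in (0 : ℝ)..r, ∫ ζ in (0 : ℝ)..c.psi ρ,
        (kb (c.psi ρ, ζ) * ω ζ * a (t - ρ, ζ) - ka (c.psi ρ, ζ) * β ζ * e (t - ρ, ζ)) := by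
  have := D.ka_cont
  have := D.kb_cont
  have := D.β_cont
  have := D.ω_cont
  -- In the coordinates `(ρ, θ)`, `ρ` is the travel time of the outer abscissa and `θ` labels a
  -- characteristic that starts on `ζ = 0` at `ρ = θ`. Along each such line both the kernel entry
  -- and `a` move on their own characteristics, so the product rule applies; primes are derivatives
  -- in `ρ`.
  set k : ℝ × ℝ → ℝ := fun x => ka (c.psi x.1, c.psi (x.1 - x.2)) * c.l (c.psi (x.1 - x.2)) with hk
  set k' : ℝ × ℝ → ℝ := fun x => c.l (c.psi (x.1 - x.2)) *
    (kb (c.psi x.1, c.psi (x.1 - x.2)) * ω (c.psi (x.1 - x.2))) with hk'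
  set A : ℝ × ℝ → ℝ := fun x => a (t - x.1, c.psi (x.1 - x.2)) with hA
  set A' : ℝ × ℝ → ℝ := fun x => -(β (c.psi (x.1 - x.2)) * e (t - x.1, c.psi (x.1 - x.2))) with hA'
  have lk : LocBdd k := .of_continuous (by fun_prop)
  have lk' : LocBdd k' := .of_continuous (by fun_prop)
  have lA : LocBdd A := D.a_locBdd.comp (by fun_prop)
  have lA' : LocBdd A' := (LocBdd.mul (.of_continuous (by fun_prop))
    (D.e_locBdd.comp (by fun_prop))).neg
  set R : ℝ × ℝ → ℝ := fun x => k' x * A x + k x * A' x with hR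
  have lR : LocBdd R := (lk'.mul lA).add (lk.mul lA')
  have along : ∀ θ ∈ uIcc 0 r, k (r, θ) * A (r, θ) = k (θ, θ) * A (θ, θ) +
      ∫ ρ in θ..r, R (ρ, θ) := by
    intro θ hθ
    rw [uIcc_of_le hr0] at hθ
    have hfi : IntervalIntegrable (fun ρ => k' (ρ, θ)) volume θ r :=
      (lk'.comp (by fun_prop : Continuous fun ρ : ℝ => (ρ, θ))).intervalIntegrable _ _
    refine mul_eq_add_integral_of_primitive (F := fun ρ => k (ρ, θ)) (G := fun ρ => A (ρ, θ)) hfi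
      ((lA'.comp (by fun_prop : Continuous fun ρ : ℝ => (ρ, θ))).intervalIntegrable _ _) ?_ ?_
    · intro ρ hρ
      rw [uIcc_of_le hθ.2] at hρ
      refine eq_add_integral_of_hasDerivWithinAt (f := fun ρ => k (ρ, θ)) (b := r) ?_ hfi hρ
      refine D.kernel_a θ r c.psi (fun ρ => c.psi (ρ - θ)) fun s hs => ⟨?_, ?_, ?_, ?_, ?_⟩
      · exact c.psi_nonneg (by linarith [hs.1])
      · exact c.strictMono_psi.monotone (by linarith [hθ.1])
      · exact (c.strictMono_psi.monotone hs.2).trans hr1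
      · exact (c.hasDerivAt_psi s).hasDerivWithinAt
      · exact ((c.hasDerivAt_psi (s - θ)).comp_sub_const s θ).hasDerivWithinAt
    · intro ρ hρ
      rw [uIcc_of_le hθ.2] at hρ
      have h1 : c.psi (ρ - θ) ∈ Icc (0 : ℝ) 1 := ⟨c.psi_nonneg (by linarith [hρ.1]),
        (c.strictMono_psi.monotone (by linarith [hθ.1, hρ.2])).trans hr1⟩
      have h2 := D.transport_a (t - θ) _ h1
      rw [Speed.phi_psi, c.integral_div_eq_integral_psi (fun ζ => β ζ * e (t - θ - c.phi ζ, ζ)),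
        Speed.phi_psi] at h2
      have h3 : A (θ, θ) = va (t - θ) := by simp [hA, D.va_eq]
      have h4 : A (ρ, θ) = a (t - θ - (ρ - θ), c.psi (ρ - θ)) := by
        simp only [hA]; congr 2; ring
      simp only [h3, h4]
      rw [h2, sub_eq_add_neg, ← intervalIntegral.integral_neg]
      congr 1
      have h5 := intervalIntegral.integral_comp_sub_right (a := θ) (b := ρ)
        (fun σ => -(β (c.psi σ) * e (t - θ - c.phi (c.psi σ), c.psi σ))) θ
      rw [sub_self] at h5
      rw [← h5]
      refine intervalIntegral.integral_congr fun σ _ => ?_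
      simp only [hA', Speed.phi_psi]
      congr 4
      ring
  have hsweep := integral_sweep (B := id) (B' := fun _ => 1) (m := id) (fun x => hasDerivAt_id x)
    (fun _ => zero_le_one) rfl (fun _ _ => Iff.rfl) (fun _ _ => Iff.rfl) lR
    (g := fun θ => k (θ, θ) * A (θ, θ))
    ((lk.mul lA).comp (by fun_prop : Continuous fun θ : ℝ => (θ, θ))) hr0
  simp only [id, mul_one] at hsweep
  have hL : ∫ ζ in (0 : ℝ)..c.psi r, ka (c.psi r, ζ) * a (t - r, ζ)
      = ∫ θ in (0 : ℝ)..r, k (r, θ) * A (r, θ) := by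
    rw [c.integral_eq_integral_psi, Speed.phi_psi]
    have h5 := intervalIntegral.integral_comp_sub_left (a := 0) (b := r)
      (fun σ => ka (c.psi r, c.psi σ) * a (t - r, c.psi σ) * c.l (c.psi σ)) r
    rw [sub_self, sub_zero] at h5
    rw [← h5]
    refine intervalIntegral.integral_congr fun σ _ => ?_
    simp only [hk, hA]
    ring
  rw [hL, intervalIntegral.integral_congr along, hsweep]
  congr 1
  · refine intervalIntegral.integral_congr fun ρ _ => ?_
    simp [hk, hA, D.va_eq]
  · refine intervalIntegral.integral_congr fun ρ _ => ?_
    rw [c.integral_eq_integral_psi _ (c.psi ρ), Speed.phi_psi]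
    have h5 := intervalIntegral.integral_comp_sub_left (a := 0) (b := ρ)
      (fun σ => (kb (c.psi ρ, c.psi σ) * ω (c.psi σ) * a (t - ρ, c.psi σ)
        - ka (c.psi ρ, c.psi σ) * β (c.psi σ) * e (t - ρ, c.psi σ)) * c.l (c.psi σ)) ρ
    rw [sub_self, sub_zero] at h5
    rw [← h5]
    refine intervalIntegral.integral_congr fun σ _ => ?_
    simp only [hR, hk, hA, hk', hA']
    ring

/-- The density of `∫ kb e` along the characteristics of `e`. -/
theorem integral_e (D : RowData c d ka kb β ω a e va vb) (t : ℝ) {r : ℝ} (hr0 : 0 ≤ r)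
    (hr1 : c.psi r ≤ 1) :
    (∫ ζ in (0 : ℝ)..c.psi r, kb (c.psi r, ζ) * e (t - r, ζ)) +
      (∫ ρ in (0 : ℝ)..r, kb (c.psi ρ, 0) * d.l 0 * vb (t - ρ)) =
      -(∫ ρ in (0 : ℝ)..r, β (c.psi ρ) * e (t - ρ, c.psi ρ)) +
      ∫ ρ in (0 : ℝ)..r, ∫ ζ in (0 : ℝ)..c.psi ρ,
        (ka (c.psi ρ, ζ) * β ζ * e (t - ρ, ζ) - kb (c.psi ρ, ζ) * ω ζ * a (t - ρ, ζ)) := by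
  have := D.ka_cont
  have := D.kb_cont
  have := D.β_cont
  have := D.ω_cont
  -- Here the line with label `θ` has travel time `θ - ρ` in the second variable: it starts on the
  -- diagonal, at `ρ = m θ` where `B ρ = θ`, and arrives at `ζ = 0` when `ρ = θ`.
  set k : ℝ × ℝ → ℝ := fun x => kb (c.psi x.1, d.psi (x.2 - x.1)) * d.l (d.psi (x.2 - x.1)) with hk
  set k' : ℝ × ℝ → ℝ := fun x => d.l (d.psi (x.2 - x.1)) *
    (ka (c.psi x.1, d.psi (x.2 - x.1)) * β (d.psi (x.2 - x.1))) with hk'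
  set A : ℝ × ℝ → ℝ := fun x => e (t - x.1, d.psi (x.2 - x.1)) with hA
  set A' : ℝ × ℝ → ℝ := fun x => -(ω (d.psi (x.2 - x.1)) * a (t - x.1, d.psi (x.2 - x.1))) with hA'
  have lk : LocBdd k := .of_continuous (by fun_prop)
  have lk' : LocBdd k' := .of_continuous (by fun_prop)
  have lA : LocBdd A := D.e_locBdd.comp (by fun_prop)
  have lA' : LocBdd A' := (LocBdd.mul (.of_continuous (by fun_prop))
    (D.a_locBdd.comp (by fun_prop))).neg
  set R : ℝ × ℝ → ℝ := fun x => k' x * A x + k x * A' x with hR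
  have lR : LocBdd R := (lk'.mul lA).add (lk.mul lA')
  set B : ℝ → ℝ := fun ρ => ρ + d.phi (c.psi ρ) with hB
  set B' : ℝ → ℝ := fun ρ => 1 + 1 / d.l (c.psi ρ) * c.l (c.psi ρ) with hB'
  set m : ℝ → ℝ := fun θ => c.phi ((c.harmonic d).psi θ) with hm
  have hBh : ∀ ρ, B ρ = (c.harmonic d).phi (c.psi ρ) := fun ρ => by
    rw [Speed.phi_harmonic, Speed.phi_psi]
  have hmB : ∀ ρ, m (B ρ) = ρ := fun ρ => by
    rw [hBh, hm]; simp
  have hBd : ∀ ρ, HasDerivAt B (B' ρ) ρ := fun ρ =>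
    (hasDerivAt_id ρ).add ((d.hasDerivAt_phi _).comp ρ (c.hasDerivAt_psi ρ))
  have hB'0 : ∀ ρ, 0 ≤ B' ρ := fun ρ => by
    have := d.pos (c.psi ρ)
    have := c.pos (c.psi ρ)
    simp only [hB']; positivity
  have hB0 : B 0 = 0 := by simp [hB]
  have hmle : ∀ ρ θ, m θ ≤ ρ ↔ θ ≤ B ρ := fun ρ θ => by
    rw [hBh, hm, ← Speed.le_psi_iff, Speed.psi_le_iff]
  have hmlt : ∀ ρ θ, m θ < ρ ↔ θ < B ρ := fun ρ θ => by
    rw [← not_le, ← not_le, not_iff_not, hBh, hm, ← Speed.psi_le_iff, Speed.le_psi_iff]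
  have hBr : r ≤ B r := by
    have := d.phi_nonneg (c.psi_nonneg hr0)
    simp only [hB]; linarith
  have hmθ : ∀ θ, 0 ≤ θ → m θ ≤ θ := fun θ hθ => by
    rw [hmle]
    have := d.phi_nonneg (c.psi_nonneg hθ)
    simp only [hB]; linarith
  have hm0 : ∀ θ, 0 ≤ θ → 0 ≤ m θ := fun θ hθ => c.phi_nonneg (Speed.psi_nonneg _ hθ)
  have along : ∀ θ, 0 ≤ θ → ∀ s, m θ ≤ s → s ≤ θ → s ≤ r →
      k (s, θ) * A (s, θ) = k (m θ, θ) * A (m θ, θ) + ∫ ρ in m θ..s, R (ρ, θ) := by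
    intro θ hθ s hs1 hs2 hs3
    have hfi : IntervalIntegrable (fun ρ => k' (ρ, θ)) volume (m θ) s :=
      (lk'.comp (by fun_prop : Continuous fun ρ : ℝ => (ρ, θ))).intervalIntegrable _ _
    refine mul_eq_add_integral_of_primitive (F := fun ρ => k (ρ, θ)) (G := fun ρ => A (ρ, θ)) hfi
      ((lA'.comp (by fun_prop : Continuous fun ρ : ℝ => (ρ, θ))).intervalIntegrable _ _) ?_ ?_
    · intro ρ hρ
      rw [uIcc_of_le hs1] at hρ
      refine eq_add_integral_of_hasDerivWithinAt (f := fun ρ => k (ρ, θ)) (b := s) ?_ hfi hρ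
      refine D.kernel_b (m θ) s c.psi (fun ρ => d.psi (θ - ρ)) fun x hx => ⟨?_, ?_, ?_, ?_, ?_⟩
      · exact d.psi_nonneg (by linarith [hx.2])
      · rw [Speed.psi_le_iff]
        have := (hmle x θ).1 hx.1
        simp only [hB] at this
        linarith
      · exact (c.strictMono_psi.monotone (hx.2.trans hs3)).trans hr1
      · exact (c.hasDerivAt_psi x).hasDerivWithinAt
      · exact ((d.hasDerivAt_psi (θ - x)).comp_const_sub θ x).hasDerivWithinAt
    · have htr : ∀ ρ ∈ Icc (m θ) s, A (ρ, θ) = vb (t - θ) +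
          ∫ σ in ρ..θ, ω (d.psi (θ - σ)) * a (t - σ, d.psi (θ - σ)) := by
        intro ρ hρ
        have h1 : d.psi (θ - ρ) ∈ Icc (0 : ℝ) 1 := by
          refine ⟨d.psi_nonneg (by linarith [hρ.2]), le_trans ?_
            ((c.strictMono_psi.monotone (hρ.2.trans hs3)).trans hr1)⟩
          rw [Speed.psi_le_iff]
          have := (hmle ρ θ).1 hρ.1
          simp only [hB] at this
          linarith
        have h2 := D.transport_e (t - θ) _ h1
        rw [Speed.phi_psi, d.integral_div_eq_integral_psi (fun ζ => ω ζ * a (t - θ + d.phi ζ, ζ)),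
          Speed.phi_psi] at h2
        have h4 : A (ρ, θ) = e (t - θ + (θ - ρ), d.psi (θ - ρ)) := by
          simp only [hA]; congr 2; ring
        rw [h4, h2]
        congr 1
        have h5 := intervalIntegral.integral_comp_sub_left (a := ρ) (b := θ)
          (fun σ => ω (d.psi σ) * a (t - θ + d.phi (d.psi σ), d.psi σ)) θ
        rw [sub_self] at h5
        rw [← h5]
        refine intervalIntegral.integral_congr fun σ _ => ?_
        simp only [Speed.phi_psi]
        congr 3
        ring
      intro ρ hρ
      rw [uIcc_of_le hs1] at hρ
      rw [htr ρ hρ, htr (m θ) ⟨le_rfl, hs1⟩]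
      simp only [hA']
      rw [intervalIntegral.integral_neg, add_assoc]
      congr 1
      have hint : ∀ x y, IntervalIntegrable
          (fun σ => ω (d.psi (θ - σ)) * a (t - σ, d.psi (θ - σ))) volume x y := fun x y =>
        (LocBdd.mul (.of_continuous (by fun_prop))
          (D.a_locBdd.comp (by fun_prop))).intervalIntegrable _ _
      rw [← intervalIntegral.integral_add_adjacent_intervals (hint (m θ) ρ) (hint ρ θ)]
      ring
  -- Lines with `θ < r` leave the triangle at `ρ = θ`. Cutting the integrand off there lets every
  -- line be integrated up to `r`.
  set R' : ℝ × ℝ → ℝ := fun x => if x.1 < x.2 then R x else 0 with hR'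
  have lR' : LocBdd R' := lR.ite (measurableSet_lt measurable_fst measurable_snd)
  have lg : LocBdd fun θ => k (m θ, θ) * A (m θ, θ) :=
    (lk.mul lA).comp (by fun_prop : Continuous fun θ : ℝ => (m θ, θ))
  have hsweep := integral_sweep hBd hB'0 hB0 hmlt hmle lR' lg hr0
  have hw : ∀ θ ∈ uIcc 0 (B r), k (m θ, θ) * A (m θ, θ) + ∫ ρ in m θ..r, R' (ρ, θ)
      = k (min r θ, θ) * A (min r θ, θ) := by
    intro θ hθ
    rw [uIcc_of_le (hr0.trans hBr)] at hθ
    rw [along θ hθ.1 (min r θ) (le_min ((hmle _ _).2 hθ.2) (hmθ θ hθ.1)) (min_le_right _ _)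
      (min_le_left _ _)]
    congr 1
    rcases le_total r θ with h | h
    · rw [min_eq_left h]
      have := integral_ite_gt (f := fun ρ => R (ρ, θ)) ((hmle _ _).2 hθ.2) h
      rw [intervalIntegral.integral_of_le ((hmle _ _).2 hθ.2),
        intervalIntegral.integral_of_le ((hmle _ _).2 hθ.2), integral_Ioc_eq_integral_Ioo,
        integral_Ioc_eq_integral_Ioo]
      refine setIntegral_congr_fun measurableSet_Ioo fun ρ hρ => ?_
      simp [hR', hρ.2.trans_le h]
    · rw [min_eq_right h]
      exact integral_ite_gt (f := fun ρ => R (ρ, θ)) (hmθ θ hθ.1) h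
  rw [intervalIntegral.integral_congr hw] at hsweep
  have lmin : LocBdd fun θ => k (min r θ, θ) * A (min r θ, θ) :=
    (lk.mul lA).comp (by fun_prop : Continuous fun θ : ℝ => (min r θ, θ))
  rw [← intervalIntegral.integral_add_adjacent_intervals (lmin.intervalIntegrable 0 r)
    (lmin.intervalIntegrable r (B r))] at hsweep
  -- Lines with label below `r` end on `ζ = 0` and supply the boundary term; labels between `r` and
  -- `B r` end at the abscissa `c.psi r` and supply the integral in question.
  have hI1 : ∫ θ in (0 : ℝ)..r, k (min r θ, θ) * A (min r θ, θ)
      = ∫ ρ in (0 : ℝ)..r, kb (c.psi ρ, 0) * d.l 0 * vb (t - ρ) := by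
    refine intervalIntegral.integral_congr fun θ hθ => ?_
    rw [uIcc_of_le hr0] at hθ
    simp [min_eq_right hθ.2, hk, hA, D.vb_eq]
  have hI2 : ∫ θ in r..B r, k (min r θ, θ) * A (min r θ, θ)
      = ∫ ζ in (0 : ℝ)..c.psi r, kb (c.psi r, ζ) * e (t - r, ζ) := by
    rw [d.integral_eq_integral_psi]
    have h5 := intervalIntegral.integral_comp_sub_right (a := r) (b := B r)
      (fun σ => kb (c.psi r, d.psi σ) * e (t - r, d.psi σ) * d.l (d.psi σ)) r
    have h6 : B r - r = d.phi (c.psi r) := by simp [hB]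
    rw [sub_self, h6] at h5
    rw [← h5]
    refine intervalIntegral.integral_congr fun θ hθ => ?_
    rw [uIcc_of_le hBr] at hθ
    simp only [min_eq_left hθ.1, hk, hA]
    ring
  -- Since `B' = 1 + c / d`, the factor `d` times `B'` is `c + d`, and the condition `diag` turns
  -- the starting values on the diagonal into `-β e`.
  have hI3 : ∫ ρ in (0 : ℝ)..r, k (m (B ρ), B ρ) * A (m (B ρ), B ρ) * B' ρ
      = -∫ ρ in (0 : ℝ)..r, β (c.psi ρ) * e (t - ρ, c.psi ρ) := by
    rw [← intervalIntegral.integral_neg]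
    refine intervalIntegral.integral_congr fun ρ hρ => ?_
    rw [uIcc_of_le hr0] at hρ
    have h7 : B ρ - ρ = d.phi (c.psi ρ) := by simp [hB]
    have h8 := D.diag (c.psi ρ) ⟨c.psi_nonneg hρ.1, (c.strictMono_psi.monotone hρ.2).trans hr1⟩
    simp only [hmB, hk, hA, h7, Speed.psi_phi, hB']
    have h9 := d.ne_zero (c.psi ρ)
    rw [← neg_mul, ← h8]
    field_simp
    ring
  have hI4 : ∫ ρ in (0 : ℝ)..r, ∫ θ in (0 : ℝ)..B ρ, R' (ρ, θ)
      = ∫ ρ in (0 : ℝ)..r, ∫ ζ in (0 : ℝ)..c.psi ρ,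
        (ka (c.psi ρ, ζ) * β ζ * e (t - ρ, ζ) - kb (c.psi ρ, ζ) * ω ζ * a (t - ρ, ζ)) := by
    refine intervalIntegral.integral_congr fun ρ hρ => ?_
    rw [uIcc_of_le hr0] at hρ
    have h10 : ρ ≤ B ρ := by
      have := d.phi_nonneg (c.psi_nonneg hρ.1)
      simp only [hB]; linarith
    rw [show ∫ θ in (0 : ℝ)..B ρ, R' (ρ, θ) = ∫ θ in ρ..B ρ, R (ρ, θ) from
      integral_ite_lt (f := fun θ => R (ρ, θ)) hρ.1 h10, d.integral_eq_integral_psi]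
    have h5 := intervalIntegral.integral_comp_sub_right (a := ρ) (b := B ρ)
      (fun σ => (ka (c.psi ρ, d.psi σ) * β (d.psi σ) * e (t - ρ, d.psi σ)
        - kb (c.psi ρ, d.psi σ) * ω (d.psi σ) * a (t - ρ, d.psi σ)) * d.l (d.psi σ)) ρ
    have h6 : B ρ - ρ = d.phi (c.psi ρ) := by simp [hB]
    rw [sub_self, h6] at h5
    rw [← h5]
    refine intervalIntegral.integral_congr fun σ _ => ?_
    simp only [hR, hk, hA, hk', hA']
    ring
  rw [hI1, hI2, hI3, hI4] at hsweep
  rw [add_comm (∫ ζ in (0 : ℝ)..c.psi r, kb (c.psi r, ζ) * e (t - r, ζ)), hsweep]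

/-- The integral transformation with the kernel decouples the transport equation of `a`. -/
theorem integral_kernel (D : RowData c d ka kb β ω a e va vb) (t : ℝ) {z : ℝ}
    (hz : z ∈ Icc (0 : ℝ) 1) :
    ∫ ζ in (0 : ℝ)..z, (ka (z, ζ) * a (t - c.phi z, ζ) + kb (z, ζ) * e (t - c.phi z, ζ)) =
      -(∫ ζ in (0 : ℝ)..z, β ζ * e (t - c.phi ζ, ζ) / c.l ζ) +
      ∫ ζ in (0 : ℝ)..z, (ka (ζ, 0) * c.l 0 * va (t - c.phi ζ) -
        kb (ζ, 0) * d.l 0 * vb (t - c.phi ζ)) / c.l ζ := by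
  have ca := D.ka_cont
  have cb := D.kb_cont
  have cβ := D.β_cont
  have cω := D.ω_cont
  have hr0 := c.phi_nonneg hz.1
  have hr1 : c.psi (c.phi z) ≤ 1 := by simpa using hz.2
  have h1 := D.integral_a t hr0 hr1
  have h2 := D.integral_e t hr0 hr1
  rw [c.integral_div_eq_integral_psi (fun ζ => β ζ * e (t - c.phi ζ, ζ)),
    c.integral_div_eq_integral_psi (fun ζ => ka (ζ, 0) * c.l 0 * va (t - c.phi ζ) -
        kb (ζ, 0) * d.l 0 * vb (t - c.phi ζ))]
  simp only [Speed.phi_psi, Speed.psi_phi] at h1 h2 ⊢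
  have hva : LocBdd va := by
    have : va = fun t => a (t, 0) := funext D.va_eq
    rw [this]; exact D.a_locBdd.comp (by fun_prop)
  have hvb : LocBdd vb := by
    have : vb = fun t => e (t, 0) := funext D.vb_eq
    rw [this]; exact D.e_locBdd.comp (by fun_prop)
  -- The double integrals in `h1` and `h2` are opposite, so adding the two identities leaves
  -- boundary terms only.
  have hneg : ∀ ρ, ∫ ζ in (0 : ℝ)..c.psi ρ,
        (kb (c.psi ρ, ζ) * ω ζ * a (t - ρ, ζ) - ka (c.psi ρ, ζ) * β ζ * e (t - ρ, ζ))
      = -∫ ζ in (0 : ℝ)..c.psi ρ,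
        (ka (c.psi ρ, ζ) * β ζ * e (t - ρ, ζ) - kb (c.psi ρ, ζ) * ω ζ * a (t - ρ, ζ)) := by
    intro ρ
    rw [← intervalIntegral.integral_neg]
    simp only [neg_sub]
  simp only [hneg, intervalIntegral.integral_neg] at h1
  rw [intervalIntegral.integral_add, intervalIntegral.integral_sub]
  · linarith
  · exact (LocBdd.mul (.of_continuous (by fun_prop)) (hva.comp (by fun_prop))).intervalIntegrable
      _ _
  · exact (LocBdd.mul (.of_continuous (by fun_prop)) (hvb.comp (by fun_prop))).intervalIntegrable
      _ _
  · exact (LocBdd.mul (.of_continuous (by fun_prop))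
      (D.a_locBdd.comp (by fun_prop))).intervalIntegrable _ _
  · exact (LocBdd.mul (.of_continuous (by fun_prop))
      (D.e_locBdd.comp (by fun_prop))).intervalIntegrable _ _

end RowData

end RowIdentity

/-! ### Solving the transport equations in the spatial direction. -/

section Strip
open MeasureTheory

theorem measurable_integral_of_clamp {X : Type*} [MeasurableSpace X] {F : X × ℝ → ℝ} {k : X → ℝ}
    (hF : Measurable F) (hk : Measurable k) (hk1 : ∀ x, k x ∈ Icc (0 : ℝ) 1) :
    Measurable fun x => ∫ ζ in (0 : ℝ)..k x, F (x, ζ) := by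
  have e : (fun x => ∫ ζ in (0 : ℝ)..k x, F (x, ζ))
      = fun x => ∫ ζ in (0 : ℝ)..1, (if ζ < k x then F (x, ζ) else 0) :=
    funext fun x => (integral_ite_gt (f := fun ζ => F (x, ζ)) (hk1 x).1 (hk1 x).2).symm
  rw [e]
  simp only [intervalIntegral.integral_of_le zero_le_one]
  have h : Measurable fun p : X × ℝ => if p.2 < k p.1 then F p else 0 :=
    Measurable.ite (measurableSet_lt measurable_snd (hk.comp measurable_fst)) hF measurable_const
  exact h.stronglyMeasurable.integral_prod_right'.measurable

/-- The solution of the two coupled transport equations on the strip `ℝ × [0, 1]` with the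
boundary values `v₁`, `v₂` at `z = 0`. -/
structure IsStripSolution (c d : Speed) (β ω : ℝ → ℝ) (v₁ v₂ : ℝ → ℝ) (X₁ X₂ : ℝ × ℝ → ℝ) :
    Prop where
  meas₁ : Measurable X₁
  meas₂ : Measurable X₂
  bdd : ∃ C, ∀ x, |X₁ x| ≤ C ∧ |X₂ x| ≤ C
  eq₁ : ∀ t, ∀ z ∈ Icc (0 : ℝ) 1, X₁ (t, z) = v₁ (t + c.phi z) -
    ∫ ζ in (0 : ℝ)..z, β ζ * X₂ (t + c.phi z - c.phi ζ, ζ) / c.l ζ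
  eq₂ : ∀ t, ∀ z ∈ Icc (0 : ℝ) 1, X₂ (t, z) = v₂ (t - d.phi z) +
    ∫ ζ in (0 : ℝ)..z, ω ζ * X₁ (t - d.phi z + d.phi ζ, ζ) / d.l ζ

/-- With both components prescribed at `z = 0` for all times, the equations are of Volterra type in
`z`, so the weight `exp (L z)` gives a contraction. No regularity in time is needed: the fixed point
is sought among bounded measurable functions. -/
theorem exists_isStripSolution (c d : Speed) {β ω : ℝ → ℝ} (hβ : Continuous β)
    (hω : Continuous ω) {v₁ v₂ : ℝ → ℝ} (hv₁ : Measurable v₁) (hv₂ : Measurable v₂) {M : ℝ}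
    (hM : ∀ t, |v₁ t| ≤ M ∧ |v₂ t| ≤ M) : ∃ X₁ X₂, IsStripSolution c d β ω v₁ v₂ X₁ X₂ := by
  have cc := c.continuous_l
  have dc := d.continuous_l
  have c0 := c.ne_zero
  have d0 := d.ne_zero
  have hM0 : 0 ≤ M := (abs_nonneg _).trans (hM 0).1
  have hβc : Continuous fun ζ => β ζ / c.l ζ := hβ.div cc c0
  have hωd : Continuous fun ζ => ω ζ / d.l ζ := hω.div dc d0
  obtain ⟨Cβ, hCβ0, hCβ⟩ := hβc.continuousOn.exists_nonneg_bound_unit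
  obtain ⟨Cω, hCω0, hCω⟩ := hωd.continuousOn.exists_nonneg_bound_unit
  set L : ℝ := 2 * (Cβ + Cω) + 1 with hL
  have hL0 : 0 < L := by positivity
  set F₁ : (ℝ × ℝ → ℝ × ℝ) → (ℝ × ℝ) × ℝ → ℝ := fun f p =>
    β p.2 / c.l p.2 * (f (p.1.1 + c.phi (clampUnit p.1.2) - c.phi p.2, p.2)).2 with hF₁
  set F₂ : (ℝ × ℝ → ℝ × ℝ) → (ℝ × ℝ) × ℝ → ℝ := fun f p =>
    ω p.2 / d.l p.2 * (f (p.1.1 - d.phi (clampUnit p.1.2) + d.phi p.2, p.2)).1 with hF₂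
  have mphi : Measurable fun x : ℝ × ℝ => c.phi (clampUnit x.2) :=
    (by fun_prop : Continuous fun x : ℝ × ℝ => c.phi (clampUnit x.2)).measurable
  have mphid : Measurable fun x : ℝ × ℝ => d.phi (clampUnit x.2) :=
    (by fun_prop : Continuous fun x : ℝ × ℝ => d.phi (clampUnit x.2)).measurable
  have mF₁ : ∀ f, Measurable f → Measurable (F₁ f) := fun f hf =>
    (hβc.measurable.comp measurable_snd).mul (measurable_snd.comp (hf.comp
      (by fun_prop : Continuous fun p : (ℝ × ℝ) × ℝ =>
        (p.1.1 + c.phi (clampUnit p.1.2) - c.phi p.2, p.2)).measurable))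
  have mF₂ : ∀ f, Measurable f → Measurable (F₂ f) := fun f hf =>
    (hωd.measurable.comp measurable_snd).mul (measurable_fst.comp (hf.comp
      (by fun_prop : Continuous fun p : (ℝ × ℝ) × ℝ =>
        (p.1.1 - d.phi (clampUnit p.1.2) + d.phi p.2, p.2)).measurable))
  have secF : ∀ {F : (ℝ × ℝ) × ℝ → ℝ} {C : ℝ}, Measurable F →
      (∀ x, ∀ ζ ∈ Icc (0 : ℝ) 1, |F (x, ζ)| ≤ C) → ∀ x : ℝ × ℝ,
      IntervalIntegrable (fun ζ => F (x, ζ)) volume 0 (clampUnit x.2) := by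
    intro F C hF hC x
    rw [intervalIntegrable_iff, uIoc_of_le (clampUnit_mem _).1]
    refine Measure.integrableOn_of_bounded (M := C) (by simp)
      (hF.comp measurable_prodMk_left).aestronglyMeasurable ?_
    filter_upwards [ae_restrict_mem measurableSet_Ioc] with ζ hζ
    exact hC x ζ ⟨hζ.1.le, hζ.2.trans (clampUnit_mem _).2⟩
  set A : Set (ℝ × ℝ → ℝ × ℝ) := {f | Measurable f ∧ ∃ C, ∀ x, ‖f x‖ ≤ C} with hA
  set Op : (ℝ × ℝ → ℝ × ℝ) → ℝ × ℝ → ℝ × ℝ := fun f x =>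
    (v₁ (x.1 + c.phi (clampUnit x.2)) - ∫ ζ in (0 : ℝ)..clampUnit x.2, F₁ f (x, ζ),
      v₂ (x.1 - d.phi (clampUnit x.2)) + ∫ ζ in (0 : ℝ)..clampUnit x.2, F₂ f (x, ζ)) with hOp
  have bF₁ : ∀ {f : ℝ × ℝ → ℝ × ℝ} {C : ℝ}, (∀ x, ‖f x‖ ≤ C) → ∀ x, ∀ ζ ∈ Icc (0 : ℝ) 1,
      |F₁ f (x, ζ)| ≤ Cβ * C := fun hC x ζ hζ => by
    rw [hF₁, abs_mul]
    exact mul_le_mul (hCβ ζ hζ) ((norm_snd_le _).trans (hC _)) (abs_nonneg _) hCβ0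
  have bF₂ : ∀ {f : ℝ × ℝ → ℝ × ℝ} {C : ℝ}, (∀ x, ‖f x‖ ≤ C) → ∀ x, ∀ ζ ∈ Icc (0 : ℝ) 1,
      |F₂ f (x, ζ)| ≤ Cω * C := fun hC x ζ hζ => by
    rw [hF₂, abs_mul]
    exact mul_le_mul (hCω ζ hζ) ((norm_fst_le _).trans (hC _)) (abs_nonneg _) hCω0
  have bint : ∀ {F : (ℝ × ℝ) × ℝ → ℝ} {C : ℝ}, (∀ x, ∀ ζ ∈ Icc (0 : ℝ) 1, |F (x, ζ)| ≤ C) →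
      ∀ x : ℝ × ℝ, |∫ ζ in (0 : ℝ)..clampUnit x.2, F (x, ζ)| ≤ C := by
    intro F C hC x
    have hx := clampUnit_mem x.2
    have hC0 : 0 ≤ C := (abs_nonneg _).trans (hC x 0 (by simp))
    have := intervalIntegral.norm_integral_le_of_norm_le_const (a := 0) (b := clampUnit x.2)
      (f := fun ζ => F (x, ζ)) (C := C) fun ζ hζ => hC x ζ (by
        rw [uIoc_of_le hx.1] at hζ
        exact ⟨hζ.1.le, hζ.2.trans hx.2⟩)
    rw [Real.norm_eq_abs, sub_zero, abs_of_nonneg hx.1] at this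
    exact this.trans (mul_le_of_le_one_right hC0 hx.2)
  have maps : ∀ f ∈ A, Op f ∈ A := by
    rintro f ⟨hf, C, hC⟩
    refine ⟨Measurable.prodMk ((hv₁.comp (measurable_fst.add mphi)).sub ?_)
      ((hv₂.comp (measurable_fst.sub mphid)).add ?_), M + (Cβ + Cω) * C, fun x => ?_⟩
    · exact measurable_integral_of_clamp (mF₁ f hf)
        (continuous_clampUnit.measurable.comp measurable_snd) fun _ => clampUnit_mem _
    · exact measurable_integral_of_clamp (mF₂ f hf)
        (continuous_clampUnit.measurable.comp measurable_snd) fun _ => clampUnit_mem _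
    · have hC0 : 0 ≤ C := (norm_nonneg _).trans (hC 0)
      have h1 := bint (bF₁ hC) x
      have h2 := bint (bF₂ hC) x
      have h3 := (hM (x.1 + c.phi (clampUnit x.2))).1
      have h4 := (hM (x.1 - d.phi (clampUnit x.2))).2
      have h5 := mul_nonneg hCβ0 hC0
      have h6 := mul_nonneg hCω0 hC0
      refine norm_prod_le_iff.2 ⟨(abs_sub _ _).trans ?_, (abs_add_le _ _).trans ?_⟩
      · linarith
      · linarith
  obtain ⟨f, ⟨hf, C, hC⟩, hfix, -⟩ := exists_fixedPoint_of_weighted_contraction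
    (w := fun x : ℝ × ℝ => Real.exp (L * clampUnit x.2)) (M := Real.exp (L * 1))
    (fun x => (Real.exp_pos _).le)
    (fun x => Real.exp_le_exp.2 (mul_le_mul_of_nonneg_left (clampUnit_mem _).2 hL0.le))
    A (by
      -- Uniform limits of measurable functions are measurable, and the limit stays within distance
      -- one of some bounded iterate.
      intro F g hF hFg
      refine ⟨measurable_of_tendsto_metrizable (fun k => (hF k).1)
        (tendsto_pi_nhds.2 fun x => hFg.tendsto_at x), ?_⟩
      rw [Metric.tendstoUniformly_iff] at hFg
      obtain ⟨k, hk⟩ := (hFg 1 one_pos).exists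
      obtain ⟨C, hC⟩ := (hF k).2
      refine ⟨1 + C, fun x => ?_⟩
      have h1 := hk x
      rw [dist_eq_norm] at h1
      have h2 := norm_add_le (g x - F k x) (F k x)
      rw [sub_add_cancel] at h2
      linarith [hC x]) Op maps
    (by
      rintro f ⟨hf, C, hC⟩ g ⟨hg, D, hD⟩ b hb h x
      have hx := clampUnit_mem x.2
      refine norm_prod_le_iff.2 ⟨?_, ?_⟩
      · simp only [hOp, Prod.fst_sub]
        rw [sub_sub_sub_cancel_left, ← intervalIntegral.integral_sub
          (secF (mF₁ g hg) (bF₁ hD) x) (secF (mF₁ f hf) (bF₁ hC) x), Real.norm_eq_abs]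
        refine (abs_integral_exp_le (C := Cβ * b) hL0 hx.1 (by positivity)
          fun ζ hζ => ?_).trans ?_
        · have hζ1 : ζ ∈ Icc (0 : ℝ) 1 := ⟨hζ.1, hζ.2.trans hx.2⟩
          simp only [hF₁]
          rw [← mul_sub, abs_mul, mul_assoc]
          have := (norm_snd_le _).trans (h (x.1 + c.phi (clampUnit x.2) - c.phi ζ, ζ))
          rw [clampUnit_eq hζ1, Prod.snd_sub, Real.norm_eq_abs, abs_sub_comm] at this
          exact mul_le_mul (hCβ ζ hζ1) this (abs_nonneg _) hCβ0
        · refine mul_le_mul_of_nonneg_right ?_ (Real.exp_pos _).le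
          rw [div_le_div_iff₀ hL0 two_pos]
          nlinarith [mul_nonneg hCω0 hb]
      · simp only [hOp, Prod.snd_sub]
        rw [add_sub_add_left_eq_sub, ← intervalIntegral.integral_sub
          (secF (mF₂ f hf) (bF₂ hC) x) (secF (mF₂ g hg) (bF₂ hD) x), Real.norm_eq_abs]
        refine (abs_integral_exp_le (C := Cω * b) hL0 hx.1 (by positivity)
          fun ζ hζ => ?_).trans ?_
        · have hζ1 : ζ ∈ Icc (0 : ℝ) 1 := ⟨hζ.1, hζ.2.trans hx.2⟩
          simp only [hF₂]
          rw [← mul_sub, abs_mul, mul_assoc]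
          have := (norm_fst_le _).trans (h (x.1 - d.phi (clampUnit x.2) + d.phi ζ, ζ))
          rw [clampUnit_eq hζ1, Prod.fst_sub, Real.norm_eq_abs] at this
          exact mul_le_mul (hCω ζ hζ1) this (abs_nonneg _) hCω0
        · refine mul_le_mul_of_nonneg_right ?_ (Real.exp_pos _).le
          rw [div_le_div_iff₀ hL0 two_pos]
          nlinarith [mul_nonneg hCβ0 hb])
    0 ⟨measurable_const, 0, by simp⟩ M hM0
    (fun x => by
      have h1 : ‖Op 0 x - (0 : ℝ × ℝ → ℝ × ℝ) x‖ ≤ M := by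
        refine norm_prod_le_iff.2 ⟨?_, ?_⟩
        · simpa [hOp, hF₁] using (hM _).1
        · simpa [hOp, hF₂] using (hM _).2
      exact h1.trans (le_mul_of_one_le_right hM0
        (Real.one_le_exp (mul_nonneg hL0.le (clampUnit_mem _).1))))
  refine ⟨fun x => (f x).1, fun x => (f x).2, measurable_fst.comp hf, measurable_snd.comp hf,
    ⟨C, fun x => ⟨(norm_fst_le _).trans (hC x), (norm_snd_le _).trans (hC x)⟩⟩, ?_, ?_⟩
  · intro t z hz
    have := congrArg Prod.fst (congrFun hfix (t, z))
    rw [← this]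
    simp only [hOp, hF₁, clampUnit_eq hz, div_mul_eq_mul_div]
  · intro t z hz
    have := congrArg Prod.snd (congrFun hfix (t, z))
    rw [← this]
    simp only [hOp, hF₂, clampUnit_eq hz, div_mul_eq_mul_div]

end Strip

/-! ### The backstepping transformation decouples the transport equations. -/

section Backstepping
open MeasureTheory

namespace PDEODESystem

variable {n : ℕ} {P : PDEODESystem n} {K : ℝ → ℝ → Matrix (Fin 2) (Fin 2) ℝ}

theorem IsKernel.continuous_ext (hK : P.IsKernel K) (i j : Fin 2) :
    Continuous fun x : ℝ × ℝ => K (Goursat.toTriangle x).1 (Goursat.toTriangle x).2 i j := by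
  have h : Continuous fun x : ℝ × ℝ => K (Goursat.toTriangle x).1 (Goursat.toTriangle x).2 :=
    hK.continuousOn.comp_continuous (f := Goursat.toTriangle) Goursat.continuous_toTriangle
      Goursat.toTriangle_mem
  exact h.matrix_elem i j

theorem IsKernel.hasDerivWithinAt (hK : P.IsKernel K) (i j : Fin 2) {r₀ r₁ : ℝ} {γ δ : ℝ → ℝ}
    (h : ∀ r ∈ Icc r₀ r₁, 0 ≤ δ r ∧ δ r ≤ γ r ∧ γ r ≤ 1 ∧
      HasDerivWithinAt γ (P.Lam (γ r) i) (Icc r₀ r₁) r ∧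
      HasDerivWithinAt δ (P.Lam (δ r) j) (Icc r₀ r₁) r) {r : ℝ} (hr : r ∈ Icc r₀ r₁) :
    HasDerivWithinAt (fun r => K (Goursat.toTriangle (γ r, δ r)).1
        (Goursat.toTriangle (γ r, δ r)).2 i j * P.Lam (δ r) j)
      (P.Lam (δ r) j * (K (Goursat.toTriangle (γ r, δ r)).1
        (Goursat.toTriangle (γ r, δ r)).2 * P.Atilde (δ r)) i j) (Icc r₀ r₁) r := by
  have e : ∀ r ∈ Icc r₀ r₁, Goursat.toTriangle (γ r, δ r) = (γ r, δ r) := fun r hr =>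
    Goursat.toTriangle_eq (h r hr).1 (h r hr).2.1 (h r hr).2.2.1
  have := hK.pde i j r₀ r₁ γ δ h r hr
  rw [e r hr]
  exact this.congr (fun r hr => by rw [e r hr]) (by rw [e r hr])

/-- Puts the second row into the form required by `RowData`, where the first coordinate advances
with a positive speed. -/
theorem IsKernel.hasDerivWithinAt_reverse (hK : P.IsKernel K) (i j : Fin 2) {r₀ r₁ : ℝ}
    {γ δ : ℝ → ℝ} (h : ∀ r ∈ Icc r₀ r₁, 0 ≤ δ r ∧ δ r ≤ γ r ∧ γ r ≤ 1 ∧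
      HasDerivWithinAt γ (-P.Lam (γ r) i) (Icc r₀ r₁) r ∧
      HasDerivWithinAt δ (-P.Lam (δ r) j) (Icc r₀ r₁) r) {r : ℝ} (hr : r ∈ Icc r₀ r₁) :
    HasDerivWithinAt (fun r => K (Goursat.toTriangle (γ r, δ r)).1
        (Goursat.toTriangle (γ r, δ r)).2 i j * P.Lam (δ r) j)
      (-(P.Lam (δ r) j * (K (Goursat.toTriangle (γ r, δ r)).1
        (Goursat.toTriangle (γ r, δ r)).2 * P.Atilde (δ r)) i j)) (Icc r₀ r₁) r := by
  have hneg : ∀ r ∈ Icc (-r₁) (-r₀), -r ∈ Icc r₀ r₁ := fun r hr =>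
    ⟨by linarith [hr.2], by linarith [hr.1]⟩
  have hr' : -r ∈ Icc (-r₁) (-r₀) := ⟨by linarith [hr.2], by linarith [hr.1]⟩
  have h1 := hK.hasDerivWithinAt i j (γ := fun r => γ (-r)) (δ := fun r => δ (-r))
    (r₀ := -r₁) (r₁ := -r₀) (fun r hr => by
      have := h (-r) (hneg r hr)
      exact ⟨this.1, this.2.1, this.2.2.1, by simpa using this.2.2.2.1.comp_neg_Icc,
        by simpa using this.2.2.2.2.comp_neg_Icc⟩) hr'
  simpa using h1.comp_neg_Icc

/-- `v` are boundary values, and `(X₁, X₂)` the corresponding solution of the scaled transport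
equations on the whole strip `ℝ × [0, 1]`. -/
abbrev StripSolution (P : PDEODESystem n) (v₁ v₂ : ℝ → ℝ) (X₁ X₂ : ℝ × ℝ → ℝ) : Prop :=
  IsStripSolution (P.speed 0) (P.speed 1) (P.coupling 0 1) (P.coupling 1 0) v₁ v₂ X₁ X₂

variable {v₁ v₂ : ℝ → ℝ} {X₁ X₂ : ℝ × ℝ → ℝ}

theorem StripSolution.locBdd₁ (hX : P.StripSolution v₁ v₂ X₁ X₂) : LocBdd X₁ := by
  obtain ⟨C, hC⟩ := hX.bdd
  exact .of_bound hX.meas₁ fun x => (hC x).1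

theorem StripSolution.locBdd₂ (hX : P.StripSolution v₁ v₂ X₁ X₂) : LocBdd X₂ := by
  obtain ⟨C, hC⟩ := hX.bdd
  exact .of_bound hX.meas₂ fun x => (hC x).2

theorem IsKernel.rowData₀ (hK : P.IsKernel K) (hX : P.StripSolution v₁ v₂ X₁ X₂) :
    RowData (P.speed 0) (P.speed 1)
      (fun x => K (Goursat.toTriangle x).1 (Goursat.toTriangle x).2 0 0)
      (fun x => K (Goursat.toTriangle x).1 (Goursat.toTriangle x).2 0 1)
      (P.coupling 0 1) (P.coupling 1 0) X₁ X₂ v₁ v₂ where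
  ka_cont := hK.continuous_ext 0 0
  kb_cont := hK.continuous_ext 0 1
  β_cont := P.continuous_coupling 0 1
  ω_cont := P.continuous_coupling 1 0
  a_locBdd := hX.locBdd₁
  e_locBdd := hX.locBdd₂
  transport_a t z hz := by
    have := hX.eq₁ (t - (P.speed 0).phi z) z hz
    simpa only [sub_add_cancel] using this
  transport_e t z hz := by
    have := hX.eq₂ (t + (P.speed 1).phi z) z hz
    simpa only [add_sub_cancel_right] using this
  kernel_a r₀ r₁ γ δ h r hr := by
    have hγ : ∀ r ∈ Icc r₀ r₁, γ r ∈ Icc (0 : ℝ) 1 := fun r hr =>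
      ⟨(h r hr).1.trans (h r hr).2.1, (h r hr).2.2.1⟩
    have hδ : ∀ r ∈ Icc r₀ r₁, δ r ∈ Icc (0 : ℝ) 1 := fun r hr =>
      ⟨(h r hr).1, (h r hr).2.1.trans (h r hr).2.2.1⟩
    have h1 := hK.hasDerivWithinAt 0 0 (γ := γ) (δ := δ) (fun r hr => by
      have := h r hr
      rwa [P.speed_l 0 (hγ r hr), P.speed_l 0 (hδ r hr)] at this) hr
    refine (h1.congr_deriv ?_).congr_of_mem (fun r hr => ?_) hr
    · rw [P.speed_l 0 (hδ r hr), P.coupling_eq 1 0 (hδ r hr), Matrix.mul_apply, Fin.sum_univ_two]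
      simp [Lam, Atilde]
    · rw [P.speed_l 0 (hδ r hr)]; simp [Lam]
  kernel_b r₀ r₁ γ δ h r hr := by
    have hγ : ∀ r ∈ Icc r₀ r₁, γ r ∈ Icc (0 : ℝ) 1 := fun r hr =>
      ⟨(h r hr).1.trans (h r hr).2.1, (h r hr).2.2.1⟩
    have hδ : ∀ r ∈ Icc r₀ r₁, δ r ∈ Icc (0 : ℝ) 1 := fun r hr =>
      ⟨(h r hr).1, (h r hr).2.1.trans (h r hr).2.2.1⟩
    have h1 := hK.hasDerivWithinAt 0 1 (γ := γ) (δ := δ) (fun r hr => by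
      have := h r hr
      rwa [P.speed_l 0 (hγ r hr), P.speed_l 1 (hδ r hr)] at this) hr
    refine (h1.neg.congr_deriv ?_).congr_of_mem (fun r hr => ?_) hr
    · rw [P.speed_l 1 (hδ r hr), P.coupling_eq 0 1 (hδ r hr), Matrix.mul_apply, Fin.sum_univ_two]
      simp [Lam, Atilde]
    · rw [P.speed_l 1 (hδ r hr)]; simp [Lam]
  diag z hz := by
    rw [P.speed_l 0 hz, P.speed_l 1 hz, P.coupling_eq 0 1 hz, Goursat.toTriangle_eq hz.1 le_rfl hz.2]
    simp only [hK.bc12 z hz]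
    have := add_pos (P.lam_pos 0 z hz) (P.lam_pos 1 z hz)
    field_simp

/-- Reversing time exchanges the directions of propagation, so `x₂` plays the part of the component
that runs towards `z = 0`. The components and speeds are interchanged and both couplings change
sign. -/
theorem IsKernel.rowData₁ (hK : P.IsKernel K) (hX : P.StripSolution v₁ v₂ X₁ X₂) :
    RowData (P.speed 1) (P.speed 0)
      (fun x => K (Goursat.toTriangle x).1 (Goursat.toTriangle x).2 1 1)
      (fun x => K (Goursat.toTriangle x).1 (Goursat.toTriangle x).2 1 0)
      (fun z => -P.coupling 1 0 z) (fun z => -P.coupling 0 1 z)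
      (fun x => X₂ (-x.1, x.2)) (fun x => X₁ (-x.1, x.2)) (fun t => v₂ (-t)) (fun t => v₁ (-t)) where
  ka_cont := hK.continuous_ext 1 1
  kb_cont := hK.continuous_ext 1 0
  β_cont := (P.continuous_coupling 1 0).neg
  ω_cont := (P.continuous_coupling 0 1).neg
  a_locBdd := hX.locBdd₂.comp (by fun_prop)
  e_locBdd := hX.locBdd₁.comp (by fun_prop)
  transport_a t z hz := by
    have := hX.eq₂ (-(t - (P.speed 1).phi z)) z hz
    rw [show -(t - (P.speed 1).phi z) - (P.speed 1).phi z = -t by ring] at this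
    simp only [this, neg_mul, neg_div, intervalIntegral.integral_neg, sub_neg_eq_add]
    congr 1
    refine intervalIntegral.integral_congr fun ζ _ => ?_
    congr 4
    ring
  transport_e t z hz := by
    have := hX.eq₁ (-(t + (P.speed 0).phi z)) z hz
    rw [show -(t + (P.speed 0).phi z) + (P.speed 0).phi z = -t by ring] at this
    simp only [this, neg_mul, neg_div, intervalIntegral.integral_neg, ← sub_eq_add_neg]
    congr 1
    refine intervalIntegral.integral_congr fun ζ _ => ?_
    congr 4
    ring
  kernel_a r₀ r₁ γ δ h r hr := by
    have hγ : ∀ r ∈ Icc r₀ r₁, γ r ∈ Icc (0 : ℝ) 1 := fun r hr =>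
      ⟨(h r hr).1.trans (h r hr).2.1, (h r hr).2.2.1⟩
    have hδ : ∀ r ∈ Icc r₀ r₁, δ r ∈ Icc (0 : ℝ) 1 := fun r hr =>
      ⟨(h r hr).1, (h r hr).2.1.trans (h r hr).2.2.1⟩
    have h1 := hK.hasDerivWithinAt_reverse 1 1 (γ := γ) (δ := δ) (fun r hr => by
      have := h r hr
      rw [P.speed_l 1 (hγ r hr), P.speed_l 1 (hδ r hr)] at this
      simpa [Lam] using this) hr
    refine (h1.neg.congr_deriv ?_).congr_of_mem (fun r hr => ?_) hr
    · rw [P.speed_l 1 (hδ r hr), P.coupling_eq 0 1 (hδ r hr), Matrix.mul_apply, Fin.sum_univ_two]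
      simp [Lam, Atilde]
    · rw [P.speed_l 1 (hδ r hr)]; simp [Lam]
  kernel_b r₀ r₁ γ δ h r hr := by
    have hγ : ∀ r ∈ Icc r₀ r₁, γ r ∈ Icc (0 : ℝ) 1 := fun r hr =>
      ⟨(h r hr).1.trans (h r hr).2.1, (h r hr).2.2.1⟩
    have hδ : ∀ r ∈ Icc r₀ r₁, δ r ∈ Icc (0 : ℝ) 1 := fun r hr =>
      ⟨(h r hr).1, (h r hr).2.1.trans (h r hr).2.2.1⟩
    have h1 := hK.hasDerivWithinAt_reverse 1 0 (γ := γ) (δ := δ) (fun r hr => by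
      have := h r hr
      rw [P.speed_l 1 (hγ r hr), P.speed_l 0 (hδ r hr)] at this
      simpa [Lam] using this) hr
    refine (h1.congr_deriv ?_).congr_of_mem (fun r hr => ?_) hr
    · rw [P.speed_l 0 (hδ r hr), P.coupling_eq 1 0 (hδ r hr), Matrix.mul_apply, Fin.sum_univ_two]
      simp [Lam, Atilde]
    · rw [P.speed_l 0 (hδ r hr)]; simp [Lam]
  diag z hz := by
    rw [P.speed_l 0 hz, P.speed_l 1 hz, P.coupling_eq 1 0 hz, Goursat.toTriangle_eq hz.1 le_rfl hz.2]
    simp only [hK.bc21 z hz]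
    have := add_pos (P.lam_pos 0 z hz) (P.lam_pos 1 z hz)
    rw [add_comm (P.lam 1 z)]
    field_simp

/-- The backstepping transformation decouples the first transport equation. -/
theorem IsKernel.backstepping₀ (hK : P.IsKernel K) (hX : P.StripSolution v₁ v₂ X₁ X₂) (t : ℝ)
    {z : ℝ} (hz : z ∈ Icc (0 : ℝ) 1) :
    X₁ (t, z) - ∫ ζ in (0 : ℝ)..z, (K z ζ 0 0 * X₁ (t, ζ) + K z ζ 0 1 * X₂ (t, ζ)) =
      v₁ (t + P.phi 0 z) - ∫ ζ in (0 : ℝ)..z, K ζ 0 0 1 * P.Lam 0 1 *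
        (v₂ (t + P.phi 0 z - P.phi 0 ζ) - P.q0 * v₁ (t + P.phi 0 z - P.phi 0 ζ)) / P.lam 0 ζ := by
  have h := (hK.rowData₀ hX).integral_kernel (t + (P.speed 0).phi z) hz
  have h01 : (0 : ℝ) ∈ Icc (0 : ℝ) 1 := by simp
  rw [hX.eq₁ t z hz, ← P.speed_phi 0 hz]
  have e1 : ∫ ζ in (0 : ℝ)..z, (K z ζ 0 0 * X₁ (t, ζ) + K z ζ 0 1 * X₂ (t, ζ))
      = ∫ ζ in (0 : ℝ)..z, (K (Goursat.toTriangle (z, ζ)).1 (Goursat.toTriangle (z, ζ)).2 0 0 *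
          X₁ (t + (P.speed 0).phi z - (P.speed 0).phi z, ζ) +
        K (Goursat.toTriangle (z, ζ)).1 (Goursat.toTriangle (z, ζ)).2 0 1 *
          X₂ (t + (P.speed 0).phi z - (P.speed 0).phi z, ζ)) := by
    refine intervalIntegral.integral_congr fun ζ hζ => ?_
    rw [uIcc_of_le hz.1] at hζ
    simp only [Goursat.toTriangle_eq hζ.1 hζ.2 hz.2, add_sub_cancel_right]
  rw [e1, h, sub_add_eq_sub_sub, sub_neg_eq_add, sub_add_cancel]
  congr 1
  refine intervalIntegral.integral_congr fun ζ hζ => ?_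
  have hζ1 := uIcc_zero_subset_unit hz hζ
  have hl := (P.lam_pos 0 0 h01).ne'
  -- By `bc11` the two boundary terms at `ζ = 0` merge into a multiple of `v₂ - q₀ v₁`. This is the
  -- purpose of the kernel's boundary condition there.
  simp only [Goursat.toTriangle_eq le_rfl hζ1.1 hζ1.2, hK.bc11 ζ hζ1, P.speed_l 0 h01,
    P.speed_l 1 h01, P.speed_phi 0 hζ1, P.speed_l 0 hζ1, Lam, Matrix.cons_val_one,
    Matrix.cons_val_fin_one]
  congr 1
  field_simp
  ring

/-- The backstepping transformation decouples the second transport equation. -/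
theorem IsKernel.backstepping₁ (hK : P.IsKernel K) (hq : P.q0 ≠ 0)
    (hX : P.StripSolution v₁ v₂ X₁ X₂) (t : ℝ) {z : ℝ} (hz : z ∈ Icc (0 : ℝ) 1) :
    X₂ (t, z) - ∫ ζ in (0 : ℝ)..z, (K z ζ 1 0 * X₁ (t, ζ) + K z ζ 1 1 * X₂ (t, ζ)) =
      v₂ (t - P.phi 1 z) + ∫ ζ in (0 : ℝ)..z, K ζ 0 1 1 * P.Lam 0 1 *
        (v₂ (t - P.phi 1 z + P.phi 1 ζ) - P.q0 * v₁ (t - P.phi 1 z + P.phi 1 ζ)) / P.lam 1 ζ := by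
  have h := (hK.rowData₁ hX).integral_kernel (-t + (P.speed 1).phi z) hz
  have h01 : (0 : ℝ) ∈ Icc (0 : ℝ) 1 := by simp
  rw [hX.eq₂ t z hz, ← P.speed_phi 1 hz]
  have e0 : ∀ y, -(-t + (P.speed 1).phi z - y) = t - (P.speed 1).phi z + y := fun y => by ring
  simp only [e0, neg_mul, neg_div, intervalIntegral.integral_neg, neg_neg, sub_add_cancel] at h
  have e1 : ∫ ζ in (0 : ℝ)..z, (K z ζ 1 0 * X₁ (t, ζ) + K z ζ 1 1 * X₂ (t, ζ))
      = ∫ ζ in (0 : ℝ)..z, (K (Goursat.toTriangle (z, ζ)).1 (Goursat.toTriangle (z, ζ)).2 1 1 *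
          X₂ (t, ζ) + K (Goursat.toTriangle (z, ζ)).1 (Goursat.toTriangle (z, ζ)).2 1 0 *
          X₁ (t, ζ)) := by
    refine intervalIntegral.integral_congr fun ζ hζ => ?_
    rw [uIcc_of_le hz.1] at hζ
    simp only [Goursat.toTriangle_eq hζ.1 hζ.2 hz.2, add_comm]
  rw [e1, h, sub_add_eq_sub_sub, add_sub_cancel_right]
  rw [sub_eq_add_neg, ← intervalIntegral.integral_neg]
  congr 1
  refine intervalIntegral.integral_congr fun ζ hζ => ?_
  have hζ1 := uIcc_zero_subset_unit hz hζ
  have hl := (P.lam_pos 0 0 h01).ne'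
  have hl1 := (P.lam_pos 1 0 h01).ne'
  simp only [Goursat.toTriangle_eq le_rfl hζ1.1 hζ1.2, hK.bc22 ζ hζ1, P.speed_l 0 h01,
    P.speed_l 1 h01, P.speed_phi 1 hζ1, P.speed_l 1 hζ1, Lam, Matrix.cons_val_one,
    Matrix.cons_val_fin_one]
  rw [← neg_div]
  congr 1
  field_simp

end PDEODESystem

end Backstepping

/-! ### Flat coordinates of the ODE and Taylor's formula for the integrator chain. -/

section FlatCoordinates
open MeasureTheory

namespace PDEODESystem

variable {n : ℕ} {P : PDEODESystem n}

theorem Controllable.isUnit_ctrbMatrix (h : P.Controllable) : IsUnit P.ctrbMatrix := by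
  rw [← Matrix.mulVec_surjective_iff_isUnit]
  have h1 : Module.finrank ℝ (LinearMap.range P.ctrbMatrix.mulVecLin) = n := h
  have h2 : LinearMap.range P.ctrbMatrix.mulVecLin = ⊤ :=
    Submodule.eq_top_of_finrank_eq (by simp [h1])
  exact LinearMap.range_eq_top.1 h2

/-- The last row of `M_c⁻¹ M_c = 1`: the input reaches `h · ξ` only after `n` differentiations. -/
theorem Controllable.h_dotProduct (h : P.Controllable) {k : ℕ} (hk : k < n) :
    P.h ⬝ᵥ (P.F ^ k *ᵥ P.b) = if k + 1 = n then 1 else 0 := by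
  have hdet : IsUnit P.ctrbMatrix.det := (Matrix.isUnit_iff_isUnit_det _).1 h.isUnit_ctrbMatrix
  have h1 := congrFun (congrFun (Matrix.nonsing_inv_mul _ hdet) ⟨n - 1, by omega⟩) ⟨k, hk⟩
  rw [Matrix.mul_apply, Matrix.one_apply] at h1
  have h2 : (∑ j, P.ctrbMatrix⁻¹ ⟨n - 1, by omega⟩ j * P.ctrbMatrix j ⟨k, hk⟩)
      = P.h ⬝ᵥ (P.F ^ k *ᵥ P.b) := rfl
  rw [h2] at h1
  rw [h1]
  simp only [Fin.mk.injEq]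
  congr 1
  rw [eq_iff_iff]
  omega

theorem Tc_mulVec (ξ : Fin n → ℝ) (i : Fin n) :
    (P.Tc *ᵥ ξ) i = (P.h ᵥ* P.F ^ (i : ℕ)) ⬝ᵥ ξ := rfl

theorem h_pow_dotProduct_F (k : ℕ) (ξ : Fin n → ℝ) :
    (P.h ᵥ* P.F ^ k) ⬝ᵥ (P.F *ᵥ ξ) = (P.h ᵥ* P.F ^ (k + 1)) ⬝ᵥ ξ := by
  rw [Matrix.dotProduct_mulVec, Matrix.vecMul_vecMul, pow_succ]

theorem Controllable.h_pow_dotProduct_b (h : P.Controllable) {k : ℕ} (hk : k < n) :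
    (P.h ᵥ* P.F ^ k) ⬝ᵥ P.b = if k + 1 = n then 1 else 0 := by
  rw [← h.h_dotProduct hk, Matrix.dotProduct_mulVec]

/-- The entries of `T_c M_c` are `h · F^(i+k) b`, which vanish for `i + k < n - 1` and equal one for
`i + k = n - 1`. With its columns reversed, the product is unit lower triangular. -/
theorem Controllable.isUnit_det_Tc (h : P.Controllable) : IsUnit P.Tc.det := by
  set N : Matrix (Fin n) (Fin n) ℝ := (P.Tc * P.ctrbMatrix).submatrix id Fin.revPerm with hN
  have hentry : ∀ i j, N i j = P.h ⬝ᵥ (P.F ^ ((i : ℕ) + (n - 1 - j)) *ᵥ P.b) := by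
    intro i j
    have h1 : N i j = (P.Tc *ᵥ (P.F ^ (n - 1 - (j : ℕ)) *ᵥ P.b)) i := by
      simp only [hN, Matrix.submatrix_apply, id, Matrix.mul_apply, Matrix.mulVec, dotProduct,
        ctrbMatrix, Matrix.of_apply, Fin.revPerm_apply, Fin.val_rev]
      refine Finset.sum_congr rfl fun x _ => ?_
      rw [show n - (j + 1) = n - 1 - (j : ℕ) by omega]
    rw [h1, Tc_mulVec, Matrix.dotProduct_mulVec, Matrix.vecMul_vecMul, ← pow_add,
      Matrix.dotProduct_mulVec]
  have hdet : N.det = 1 := by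
    rw [Matrix.det_of_isLowerTriangular]
    · refine Finset.prod_eq_one fun i _ => ?_
      have := i.isLt
      rw [hentry, h.h_dotProduct (by omega), if_pos (by omega)]
    · intro i j hij
      have hij' : i < j := hij
      have h1 : (i : ℕ) < j := hij'
      have := j.isLt
      rw [hentry, h.h_dotProduct (by omega), if_neg (by omega)]
  rw [hN, Matrix.det_permute', Matrix.det_mul] at hdet
  refine isUnit_iff_ne_zero.2 fun h0 => ?_
  simp [h0] at hdet

/-- The velocity of the state of an integrator chain of length `n` with input `w`. -/
def chainNext (Y : Fin n → ℝ) (w : ℝ) (i : Fin n) : ℝ :=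
  if hi : (i : ℕ) + 1 < n then Y ⟨i + 1, hi⟩ else w

/-- The rows of `T_c` other than the last annihilate `b`, so each coordinate has the next one as its
derivative; the last one receives the input plus `h · Fⁿ ξ`. -/
theorem Controllable.Tc_mulVec_field (h : P.Controllable) (ξ : Fin n → ℝ) (v : ℝ) :
    P.Tc *ᵥ (P.F *ᵥ ξ + v • P.b) = chainNext (P.Tc *ᵥ ξ) (v + (P.h ᵥ* P.F ^ n) ⬝ᵥ ξ) := by
  funext i
  rw [Tc_mulVec, dotProduct_add, h_pow_dotProduct_F, dotProduct_smul,
    h.h_pow_dotProduct_b i.isLt, chainNext]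
  have := i.isLt
  by_cases h1 : (i : ℕ) + 1 < n
  · rw [dif_pos h1, if_neg (by omega), Tc_mulVec]
    simp
  · have h2 : (i : ℕ) + 1 = n := by omega
    rw [dif_neg h1, if_pos h2, h2]
    simp [add_comm]

/-- Two integrator chains with the same initial state and the same input agree. -/
theorem chain_unique {Y Y' : ℝ → Fin n → ℝ} {w w' : ℝ → ℝ} {a b : ℝ} (h0 : Y a = Y' a)
    (hw : ∀ τ ∈ Icc a b, w τ = w' τ)
    (hY : ∀ τ ∈ Icc a b, ∀ i, Y τ i = Y a i + ∫ s in a..τ, chainNext (Y s) (w s) i)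
    (hY' : ∀ τ ∈ Icc a b, ∀ i, Y' τ i = Y' a i + ∫ s in a..τ, chainNext (Y' s) (w' s) i) :
    ∀ τ ∈ Icc a b, Y τ = Y' τ := by
  -- Induction from the last integrator, which is driven by the input alone, towards the first; `m`
  -- counts the integrators after `i`.
  have key : ∀ m : ℕ, ∀ i : Fin n, (i : ℕ) + m + 1 = n → ∀ τ ∈ Icc a b, Y τ i = Y' τ i := by
    intro m
    induction m with
    | zero =>
      intro i hi τ hτ
      rw [hY τ hτ, hY' τ hτ, h0]
      congr 1
      refine intervalIntegral.integral_congr fun s hs => ?_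
      rw [uIcc_of_le hτ.1] at hs
      have : ¬ ((i : ℕ) + 1 < n) := by omega
      simp only [chainNext, this, dif_neg, not_false_eq_true]
      exact hw s ⟨hs.1, hs.2.trans hτ.2⟩
    | succ m ih =>
      intro i hi τ hτ
      rw [hY τ hτ, hY' τ hτ, h0]
      congr 1
      refine intervalIntegral.integral_congr fun s hs => ?_
      rw [uIcc_of_le hτ.1] at hs
      have h1 : (i : ℕ) + 1 < n := by omega
      simp only [chainNext, h1, dif_pos]
      exact ih ⟨i + 1, h1⟩ (by simp only; omega) s ⟨hs.1, hs.2.trans hτ.2⟩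
  intro τ hτ
  funext i
  exact key (n - 1 - i) i (by have := i.isLt; omega) τ hτ

/-- Cauchy's formula for one more integration. -/
theorem integral_integral_pow {w : ℝ → ℝ} (hw : LocBdd w) (m : ℕ) {a τ : ℝ} (haτ : a ≤ τ) :
    ∫ s in a..τ, ∫ σ in a..s, (s - σ) ^ m / (m ! : ℝ) * w σ =
      ∫ σ in a..τ, (τ - σ) ^ (m + 1) / ((m + 1)! : ℝ) * w σ := by
  set F : ℝ × ℝ → ℝ := fun x => if x.2 < x.1 then (x.1 - x.2) ^ m / (m ! : ℝ) * w x.2 else 0 with hF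
  have lF : LocBdd F := LocBdd.ite (LocBdd.mul (.of_continuous (by fun_prop))
    (hw.comp (by fun_prop))) (measurableSet_lt measurable_snd measurable_fst)
  have hsw := lF.integral_swap haτ haτ
  have hL : ∫ s in a..τ, ∫ σ in a..τ, F (s, σ)
      = ∫ s in a..τ, ∫ σ in a..s, (s - σ) ^ m / (m ! : ℝ) * w σ := by
    refine intervalIntegral.integral_congr fun s hs => ?_
    rw [uIcc_of_le haτ] at hs
    exact integral_ite_gt (f := fun σ => (s - σ) ^ m / (m ! : ℝ) * w σ) hs.1 hs.2
  · rw [← hL, hsw]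
    refine intervalIntegral.integral_congr fun σ hσ => ?_
    rw [uIcc_of_le haτ] at hσ
    simp only [hF]
    rw [integral_ite_lt (f := fun s => (s - σ) ^ m / (m ! : ℝ) * w σ) hσ.1 hσ.2,
      intervalIntegral.integral_mul_const, intervalIntegral.integral_div,
      intervalIntegral.integral_comp_sub_right (fun x => x ^ m) σ, integral_pow]
    rw [Nat.factorial_succ]
    push_cast
    have : (m ! : ℝ) ≠ 0 := by positivity
    field_simp
    simp

/-- At the left end of the window all positive powers vanish, and `0 ^ 0 = 1` leaves the term `k =
i`. -/
theorem yDer_left (η : Fin n → ℝ) (ηd : ℝ → ℝ) : P.yDer η ηd (-P.tau2) = η := by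
  funext i
  rw [yDer, intervalIntegral.integral_same, add_zero, Finset.sum_eq_single i]
  · simp
  · intro k _ hk
    split_ifs with h
    · have h1 : (i : ℕ) < k := lt_of_le_of_ne h fun h' => hk (Fin.ext h'.symm)
      rw [neg_add_cancel, zero_pow (by omega)]
      simp
    · rfl
  · simp

/-- The polynomial part integrates term by term, and the remainder gains one order by Cauchy's
formula for repeated integration. -/
theorem yDer_chain {η : Fin n → ℝ} {ηd : ℝ → ℝ} (hηd : LocBdd ηd) {τ : ℝ} (hτ : -P.tau2 ≤ τ)
    (i : Fin n) : P.yDer η ηd τ i = η i +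
      ∫ s in (-P.tau2)..τ, chainNext (P.yDer η ηd s) (ηd s) i := by
  have hilt := i.isLt
  by_cases hi : (i : ℕ) + 1 < n
  · have e : n - 1 - (i : ℕ) = n - 1 - ((i : ℕ) + 1) + 1 := by omega
    have hrhs : ∀ s, chainNext (P.yDer η ηd s) (ηd s) i =
        (∑ k : Fin n, if (⟨i + 1, hi⟩ : Fin n) ≤ k then
          (s + P.tau2) ^ ((k : ℕ) - ((i : ℕ) + 1)) / (((k : ℕ) - ((i : ℕ) + 1))! : ℝ) * η k else 0) +
        ∫ σ in (-P.tau2)..s, (s - σ) ^ (n - 1 - ((i : ℕ) + 1)) /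
          ((n - 1 - ((i : ℕ) + 1))! : ℝ) * ηd σ := fun s => by
      simp only [chainNext, hi, dif_pos, yDer]
    have hcont : ∀ k : Fin n, Continuous fun s : ℝ => if (⟨i + 1, hi⟩ : Fin n) ≤ k then
          (s + P.tau2) ^ ((k : ℕ) - ((i : ℕ) + 1)) / (((k : ℕ) - ((i : ℕ) + 1))! : ℝ) * η k
          else 0 := by
      intro k
      split_ifs <;> fun_prop
    have hint2 : IntervalIntegrable (fun s => ∫ σ in (-P.tau2)..s,
        (s - σ) ^ (n - 1 - ((i : ℕ) + 1)) / ((n - 1 - ((i : ℕ) + 1))! : ℝ) * ηd σ) volume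
        (-P.tau2) τ := by
      set m := n - 1 - ((i : ℕ) + 1)
      have lF : LocBdd fun x : ℝ × ℝ => if x.2 < x.1 then
          (x.1 - x.2) ^ m / (m ! : ℝ) * ηd x.2 else 0 :=
        LocBdd.ite (LocBdd.mul (.of_continuous (by fun_prop))
          (hηd.comp (by fun_prop))) (measurableSet_lt measurable_snd measurable_fst)
      refine ((lF.integral_param hτ).intervalIntegrable (-P.tau2) τ).congr fun s hs => ?_
      rw [uIoc_of_le hτ] at hs
      exact integral_ite_gt (f := fun σ => (s - σ) ^ m / (m ! : ℝ) * ηd σ) hs.1.le hs.2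
    simp only [hrhs]
    rw [intervalIntegral.integral_add ((continuous_finsetSum _ fun k _ =>
      hcont k).intervalIntegrable _ _) hint2, intervalIntegral.integral_finsetSum
      fun k _ => (hcont k).intervalIntegrable _ _, integral_integral_pow hηd _ hτ, ← e,
      yDer, ← add_assoc]
    congr 1
    -- The term `k = i` is the initial value, absent from the polynomial of the next derivative;
    -- every `k > i` is the integral of the corresponding term there.
    have hsplit : ∀ k : Fin n, (if i ≤ k then
        (τ + P.tau2) ^ ((k : ℕ) - (i : ℕ)) / (((k : ℕ) - (i : ℕ))! : ℝ) * η k else 0)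
        = (if k = i then η k else 0) + ∫ s in (-P.tau2)..τ, (if (⟨i + 1, hi⟩ : Fin n) ≤ k then
          (s + P.tau2) ^ ((k : ℕ) - ((i : ℕ) + 1)) / (((k : ℕ) - ((i : ℕ) + 1))! : ℝ) * η k
          else 0) := by
      intro k
      by_cases h1 : k = i
      · subst h1
        have : ¬ ((⟨k + 1, hi⟩ : Fin n) ≤ k) := by simp [Fin.le_def]
        simp [this]
      · by_cases h2 : i ≤ k
        · have h3 : (i : ℕ) < k := lt_of_le_of_ne h2 fun h' => h1 (Fin.ext h'.symm)
          have h4 : (⟨i + 1, hi⟩ : Fin n) ≤ k := h3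
          simp only [h1, h2, h4, if_true, if_false, zero_add]
          rw [intervalIntegral.integral_mul_const, intervalIntegral.integral_div,
            intervalIntegral.integral_comp_add_right (fun x => x ^ ((k : ℕ) - ((i : ℕ) + 1))),
            integral_pow, neg_add_cancel]
          obtain ⟨m, hm⟩ : ∃ m, (k : ℕ) = i + m + 1 := ⟨k - i - 1, by omega⟩
          have e1 : (k : ℕ) - i = m + 1 := by omega
          have e2 : (k : ℕ) - (i + 1) = m := by omega
          rw [e1, e2, Nat.factorial_succ]
          push_cast
          have : (m ! : ℝ) ≠ 0 := by positivity
          field_simp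
          simp [mul_comm]
        · have h4 : ¬ ((⟨i + 1, hi⟩ : Fin n) ≤ k) := fun h => h2 (le_trans
            (Fin.le_def.2 (Nat.le_succ _)) h)
          simp [h1, h2, h4]
    rw [Finset.sum_congr rfl fun k _ => hsplit k, Finset.sum_add_distrib]
    simp
  · have hlast : ∀ s, chainNext (P.yDer η ηd s) (ηd s) i = ηd s := fun s => by
      simp [chainNext, hi]
    simp only [hlast]
    rw [yDer, Finset.sum_eq_single i]
    · have : n - 1 - (i : ℕ) = 0 := by omega
      simp [this]
    · intro k _ hk
      have : ¬ i ≤ k := fun h => by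
        have h1 : (i : ℕ) < k := lt_of_le_of_ne h fun h' => hk (Fin.ext h'.symm)
        have := k.isLt
        omega
      simp [this]
    · simp

end PDEODESystem

end FlatCoordinates

/-! ### Trajectories of the ODE and their flat parametrization. -/

section Trajectories
open MeasureTheory

/-- `f` agrees on `[a, b]` with a measurable locally bounded function. -/
def LocBddOn (f : ℝ → ℝ) (a b : ℝ) : Prop := ∃ g, LocBdd g ∧ EqOn f g (Icc a b)

namespace LocBddOn

variable {f g : ℝ → ℝ} {a b c : ℝ}

theorem of_locBdd (hf : LocBdd f) : LocBddOn f a b := ⟨f, hf, fun _ _ => rfl⟩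

theorem of_piecewise (hf : PiecewiseContinuousOn f a b) : LocBddOn f a b := by
  obtain ⟨M, hM⟩ := hf.exists_bound
  refine ⟨_, .of_bound hf.measurable_indicator (C := |M|) fun x => ?_,
    fun x hx => (indicator_of_mem hx f).symm⟩
  by_cases hx : x ∈ Icc a b
  · rw [indicator_of_mem hx]
    exact (hM x hx).trans (le_abs_self M)
  · rw [indicator_of_notMem hx, abs_zero]
    exact abs_nonneg _

theorem of_continuousOn (hf : ContinuousOn f (Icc a b)) : LocBddOn f a b :=
  of_piecewise (.of_continuousOn hf)

theorem add (hf : LocBddOn f a b) (hg : LocBddOn g a b) : LocBddOn (fun x => f x + g x) a b := by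
  obtain ⟨f', hf', e⟩ := hf
  obtain ⟨g', hg', e'⟩ := hg
  exact ⟨_, hf'.add hg', fun x hx => by simp only [e hx, e' hx]⟩

theorem mul (hf : LocBddOn f a b) (hg : LocBddOn g a b) : LocBddOn (fun x => f x * g x) a b := by
  obtain ⟨f', hf', e⟩ := hf
  obtain ⟨g', hg', e'⟩ := hg
  exact ⟨_, hf'.mul hg', fun x hx => by simp only [e hx, e' hx]⟩

theorem const_mul (hf : LocBddOn f a b) (k : ℝ) : LocBddOn (fun x => k * f x) a b :=
  (of_continuousOn continuousOn_const).mul hf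

theorem mono {a' b' : ℝ} (hf : LocBddOn f a b) (ha : a ≤ a') (hb : b' ≤ b) :
    LocBddOn f a' b' := by
  obtain ⟨f', hf', e⟩ := hf
  exact ⟨f', hf', e.mono (Icc_subset_Icc ha hb)⟩

theorem comp_add (hf : LocBddOn f a b) (t : ℝ) :
    LocBddOn (fun x => f (t + x)) (a - t) (b - t) := by
  obtain ⟨f', hf', e⟩ := hf
  exact ⟨_, hf'.comp (k := fun x => t + x) (by fun_prop), fun x hx =>
    e ⟨by linarith [hx.1], by linarith [hx.2]⟩⟩

theorem intervalIntegrable (hf : LocBddOn f a b) {s t : ℝ} (hs : s ∈ Icc a b) (ht : t ∈ Icc a b) :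
    IntervalIntegrable f volume s t := by
  obtain ⟨g, hg, e⟩ := hf
  refine (hg.intervalIntegrable s t).congr fun x hx => ?_
  exact (e (uIcc_subset_Icc hs ht (uIoc_subset_uIcc hx))).symm

theorem continuousOn_primitive (hf : LocBddOn f a b) :
    ContinuousOn (fun x => ∫ s in a..x, f s) (Icc a b) := by
  obtain ⟨g, hg, e⟩ := hf
  refine (intervalIntegral.continuous_primitive hg.intervalIntegrable a).continuousOn.congr
    fun x hx => intervalIntegral.integral_congr fun s hs => ?_
  rw [uIcc_of_le hx.1] at hs
  exact e ⟨hs.1, hs.2.trans hx.2⟩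

theorem congr (hf : LocBddOn f a b) (h : EqOn g f (Icc a b)) : LocBddOn g a b := by
  obtain ⟨f', hf', e⟩ := hf
  exact ⟨f', hf', h.trans e⟩

theorem sub (hf : LocBddOn f a b) (hg : LocBddOn g a b) : LocBddOn (fun x => f x - g x) a b :=
  (hf.add (hg.const_mul (-1))).congr fun x _ => by ring

theorem glue (hf : LocBddOn f a b) (hf' : LocBddOn f b c) : LocBddOn f a c := by
  obtain ⟨g, hg, e⟩ := hf
  obtain ⟨g', hg', e'⟩ := hf'
  refine ⟨_, (hg.ite (p := (· ≤ b)) measurableSet_Iic).add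
    (hg'.ite (p := (b < ·)) measurableSet_Ioi), fun x hx => ?_⟩
  rcases le_or_gt x b with h | h
  · simp [e ⟨hx.1, h⟩, h, not_lt.mpr h]
  · simp [e' ⟨h.le, hx.2⟩, h, not_le.mpr h]

end LocBddOn

theorem mulVec_primitive {m n : ℕ} (M : Matrix (Fin m) (Fin n) ℝ) {Y₀ Y₁ : Fin n → ℝ}
    {g : ℝ → Fin n → ℝ} {a b : ℝ} (hg : ∀ j, IntervalIntegrable (fun s => g s j) volume a b)
    (h : ∀ j, Y₁ j = Y₀ j + ∫ s in a..b, g s j) (i : Fin m) :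
    (M *ᵥ Y₁) i = (M *ᵥ Y₀) i + ∫ s in a..b, (M *ᵥ g s) i := by
  have h1 : ∫ s in a..b, (M *ᵥ g s) i = ∑ j, M i j * ∫ s in a..b, g s j := by
    simp only [Matrix.mulVec, dotProduct]
    rw [intervalIntegral.integral_finsetSum fun j _ => (hg j).const_mul _]
    simp
  rw [h1]
  simp only [Matrix.mulVec, dotProduct]
  rw [← Finset.sum_add_distrib]
  exact Finset.sum_congr rfl fun j _ => by rw [h j]; ring

namespace PDEODESystem

variable {n : ℕ} {P : PDEODESystem n}

/-- `(ξ, v)` is a trajectory of the ODE `ξ' = F ξ + b v` on `[a, b]`. -/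
structure IsTrajectory (P : PDEODESystem n) (ξ : ℝ → Fin n → ℝ) (v : ℝ → ℝ) (a b : ℝ) :
    Prop where
  cont : ContinuousOn ξ (Icc a b)
  locBdd : LocBddOn v a b
  ode : ∀ τ ∈ Icc a b, ∀ i, ξ τ i = ξ a i + ∫ s in a..τ, ((P.F *ᵥ ξ s) i + P.b i * v s)

theorem continuousOn_mulVec {m n : ℕ} (M : Matrix (Fin m) (Fin n) ℝ) {ξ : ℝ → Fin n → ℝ}
    {s : Set ℝ} (h : ContinuousOn ξ s) (i : Fin m) : ContinuousOn (fun t => (M *ᵥ ξ t) i) s := by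
  simp only [Matrix.mulVec, dotProduct]
  exact continuousOn_finsetSum _ fun j _ =>
    continuousOn_const.mul ((continuous_apply j).comp_continuousOn h)

theorem continuousOn_dotProduct {n : ℕ} (c : Fin n → ℝ) {ξ : ℝ → Fin n → ℝ}
    {s : Set ℝ} (h : ContinuousOn ξ s) : ContinuousOn (fun t => c ⬝ᵥ ξ t) s := by
  simp only [dotProduct]
  exact continuousOn_finsetSum _ fun j _ =>
    continuousOn_const.mul ((continuous_apply j).comp_continuousOn h)

namespace IsTrajectory

variable {ξ : ℝ → Fin n → ℝ} {v : ℝ → ℝ} {a b : ℝ}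

theorem locBddOn_field (h : P.IsTrajectory ξ v a b) (i : Fin n) :
    LocBddOn (fun s => (P.F *ᵥ ξ s) i + P.b i * v s) a b :=
  (LocBddOn.of_continuousOn (continuousOn_mulVec _ h.cont i)).add (h.locBdd.const_mul _)

theorem eq_add_integral (h : P.IsTrajectory ξ v a b) {s t : ℝ} (hs : s ∈ Icc a b)
    (ht : t ∈ Icc a b) (i : Fin n) :
    ξ t i = ξ s i + ∫ r in s..t, ((P.F *ᵥ ξ r) i + P.b i * v r) := by
  have ha : a ∈ Icc a b := ⟨le_rfl, hs.1.trans hs.2⟩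
  rw [h.ode t ht, h.ode s hs, add_assoc, intervalIntegral.integral_add_adjacent_intervals
    ((h.locBddOn_field i).intervalIntegrable ha hs) ((h.locBddOn_field i).intervalIntegrable hs ht)]

theorem mono (h : P.IsTrajectory ξ v a b) {a' b' : ℝ} (ha : a ≤ a') (hb : b' ≤ b) :
    P.IsTrajectory ξ v a' b' where
  cont := h.cont.mono (Icc_subset_Icc ha hb)
  locBdd := h.locBdd.mono ha hb
  ode _ hτ i := h.eq_add_integral ⟨ha, hτ.1.trans (hτ.2.trans hb)⟩ ⟨ha.trans hτ.1, hτ.2.trans hb⟩ i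

theorem shift (h : P.IsTrajectory ξ v a b) (t : ℝ) :
    P.IsTrajectory (fun τ => ξ (t + τ)) (fun τ => v (t + τ)) (a - t) (b - t) where
  cont := h.cont.comp (by fun_prop) fun x hx => ⟨by linarith [hx.1], by linarith [hx.2]⟩
  locBdd := h.locBdd.comp_add t
  ode τ hτ i := by
    rw [h.ode (t + τ) ⟨by linarith [hτ.1], by linarith [hτ.2]⟩,
      intervalIntegral.integral_comp_add_left
        (fun s => (P.F *ᵥ ξ s) i + P.b i * v s) t, add_sub_cancel]

/-- The coordinates `T_c ξ` of a trajectory form an integrator chain. -/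
theorem chain (h : P.IsTrajectory ξ v a b) (hc : P.Controllable) {s t : ℝ} (hs : s ∈ Icc a b)
    (ht : t ∈ Icc a b) (i : Fin n) :
    (P.Tc *ᵥ ξ t) i = (P.Tc *ᵥ ξ s) i +
      ∫ r in s..t, chainNext (P.Tc *ᵥ ξ r) (v r + (P.h ᵥ* P.F ^ n) ⬝ᵥ ξ r) i := by
  have h1 := mulVec_primitive P.Tc (Y₀ := ξ s) (Y₁ := ξ t) (g := fun r => P.F *ᵥ ξ r + v r • P.b)
    (a := s) (b := t) (fun j => ((h.locBddOn_field j).intervalIntegrable hs ht).congr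
      fun r _ => by simp [mul_comm])
    (fun j => by
      rw [h.eq_add_integral hs ht j]
      simp [mul_comm]) i
  simp only [hc.Tc_mulVec_field] at h1
  exact h1

end IsTrajectory

theorem yDer_congr {η : Fin n → ℝ} {ηd ηd' : ℝ → ℝ} {τ : ℝ} (hτ : -P.tau2 ≤ τ)
    (h : EqOn ηd ηd' (Icc (-P.tau2) τ)) : P.yDer η ηd τ = P.yDer η ηd' τ := by
  funext i
  simp only [yDer]
  congr 1
  refine intervalIntegral.integral_congr fun s hs => ?_
  rw [uIcc_of_le hτ] at hs
  simp only [h hs]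

theorem yDer_chain_of_locBddOn {η : Fin n → ℝ} {ηd : ℝ → ℝ} {b : ℝ}
    (hηd : LocBddOn ηd (-P.tau2) b) {τ : ℝ} (hτ : τ ∈ Icc (-P.tau2) b) (i : Fin n) :
    P.yDer η ηd τ i = η i + ∫ s in (-P.tau2)..τ, chainNext (P.yDer η ηd s) (ηd s) i := by
  obtain ⟨g, hg, e⟩ := hηd
  rw [yDer_congr hτ.1 (e.mono (Icc_subset_Icc le_rfl hτ.2)), yDer_chain hg hτ.1]
  congr 1
  refine intervalIntegral.integral_congr fun s hs => ?_
  rw [uIcc_of_le hτ.1] at hs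
  have hs' : s ∈ Icc (-P.tau2) b := ⟨hs.1, hs.2.trans hτ.2⟩
  simp only [e hs', yDer_congr hs.1 (e.mono (Icc_subset_Icc le_rfl hs'.2))]

theorem locBddOn_yDer {η : Fin n → ℝ} {ηd : ℝ → ℝ} {b : ℝ}
    (hηd : LocBddOn ηd (-P.tau2) b) (i : Fin n) :
    LocBddOn (fun τ => P.yDer η ηd τ i) (-P.tau2) b := by
  obtain ⟨g, hg, e⟩ := hηd
  rcases lt_or_ge b (-P.tau2) with hb | hb
  · exact ⟨0, .of_continuous continuous_zero, fun x hx => by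
      exfalso; linarith [hx.1, hx.2]⟩
  set m := n - 1 - (i : ℕ) with hm
  have lF : LocBdd fun x : ℝ × ℝ => if x.2 < x.1 then (x.1 - x.2) ^ m / (m ! : ℝ) * g x.2 else 0 :=
    LocBdd.ite (LocBdd.mul (.of_continuous (by fun_prop)) (hg.comp (by fun_prop)))
      (measurableSet_lt measurable_snd measurable_fst)
  have hsum : LocBdd fun τ : ℝ => ∑ k : Fin n, if i ≤ k then
      (τ + P.tau2) ^ ((k : ℕ) - (i : ℕ)) / (((k : ℕ) - (i : ℕ))! : ℝ) * η k else 0 :=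
    .of_continuous (continuous_finsetSum _ fun k _ => by split_ifs <;> fun_prop)
  refine ⟨_, hsum.add (lF.integral_param hb), fun τ hτ => ?_⟩
  change P.yDer η ηd τ i = _
  rw [yDer_congr hτ.1 (e.mono (Icc_subset_Icc le_rfl hτ.2)), yDer]
  congr 1
  exact (integral_ite_gt (f := fun σ => (τ - σ) ^ m / (m ! : ℝ) * g σ) hτ.1 hτ.2).symm

theorem locBddOn_chainNext {Y : ℝ → Fin n → ℝ} {w : ℝ → ℝ} {a b : ℝ}
    (hY : ∀ i, LocBddOn (fun s => Y s i) a b) (hw : LocBddOn w a b) (i : Fin n) :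
    LocBddOn (fun s => chainNext (Y s) (w s) i) a b := by
  by_cases hi : (i : ℕ) + 1 < n
  · simpa only [chainNext, hi, dif_pos] using hY ⟨i + 1, hi⟩
  · simpa only [chainNext, hi, dif_neg, not_false_eq_true] using hw

theorem continuousOn_yDer {η : Fin n → ℝ} {ηd : ℝ → ℝ} {b : ℝ}
    (hηd : LocBddOn ηd (-P.tau2) b) : ContinuousOn (P.yDer η ηd) (Icc (-P.tau2) b) := by
  refine continuousOn_pi.2 fun i => ?_
  have h := (locBddOn_chainNext (fun i => locBddOn_yDer (η := η) hηd i) hηd i).continuousOn_primitive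
  exact (continuousOn_const.add h).congr fun τ hτ => yDer_chain_of_locBddOn hηd hτ i

theorem Controllable.Tc_mulVec_xiPar (hc : P.Controllable) (η : Fin n → ℝ) (ηd : ℝ → ℝ) (τ : ℝ) :
    P.Tc *ᵥ P.xiPar η ηd τ = P.yDer η ηd τ := by
  rw [xiPar, Matrix.mulVec_mulVec, Matrix.mul_nonsing_inv _ hc.isUnit_det_Tc, Matrix.one_mulVec]

theorem Controllable.inv_Tc_mulVec (hc : P.Controllable) (ξ : Fin n → ℝ) :
    P.Tc⁻¹ *ᵥ (P.Tc *ᵥ ξ) = ξ := by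
  rw [Matrix.mulVec_mulVec, Matrix.nonsing_inv_mul _ hc.isUnit_det_Tc, Matrix.one_mulVec]

theorem xiPar_left (η : Fin n → ℝ) (ηd : ℝ → ℝ) :
    P.xiPar η ηd (-P.tau2) = P.Tc⁻¹ *ᵥ η := by
  rw [xiPar, yDer_left]

/-- The image under `T_c⁻¹` of the integrator chain: `x10Par` is defined so that `v + h · Fⁿ ξ` is
the prescribed input of the chain. -/
theorem isTrajectory_xiPar (hc : P.Controllable) {η : Fin n → ℝ} {ηd : ℝ → ℝ} {b : ℝ}
    (hηd : LocBddOn ηd (-P.tau2) b) :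
    P.IsTrajectory (P.xiPar η ηd) (P.x10Par η ηd) (-P.tau2) b := by
  have hcont : ContinuousOn (P.xiPar η ηd) (Icc (-P.tau2) b) :=
    continuousOn_pi.2 fun i => continuousOn_mulVec _ (continuousOn_yDer hηd) i
  have hv : LocBddOn (P.x10Par η ηd) (-P.tau2) b :=
    hηd.sub (.of_continuousOn (continuousOn_dotProduct _ hcont))
  refine ⟨hcont, hv, fun τ hτ i => ?_⟩
  have hm : -P.tau2 ∈ Icc (-P.tau2) b := ⟨le_rfl, hτ.1.trans hτ.2⟩
  have h1 := mulVec_primitive P.Tc⁻¹ (Y₀ := η) (Y₁ := P.yDer η ηd τ)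
    (g := fun s => chainNext (P.yDer η ηd s) (ηd s)) (a := -P.tau2) (b := τ)
    (fun j => (locBddOn_chainNext (fun i => locBddOn_yDer hηd i) hηd j).intervalIntegrable hm hτ)
    (fun j => yDer_chain_of_locBddOn hηd hτ j) i
  rw [xiPar_left]
  refine h1.trans ?_
  congr 1
  refine intervalIntegral.integral_congr fun s _ => ?_
  have h2 := hc.Tc_mulVec_field (P.xiPar η ηd s) (P.x10Par η ηd s)
  have h3 : P.x10Par η ηd s + (P.h ᵥ* P.F ^ n) ⬝ᵥ P.xiPar η ηd s = ηd s := by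
    rw [x10Par]; ring
  rw [h3, hc.Tc_mulVec_xiPar] at h2
  rw [← h2, hc.inv_Tc_mulVec]
  simp [mul_comm]

/-- The flat coordinates of a trajectory parametrize it. -/
theorem IsTrajectory.xiPar_eq (hc : P.Controllable) {ξ : ℝ → Fin n → ℝ} {v : ℝ → ℝ} {b : ℝ}
    (h : P.IsTrajectory ξ v (-P.tau2) b) {η : Fin n → ℝ} {ηd : ℝ → ℝ}
    (hη : η = P.Tc *ᵥ ξ (-P.tau2))
    (hηd : ∀ τ ∈ Icc (-P.tau2) b, ηd τ = v τ + (P.h ᵥ* P.F ^ n) ⬝ᵥ ξ τ) {τ : ℝ}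
    (hτ : τ ∈ Icc (-P.tau2) b) : P.xiPar η ηd τ = ξ τ ∧ P.x10Par η ηd τ = v τ := by
  have lηd : LocBddOn ηd (-P.tau2) b :=
    (h.locBdd.add (.of_continuousOn (continuousOn_dotProduct _ h.cont))).congr hηd
  have hm : -P.tau2 ∈ Icc (-P.tau2) b := ⟨le_rfl, hτ.1.trans hτ.2⟩
  -- Taylor's formula started from `η` and the coordinates `T_c ξ` are integrator chains with the
  -- same initial state and input.
  have hu := chain_unique (Y := P.yDer η ηd) (Y' := fun τ => P.Tc *ᵥ ξ τ) (w := ηd)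
    (w' := fun τ => v τ + (P.h ᵥ* P.F ^ n) ⬝ᵥ ξ τ) (a := -P.tau2) (b := b)
    (by rw [yDer_left, hη]) hηd
    (fun τ hτ i => by rw [yDer_left]; exact yDer_chain_of_locBddOn lηd hτ i)
    (fun τ hτ i => h.chain hc hm hτ i) τ hτ
  have h1 : P.xiPar η ηd τ = ξ τ := by rw [xiPar, hu, hc.inv_Tc_mulVec]
  refine ⟨h1, ?_⟩
  rw [x10Par, h1, hηd τ hτ]
  ring

end PDEODESystem

end Trajectories

/-! ### Linear differential equations with a convolution memory term. -/

section Memory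
open MeasureTheory

/-- The Lipschitz estimate is assumed for every rate `L ≥ 1`, so `L` may be chosen after `C`.
Composing with the projection onto `[0, T]` makes the operator act on functions on the whole line.
-/
theorem exists_continuous_fixedPoint {E : Type*} [NormedAddCommGroup E] [CompleteSpace E]
    {T C : ℝ} (hT : 0 ≤ T) (Op : (ℝ → E) → ℝ → E)
    (hcont : ∀ f, Continuous f → ContinuousOn (Op f) (Icc 0 T))
    (hlip : ∀ f g, Continuous f → Continuous g → ∀ L b, 1 ≤ L → 0 ≤ b →
      (∀ s ∈ Icc 0 T, ‖f s - g s‖ ≤ b * Real.exp (L * s)) →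
      ∀ s ∈ Icc 0 T, ‖Op f s - Op g s‖ ≤ C * b / L * Real.exp (L * s)) :
    ∃ f, Continuous f ∧ ∀ s ∈ Icc 0 T, f s = Op f s := by
  set k : ℝ → ℝ := fun s => (projIcc 0 T hT s : ℝ) with hk
  have kc : Continuous k := continuous_subtype_val.comp continuous_projIcc
  have km : ∀ s, k s ∈ Icc 0 T := fun s => (projIcc 0 T hT s).2
  have ke : ∀ s ∈ Icc 0 T, k s = s := fun s hs => by rw [hk]; simp only [projIcc_of_mem hT hs]
  set L : ℝ := 2 * |C| + 1 with hL
  have hL1 : 1 ≤ L := by have := abs_nonneg C; linarith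
  have hCL : C / L ≤ 1 / 2 := by
    rw [div_le_div_iff₀ (by linarith) two_pos]
    have := le_abs_self C
    linarith
  obtain ⟨b₀, hb₀⟩ := isCompact_Icc.exists_bound_of_continuousOn (hcont 0 continuous_zero)
  have hexp : ∀ s, 1 ≤ Real.exp (L * k s) := fun s =>
    Real.one_le_exp (mul_nonneg (by linarith) (km s).1)
  obtain ⟨f, hf, hfix, -⟩ := exists_fixedPoint_of_weighted_contraction
    (w := fun s => Real.exp (L * k s)) (M := Real.exp (L * T)) (fun s => (Real.exp_pos _).le)
    (fun s => Real.exp_le_exp.2 (mul_le_mul_of_nonneg_left (km s).2 (by linarith)))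
    {f : ℝ → E | Continuous f}
    (fun F g hF hFg => hFg.continuous (Frequently.of_forall hF))
    (fun f s => Op f (k s))
    (fun f hf => (hcont f hf).comp_continuous kc km)
    (fun f hf g hg b hb h s => by
      have h1 := hlip f g hf hg L b hL1 hb (fun s hs => by simpa only [ke s hs] using h s)
        (k s) (km s)
      refine h1.trans (mul_le_mul_of_nonneg_right ?_ (Real.exp_pos _).le)
      have := mul_le_mul_of_nonneg_right hCL hb
      calc C * b / L = C / L * b := by ring
        _ ≤ 1 / 2 * b := this
        _ = b / 2 := by ring)
    0 continuous_zero |b₀| (abs_nonneg _)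
    (fun s => by
      have h1 := (hb₀ (k s) (km s)).trans (le_abs_self b₀)
      simpa using h1.trans (le_mul_of_one_le_right (abs_nonneg b₀) (hexp s)))
  refine ⟨f, hf, fun s hs => ?_⟩
  have := congrFun hfix s
  simpa only [ke s hs] using this.symm

/-- Grönwall-type uniqueness: the a priori bound may be arbitrary, because the rate `L` is chosen so
that each application of the estimate halves it. -/
theorem nonpos_of_volterra {T C : ℝ} {e : ℝ → ℝ} (he : ∃ B, ∀ s ∈ Icc 0 T, e s ≤ B)
    (h : ∀ L b, 1 ≤ L → 0 ≤ b → (∀ s ∈ Icc 0 T, e s ≤ b * Real.exp (L * s)) →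
      ∀ s ∈ Icc 0 T, e s ≤ C * b / L * Real.exp (L * s)) : ∀ s ∈ Icc 0 T, e s ≤ 0 := by
  set L : ℝ := 2 * |C| + 1 with hL
  have hL1 : 1 ≤ L := by have := abs_nonneg C; linarith
  have hCL : C / L ≤ 1 / 2 := by
    rw [div_le_div_iff₀ (by linarith) two_pos]
    have := le_abs_self C
    linarith
  obtain ⟨B, hB⟩ := he
  have := eq_zero_of_weighted_contraction (S := Icc 0 T) (fun s => e s)
    (fun s => Real.exp (L * s)) |B| (abs_nonneg B)
    (fun s => ((hB s s.2).trans (le_abs_self B)).trans (le_mul_of_one_le_right (abs_nonneg B)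
      (Real.one_le_exp (mul_nonneg (by linarith) s.2.1))))
    (fun b hb hs s => by
      refine (h L b hL1 hb (fun s hs' => hs ⟨s, hs'⟩) s s.2).trans
        (mul_le_mul_of_nonneg_right ?_ (Real.exp_pos _).le)
      have := mul_le_mul_of_nonneg_right hCL hb
      calc C * b / L = C / L * b := by ring
        _ ≤ 1 / 2 * b := this
        _ = b / 2 := by ring)
  exact fun s hs => this ⟨s, hs⟩

theorem abs_dotProduct_le {n : ℕ} (c d : Fin n → ℝ) : |c ⬝ᵥ d| ≤ (∑ j, |c j|) * ‖d‖ := by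
  rw [dotProduct, Finset.sum_mul]
  refine (Finset.abs_sum_le_sum_abs _ _).trans (Finset.sum_le_sum fun j _ => ?_)
  rw [abs_mul]
  exact mul_le_mul_of_nonneg_left (norm_le_pi_norm d j) (abs_nonneg _)

theorem exists_mulVec_bound {m n : ℕ} (M : Matrix (Fin m) (Fin n) ℝ) :
    ∃ C, 0 ≤ C ∧ ∀ d i, |(M *ᵥ d) i| ≤ C * ‖d‖ := by
  refine ⟨∑ i, ∑ j, |M i j|, by positivity, fun d i => (abs_dotProduct_le _ _).trans ?_⟩
  refine mul_le_mul_of_nonneg_right ?_ (norm_nonneg _)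
  exact Finset.single_le_sum (f := fun i => ∑ j, |M i j|) (fun _ _ => by positivity)
    (Finset.mem_univ i)

/-- The response at time `s` to the input `w` on `[0, s]` with impulse response `m`. -/
noncomputable def memory (m w : ℝ → ℝ) (s : ℝ) : ℝ := ∫ σ in (0 : ℝ)..s, m (s - σ) * w σ

theorem continuous_memory {m w : ℝ → ℝ} (hm : Continuous m) (hw : Continuous w) :
    Continuous (memory m w) :=
  intervalIntegral.continuous_parametric_intervalIntegral_of_continuous (by fun_prop)
    continuous_id

theorem memory_congr {m w w' : ℝ → ℝ} {s : ℝ} (hs : 0 ≤ s) (h : EqOn w w' (Icc 0 s)) :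
    memory m w s = memory m w' s :=
  intervalIntegral.integral_congr fun σ hσ => by
    rw [uIcc_of_le hs] at hσ
    simp only [h hσ]

theorem continuousOn_memory {m w : ℝ → ℝ} {T : ℝ} (hm : Continuous m)
    (hw : ContinuousOn w (Icc 0 T)) : ContinuousOn (memory m w) (Icc 0 T) := by
  rcases lt_or_ge T 0 with hT | hT
  · rw [Icc_eq_empty (not_le.2 hT)]; exact continuousOn_empty _
  · refine (continuous_memory hm ((continuousOn_iff_continuous_domRestrict.1 hw).Icc_extend' (h := hT))).continuousOn.congr fun s hs => ?_
    refine memory_congr hs.1 fun σ hσ => ?_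
    rw [IccExtend_of_mem hT _ ⟨hσ.1, hσ.2.trans hs.2⟩, domRestrict_apply]

theorem memory_sub {m w w' : ℝ → ℝ} (hm : Continuous m) {T s : ℝ} (hs : s ∈ Icc 0 T)
    (hw : ContinuousOn w (Icc 0 T)) (hw' : ContinuousOn w' (Icc 0 T)) :
    memory m (fun σ => w σ - w' σ) s = memory m w s - memory m w' s := by
  have key : ∀ w : ℝ → ℝ, ContinuousOn w (Icc 0 T) →
      IntervalIntegrable (fun σ => m (s - σ) * w σ) volume 0 s := fun w hw => by
    refine ContinuousOn.intervalIntegrable_of_Icc hs.1 (ContinuousOn.mul (by fun_prop)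
      (hw.mono (Icc_subset_Icc le_rfl hs.2)))
  rw [memory, memory, memory, ← intervalIntegral.integral_sub (key w hw) (key w' hw')]
  simp only [mul_sub]

variable {n : ℕ} (G : Matrix (Fin n) (Fin n) ℝ) (β c : Fin n → ℝ) (m : ℝ → ℝ)

/-- The right-hand side of `ζ' = G ζ + β (cᵀ ζ * m)`. -/
noncomputable def memoryField (ζ : ℝ → Fin n → ℝ) (s : ℝ) (i : Fin n) : ℝ :=
  (G *ᵥ ζ s) i + β i * memory m (fun σ => c ⬝ᵥ ζ σ) s

variable {G β c m}

theorem continuousOn_memoryField (hm : Continuous m) {ζ : ℝ → Fin n → ℝ} {T : ℝ}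
    (hζ : ContinuousOn ζ (Icc 0 T)) (i : Fin n) :
    ContinuousOn (fun s => memoryField G β c m ζ s i) (Icc 0 T) :=
  (PDEODESystem.continuousOn_mulVec G hζ i).add
    (continuousOn_const.mul (continuousOn_memory hm (PDEODESystem.continuousOn_dotProduct c hζ)))

theorem memoryField_sub (hm : Continuous m) {ζ ζ' : ℝ → Fin n → ℝ} {T s : ℝ} (hs : s ∈ Icc 0 T)
    (hζ : ContinuousOn ζ (Icc 0 T)) (hζ' : ContinuousOn ζ' (Icc 0 T)) (i : Fin n) :
    memoryField G β c m (fun s => ζ s - ζ' s) s i =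
      memoryField G β c m ζ s i - memoryField G β c m ζ' s i := by
  simp only [memoryField, Matrix.mulVec_sub, Pi.sub_apply, dotProduct_sub]
  rw [memory_sub hm hs (PDEODESystem.continuousOn_dotProduct c hζ)
    (PDEODESystem.continuousOn_dotProduct c hζ')]
  ring

variable (G β c m) in
-- Because the field is linear, one bound serves both existence and uniqueness when it is applied to
-- differences.
theorem exists_memoryField_bound (hm : Continuous m) (T : ℝ) :
    ∃ C, 0 ≤ C ∧ ∀ (ζ : ℝ → Fin n → ℝ) (L b : ℝ), 1 ≤ L → 0 ≤ b →
      (∀ s ∈ Icc 0 T, ‖ζ s‖ ≤ b * Real.exp (L * s)) → ∀ r ∈ Icc 0 T,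
        ‖fun i => ∫ s in (0 : ℝ)..r, memoryField G β c m ζ s i‖ ≤ C * b / L * Real.exp (L * r) := by
  obtain ⟨CG, hCG0, hCG⟩ := exists_mulVec_bound G
  obtain ⟨Cm, hCm⟩ := isCompact_Icc.exists_bound_of_continuousOn (s := Icc 0 T) hm.continuousOn
  set Cc := ∑ j, |c j| with hCc
  have hCc0 : 0 ≤ Cc := by positivity
  refine ⟨CG + ‖β‖ * (|Cm| * Cc), by positivity, fun ζ L b hL hb h r hr => ?_⟩
  have hL0 : 0 < L := by linarith
  refine (pi_norm_le_iff_of_nonneg (by positivity)).2 fun i => ?_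
  refine abs_integral_exp_le (C := (CG + ‖β‖ * (|Cm| * Cc)) * b) hL0 hr.1 (by positivity)
    fun s hs => ?_
  have hs' : s ∈ Icc 0 T := ⟨hs.1, hs.2.trans hr.2⟩
  have h1 : |memory m (fun σ => c ⬝ᵥ ζ σ) s| ≤ |Cm| * Cc * b * Real.exp (L * s) := by
    refine (abs_integral_exp_le (C := |Cm| * Cc * b) hL0 hs.1 (by positivity)
      fun σ hσ => ?_).trans ?_
    · rw [abs_mul, mul_assoc, mul_assoc]
      refine mul_le_mul ((hCm _ ⟨by linarith [hσ.2], by linarith [hσ.1, hs'.2]⟩).trans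
        (le_abs_self _)) ?_ (abs_nonneg _) (abs_nonneg _)
      exact (abs_dotProduct_le _ _).trans
        (mul_le_mul_of_nonneg_left (h σ ⟨hσ.1, hσ.2.trans hs'.2⟩) hCc0)
    -- The convolution gains its own factor `1 / L`, which is discarded because `L ≥ 1`; the outer
    -- integration supplies the factor that counts.
    · exact mul_le_mul_of_nonneg_right (div_le_self (by positivity) hL) (Real.exp_pos _).le
  calc |memoryField G β c m ζ s i|
      ≤ |(G *ᵥ ζ s) i| + |β i| * |memory m (fun σ => c ⬝ᵥ ζ σ) s| := by
        rw [← abs_mul]; exact abs_add_le _ _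
    _ ≤ CG * (b * Real.exp (L * s)) + ‖β‖ * (|Cm| * Cc * b * Real.exp (L * s)) :=
        add_le_add ((hCG _ _).trans (mul_le_mul_of_nonneg_left (h s hs') hCG0))
          (mul_le_mul (norm_le_pi_norm β i) h1 (abs_nonneg _) (norm_nonneg _))
    _ = _ := by ring

theorem exists_memoryODE_solution (hm : Continuous m) {T : ℝ} (hT : 0 ≤ T)
    {h : ℝ → Fin n → ℝ} (hh : ContinuousOn h (Icc 0 T)) :
    ∃ ζ : ℝ → Fin n → ℝ, Continuous ζ ∧ ∀ r ∈ Icc 0 T, ∀ i,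
      ζ r i = h r i + ∫ s in (0 : ℝ)..r, memoryField G β c m ζ s i := by
  obtain ⟨C, -, hC⟩ := exists_memoryField_bound G β c m hm T
  obtain ⟨ζ, hζ, hfix⟩ := exists_continuous_fixedPoint (E := Fin n → ℝ) (C := C) hT
    (fun ζ r i => h r i + ∫ s in (0 : ℝ)..r, memoryField G β c m ζ s i)
    (fun ζ hζ => continuousOn_pi.2 fun i =>
      ((continuous_apply i).comp_continuousOn hh).add
        (LocBddOn.of_continuousOn
          (continuousOn_memoryField hm hζ.continuousOn i)).continuousOn_primitive)
    (fun f g hf hg L b hL hb hfg r hr => by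
      have h1 := hC (fun s => f s - g s) L b hL hb hfg r hr
      refine le_of_eq_of_le (congrArg norm (funext fun i => ?_)) h1
      simp only [Pi.sub_apply, add_sub_add_left_eq_sub]
      have hi : ∀ ζ : ℝ → Fin n → ℝ, Continuous ζ →
          IntervalIntegrable (fun s => memoryField G β c m ζ s i) volume 0 r := fun ζ hζ =>
        (LocBddOn.of_continuousOn (continuousOn_memoryField (T := T) hm hζ.continuousOn
          i)).intervalIntegrable ⟨le_rfl, hT⟩ hr
      rw [← intervalIntegral.integral_sub (hi f hf) (hi g hg)]
      refine intervalIntegral.integral_congr fun s hs => ?_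
      rw [uIcc_of_le hr.1] at hs
      exact (memoryField_sub hm (T := T) ⟨hs.1, hs.2.trans hr.2⟩ hf.continuousOn
        hg.continuousOn i).symm)
  exact ⟨ζ, hζ, fun r hr i => congrFun (hfix r hr) i⟩

theorem memoryODE_unique (hm : Continuous m) {T : ℝ} {h ζ ζ' : ℝ → Fin n → ℝ}
    (hζc : ContinuousOn ζ (Icc 0 T)) (hζc' : ContinuousOn ζ' (Icc 0 T))
    (hζ : ∀ r ∈ Icc 0 T, ∀ i, ζ r i = h r i + ∫ s in (0 : ℝ)..r, memoryField G β c m ζ s i)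
    (hζ' : ∀ r ∈ Icc 0 T, ∀ i, ζ' r i = h r i + ∫ s in (0 : ℝ)..r, memoryField G β c m ζ' s i) :
    EqOn ζ ζ' (Icc 0 T) := by
  obtain ⟨C, -, hC⟩ := exists_memoryField_bound G β c m hm T
  obtain ⟨B, hB⟩ := isCompact_Icc.exists_bound_of_continuousOn (hζc.sub hζc')
  have key := nonpos_of_volterra (C := C) (e := fun s => ‖ζ s - ζ' s‖) ⟨B, hB⟩
    fun L b hL hb hs r hr => by
      have h1 := hC (fun s => ζ s - ζ' s) L b hL hb hs r hr
      refine le_of_eq_of_le (congrArg norm (funext fun i => ?_)) h1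
      have hi : ∀ ζ : ℝ → Fin n → ℝ, ContinuousOn ζ (Icc 0 T) →
          IntervalIntegrable (fun s => memoryField G β c m ζ s i) volume 0 r := fun ζ hζ =>
        (LocBddOn.of_continuousOn (continuousOn_memoryField (T := T) hm hζ
          i)).intervalIntegrable ⟨le_rfl, hr.1.trans hr.2⟩ hr
      rw [Pi.sub_apply, hζ r hr, hζ' r hr, add_sub_add_left_eq_sub,
        ← intervalIntegral.integral_sub (hi ζ hζc) (hi ζ' hζc')]
      refine intervalIntegral.integral_congr fun s hs => ?_
      rw [uIcc_of_le hr.1] at hs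
      exact (memoryField_sub hm (T := T) ⟨hs.1, hs.2.trans hr.2⟩ hζc hζc' i).symm
  intro s hs
  exact sub_eq_zero.1 (norm_le_zero_iff.1 (key s hs))

end Memory

/-! ### Trajectories on the window `[-τ₂, τ₁]` and profiles `x̄`. -/

section Parametrization
open MeasureTheory

/-- Once the input is written as a datum `g` plus a memory of `c · ζ`, the ODE splits into known
forcing and the homogeneous memory field. -/
theorem integral_memoryField_add {n : ℕ} {G : Matrix (Fin n) (Fin n) ℝ} {β c : Fin n → ℝ}
    {m g f : ℝ → ℝ} (hm : Continuous m) {ζ : ℝ → Fin n → ℝ} {T : ℝ}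
    (hζ : ContinuousOn ζ (Icc 0 T)) (hg : LocBddOn g 0 T) {i : Fin n}
    (hf : ∀ s ∈ Icc 0 T, f s = (G *ᵥ ζ s) i + β i * (g s + memory m (fun σ => c ⬝ᵥ ζ σ) s))
    {r : ℝ} (hr : r ∈ Icc 0 T) : ∫ s in (0 : ℝ)..r, f s =
      (∫ s in (0 : ℝ)..r, β i * g s) + ∫ s in (0 : ℝ)..r, memoryField G β c m ζ s i := by
  have h0 : (0 : ℝ) ∈ Icc 0 T := ⟨le_rfl, hr.1.trans hr.2⟩
  rw [← intervalIntegral.integral_add ((hg.const_mul _).intervalIntegrable h0 hr)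
    ((LocBddOn.of_continuousOn (continuousOn_memoryField hm hζ i)).intervalIntegrable h0 hr)]
  refine intervalIntegral.integral_congr fun s hs => ?_
  rw [uIcc_of_le hr.1] at hs
  simp only [hf s ⟨hs.1, hs.2.trans hr.2⟩, memoryField]
  ring

theorem integral_zero_neg (f : ℝ → ℝ) (r : ℝ) :
    ∫ s in (0 : ℝ)..(-r), f s = ∫ s in (0 : ℝ)..r, -f (-s) := by
  rw [intervalIntegral.integral_neg, intervalIntegral.integral_comp_neg,
    intervalIntegral.integral_symm (-r)]
  simp

namespace PDEODESystem

variable {n : ℕ} {P : PDEODESystem n} {K : ℝ → ℝ → Matrix (Fin 2) (Fin 2) ℝ}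

theorem tau1_eq : P.tau1 = (P.speed 0).phi 1 := (P.speed_phi 0 (by simp)).symm

theorem tau2_eq : P.tau2 = (P.speed 1).phi 1 := (P.speed_phi 1 (by simp)).symm

theorem tau1_nonneg : 0 ≤ P.tau1 := tau1_eq (P := P) ▸ (P.speed 0).phi_nonneg zero_le_one

theorem tau2_nonneg : 0 ≤ P.tau2 := tau2_eq (P := P) ▸ (P.speed 1).phi_nonneg zero_le_one

theorem phi_mem (i : Fin 2) {z : ℝ} (hz : z ∈ Icc (0 : ℝ) 1) : P.phi i z ∈ Icc 0 (P.phi i 1) := by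
  rw [← P.speed_phi i hz, ← P.speed_phi i (z := 1) (by simp)]
  exact ⟨(P.speed i).phi_nonneg hz.1, (P.speed i).strictMono_phi.monotone hz.2⟩

theorem psi_mem (i : Fin 2) {r : ℝ} (hr : r ∈ Icc 0 (P.phi i 1)) :
    (P.speed i).psi r ∈ Icc (0 : ℝ) 1 := by
  rw [← P.speed_phi i (z := 1) (by simp)] at hr
  exact ⟨(P.speed i).psi_nonneg hr.1, (P.speed i).psi_le_iff.2 hr.2⟩

theorem phi_psi (i : Fin 2) {r : ℝ} (hr : r ∈ Icc 0 (P.phi i 1)) :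
    P.phi i ((P.speed i).psi r) = r := by
  rw [← P.speed_phi i (psi_mem i hr), Speed.phi_psi]

variable (P K) in
/-- The influence of `cᵀ ξ` on the profile `x̄`, as a function of the travel time. -/
noncomputable def impulse (i : Fin 2) (ρ : ℝ) : ℝ :=
  K (clampUnit ((P.speed i).psi ρ)) 0 i 1 * P.Lam 0 1

theorem IsKernel.continuous_source (hK : P.IsKernel K) (i j : Fin 2) :
    Continuous fun z => K (clampUnit z) 0 i j := by
  have h : Continuous fun z => K (clampUnit z) 0 :=
    hK.continuousOn.comp_continuous (f := fun z => (clampUnit z, (0 : ℝ)))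
      (by fun_prop) fun z => ⟨le_rfl, (clampUnit_mem z).1, (clampUnit_mem z).2⟩
  exact h.matrix_elem i j

theorem IsKernel.continuous_impulse (hK : P.IsKernel K) (i : Fin 2) :
    Continuous (P.impulse K i) :=
  ((hK.continuous_source i 1).comp (P.speed i).continuous_psi).mul continuous_const

/-- In the travel time coordinate the source term is a convolution, because the argument of `w` is a
difference of travel times. -/
theorem integral_source (i : Fin 2) (w : ℝ → ℝ) {z : ℝ} (hz : z ∈ Icc (0 : ℝ) 1) :
    ∫ ζ in (0 : ℝ)..z, K ζ 0 i 1 * P.Lam 0 1 * w (P.phi i z - P.phi i ζ) / P.lam i ζ =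
      memory (P.impulse K i) w (P.phi i z) := by
  have e : ∫ ζ in (0 : ℝ)..z, K ζ 0 i 1 * P.Lam 0 1 * w (P.phi i z - P.phi i ζ) / P.lam i ζ =
      ∫ ζ in (0 : ℝ)..z, (K (clampUnit ζ) 0 i 1 * P.Lam 0 1 *
        w ((P.speed i).phi z - (P.speed i).phi ζ)) / (P.speed i).l ζ := by
    refine intervalIntegral.integral_congr fun ζ hζ => ?_
    have hζ' := uIcc_zero_subset_unit hz hζ
    simp only [clampUnit_eq hζ', P.speed_phi i hz, P.speed_phi i hζ', P.speed_l i hζ']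
  rw [e, (P.speed i).integral_div_eq_integral_psi, memory, ← P.speed_phi i hz]
  have h := intervalIntegral.integral_comp_sub_left (a := 0) (b := (P.speed i).phi z)
    (fun σ => P.impulse K i ((P.speed i).phi z - σ) * w σ) ((P.speed i).phi z)
  rw [sub_self, sub_zero] at h
  rw [← h]
  simp [impulse]

variable (P K) in
/-- The profile `x̄` in terms of the trajectory `(ξ, v)` on `[-τ₂, τ₁]`, `v = x̄₁(0, ·)`. -/
noncomputable def parX (ξ : ℝ → Fin n → ℝ) (v : ℝ → ℝ) (z : ℝ) : Fin 2 → ℝ :=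
  ![v (P.phi 0 z) - memory (P.impulse K 0) (fun σ => P.c ⬝ᵥ ξ σ) (P.phi 0 z),
    P.q0 * v (-P.phi 1 z) + P.c ⬝ᵥ ξ (-P.phi 1 z) +
      memory (P.impulse K 1) (fun σ => P.c ⬝ᵥ ξ (-σ)) (P.phi 1 z)]

theorem Cmat_mulVec (ζ : ℝ) (ξ : Fin n → ℝ) (i : Fin 2) :
    (P.Cmat K ζ *ᵥ ξ) i = K ζ 0 i 1 * P.Lam 0 1 * (P.c ⬝ᵥ ξ) := by
  simp only [Matrix.mulVec, Cmat, dotProduct, Finset.mul_sum, Matrix.of_apply, mul_assoc]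

theorem xbarPar_eq (η : Fin n → ℝ) (ηd : ℝ → ℝ) {z : ℝ} (hz : z ∈ Icc (0 : ℝ) 1) :
    P.xbarPar K η ηd z = P.parX K (P.xiPar η ηd) (P.x10Par η ηd) z := by
  have h0 := integral_source (P := P) (K := K) 0 (fun σ => P.c ⬝ᵥ P.xiPar η ηd σ) hz
  have h1 := integral_source (P := P) (K := K) 1 (fun σ => P.c ⬝ᵥ P.xiPar η ηd (-σ)) hz
  simp only [neg_sub] at h1
  simp only [xbarPar, parX, Cmat_mulVec, x20Par, h0, neg_add_eq_sub, h1]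

theorem mem_window₀ {r : ℝ} (hr : r ∈ Icc 0 (P.phi 0 1)) : r ∈ Icc (-P.tau2) P.tau1 :=
  ⟨by linarith [hr.1, P.tau2_nonneg], hr.2⟩

theorem mem_window₁ {r : ℝ} (hr : r ∈ Icc 0 (P.phi 1 1)) : -r ∈ Icc (-P.tau2) P.tau1 :=
  ⟨neg_le_neg hr.2, by linarith [hr.1, P.tau1_nonneg]⟩

theorem zero_mem_window : (0 : ℝ) ∈ Icc (-P.tau2) P.tau1 :=
  ⟨by linarith [P.tau2_nonneg], P.tau1_nonneg⟩

theorem parX_congr {ξ ξ' : ℝ → Fin n → ℝ} {v v' : ℝ → ℝ}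
    (hξ : EqOn ξ ξ' (Icc (-P.tau2) P.tau1)) (hv : EqOn v v' (Icc (-P.tau2) P.tau1)) {z : ℝ}
    (hz : z ∈ Icc (0 : ℝ) 1) : P.parX K ξ v z = P.parX K ξ' v' z := by
  have h0 := P.phi_mem 0 hz
  have h1 := P.phi_mem 1 hz
  have e0 := memory_congr (m := P.impulse K 0) (w := fun σ => P.c ⬝ᵥ ξ σ)
    (w' := fun σ => P.c ⬝ᵥ ξ' σ) h0.1
    fun σ hσ => by simp only [hξ (mem_window₀ ⟨hσ.1, hσ.2.trans h0.2⟩)]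
  have e1 := memory_congr (m := P.impulse K 1) (w := fun σ => P.c ⬝ᵥ ξ (-σ))
    (w' := fun σ => P.c ⬝ᵥ ξ' (-σ)) h1.1
    fun σ hσ => by simp only [hξ (mem_window₁ ⟨hσ.1, hσ.2.trans h1.2⟩)]
  simp only [parX, e0, e1, hv (mem_window₀ h0), hv (mem_window₁ h1), hξ (mem_window₁ h1)]

variable (P) in
/-- The system matrix of the ODE in reversed time, with `x̄₂(0, ·)` as input. -/
noncomputable def reverseF : Matrix (Fin n) (Fin n) ℝ :=
  -P.F + Matrix.vecMulVec (P.q0⁻¹ • P.b) P.c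

/-- The rank-one term comes from solving `x̄₂(0,·) = q₀ v + c · ξ` for `v`; the overall sign is that
of reversed time. -/
theorem reverseF_mulVec (ξ : Fin n → ℝ) (i : Fin n) :
    (P.reverseF *ᵥ ξ) i = -(P.F *ᵥ ξ) i + P.q0⁻¹ * P.b i * (P.c ⬝ᵥ ξ) := by
  rw [reverseF, Matrix.add_mulVec, Pi.add_apply, Matrix.neg_mulVec, Pi.neg_apply,
    Matrix.vecMulVec_mulVec]
  simp [mul_comm]

/-- Trajectories glued from two halves are anchored at time `0`, inside the window, rather than at
its left end. -/
theorem IsTrajectory.of_base {ξ : ℝ → Fin n → ℝ} {v : ℝ → ℝ} {a b c : ℝ} (hc : c ∈ Icc a b)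
    (hξ : ContinuousOn ξ (Icc a b)) (hv : LocBddOn v a b) (ode : ∀ τ ∈ Icc a b, ∀ i,
      ξ τ i = ξ c i + ∫ s in c..τ, ((P.F *ᵥ ξ s) i + P.b i * v s)) :
    P.IsTrajectory ξ v a b where
  cont := hξ
  locBdd := hv
  ode τ hτ i := by
    have ha : a ∈ Icc a b := ⟨le_rfl, hτ.1.trans hτ.2⟩
    have l : LocBddOn (fun s => (P.F *ᵥ ξ s) i + P.b i * v s) a b :=
      (LocBddOn.of_continuousOn (continuousOn_mulVec _ hξ i)).add (hv.const_mul _)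
    have h := intervalIntegral.integral_add_adjacent_intervals (l.intervalIntegrable hc ha)
      (l.intervalIntegrable ha hτ)
    rw [ode τ hτ, ode a ha, ← h]
    ring

section

variable {ξ : ℝ → Fin n → ℝ} {v : ℝ → ℝ}

theorem locBddOn_neg {v : ℝ → ℝ} {a b : ℝ} (h : LocBddOn v (-b) (-a)) :
    LocBddOn (fun s => v (-s)) a b := by
  obtain ⟨g, hg, e⟩ := h
  exact ⟨_, hg.comp continuous_neg, fun x hx => e ⟨by linarith [hx.2], by linarith [hx.1]⟩⟩

/-- In forward time, `ξ` solves a Volterra equation with the datum `x̄₁`. -/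
theorem IsTrajectory.forward (hK : P.IsKernel K) (h : P.IsTrajectory ξ v (-P.tau2) P.tau1)
    {g : ℝ → ℝ} (hg : ∀ z ∈ Icc (0 : ℝ) 1, P.parX K ξ v z 0 = g (P.phi 0 z)) :
    (∀ r ∈ Icc 0 P.tau1, v r = g r + memory (P.impulse K 0) (fun σ => P.c ⬝ᵥ ξ σ) r) ∧
    ∀ r ∈ Icc 0 P.tau1, ∀ i, ξ r i = (ξ 0 i + ∫ s in (0 : ℝ)..r, P.b i * g s) +
      ∫ s in (0 : ℝ)..r, memoryField P.F P.b P.c (P.impulse K 0) ξ s i := by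
  have h1 : ∀ r ∈ Icc 0 P.tau1,
      v r = g r + memory (P.impulse K 0) (fun σ => P.c ⬝ᵥ ξ σ) r := fun r hr => by
    have := hg _ (psi_mem 0 hr)
    simp only [parX, phi_psi 0 hr, Matrix.cons_val_zero] at this
    linarith
  refine ⟨h1, fun r hr i => ?_⟩
  have hc : ContinuousOn ξ (Icc 0 P.tau1) := h.cont.mono fun r hr => mem_window₀ hr
  have lg : LocBddOn g 0 P.tau1 :=
    ((h.locBdd.mono (zero_mem_window (P := P)).1 le_rfl).sub (.of_continuousOn
      (continuousOn_memory (hK.continuous_impulse 0) (continuousOn_dotProduct P.c hc)))).congr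
      fun s hs => by simp only [h1 s hs]; ring
  rw [h.eq_add_integral zero_mem_window (mem_window₀ hr), add_assoc,
    integral_memoryField_add (hK.continuous_impulse 0) hc lg (β := P.b) (c := P.c)
      (fun s hs => by rw [h1 s hs]) hr]

/-- In reversed time, `ξ` solves a Volterra equation with the datum `x̄₂`. -/
theorem IsTrajectory.backward (hK : P.IsKernel K) (hq : P.q0 ≠ 0)
    (h : P.IsTrajectory ξ v (-P.tau2) P.tau1)
    {g : ℝ → ℝ} (hg : ∀ z ∈ Icc (0 : ℝ) 1, P.parX K ξ v z 1 = g (P.phi 1 z)) :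
    (∀ r ∈ Icc 0 P.tau2, v (-r) = P.q0⁻¹ * (g r - P.c ⬝ᵥ ξ (-r) -
      memory (P.impulse K 1) (fun σ => P.c ⬝ᵥ ξ (-σ)) r)) ∧
    ∀ r ∈ Icc 0 P.tau2, ∀ i, ξ (-r) i =
      (ξ 0 i + ∫ s in (0 : ℝ)..r, (P.q0⁻¹ • P.b) i * -g s) +
      ∫ s in (0 : ℝ)..r, memoryField P.reverseF (P.q0⁻¹ • P.b) P.c (P.impulse K 1)
        (fun s => ξ (-s)) s i := by
  have h1 : ∀ r ∈ Icc 0 P.tau2, v (-r) = P.q0⁻¹ * (g r - P.c ⬝ᵥ ξ (-r) -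
      memory (P.impulse K 1) (fun σ => P.c ⬝ᵥ ξ (-σ)) r) := fun r hr => by
    have := hg _ (psi_mem 1 hr)
    simp only [parX, phi_psi 1 hr, Matrix.cons_val_one, Matrix.cons_val_zero] at this
    rw [eq_inv_mul_iff_mul_eq₀ hq]
    linarith
  refine ⟨h1, fun r hr i => ?_⟩
  have hc : ContinuousOn (fun s => ξ (-s)) (Icc 0 P.tau2) :=
    h.cont.comp continuous_neg.continuousOn fun r hr => mem_window₁ hr
  have lg : LocBddOn (fun s => -g s) 0 P.tau2 := by
    have lv : LocBddOn (fun s => v (-s)) 0 P.tau2 :=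
      locBddOn_neg (h.locBdd.mono le_rfl (by linarith [P.tau1_nonneg]))
    refine (((lv.const_mul P.q0).add (.of_continuousOn (continuousOn_dotProduct P.c hc))).add
      (.of_continuousOn (continuousOn_memory (hK.continuous_impulse 1)
        (continuousOn_dotProduct P.c hc)))).const_mul (-1) |>.congr fun s hs => ?_
    simp only [h1 s hs, mul_inv_cancel_left₀ hq]
    ring
  rw [h.eq_add_integral zero_mem_window (mem_window₁ hr), add_assoc, integral_zero_neg,
    integral_memoryField_add (hK.continuous_impulse 1) hc lg (β := P.q0⁻¹ • P.b) (c := P.c)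
      (G := P.reverseF) (fun s hs => by
        rw [h1 s hs, reverseF_mulVec, Pi.smul_apply, smul_eq_mul]; ring) hr]

/-- A trajectory on `[-τ₂, τ₁]` is determined by `ξ(0)` and the profile `x̄`. -/
theorem IsTrajectory.unique (hK : P.IsKernel K) (hq : P.q0 ≠ 0)
    (h : P.IsTrajectory ξ v (-P.tau2) P.tau1) {ξ' : ℝ → Fin n → ℝ} {v' : ℝ → ℝ}
    (h' : P.IsTrajectory ξ' v' (-P.tau2) P.tau1) (h0 : ξ 0 = ξ' 0)
    (hX : ∀ z ∈ Icc (0 : ℝ) 1, P.parX K ξ v z = P.parX K ξ' v' z) :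
    EqOn ξ ξ' (Icc (-P.tau2) P.tau1) ∧ EqOn v v' (Icc (-P.tau2) P.tau1) := by
  set g : Fin 2 → ℝ → ℝ := fun i r => P.parX K ξ v ((P.speed i).psi r) i
  have hg : ∀ i, ∀ z ∈ Icc (0 : ℝ) 1, P.parX K ξ v z i = g i (P.phi i z) := fun i z hz => by
    simp only [g, ← P.speed_phi i hz, Speed.psi_phi]
  obtain ⟨f1, f2⟩ := h.forward hK (hg 0)
  obtain ⟨f1', f2'⟩ := h'.forward hK fun z hz => hX z hz ▸ hg 0 z hz
  obtain ⟨b1, b2⟩ := h.backward hK hq (hg 1)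
  obtain ⟨b1', b2'⟩ := h'.backward hK hq fun z hz => hX z hz ▸ hg 1 z hz
  rw [← h0] at f2' b2'
  have cf : ∀ {ξ : ℝ → Fin n → ℝ}, ContinuousOn ξ (Icc (-P.tau2) P.tau1) →
      ContinuousOn ξ (Icc 0 P.tau1) := fun hc => hc.mono fun r hr => mem_window₀ hr
  have cb : ∀ {ξ : ℝ → Fin n → ℝ}, ContinuousOn ξ (Icc (-P.tau2) P.tau1) →
      ContinuousOn (fun s => ξ (-s)) (Icc 0 P.tau2) := fun hc =>
    hc.comp continuous_neg.continuousOn fun r hr => mem_window₁ hr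
  have ef := memoryODE_unique (hK.continuous_impulse 0) (cf h.cont) (cf h'.cont)
    (h := fun r i => ξ 0 i + ∫ s in (0 : ℝ)..r, P.b i * g 0 s) f2 f2'
  have eb := memoryODE_unique (hK.continuous_impulse 1) (cb h.cont) (cb h'.cont)
    (h := fun r i => ξ 0 i + ∫ s in (0 : ℝ)..r, (P.q0⁻¹ • P.b) i * -g 1 s) b2 b2'
  have key : ∀ τ ∈ Icc (-P.tau2) P.tau1, ξ τ = ξ' τ ∧ v τ = v' τ := by
    intro τ hτ
    rcases le_total 0 τ with h0 | h0
    · have hr : τ ∈ Icc 0 P.tau1 := ⟨h0, hτ.2⟩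
      refine ⟨ef hr, ?_⟩
      rw [f1 τ hr, f1' τ hr, memory_congr h0 fun σ hσ => ?_]
      simp only [ef ⟨hσ.1, hσ.2.trans hτ.2⟩]
    · have hr : -τ ∈ Icc 0 P.tau2 := ⟨by linarith, by linarith [hτ.1]⟩
      have e1 := eb hr
      have e2 := b1 _ hr
      have e3 := b1' _ hr
      simp only [neg_neg] at e1 e2 e3
      refine ⟨e1, ?_⟩
      rw [e2, e3, e1, memory_congr hr.1 fun σ hσ => ?_]
      have := eb ⟨hσ.1, hσ.2.trans hr.2⟩
      simp only at this
      simp only [this]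
  exact ⟨fun τ hτ => (key τ hτ).1, fun τ hτ => (key τ hτ).2⟩

/-- The first component of the profile drives the ODE forwards on `[0, τ₁]`; the second drives it
backwards on `[-τ₂, 0]`, after division by `q₀`. Both halves start at `ξ₀`. -/
theorem exists_trajectory_of_profile (hK : P.IsKernel K) (hq : P.q0 ≠ 0) {ξ₀ : Fin n → ℝ}
    {y : ℝ → Fin 2 → ℝ} (hy : ∀ i, PiecewiseContinuousOn (fun z => y z i) 0 1)
    (hy0 : y 0 1 = P.q0 * y 0 0 + P.c ⬝ᵥ ξ₀) :
    ∃ ξ v, P.IsTrajectory ξ v (-P.tau2) P.tau1 ∧ PiecewiseContinuousOn v (-P.tau2) P.tau1 ∧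
      ξ 0 = ξ₀ ∧ ∀ z ∈ Icc (0 : ℝ) 1, P.parX K ξ v z = y z := by
  set g : Fin 2 → ℝ → ℝ := fun i r => y ((P.speed i).psi r) i with hgdef
  have gpc : ∀ i, PiecewiseContinuousOn (g i) 0 (P.phi i 1) := fun i =>
    (hy i).comp_strictMonoOn (P.speed i).continuous_psi.continuousOn
      ((P.speed i).strictMono_psi.strictMonoOn _) fun r hr => psi_mem i hr
  have hg : ∀ i, ∀ z ∈ Icc (0 : ℝ) 1, g i (P.phi i z) = y z i := fun i z hz => by
    simp only [g, ← P.speed_phi i hz, Speed.psi_phi]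
  -- The factor `k` is the direction of time, `1` for the future half and `-1` for the past half.
  have hprim : ∀ (i : Fin 2) (β : Fin n → ℝ) (k : ℝ), ContinuousOn
      (fun r (j : Fin n) => ξ₀ j + ∫ s in (0 : ℝ)..r, β j * (k * g i s)) (Icc 0 (P.phi i 1)) :=
    fun i β k => continuousOn_pi.2 fun j => continuousOn_const.add
      (((LocBddOn.of_piecewise (gpc i)).const_mul k).const_mul (β j)).continuousOn_primitive
  obtain ⟨ζ, ζc, hζ⟩ := exists_memoryODE_solution (G := P.F) (β := P.b) (c := P.c)
    (hK.continuous_impulse 0) P.tau1_nonneg (hprim 0 P.b 1)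
  obtain ⟨ω, ωc, hω⟩ := exists_memoryODE_solution (G := P.reverseF) (β := P.q0⁻¹ • P.b) (c := P.c)
    (hK.continuous_impulse 1) P.tau2_nonneg (hprim 1 (P.q0⁻¹ • P.b) (-1))
  have hζ0 : ζ 0 = ξ₀ := funext fun i => by simpa using hζ 0 ⟨le_rfl, P.tau1_nonneg⟩ i
  have hω0 : ω 0 = ξ₀ := funext fun i => by simpa using hω 0 ⟨le_rfl, P.tau2_nonneg⟩ i
  set vp : ℝ → ℝ := fun r => g 0 r + memory (P.impulse K 0) (fun σ => P.c ⬝ᵥ ζ σ) r with hvp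
  set vm : ℝ → ℝ := fun r => P.q0⁻¹ * (g 1 r - P.c ⬝ᵥ ω r -
    memory (P.impulse K 1) (fun σ => P.c ⬝ᵥ ω σ) r) with hvm
  -- The two halves agree on the value of the input at `0` exactly because the profile satisfies the
  -- boundary condition `hy0`.
  have hv0 : vp 0 = vm 0 := by
    have h1 : g 0 0 = y 0 0 := by simp [g]
    have h2 : g 1 0 = y 0 1 := by simp [g]
    simp only [hvp, hvm, h1, h2, hω0, memory, intervalIntegral.integral_same, hy0]
    field_simp
    ring
  have cdot : ∀ ζ : ℝ → Fin n → ℝ, Continuous ζ → Continuous fun s => P.c ⬝ᵥ ζ s := fun ζ h =>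
    continuousOn_univ.1 (continuousOn_dotProduct P.c h.continuousOn)
  have vpc : PiecewiseContinuousOn vp 0 P.tau1 := (gpc 0).add (.of_continuousOn
    (continuous_memory (hK.continuous_impulse 0) (cdot ζ ζc)).continuousOn)
  have vmc : PiecewiseContinuousOn vm 0 P.tau2 :=
    (PiecewiseContinuousOn.of_continuousOn continuousOn_const).mul
      (((gpc 1).sub (.of_continuousOn (cdot ω ωc).continuousOn)).sub (.of_continuousOn
        (continuous_memory (hK.continuous_impulse 1) (cdot ω ωc)).continuousOn))
  set ξ : ℝ → Fin n → ℝ := fun τ => if 0 ≤ τ then ζ τ else ω (-τ) with hξ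
  set v : ℝ → ℝ := fun τ => if 0 ≤ τ then vp τ else vm (-τ) with hv
  have ξp : ∀ τ, 0 ≤ τ → ξ τ = ζ τ := fun τ h => if_pos h
  have vp' : ∀ τ, 0 ≤ τ → v τ = vp τ := fun τ h => if_pos h
  have ξm : ∀ τ, τ ≤ 0 → ξ τ = ω (-τ) := fun τ h => by
    rcases h.lt_or_eq with h | rfl
    · exact if_neg (not_le.2 h)
    · rw [ξp 0 le_rfl, neg_zero, hζ0, hω0]
  have vm' : ∀ τ, τ ≤ 0 → v τ = vm (-τ) := fun τ h => by
    rcases h.lt_or_eq with h | rfl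
    · exact if_neg (not_le.2 h)
    · rw [vp' 0 le_rfl, neg_zero, hv0]
  have vpw : PiecewiseContinuousOn v (-P.tau2) P.tau1 := by
    refine .glue (b := 0) ?_ (vpc.congr fun τ hτ => vp' τ hτ.1)
    have := vmc.comp_neg
    rw [neg_zero] at this
    exact this.congr fun τ hτ => vm' τ hτ.2
  have ξcont : ContinuousOn ξ (Icc (-P.tau2) P.tau1) := by
    rw [← Icc_union_Icc_eq_Icc (zero_mem_window (P := P)).1 (zero_mem_window (P := P)).2]
    exact ((ωc.comp continuous_neg).continuousOn.congr fun τ hτ => ξm τ hτ.2).union_of_isClosed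
      (ζc.continuousOn.congr fun τ hτ => ξp τ hτ.1) isClosed_Icc isClosed_Icc
  have hmp : ∀ r, 0 ≤ r → memory (P.impulse K 0) (fun σ => P.c ⬝ᵥ ξ σ) r =
      memory (P.impulse K 0) (fun σ => P.c ⬝ᵥ ζ σ) r := fun r hr =>
    memory_congr hr fun σ hσ => by simp only [ξp σ hσ.1]
  have hmm : ∀ r, 0 ≤ r → memory (P.impulse K 1) (fun σ => P.c ⬝ᵥ ξ (-σ)) r =
      memory (P.impulse K 1) (fun σ => P.c ⬝ᵥ ω σ) r := fun r hr =>
    memory_congr hr fun σ hσ => by simp only [ξm (-σ) (neg_nonpos.2 hσ.1), neg_neg]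
  refine ⟨ξ, v, .of_base zero_mem_window ξcont (.of_piecewise vpw) fun τ hτ i => ?_, vpw,
    (ξp 0 le_rfl).trans hζ0, fun z hz => ?_⟩
  · rw [ξp 0 le_rfl, hζ0]
    rcases le_total 0 τ with h0 | h0
    · have hr : τ ∈ Icc 0 P.tau1 := ⟨h0, hτ.2⟩
      rw [ξp τ h0, hζ τ hr, add_assoc]
      congr 1
      rw [integral_memoryField_add (hK.continuous_impulse 0) ζc.continuousOn
        (.of_piecewise (gpc 0)) (G := P.F) (β := P.b) (c := P.c) (i := i)
        (f := fun s => (P.F *ᵥ ξ s) i + P.b i * v s) (fun s hs => ?_) hr]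
      · simp only [one_mul]
      · rw [ξp s hs.1, vp' s hs.1]
    · have hr : -τ ∈ Icc 0 P.tau2 := ⟨by linarith, by linarith [hτ.1]⟩
      rw [ξm τ h0, hω _ hr, add_assoc]
      congr 1
      have := integral_zero_neg (fun s => (P.F *ᵥ ξ s) i + P.b i * v s) (-τ)
      rw [neg_neg] at this
      rw [this, integral_memoryField_add (hK.continuous_impulse 1) ωc.continuousOn
        ((LocBddOn.of_piecewise (gpc 1)).const_mul (-1)) (G := P.reverseF) (β := P.q0⁻¹ • P.b)
        (c := P.c) (i := i) (f := fun s => -((P.F *ᵥ ξ (-s)) i + P.b i * v (-s)))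
        (fun s hs => ?_) hr]
      rw [ξm (-s) (neg_nonpos.2 hs.1), vm' (-s) (neg_nonpos.2 hs.1), neg_neg, reverseF_mulVec]
      simp only [hvm, Pi.smul_apply, smul_eq_mul]
      ring
  · have h0 := P.phi_mem 0 hz
    have h1 := P.phi_mem 1 hz
    funext i
    fin_cases i
    · simp only [parX, Fin.zero_eta, Matrix.cons_val_zero, hmp _ h0.1, vp' _ h0.1, hvp,
        add_sub_cancel_right, hg 0 z hz]
    · simp only [parX, Fin.mk_one, Matrix.cons_val_one, Matrix.cons_val_zero, hmm _ h1.1,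
        vm' _ (neg_nonpos.2 h1.1), ξm _ (neg_nonpos.2 h1.1), hvm, neg_neg,
        mul_inv_cancel_left₀ hq, hg 1 z hz]
      ring

end

end PDEODESystem

end Parametrization

/-! ### Invertibility of the backstepping transformation and the bijection of states. -/

section Backstepping
open MeasureTheory

/-- A Volterra integral of a bounded measurable function with a continuous kernel is continuous. -/
theorem continuousOn_volterra_integral {k : ℝ × ℝ → ℝ} (hk : Continuous k) {f : ℝ → ℝ}
    {a b : ℝ} (hf : LocBddOn f a b) :
    ContinuousOn (fun z => ∫ ζ in a..z, k (z, ζ) * f ζ) (Icc a b) := by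
  obtain ⟨g, hg, e⟩ := hf
  obtain ⟨Cg, hCg⟩ := hg.bdd (Icc a b) isCompact_Icc
  intro z₀ hz₀
  set F : ℝ → ℝ → ℝ := fun z ζ => if ζ < z then k (z, ζ) * g ζ else 0 with hF
  have hFz : ∀ z ∈ Icc a b,
      ∫ ζ in a..z, k (z, ζ) * f ζ = ∫ ζ in a..b, F z ζ := fun z hz => by
    rw [integral_ite_gt hz.1 hz.2]
    refine intervalIntegral.integral_congr fun ζ hζ => ?_
    rw [uIcc_of_le hz.1] at hζ
    simp only [e ⟨hζ.1, hζ.2.trans hz.2⟩]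
  refine ContinuousWithinAt.congr (f := fun z => ∫ ζ in a..b, F z ζ) ?_
    (fun z hz => hFz z hz) (hFz z₀ hz₀)
  obtain ⟨Ck, hCk⟩ := (isCompact_Icc.prod isCompact_Icc).exists_bound_of_continuousOn
    (s := Icc a b ×ˢ Icc a b) hk.continuousOn
  refine intervalIntegral.continuousWithinAt_of_dominated_interval (bound := fun _ => |Ck| * |Cg|)
    ?_ ?_ intervalIntegrable_const ?_
  · refine Eventually.of_forall fun z => ?_
    refine (Measurable.ite (measurableSet_lt measurable_id measurable_const)
      ((hk.comp (by fun_prop)).measurable.mul hg.meas) measurable_const).aestronglyMeasurable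
  · filter_upwards [self_mem_nhdsWithin] with z hz
    refine Eventually.of_forall fun ζ hζ => ?_
    rw [uIoc_of_le (hz₀.1.trans hz₀.2)] at hζ
    simp only [hF]
    split_ifs with h
    · rw [norm_mul]
      exact mul_le_mul ((hCk (z, ζ) ⟨hz, hζ.1.le, hζ.2⟩).trans (le_abs_self _))
        ((hCg ζ ⟨hζ.1.le, hζ.2⟩).trans (le_abs_self _)) (norm_nonneg _) (abs_nonneg _)
    · rw [norm_zero]; positivity
  -- For fixed `ζ` the integrand can jump only at `z = ζ`; continuity at `z₀` therefore fails at
  -- most for the single value `ζ = z₀`.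
  · have : ∀ᵐ ζ : ℝ, ζ ≠ z₀ := by simp [ae_iff]
    filter_upwards [this] with ζ hζ _
    refine ContinuousAt.continuousWithinAt ?_
    rcases lt_or_gt_of_ne hζ with h | h
    · refine ContinuousAt.congr (f := fun z => k (z, ζ) * g ζ)
        (by fun_prop : Continuous fun z => k (z, ζ) * g ζ).continuousAt ?_
      filter_upwards [lt_mem_nhds h] with z hz
      simp [hF, hz]
    · refine ContinuousAt.congr (f := fun z => 0) continuousAt_const ?_
      filter_upwards [gt_mem_nhds h] with z hz
      simp [hF, not_lt.2 hz.le]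

/-- The Volterra operator with the matrix kernel `K`. -/
noncomputable def volterra (K : ℝ → ℝ → Matrix (Fin 2) (Fin 2) ℝ) (X : ℝ → Fin 2 → ℝ) (z : ℝ)
    (i : Fin 2) : ℝ := ∫ ζ in (0 : ℝ)..z, (K z ζ *ᵥ X ζ) i

namespace PDEODESystem

variable {n : ℕ} {P : PDEODESystem n} {K : ℝ → ℝ → Matrix (Fin 2) (Fin 2) ℝ}

theorem volterra_congr {X X' : ℝ → Fin 2 → ℝ} {z : ℝ} (hz : 0 ≤ z) (h : EqOn X X' (Icc 0 z)) :
    volterra K X z = volterra K X' z := funext fun i =>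
  intervalIntegral.integral_congr fun ζ hζ => by
    rw [uIcc_of_le hz] at hζ
    simp only [h hζ]

theorem IsKernel.volterra_integrand (X : ℝ → Fin 2 → ℝ) {z ζ : ℝ}
    (hz : z ∈ Icc (0 : ℝ) 1) (hζ : ζ ∈ Icc 0 z) (i : Fin 2) :
    (K z ζ *ᵥ X ζ) i =
      K (Goursat.toTriangle (z, ζ)).1 (Goursat.toTriangle (z, ζ)).2 i 0 * X ζ 0 +
      K (Goursat.toTriangle (z, ζ)).1 (Goursat.toTriangle (z, ζ)).2 i 1 * X ζ 1 := by
  rw [Goursat.toTriangle_eq hζ.1 hζ.2 hz.2]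
  simp [Matrix.mulVec, dotProduct, Fin.sum_univ_two]

theorem IsKernel.intervalIntegrable_volterra (hK : P.IsKernel K) {X : ℝ → Fin 2 → ℝ}
    (hX : ∀ i, LocBddOn (fun z => X z i) 0 1) {z : ℝ} (hz : z ∈ Icc (0 : ℝ) 1) (i : Fin 2) :
    IntervalIntegrable (fun ζ => (K z ζ *ᵥ X ζ) i) volume 0 z := by
  have l : ∀ j, LocBddOn (fun ζ => K (Goursat.toTriangle (z, ζ)).1
      (Goursat.toTriangle (z, ζ)).2 i j * X ζ j) 0 1 := fun j =>
    (LocBddOn.of_continuousOn ((hK.continuous_ext i j).comp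
      (Continuous.prodMk_right z)).continuousOn).mul (hX j)
  refine (((l 0).add (l 1)).intervalIntegrable ⟨le_rfl, zero_le_one⟩ hz).congr fun ζ hζ => ?_
  rw [uIoc_of_le hz.1] at hζ
  exact (volterra_integrand X hz ⟨hζ.1.le, hζ.2⟩ i).symm

theorem IsKernel.volterra_eq (hK : P.IsKernel K) {X : ℝ → Fin 2 → ℝ}
    (hX : ∀ i, LocBddOn (fun z => X z i) 0 1) {z : ℝ} (hz : z ∈ Icc (0 : ℝ) 1) (i : Fin 2) :
    volterra K X z i =
      (∫ ζ in (0 : ℝ)..z, K (Goursat.toTriangle (z, ζ)).1 (Goursat.toTriangle (z, ζ)).2 i 0 *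
        X ζ 0) +
      ∫ ζ in (0 : ℝ)..z, K (Goursat.toTriangle (z, ζ)).1 (Goursat.toTriangle (z, ζ)).2 i 1 *
        X ζ 1 := by
  have l : ∀ j, IntervalIntegrable (fun ζ => K (Goursat.toTriangle (z, ζ)).1
      (Goursat.toTriangle (z, ζ)).2 i j * X ζ j) volume 0 z := fun j =>
    ((LocBddOn.of_continuousOn ((hK.continuous_ext i j).comp
      (Continuous.prodMk_right z)).continuousOn).mul (hX j)).intervalIntegrable
        ⟨le_rfl, zero_le_one⟩ hz
  rw [volterra, ← intervalIntegral.integral_add (l 0) (l 1)]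
  refine intervalIntegral.integral_congr fun ζ hζ => ?_
  rw [uIcc_of_le hz.1] at hζ
  exact volterra_integrand X hz hζ i

theorem IsKernel.continuousOn_volterra (hK : P.IsKernel K) {X : ℝ → Fin 2 → ℝ}
    (hX : ∀ i, LocBddOn (fun z => X z i) 0 1) : ContinuousOn (volterra K X) (Icc 0 1) :=
  continuousOn_pi.2 fun i =>
    ((continuousOn_volterra_integral (hK.continuous_ext i 0) (hX 0)).add
      (continuousOn_volterra_integral (hK.continuous_ext i 1) (hX 1))).congr
      fun _ hz => hK.volterra_eq hX hz i

theorem IsKernel.volterra_sub (hK : P.IsKernel K) {X X' : ℝ → Fin 2 → ℝ}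
    (hX : ∀ i, LocBddOn (fun z => X z i) 0 1) (hX' : ∀ i, LocBddOn (fun z => X' z i) 0 1) {z : ℝ}
    (hz : z ∈ Icc (0 : ℝ) 1) :
    volterra K (fun z => X z - X' z) z = volterra K X z - volterra K X' z := by
  funext i
  simp only [volterra, Pi.sub_apply, Matrix.mulVec_sub]
  exact intervalIntegral.integral_sub (hK.intervalIntegrable_volterra hX hz i)
    (hK.intervalIntegrable_volterra hX' hz i)

/-- Boundedness of the kernel on the compact triangle and the gain `1 / L` are all that inversion of
the transformation requires. -/
theorem IsKernel.exists_volterra_bound (hK : P.IsKernel K) :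
    ∃ C, 0 ≤ C ∧ ∀ (X : ℝ → Fin 2 → ℝ) (L b : ℝ), 1 ≤ L → 0 ≤ b →
      (∀ s ∈ Icc (0 : ℝ) 1, ‖X s‖ ≤ b * Real.exp (L * s)) → ∀ z ∈ Icc (0 : ℝ) 1,
        ‖volterra K X z‖ ≤ C * b / L * Real.exp (L * z) := by
  have hb : ∀ i j, ∃ C, ∀ z ∈ Icc (0 : ℝ) 1, ∀ ζ ∈ Icc 0 z,
      |K (Goursat.toTriangle (z, ζ)).1 (Goursat.toTriangle (z, ζ)).2 i j| ≤ C := fun i j => by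
    obtain ⟨C, hC⟩ := (isCompact_Icc.prod isCompact_Icc).exists_bound_of_continuousOn
      (s := Icc (0 : ℝ) 1 ×ˢ Icc (0 : ℝ) 1) (hK.continuous_ext i j).continuousOn
    exact ⟨C, fun z hz ζ hζ => hC (z, ζ) ⟨hz, hζ.1, hζ.2.trans hz.2⟩⟩
  choose C hC using hb
  have hC0 : ∀ i j, 0 ≤ C i j := fun i j =>
    (abs_nonneg _).trans (hC i j 0 ⟨le_rfl, zero_le_one⟩ 0 ⟨le_rfl, le_rfl⟩)
  refine ⟨∑ i, ∑ j, C i j, Finset.sum_nonneg fun i _ => Finset.sum_nonneg fun j _ => hC0 i j,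
    fun X L b hL hb h z hz => ?_⟩
  have hS : ∀ i, C i 0 + C i 1 ≤ ∑ i, ∑ j, C i j := fun i => by
    have := Finset.single_le_sum (f := fun i => ∑ j, C i j)
      (fun i _ => Finset.sum_nonneg fun j _ => hC0 i j) (Finset.mem_univ i)
    simpa only [Fin.sum_univ_two (f := C i)] using this
  have hS0 : 0 ≤ ∑ i, ∑ j, C i j := (add_nonneg (hC0 0 0) (hC0 0 1)).trans (hS 0)
  refine (pi_norm_le_iff_of_nonneg (by positivity)).2 fun i => ?_
  refine abs_integral_exp_le (by linarith) hz.1 (by positivity) fun ζ hζ => ?_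
  rw [volterra_integrand X hz hζ]
  have hζ' : ζ ∈ Icc (0 : ℝ) 1 := ⟨hζ.1, hζ.2.trans hz.2⟩
  have hx : ∀ j, |X ζ j| ≤ b * Real.exp (L * ζ) := fun j => (norm_le_pi_norm _ j).trans (h ζ hζ')
  have hm : ∀ j, |K (Goursat.toTriangle (z, ζ)).1 (Goursat.toTriangle (z, ζ)).2 i j * X ζ j| ≤
      C i j * (b * Real.exp (L * ζ)) := fun j => by
    rw [abs_mul]
    exact mul_le_mul (hC i j z hz ζ hζ) (hx j) (abs_nonneg _) (hC0 i j)
  refine (abs_add_le _ _).trans ((add_le_add (hm 0) (hm 1)).trans ?_)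
  rw [← add_mul, mul_assoc]
  exact mul_le_mul_of_nonneg_right (hS i) (by positivity)

/-- The backstepping transformation is injective. -/
theorem IsKernel.eqOn_of_sub_volterra_eq (hK : P.IsKernel K) {X X' : ℝ → Fin 2 → ℝ}
    (hX : ∀ i, LocBddOn (fun z => X z i) 0 1) (hX' : ∀ i, LocBddOn (fun z => X' z i) 0 1)
    (h : ∀ z ∈ Icc (0 : ℝ) 1, X z - volterra K X z = X' z - volterra K X' z) :
    EqOn X X' (Icc 0 1) := by
  obtain ⟨C, -, hC⟩ := hK.exists_volterra_bound
  have hd : ∀ z ∈ Icc (0 : ℝ) 1, X z - X' z = volterra K (fun z => X z - X' z) z := fun z hz => by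
    rw [hK.volterra_sub hX hX' hz, sub_eq_sub_iff_sub_eq_sub]
    exact h z hz
  -- The difference equals its own Volterra integral, hence is continuous; this supplies the a
  -- priori bound.
  obtain ⟨B, hB⟩ := isCompact_Icc.exists_bound_of_continuousOn
    (hK.continuousOn_volterra (X := fun z => X z - X' z) fun i => (hX i).sub (hX' i))
  have key := nonpos_of_volterra (C := C) (T := 1) (e := fun z => ‖X z - X' z‖)
    ⟨B, fun z hz => by rw [hd z hz]; exact hB z hz⟩
    fun L b hL hb hs z hz => by
      have := hC (fun z => X z - X' z) L b hL hb hs z hz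
      rwa [← hd z hz] at this
  exact fun z hz => sub_eq_zero.1 (norm_le_zero_iff.1 (key z hz))

/-- The backstepping transformation is surjective. -/
theorem IsKernel.exists_sub_volterra_eq (hK : P.IsKernel K) {y : ℝ → Fin 2 → ℝ}
    (hy : ∀ i, PiecewiseContinuousOn (fun z => y z i) 0 1) :
    ∃ X : ℝ → Fin 2 → ℝ, (∀ i, PiecewiseContinuousOn (fun z => X z i) 0 1) ∧
      ∀ z ∈ Icc (0 : ℝ) 1, X z - volterra K X z = y z := by
  obtain ⟨C, -, hC⟩ := hK.exists_volterra_bound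
  have hl : ∀ w : ℝ → Fin 2 → ℝ, Continuous w → ∀ i, LocBddOn (fun z => (w z + y z) i) 0 1 :=
    fun w hw i => (LocBddOn.of_continuousOn ((continuous_apply i).comp hw).continuousOn).add
      (.of_piecewise (hy i))
  -- The unknown is `w = X - y`, a Volterra integral and so continuous even where `y` jumps. The
  -- jumps of `X` are those of `y`.
  obtain ⟨w, hw, hfix⟩ := exists_continuous_fixedPoint (E := Fin 2 → ℝ) (C := C) zero_le_one
    (fun w => volterra K fun z => w z + y z)
    (fun w hw => hK.continuousOn_volterra (hl w hw))
    (fun f g hf hg L b hL hb hfg z hz => by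
      rw [← hK.volterra_sub (hl f hf) (hl g hg) hz]
      simp only [add_sub_add_right_eq_sub]
      exact hC (fun s => f s - g s) L b hL hb hfg z hz)
  refine ⟨fun z => w z + y z, fun i => (PiecewiseContinuousOn.of_continuousOn
    ((continuous_apply i).comp hw).continuousOn).add (hy i), fun z hz => ?_⟩
  rw [← hfix z hz, add_sub_cancel_left]

theorem xbar_eq (x : ℝ → Fin 2 → ℝ) (z : ℝ) :
    P.xbar K x z = P.scaled x z - volterra K (P.scaled x) z := rfl

theorem scaled_congr {x x' : ℝ → Fin 2 → ℝ} {z : ℝ} (h : x z = x' z) :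
    P.scaled x z = P.scaled x' z := by simp only [scaled, h]

theorem scaled_injective {x x' : ℝ → Fin 2 → ℝ} {z : ℝ} (h : P.scaled x z = P.scaled x' z) :
    x z = x' z := by
  have h0 := congrFun h 0
  have h1 := congrFun h 1
  simp only [scaled, Matrix.cons_val_zero, Matrix.cons_val_one,
    mul_right_inj' (Real.exp_pos _).ne'] at h0 h1
  funext i
  fin_cases i
  · exact h0
  · exact h1

theorem piecewise_scaled {x : ℝ → Fin 2 → ℝ}
    (hx : ∀ i, PiecewiseContinuousOn (fun z => x z i) 0 1) (i : Fin 2) :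
    PiecewiseContinuousOn (fun z => P.scaled x z i) 0 1 := by
  fin_cases i
  · exact (PiecewiseContinuousOn.of_continuousOn
      (P.continuousOn_alpha 0).rexp).mul (hx 0)
  · exact (PiecewiseContinuousOn.of_continuousOn
      (P.continuousOn_alpha 1).neg.rexp).mul (hx 1)

theorem exists_scaled_eq {X : ℝ → Fin 2 → ℝ}
    (hX : ∀ i, PiecewiseContinuousOn (fun z => X z i) 0 1) :
    ∃ x : ℝ → Fin 2 → ℝ, (∀ i, PiecewiseContinuousOn (fun z => x z i) 0 1) ∧ P.scaled x = X := by
  refine ⟨fun z => ![Real.exp (-P.alpha 0 z) * X z 0, Real.exp (P.alpha 1 z) * X z 1],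
    fun i => ?_, ?_⟩
  · fin_cases i
    · exact (PiecewiseContinuousOn.of_continuousOn
        (P.continuousOn_alpha 0).neg.rexp).mul (hX 0)
    · exact (PiecewiseContinuousOn.of_continuousOn
        (P.continuousOn_alpha 1).rexp).mul (hX 1)
  · funext z i
    fin_cases i <;> simp [scaled, ← mul_assoc, ← Real.exp_add]

theorem scaled_zero (x : ℝ → Fin 2 → ℝ) : P.scaled x 0 = x 0 := by
  funext i
  fin_cases i <;> simp [scaled, alpha]

theorem xbar_zero (x : ℝ → Fin 2 → ℝ) : P.xbar K x 0 = x 0 := by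
  rw [xbar_eq, scaled_zero]
  funext i
  simp [volterra]

theorem parX_zero (ξ : ℝ → Fin n → ℝ) (v : ℝ → ℝ) :
    P.parX K ξ v 0 = ![v 0, P.q0 * v 0 + P.c ⬝ᵥ ξ 0] := by
  simp [parX, phi, memory]

theorem xbar_congr {x x' : ℝ → Fin 2 → ℝ} (h : EqOn x x' (Icc 0 1)) {z : ℝ}
    (hz : z ∈ Icc (0 : ℝ) 1) : P.xbar K x z = P.xbar K x' z := by
  rw [xbar_eq, xbar_eq, scaled_congr (h hz), volterra_congr hz.1 fun ζ hζ =>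
    scaled_congr (h ⟨hζ.1, hζ.2.trans hz.2⟩)]

theorem locBddOn_scaled {x : ℝ → Fin 2 → ℝ}
    (hx : ∀ i, PiecewiseContinuousOn (fun z => x z i) 0 1) (i : Fin 2) :
    LocBddOn (fun z => P.scaled x z i) 0 1 := .of_piecewise (piecewise_scaled hx i)

theorem IsKernel.piecewise_xbar (hK : P.IsKernel K) {x : ℝ → Fin 2 → ℝ}
    (hx : ∀ i, PiecewiseContinuousOn (fun z => x z i) 0 1) (i : Fin 2) :
    PiecewiseContinuousOn (fun z => P.xbar K x z i) 0 1 :=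
  (piecewise_scaled hx i).sub (.of_continuousOn
    ((continuous_apply i).comp_continuousOn (hK.continuousOn_volterra (locBddOn_scaled hx))))

theorem continuousOn_phi (i : Fin 2) : ContinuousOn (P.phi i) (Icc 0 1) :=
  (P.speed i).continuous_phi.continuousOn.congr fun _ hz => (P.speed_phi i hz).symm

theorem strictMonoOn_phi (i : Fin 2) : StrictMonoOn (P.phi i) (Icc 0 1) :=
  ((P.speed i).strictMono_phi.strictMonoOn _).congr fun _ hz => P.speed_phi i hz

theorem IsKernel.piecewise_parX (hK : P.IsKernel K) {ξ : ℝ → Fin n → ℝ} {v : ℝ → ℝ}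
    (hξ : ContinuousOn ξ (Icc (-P.tau2) P.tau1))
    (hv : PiecewiseContinuousOn v (-P.tau2) P.tau1) (i : Fin 2) :
    PiecewiseContinuousOn (fun z => P.parX K ξ v z i) 0 1 := by
  have hm : ∀ i, MapsTo (P.phi i) (Icc 0 1) (Icc 0 (P.phi i 1)) := fun i z hz => P.phi_mem i hz
  have key : ∀ (i : Fin 2) {f : ℝ → ℝ}, PiecewiseContinuousOn f 0 (P.phi i 1) →
      PiecewiseContinuousOn (fun z => f (P.phi i z)) 0 1 := fun i f hf =>
    hf.comp_strictMonoOn (continuousOn_phi i) (strictMonoOn_phi i) (hm i)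
  have c0 : ContinuousOn ξ (Icc 0 P.tau1) := hξ.mono fun r hr => mem_window₀ hr
  have c1 : ContinuousOn (fun s => ξ (-s)) (Icc 0 P.tau2) :=
    hξ.comp continuous_neg.continuousOn fun r hr => mem_window₁ hr
  have v0 : PiecewiseContinuousOn v 0 P.tau1 := hv.mono (zero_mem_window (P := P)).1 le_rfl
  have v1 : PiecewiseContinuousOn (fun s => v (-s)) 0 P.tau2 := by
    have := (hv.mono le_rfl (zero_mem_window (P := P)).2).comp_neg
    rwa [neg_neg, neg_zero] at this
  fin_cases i
  · exact key 0 (v0.sub (.of_continuousOn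
      (continuousOn_memory (hK.continuous_impulse 0) (continuousOn_dotProduct P.c c0))))
  · exact key 1 ((((PiecewiseContinuousOn.of_continuousOn continuousOn_const).mul v1).add
      (.of_continuousOn (continuousOn_dotProduct P.c c1))).add (.of_continuousOn
      (continuousOn_memory (hK.continuous_impulse 1) (continuousOn_dotProduct P.c c1))))

theorem xiPar_congr {η : Fin n → ℝ} {ηd ηd' : ℝ → ℝ}
    (h : EqOn ηd ηd' (Icc (-P.tau2) P.tau1)) {τ : ℝ} (hτ : τ ∈ Icc (-P.tau2) P.tau1) :
    P.xiPar η ηd τ = P.xiPar η ηd' τ := by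
  rw [xiPar, xiPar, yDer_congr hτ.1 (h.mono (Icc_subset_Icc le_rfl hτ.2))]

theorem x10Par_congr {η : Fin n → ℝ} {ηd ηd' : ℝ → ℝ}
    (h : EqOn ηd ηd' (Icc (-P.tau2) P.tau1)) {τ : ℝ} (hτ : τ ∈ Icc (-P.tau2) P.tau1) :
    P.x10Par η ηd τ = P.x10Par η ηd' τ := by
  rw [x10Par, x10Par, xiPar_congr h hτ, h hτ]

theorem IsHCCFState.isTrajectory (hc : P.Controllable) {η : Fin n → ℝ} {ηd : ℝ → ℝ}
    (h : P.IsHCCFState η ηd) :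
    P.IsTrajectory (P.xiPar η ηd) (P.x10Par η ηd) (-P.tau2) P.tau1 :=
  isTrajectory_xiPar hc (.of_piecewise h)

theorem IsHCCFState.piecewise_x10Par (hc : P.Controllable) {η : Fin n → ℝ} {ηd : ℝ → ℝ}
    (h : P.IsHCCFState η ηd) : PiecewiseContinuousOn (P.x10Par η ηd) (-P.tau2) P.tau1 :=
  PiecewiseContinuousOn.sub h (.of_continuousOn (continuousOn_dotProduct _
    (h.isTrajectory hc).cont))

/-- The state of the canonical form is determined by the trajectory on `[-τ₂, τ₁]`. -/
theorem Controllable.hccfState_eq (hc : P.Controllable) {η η' : Fin n → ℝ} {ηd ηd' : ℝ → ℝ}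
    (h : EqOn (P.xiPar η ηd) (P.xiPar η' ηd') (Icc (-P.tau2) P.tau1))
    (h' : EqOn (P.x10Par η ηd) (P.x10Par η' ηd') (Icc (-P.tau2) P.tau1)) :
    η = η' ∧ EqOn ηd ηd' (Icc (-P.tau2) P.tau1) := by
  refine ⟨?_, fun τ hτ => ?_⟩
  · have := h ⟨le_rfl, (zero_mem_window (P := P)).1.trans P.tau1_nonneg⟩
    rw [← yDer_left (P := P) η ηd, ← yDer_left (P := P) η' ηd', ← hc.Tc_mulVec_xiPar, this,
      hc.Tc_mulVec_xiPar]
  · have := h' hτ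
    rw [x10Par, x10Par, h hτ] at this
    linarith

/-- Trajectories on `[-τ₂, τ₁]` yield states of the canonical form. -/
theorem IsTrajectory.exists_hccfState (hc : P.Controllable) {ξ : ℝ → Fin n → ℝ} {v : ℝ → ℝ}
    (h : P.IsTrajectory ξ v (-P.tau2) P.tau1) (hv : PiecewiseContinuousOn v (-P.tau2) P.tau1) :
    ∃ η ηd, P.IsHCCFState η ηd ∧ EqOn (P.xiPar η ηd) ξ (Icc (-P.tau2) P.tau1) ∧
      EqOn (P.x10Par η ηd) v (Icc (-P.tau2) P.tau1) :=
  ⟨P.Tc *ᵥ ξ (-P.tau2), fun τ => v τ + (P.h ᵥ* P.F ^ n) ⬝ᵥ ξ τ,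
    hv.add (.of_continuousOn (continuousOn_dotProduct _ h.cont)),
    fun _ hτ => (h.xiPar_eq hc rfl (fun _ _ => rfl) hτ).1,
    fun _ hτ => (h.xiPar_eq hc rfl (fun _ _ => rfl) hτ).2⟩

/-- Both kinds of states are in bijection with trajectories on `[-τ₂, τ₁]`: canonical states by the
flat coordinates, system states by the invertible map `x ↦ x̄` and the driving of the two halves by
`x̄₁` and `x̄₂`. -/
theorem correspondsBijectively (hc : P.Controllable) (hq : P.q0 ≠ 0) (hK : P.IsKernel K) :
    P.CorrespondsBijectively K := by
  refine ⟨fun ξ₀ x hx => ?_, fun η ηd hη => ?_, ?_⟩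
  · obtain ⟨ξ, v, ht, hv, h0, hX⟩ := exists_trajectory_of_profile hK hq (ξ₀ := ξ₀)
      (y := P.xbar K x) (hK.piecewise_xbar hx.pc) (by rw [xbar_zero]; exact hx.bc0)
    obtain ⟨η, ηd, hη, e1, e2⟩ := ht.exists_hccfState hc hv
    refine ⟨η, ηd, hx, hη, ?_, fun z hz => ?_⟩
    · rw [e1 zero_mem_window, h0]
    · rw [xbarPar_eq _ _ hz, parX_congr e1 e2 hz, hX z hz]
  · have ht := hη.isTrajectory hc
    obtain ⟨X, hX, hXy⟩ := hK.exists_sub_volterra_eq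
      (hK.piecewise_parX ht.cont (hη.piecewise_x10Par hc))
    obtain ⟨x, hx, rfl⟩ := exists_scaled_eq (P := P) hX
    refine ⟨P.xiPar η ηd 0, x, ⟨hx, ?_⟩, hη, rfl, fun z hz => ?_⟩
    · have := hXy 0 ⟨le_rfl, zero_le_one⟩
      rw [← xbar_eq, xbar_zero, parX_zero] at this
      rw [this]
      simp
    · rw [xbarPar_eq _ _ hz, xbar_eq, hXy z hz]
  · intro ξ x η ηd ξ' x' η' ηd' h h'
    have ht := h.isHCCFState.isTrajectory hc
    have ht' := h'.isHCCFState.isTrajectory hc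
    constructor
    · rintro ⟨hξ, hx⟩
      have := ht.unique hK hq ht' (by rw [← h.xi_eq, ← h'.xi_eq, hξ]) fun z hz => by
        rw [← xbarPar_eq _ _ hz, ← xbarPar_eq _ _ hz, ← h.xbar_eq z hz, ← h'.xbar_eq z hz,
          xbar_congr hx hz]
      exact hc.hccfState_eq this.1 this.2
    · rintro ⟨rfl, hηd⟩
      refine ⟨?_, ?_⟩
      · rw [h.xi_eq, h'.xi_eq, xiPar_congr hηd zero_mem_window]
      · have := hK.eqOn_of_sub_volterra_eq (locBddOn_scaled (P := P) h.isState.pc)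
          (locBddOn_scaled (P := P) h'.isState.pc) fun z hz => by
            rw [← xbar_eq, ← xbar_eq, h.xbar_eq z hz, h'.xbar_eq z hz, xbarPar_eq _ _ hz,
              xbarPar_eq _ _ hz, parX_congr (fun τ hτ => xiPar_congr hηd hτ)
                (fun τ hτ => x10Par_congr hηd hτ) hz]
        exact fun z hz => scaled_injective (this hz)

end PDEODESystem

end Backstepping

/-! ### The boundary condition at `z = 1` in canonical coordinates. -/

section BoundaryFunctional
open MeasureTheory

theorem continuousOn_volterra_integral_right {k : ℝ × ℝ → ℝ} (hk : Continuous k) {f : ℝ → ℝ}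
    {a b : ℝ} (hf : LocBddOn f a b) :
    ContinuousOn (fun z => ∫ ζ in z..b, k (z, ζ) * f ζ) (Icc a b) := by
  have h := continuousOn_volterra_integral (k := fun x => k (-x.1, -x.2)) (by fun_prop)
    (PDEODESystem.locBddOn_neg (a := -b) (b := -a) (by simpa using hf))
  have h2 := h.comp (f := fun z : ℝ => -z) (s := Icc a b) (by fun_prop)
    fun z hz => ⟨by linarith [hz.2], by linarith [hz.1]⟩
  refine h2.congr fun z _ => ?_
  have := intervalIntegral.integral_comp_neg (a := -b) (b := -z) fun ζ => k (z, ζ) * f ζ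
  simpa using this.symm

namespace PDEODESystem

variable {n : ℕ} {P : PDEODESystem n} {K : ℝ → ℝ → Matrix (Fin 2) (Fin 2) ℝ}

variable (P) in
/-- Functionals of the state of the canonical form that have a continuous density with respect to
the profile. -/
def IsIntegralFunctional (Φ : (Fin n → ℝ) → (ℝ → ℝ) → ℝ) : Prop :=
  ∃ (a : Fin n → ℝ) (ad : ℝ → ℝ), ContinuousOn ad (Icc (-P.tau2) P.tau1) ∧
    ∀ η ηd, P.IsHCCFState η ηd →
      Φ η ηd = (∫ τ in (-P.tau2)..P.tau1, ad τ * ηd τ) + ∑ i, a i * η i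

theorem left_le_right : -P.tau2 ≤ P.tau1 :=
  (zero_mem_window (P := P)).1.trans P.tau1_nonneg

theorem left_mem_window : -P.tau2 ∈ Icc (-P.tau2) P.tau1 := ⟨le_rfl, left_le_right⟩

theorem right_mem_window : P.tau1 ∈ Icc (-P.tau2) P.tau1 := ⟨left_le_right, le_rfl⟩

namespace IsIntegralFunctional

variable {Φ Ψ : (Fin n → ℝ) → (ℝ → ℝ) → ℝ}

theorem congr (h : P.IsIntegralFunctional Φ)
    (e : ∀ η ηd, P.IsHCCFState η ηd → Ψ η ηd = Φ η ηd) : P.IsIntegralFunctional Ψ := by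
  obtain ⟨a, ad, hc, hΦ⟩ := h
  exact ⟨a, ad, hc, fun η ηd hη => (e η ηd hη).trans (hΦ η ηd hη)⟩

theorem add (h : P.IsIntegralFunctional Φ) (h' : P.IsIntegralFunctional Ψ) :
    P.IsIntegralFunctional (Φ + Ψ) := by
  obtain ⟨a, ad, hc, hΦ⟩ := h
  obtain ⟨a', ad', hc', hΨ⟩ := h'
  refine ⟨a + a', fun τ => ad τ + ad' τ, hc.add hc', fun η ηd hη => ?_⟩
  have i1 := ((LocBddOn.of_continuousOn hc).mul (.of_piecewise hη)).intervalIntegrable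
    left_mem_window right_mem_window
  have i2 := ((LocBddOn.of_continuousOn hc').mul (.of_piecewise hη)).intervalIntegrable
    left_mem_window right_mem_window
  simp only [Pi.add_apply, hΦ η ηd hη, hΨ η ηd hη, add_mul, Finset.sum_add_distrib]
  rw [intervalIntegral.integral_add i1 i2]
  ring

theorem const_mul (h : P.IsIntegralFunctional Φ) (k : ℝ) :
    P.IsIntegralFunctional fun η ηd => k * Φ η ηd := by
  obtain ⟨a, ad, hc, hΦ⟩ := h
  refine ⟨fun i => k * a i, fun τ => k * ad τ, continuousOn_const.mul hc, fun η ηd hη => ?_⟩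
  simp only [hΦ η ηd hη, mul_assoc, intervalIntegral.integral_const_mul, ← Finset.mul_sum, mul_add]

theorem zero : P.IsIntegralFunctional 0 :=
  ⟨0, 0, continuousOn_const, fun η ηd _ => by simp⟩

theorem sum {Φ : Fin n → (Fin n → ℝ) → (ℝ → ℝ) → ℝ} (h : ∀ i, P.IsIntegralFunctional (Φ i)) :
    P.IsIntegralFunctional fun η ηd => ∑ i, Φ i η ηd := by
  have := Finset.sum_induction (s := Finset.univ) Φ P.IsIntegralFunctional
    (fun _ _ h h' => h.add h') zero fun i _ => h i
  exact this.congr fun η ηd _ => by simp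

end IsIntegralFunctional

theorem isIntegralFunctional_yDer (i : Fin n) :
    P.IsIntegralFunctional fun η ηd => P.yDer η ηd P.tau1 i := by
  refine ⟨fun k => if i ≤ k then
      (P.tau1 + P.tau2) ^ ((k : ℕ) - (i : ℕ)) / (((k : ℕ) - (i : ℕ))! : ℝ) else 0,
    fun σ => (P.tau1 - σ) ^ (n - 1 - (i : ℕ)) / ((n - 1 - (i : ℕ))! : ℝ), by fun_prop,
    fun η ηd _ => ?_⟩
  simp only [yDer, ite_mul, zero_mul]
  rw [add_comm]

/-- After exchanging the order of integration, the density at `σ` is an integral of `μ` over `[σ,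
τ₁]`, which is continuous even where `μ` jumps. -/
theorem isIntegralFunctional_integral_yDer {μ : ℝ → ℝ} (hμ : LocBdd μ) (i : Fin n) :
    P.IsIntegralFunctional fun η ηd =>
      ∫ τ in (-P.tau2)..P.tau1, μ τ * P.yDer η ηd τ i := by
  set m := n - 1 - (i : ℕ) with hm
  set p : Fin n → ℝ → ℝ := fun k τ => if i ≤ k then
      (τ + P.tau2) ^ ((k : ℕ) - (i : ℕ)) / (((k : ℕ) - (i : ℕ))! : ℝ) else 0 with hp
  have pc : ∀ k, Continuous (p k) := fun k => by
    simp only [hp]; split_ifs <;> fun_prop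
  refine ⟨fun k => ∫ τ in (-P.tau2)..P.tau1, μ τ * p k τ,
    fun σ => ∫ τ in σ..P.tau1, (τ - σ) ^ m / (m ! : ℝ) * μ τ,
    continuousOn_volterra_integral_right (k := fun x => (x.2 - x.1) ^ m / (m ! : ℝ))
      (by fun_prop) (.of_locBdd hμ), fun η ηd hη => ?_⟩
  obtain ⟨g, hg, e⟩ := LocBddOn.of_piecewise hη
  have hle := left_le_right (P := P)
  set F : ℝ × ℝ → ℝ := fun x => if x.2 < x.1 then
    (x.1 - x.2) ^ m / (m ! : ℝ) * μ x.1 * g x.2 else 0 with hF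
  have lF : LocBdd F := LocBdd.ite ((LocBdd.mul (.of_continuous (by fun_prop))
    (hμ.comp continuous_fst)).mul (hg.comp continuous_snd))
    (measurableSet_lt measurable_snd measurable_fst)
  have hpt : ∀ τ ∈ Icc (-P.tau2) P.tau1, μ τ * P.yDer η ηd τ i =
      (∑ k, η k * (μ τ * p k τ)) + ∫ σ in (-P.tau2)..P.tau1, F (τ, σ) := fun τ hτ => by
    simp only [hF]
    rw [integral_ite_gt (f := fun σ => (τ - σ) ^ m / (m ! : ℝ) * μ τ * g σ) hτ.1 hτ.2, yDer,
      mul_add, Finset.mul_sum]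
    congr 1
    · refine Finset.sum_congr rfl fun k _ => ?_
      simp only [hp]
      split_ifs <;> ring
    · rw [← intervalIntegral.integral_const_mul]
      refine intervalIntegral.integral_congr fun σ hσ => ?_
      rw [uIcc_of_le hτ.1] at hσ
      simp only [e ⟨hσ.1, hσ.2.trans hτ.2⟩]
      ring
  beta_reduce
  rw [intervalIntegral.integral_congr (g := fun τ => (∑ k, η k * (μ τ * p k τ)) +
      ∫ σ in (-P.tau2)..P.tau1, F (τ, σ)) fun τ hτ => hpt τ (by rwa [uIcc_of_le hle] at hτ),
    intervalIntegral.integral_add, intervalIntegral.integral_finsetSum, lF.integral_swap hle hle,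
    add_comm]
  · congr 1
    · refine intervalIntegral.integral_congr fun σ hσ => ?_
      rw [uIcc_of_le hle] at hσ
      simp only [hF]
      rw [integral_ite_lt (f := fun τ => (τ - σ) ^ m / (m ! : ℝ) * μ τ * g σ) hσ.1 hσ.2,
        intervalIntegral.integral_mul_const, e hσ]
    · refine Finset.sum_congr rfl fun k _ => ?_
      rw [intervalIntegral.integral_const_mul, mul_comm]
  · exact fun k _ => ((hμ.mul (.of_continuous (pc k))).intervalIntegrable _ _).const_mul _
  · have := IntervalIntegrable.sum (μ := volume) (a := -P.tau2) (b := P.tau1) Finset.univ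
      (f := fun k τ => η k * (μ τ * p k τ)) fun k _ =>
        ((hμ.mul (.of_continuous (pc k))).intervalIntegrable _ _).const_mul _
    exact this.congr fun τ _ => by rw [Finset.sum_apply]
  · exact (lF.integral_param hle).intervalIntegrable _ _

theorem dotProduct_xiPar (w : Fin n → ℝ) (η : Fin n → ℝ) (ηd : ℝ → ℝ) (τ : ℝ) :
    w ⬝ᵥ P.xiPar η ηd τ = ∑ i, (w ᵥ* P.Tc⁻¹) i * P.yDer η ηd τ i := by
  rw [xiPar, Matrix.dotProduct_mulVec]
  rfl

theorem isIntegralFunctional_right (w : Fin n → ℝ) :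
    P.IsIntegralFunctional fun η ηd => w ⬝ᵥ P.xiPar η ηd P.tau1 :=
  (IsIntegralFunctional.sum fun i => (isIntegralFunctional_yDer i).const_mul
    ((w ᵥ* P.Tc⁻¹) i)).congr fun η ηd _ => dotProduct_xiPar w η ηd _

theorem isIntegralFunctional_left (w : Fin n → ℝ) :
    P.IsIntegralFunctional fun η ηd => w ⬝ᵥ P.xiPar η ηd (-P.tau2) :=
  ⟨w ᵥ* P.Tc⁻¹, 0, continuousOn_const, fun η ηd _ => by
    simp [dotProduct_xiPar, yDer_left]⟩

theorem isIntegralFunctional_integral {μ : ℝ → ℝ} (hμ : LocBdd μ) (w : Fin n → ℝ) :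
    P.IsIntegralFunctional fun η ηd =>
      ∫ τ in (-P.tau2)..P.tau1, μ τ * (w ⬝ᵥ P.xiPar η ηd τ) :=
  (IsIntegralFunctional.sum fun i => (isIntegralFunctional_integral_yDer hμ i).const_mul
    ((w ᵥ* P.Tc⁻¹) i)).congr fun η ηd hη => by
      simp only [dotProduct_xiPar, Finset.mul_sum]
      rw [intervalIntegral.integral_finsetSum]
      · refine Finset.sum_congr rfl fun i _ => ?_
        rw [← intervalIntegral.integral_const_mul]
        simp only [mul_left_comm]
      · exact fun i _ => ((LocBddOn.of_locBdd hμ).mul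
          ((locBddOn_yDer (.of_piecewise hη) i).const_mul _)).intervalIntegrable
          left_mem_window right_mem_window

/-- Written over the whole window, the weight is cut off at `0`; this jump is why the weights `μ`
are only required to be measurable and locally bounded. -/
theorem memory_eq_integral_right (m w : ℝ → ℝ) :
    memory m w P.tau1 = ∫ τ in (-P.tau2)..P.tau1, (if 0 < τ then m (P.tau1 - τ) else 0) * w τ := by
  simp only [ite_mul, zero_mul]
  exact (integral_ite_lt (f := fun τ => m (P.tau1 - τ) * w τ) (zero_mem_window (P := P)).1
    (zero_mem_window (P := P)).2).symm

theorem memory_eq_integral_left (m w : ℝ → ℝ) :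
    memory m (fun σ => w (-σ)) P.tau2 =
      ∫ τ in (-P.tau2)..P.tau1, (if τ < 0 then m (P.tau2 + τ) else 0) * w τ := by
  simp only [ite_mul, zero_mul]
  rw [integral_ite_gt (f := fun τ => m (P.tau2 + τ) * w τ) (zero_mem_window (P := P)).1
    (zero_mem_window (P := P)).2, memory]
  have := intervalIntegral.integral_comp_neg (a := 0) (b := P.tau2) fun τ => m (P.tau2 + τ) * w τ
  rw [neg_zero] at this
  rw [← this]
  simp only [← sub_eq_add_neg]

/-- In `x̄₁(1) - q̄₁ x̄₂(1)` the profile enters pointwise only through its two end values, with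
coefficients `1` and `-q̄₁ q₀`. What is left depends on `ξ` at the ends of the window and on
convolutions of `c · ξ`, and each of these has a continuous density. -/
theorem IsKernel.isIntegralFunctional_boundary (hK : P.IsKernel K) :
    P.IsIntegralFunctional fun η ηd =>
      P.xbarPar K η ηd 1 0 - P.q1bar * P.xbarPar K η ηd 1 1 - ηd P.tau1 +
        P.q1bar * P.q0 * ηd (-P.tau2) := by
  have l0 : LocBdd fun τ => if 0 < τ then P.impulse K 0 (P.tau1 - τ) else 0 :=
    (LocBdd.of_continuous ((hK.continuous_impulse 0).comp (by fun_prop))).ite measurableSet_Ioi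
  have l1 : LocBdd fun τ => if τ < 0 then P.impulse K 1 (P.tau2 + τ) else 0 :=
    (LocBdd.of_continuous ((hK.continuous_impulse 1).comp (by fun_prop))).ite measurableSet_Iio
  refine ((((isIntegralFunctional_right (P.h ᵥ* P.F ^ n)).const_mul (-1)).add
    ((isIntegralFunctional_integral l0 P.c).const_mul (-1))).add
    (((isIntegralFunctional_left (P.h ᵥ* P.F ^ n)).const_mul (P.q1bar * P.q0)).add
    (((isIntegralFunctional_left P.c).const_mul (-P.q1bar)).add
    ((isIntegralFunctional_integral l1 P.c).const_mul (-P.q1bar))))).congr fun η ηd _ => ?_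
  rw [xbarPar_eq _ _ ⟨zero_le_one, le_rfl⟩]
  simp only [parX, Matrix.cons_val_zero, Matrix.cons_val_one, Pi.add_apply]
  change P.x10Par η ηd P.tau1 - memory _ _ P.tau1 - P.q1bar * (P.q0 * P.x10Par η ηd (-P.tau2) +
    P.c ⬝ᵥ P.xiPar η ηd (-P.tau2) + memory _ _ P.tau2) - _ + _ = _
  rw [memory_eq_integral_right, memory_eq_integral_left _ fun σ => P.c ⬝ᵥ P.xiPar η ηd σ,
    x10Par, x10Par]
  ring

/-- The integral in the input transformation is precisely the combination of Volterra terms of `x̄`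
at `z = 1`. The two equations then differ by the nonzero factor `exp (α₁(1))`. -/
theorem IsKernel.xbar_boundary (hK : P.IsKernel K) {x : ℝ → Fin 2 → ℝ}
    (hx : ∀ i, PiecewiseContinuousOn (fun z => x z i) 0 1) (u : ℝ) :
    x 1 0 = P.q1 * x 1 1 + u ↔
      P.xbar K x 1 0 - P.q1bar * P.xbar K x 1 1 = P.inputTransform K x u := by
  have i0 := hK.intervalIntegrable_volterra (locBddOn_scaled (P := P) hx) ⟨zero_le_one, le_rfl⟩ 0
  have i1 := hK.intervalIntegrable_volterra (locBddOn_scaled (P := P) hx) ⟨zero_le_one, le_rfl⟩ 1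
  have e : P.inputTransform K x u = Real.exp (P.alpha 0 1) * u +
      (P.q1bar * volterra K (P.scaled x) 1 1 - volterra K (P.scaled x) 1 0) := by
    rw [inputTransform, intervalIntegral.integral_sub (i1.const_mul _) i0,
      intervalIntegral.integral_const_mul]
    rfl
  have h1 : P.q1bar * Real.exp (-P.alpha 1 1) = P.q1 * Real.exp (P.alpha 0 1) := by
    rw [q1bar, mul_assoc, ← Real.exp_add]
    congr 2
    ring
  have h2 : P.xbar K x 1 0 - P.q1bar * P.xbar K x 1 1 - P.inputTransform K x u =
      Real.exp (P.alpha 0 1) * (x 1 0 - (P.q1 * x 1 1 + u)) := by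
    rw [e, xbar_eq]
    simp only [Pi.sub_apply, scaled, Matrix.cons_val_zero, Matrix.cons_val_one]
    linear_combination (-x 1 1) * h1
  rw [← sub_eq_zero, ← sub_eq_zero (b := P.inputTransform K x u), h2, mul_eq_zero]
  simp [(Real.exp_pos _).ne']

/-- The coefficients of the canonical form: its boundary condition is that of the system. -/
theorem IsKernel.exists_coefficients (hK : P.IsKernel K) :
    ∃ (a : Fin (n + 1) → ℝ) (ad : ℝ → ℝ), ContinuousOn ad (Icc (-P.tau2) P.tau1) ∧
      ∀ ξ x η ηd u, P.Corresponds K ξ x η ηd → (x 1 0 = P.q1 * x 1 1 + u ↔ ηd P.tau1 =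
        -(∫ τ in (-P.tau2)..P.tau1, ad τ * ηd τ) - ∑ i : Fin n, a i.castSucc * η i
          - a (Fin.last n) * ηd (-P.tau2) + P.inputTransform K x u) := by
  obtain ⟨a, ad, hc, h⟩ := hK.isIntegralFunctional_boundary
  -- The last coefficient `a_n = -q̄₁ q₀` is the point evaluation at `-τ₂`, which no continuous
  -- density can represent.
  refine ⟨Fin.snoc a (-(P.q1bar * P.q0)), ad, hc, fun ξ x η ηd u hC => ?_⟩
  have h1 := h η ηd hC.isHCCFState
  rw [hK.xbar_boundary hC.isState.pc, hC.xbar_eq 1 ⟨zero_le_one, le_rfl⟩]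
  simp only [Fin.snoc_castSucc, Fin.snoc_last]
  constructor <;> intro h2 <;> linarith

end PDEODESystem

end BoundaryFunctional

/-! ### The scaling of the transport equations, and uniqueness on a domain of dependence. -/

section ScaledTransport
open MeasureTheory

/-- Variation of constants: multiplication by an integrating factor `E`, `E' = -p E`, removes the
term `p f` from the linear equation `f' = p f + r`. -/
theorem integratingFactor {E p f r : ℝ → ℝ} {a b c : ℝ} (hc : c ∈ Icc a b)
    (hp : ContinuousOn p (Icc a b)) (hEc : ContinuousOn E (Icc a b)) (hE0 : ∀ z, E z ≠ 0)
    (hE : ∀ s ∈ Icc a b, ∀ t ∈ Icc a b, E t = E s + ∫ ζ in s..t, -(p ζ * E ζ))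
    (hE' : ∀ s ∈ Icc a b, ∀ t ∈ Icc a b, (E t)⁻¹ = (E s)⁻¹ + ∫ ζ in s..t, p ζ * (E ζ)⁻¹)
    (hf : LocBddOn f a b) (hr : LocBddOn r a b) :
    (∀ z ∈ Icc a b, f z = f c + ∫ ζ in c..z, (p ζ * f ζ + r ζ)) ↔
      ∀ z ∈ Icc a b, E z * f z = E c * f c + ∫ ζ in c..z, E ζ * r ζ := by
  have lp : LocBddOn p a b := .of_continuousOn hp
  have lE : LocBddOn E a b := .of_continuousOn hEc
  have lE' : LocBddOn (fun z => (E z)⁻¹) a b := .of_continuousOn (hEc.inv₀ fun z _ => hE0 z)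
  have sub : ∀ {z x : ℝ}, z ∈ Icc a b → x ∈ uIcc c z → x ∈ Icc a b := fun hz hx =>
    uIcc_subset_Icc hc hz hx
  constructor
  · intro h z hz
    have := mul_eq_add_integral_of_primitive (F := E) (G := f) (a := c) (b := z)
      (((lp.mul lE).const_mul (-1)).intervalIntegrable hc hz)
      (((lp.mul hf).add hr).intervalIntegrable hc hz)
      (fun x hx => by simpa only [neg_one_mul] using hE c hc x (sub hz hx))
      (fun x hx => h x (sub hz hx))
    rw [this]
    congr 1
    refine intervalIntegral.integral_congr fun ζ _ => ?_
    ring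
  · intro h z hz
    have := mul_eq_add_integral_of_primitive (F := fun z => (E z)⁻¹) (G := fun z => E z * f z)
      (a := c) (b := z) ((lp.mul lE').intervalIntegrable hc hz)
      ((lE.mul hr).intervalIntegrable hc hz) (fun x hx => hE' c hc x (sub hz hx))
      (fun x hx => h x (sub hz hx))
    simp only [inv_mul_cancel_left₀ (hE0 _)] at this
    rw [this]
    congr 1
    refine intervalIntegral.integral_congr fun ζ _ => ?_
    have := inv_mul_cancel₀ (hE0 ζ)
    simp only [mul_assoc, inv_mul_cancel_left₀ (hE0 ζ)]

namespace PDEODESystem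

variable {n : ℕ} {P : PDEODESystem n}

theorem continuousOn_rate (i : Fin 2) :
    ContinuousOn (fun z => P.A z i i / P.lam i z) (Icc 0 1) :=
  (P.A_continuousOn i i).div (P.lam_continuousOn i) fun z hz => (P.lam_pos i z hz).ne'

/-- Extending the rate by constants beyond `[0, 1]` makes `α_i` differentiable everywhere, so the
end points need no separate treatment. -/
theorem exp_alpha_primitive (i : Fin 2) (k : ℝ) {s t : ℝ} (hs : s ∈ Icc (0 : ℝ) 1)
    (ht : t ∈ Icc (0 : ℝ) 1) : Real.exp (k * P.alpha i t) = Real.exp (k * P.alpha i s) +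
      ∫ ζ in s..t, k * (P.A ζ i i / P.lam i ζ) * Real.exp (k * P.alpha i ζ) := by
  set p : ℝ → ℝ := fun z => P.A (clampUnit z) i i / P.lam i (clampUnit z) with hp
  have pc : Continuous p := (continuousOn_rate i).comp_continuous continuous_clampUnit clampUnit_mem
  set q : ℝ → ℝ := fun z => ∫ ζ in (0 : ℝ)..z, p ζ with hq
  have hd : ∀ z, HasDerivAt (fun z => Real.exp (k * q z)) (k * p z * Real.exp (k * q z)) z :=
    fun z => by
      have := ((pc.integral_hasStrictDerivAt 0 z).hasDerivAt.const_mul k).exp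
      rwa [mul_comm (Real.exp _)] at this
  have qc : Continuous q := continuous_iff_continuousAt.2 fun z =>
    (pc.integral_hasStrictDerivAt 0 z).hasDerivAt.continuousAt
  have h := intervalIntegral.integral_eq_sub_of_hasDerivAt (a := s) (b := t) (fun z _ => hd z)
    ((by fun_prop : Continuous fun z => k * p z * Real.exp (k * q z)).intervalIntegrable _ _)
  have e : ∀ z ∈ Icc (0 : ℝ) 1, q z = P.alpha i z := fun z hz =>
    intervalIntegral.integral_congr fun ζ hζ => by
      simp only [hp, clampUnit_eq (uIcc_zero_subset_unit hz hζ)]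
  rw [← e t ht, ← e s hs, eq_add_of_sub_eq' h.symm]
  congr 1
  refine intervalIntegral.integral_congr fun ζ hζ => ?_
  have hζ' := uIcc_subset_Icc hs ht hζ
  simp only [hp, clampUnit_eq hζ', e ζ hζ']

/-- The sign `k` is `1` for the first component and `-1` for the second, because they are
transported in opposite directions. -/
theorem scaledRow (i : Fin 2) (k : ℝ) {f r : ℝ → ℝ} {a b c : ℝ} (ha : 0 ≤ a) (hb : b ≤ 1)
    (hc : c ∈ Icc a b) (hf : LocBddOn f a b) (hr : LocBddOn r a b) :
    (∀ z ∈ Icc a b, f z = f c + ∫ ζ in c..z, (-k * (P.A ζ i i / P.lam i ζ) * f ζ + r ζ)) ↔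
      ∀ z ∈ Icc a b, Real.exp (k * P.alpha i z) * f z = Real.exp (k * P.alpha i c) * f c +
        ∫ ζ in c..z, Real.exp (k * P.alpha i ζ) * r ζ := by
  have hsub : Icc a b ⊆ Icc (0 : ℝ) 1 := Icc_subset_Icc ha hb
  refine integratingFactor (E := fun z => Real.exp (k * P.alpha i z)) hc
    (continuousOn_const.mul ((continuousOn_rate i).mono hsub))
    ((continuousOn_const.mul ((P.continuousOn_alpha i).mono hsub)).rexp)
    (fun z => (Real.exp_pos _).ne') (fun s hs t ht => ?_) (fun s hs t ht => ?_) hf hr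
  · rw [exp_alpha_primitive i k (hsub hs) (hsub ht)]
    congr 1
    refine intervalIntegral.integral_congr fun ζ _ => ?_
    ring
  · have := exp_alpha_primitive (P := P) i (-k) (hsub hs) (hsub ht)
    simp only [neg_mul, Real.exp_neg] at this ⊢
    exact this

theorem locBddOn_coefficient (i j : Fin 2) {a b : ℝ} (ha : 0 ≤ a) (hb : b ≤ 1) :
    LocBddOn (fun z => P.A z i j / P.lam i z) a b :=
  .of_continuousOn (((P.A_continuousOn i j).div (P.lam_continuousOn i)
    fun z hz => (P.lam_pos i z hz).ne').mono (Icc_subset_Icc ha hb))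

/-- The first transport equation along one characteristic curve, for `x` and for `x̃`. -/
theorem scaledRow_iff₀ {X : ℝ → Fin 2 → ℝ} {z' : ℝ} (hz' : z' ∈ Icc (0 : ℝ) 1)
    (hX : ∀ i, LocBddOn (fun ζ => X ζ i) 0 z') :
    (∀ z ∈ Icc 0 z', X z 0 = X z' 0 + ∫ ζ in z..z', (P.A ζ *ᵥ X ζ) 0 / P.lam 0 ζ) ↔
      ∀ z ∈ Icc 0 z', P.scaled X z 0 = P.scaled X z' 0 +
        ∫ ζ in z..z', P.coupling 0 1 ζ * P.scaled X ζ 1 / (P.speed 0).l ζ := by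
  have h := scaledRow (P := P) 0 1 (f := fun ζ => X ζ 0)
    (r := fun ζ => -1 * (P.A ζ 0 1 / P.lam 0 ζ * X ζ 1)) le_rfl hz'.2
    ⟨hz'.1, le_rfl⟩ (hX 0) (((locBddOn_coefficient 0 1 le_rfl hz'.2).mul (hX 1)).const_mul (-1))
  have e1 : ∀ z, ∫ ζ in z..z', (P.A ζ *ᵥ X ζ) 0 / P.lam 0 ζ = ∫ ζ in z'..z,
      (-1 * (P.A ζ 0 0 / P.lam 0 ζ) * X ζ 0 + -1 * (P.A ζ 0 1 / P.lam 0 ζ * X ζ 1)) := fun z => by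
    rw [intervalIntegral.integral_symm, ← intervalIntegral.integral_neg]
    refine intervalIntegral.integral_congr fun ζ _ => ?_
    simp only [Matrix.mulVec, dotProduct, Fin.sum_univ_two]
    ring
  have e2 : ∀ z ∈ Icc 0 z', ∫ ζ in z..z', P.coupling 0 1 ζ * P.scaled X ζ 1 / (P.speed 0).l ζ =
      ∫ ζ in z'..z, Real.exp (1 * P.alpha 0 ζ) * (-1 * (P.A ζ 0 1 / P.lam 0 ζ * X ζ 1)) :=
    fun z hz => by
      rw [intervalIntegral.integral_symm, ← intervalIntegral.integral_neg]
      refine intervalIntegral.integral_congr fun ζ hζ => ?_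
      have hζ' : ζ ∈ Icc (0 : ℝ) 1 :=
        uIcc_subset_Icc hz' ⟨hz.1, hz.2.trans hz'.2⟩ hζ
      have : Real.exp (P.alpha 0 ζ + P.alpha 1 ζ) * Real.exp (-P.alpha 1 ζ) =
          Real.exp (P.alpha 0 ζ) := by rw [← Real.exp_add, add_neg_cancel_right]
      simp only [P.coupling_eq 0 1 hζ', P.speed_l 0 hζ', scaled, Atilde, Matrix.cons_val_one,
        Matrix.cons_val_zero, Matrix.of_apply, Matrix.cons_val', one_mul]
      rw [← this]
      ring
  simp only [one_mul] at h e2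
  have e0 : ∀ z, P.scaled X z 0 = Real.exp (P.alpha 0 z) * X z 0 := fun z => rfl
  simp only [e1, e0]
  rw [h]
  exact forall₂_congr fun z hz => by rw [e2 z hz]

/-- The second transport equation along one characteristic curve, for `x` and for `x̃`. -/
theorem scaledRow_iff₁ {X : ℝ → Fin 2 → ℝ} {z : ℝ} (hz : z ∈ Icc (0 : ℝ) 1)
    (hX : ∀ i, LocBddOn (fun ζ => X ζ i) z 1) :
    (∀ z' ∈ Icc z 1, X z' 1 = X z 1 + ∫ ζ in z..z', (P.A ζ *ᵥ X ζ) 1 / P.lam 1 ζ) ↔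
      ∀ z' ∈ Icc z 1, P.scaled X z' 1 = P.scaled X z 1 +
        ∫ ζ in z..z', P.coupling 1 0 ζ * P.scaled X ζ 0 / (P.speed 1).l ζ := by
  have h := scaledRow (P := P) 1 (-1) (f := fun ζ => X ζ 1)
    (r := fun ζ => P.A ζ 1 0 / P.lam 1 ζ * X ζ 0) hz.1 le_rfl
    ⟨le_rfl, hz.2⟩ (hX 1) ((locBddOn_coefficient 1 0 hz.1 le_rfl).mul (hX 0))
  have e1 : ∀ z', ∫ ζ in z..z', (P.A ζ *ᵥ X ζ) 1 / P.lam 1 ζ = ∫ ζ in z..z',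
      (- -1 * (P.A ζ 1 1 / P.lam 1 ζ) * X ζ 1 + P.A ζ 1 0 / P.lam 1 ζ * X ζ 0) := fun z' => by
    refine intervalIntegral.integral_congr fun ζ _ => ?_
    simp only [Matrix.mulVec, dotProduct, Fin.sum_univ_two]
    ring
  have e2 : ∀ z' ∈ Icc z 1, ∫ ζ in z..z', P.coupling 1 0 ζ * P.scaled X ζ 0 / (P.speed 1).l ζ =
      ∫ ζ in z..z', Real.exp (-1 * P.alpha 1 ζ) * (P.A ζ 1 0 / P.lam 1 ζ * X ζ 0) :=
    fun z' hz' => by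
      refine intervalIntegral.integral_congr fun ζ hζ => ?_
      have hζ' : ζ ∈ Icc (0 : ℝ) 1 := uIcc_subset_Icc hz ⟨hz.1.trans hz'.1, hz'.2⟩ hζ
      have : Real.exp (-P.alpha 0 ζ - P.alpha 1 ζ) * Real.exp (P.alpha 0 ζ) =
          Real.exp (-P.alpha 1 ζ) := by rw [← Real.exp_add]; congr 1; ring
      simp only [P.coupling_eq 1 0 hζ', P.speed_l 1 hζ', scaled, Atilde, Matrix.cons_val_one,
        Matrix.cons_val_zero, Matrix.of_apply, Matrix.cons_val', neg_one_mul]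
      rw [← this]
      ring
  have e0 : ∀ z, P.scaled X z 1 = Real.exp (-1 * P.alpha 1 z) * X z 1 := fun z => by
    rw [neg_one_mul]; rfl
  simp only [e1]
  rw [h]
  exact forall₂_congr fun z' hz' => by rw [e2 z' hz', e0, e0]

end PDEODESystem

/-- Uniqueness for the coupled transport equations on `{t ≥ 0, t + φ_c z ≤ S}`, without boundary
condition at `z = 1`, when the initial value of the second component is a Volterra integral of the
initial profile. -/
theorem eq_zero_of_transport (c d : Speed) {β ω : ℝ → ℝ} (hβ : Continuous β) (hω : Continuous ω)
    {k : Fin 2 → ℝ → ℝ → ℝ} {Ck : ℝ} (hk : ∀ i, ∀ z ∈ Icc (0 : ℝ) 1, ∀ ζ ∈ Icc 0 z, |k i z ζ| ≤ Ck)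
    {e₁ e₂ : ℝ → ℝ → ℝ} {S M : ℝ}
    (hM : ∀ t, 0 ≤ t → t ≤ S → ∀ z ∈ Icc (0 : ℝ) 1, |e₁ t z| ≤ M ∧ |e₂ t z| ≤ M)
    (h₁ : ∀ t, 0 ≤ t → ∀ z ∈ Icc (0 : ℝ) 1, t + c.phi z ≤ S →
      e₁ t z = -∫ ζ in (0 : ℝ)..z, β ζ * e₂ (t + c.phi z - c.phi ζ) ζ / c.l ζ)
    (h₂ : ∀ t, 0 ≤ t → ∀ z ∈ Icc (0 : ℝ) 1, ∀ z' ∈ Icc z 1, t + d.phi z' - d.phi z ≤ S →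
      e₂ (t + d.phi z' - d.phi z) z' =
        e₂ t z + ∫ ζ in z..z', ω ζ * e₁ (t + d.phi ζ - d.phi z) ζ / d.l ζ)
    (h₂₀ : ∀ t, 0 ≤ t → t ≤ S → e₂ t 0 = 0)
    (hinit : ∀ z ∈ Icc (0 : ℝ) 1, c.phi z ≤ S →
      e₂ 0 z = ∫ ζ in (0 : ℝ)..z, (k 0 z ζ * e₁ 0 ζ + k 1 z ζ * e₂ 0 ζ)) :
    ∀ t, 0 ≤ t → ∀ z ∈ Icc (0 : ℝ) 1, t + c.phi z ≤ S → e₁ t z = 0 ∧ e₂ t z = 0 := by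
  have cc := c.continuous_l
  have dc := d.continuous_l
  obtain ⟨Cβ, hCβ0, hCβ⟩ := ContinuousOn.exists_nonneg_bound_unit
    (f := fun z => β z / c.l z) (hβ.div cc c.ne_zero).continuousOn
  obtain ⟨Cω, hCω0, hCω⟩ := ContinuousOn.exists_nonneg_bound_unit
    (f := fun z => ω z / d.l z) (hω.div dc d.ne_zero).continuousOn
  have hCk0 : 0 ≤ Ck := (abs_nonneg _).trans (hk 0 0 ⟨le_rfl, zero_le_one⟩ 0 ⟨le_rfl, le_rfl⟩)
  -- A domain of dependence: `t + φ_c(z)` is constant along characteristics of the first component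
  -- towards `z = 0`, and decreases when those of the second are followed back in time. The integral
  -- equations therefore never leave it.
  set D : Set (ℝ × ℝ) := {p | 0 ≤ p.1 ∧ p.2 ∈ Icc (0 : ℝ) 1 ∧ p.1 + c.phi p.2 ≤ S} with hD
  set C := Cβ + Cω + 2 * Ck with hC
  have hC0 : 0 ≤ C := by positivity
  set L := 2 * C + 1 with hL
  have hL0 : 0 < L := by positivity
  have hfin : ∀ {b y : ℝ}, 0 ≤ b → C * b / L * Real.exp y ≤ b / 2 * Real.exp y := fun {b y} hb => by
    refine mul_le_mul_of_nonneg_right ?_ (Real.exp_pos _).le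
    rw [div_le_div_iff₀ hL0 two_pos]
    nlinarith
  have key := eq_zero_of_weighted_contraction (S := D)
    (fun p => max |e₁ p.1.1 p.1.2| |e₂ p.1.1 p.1.2|) (fun p => Real.exp (L * p.1.2))
    |M| (abs_nonneg M) (fun p => by
      have hle : p.1.1 ≤ S := by
        have := c.phi_nonneg p.2.2.1.1
        linarith [p.2.2.2]
      have := hM p.1.1 p.2.1 hle p.1.2 p.2.2.1
      exact ((max_le this.1 this.2).trans (le_abs_self M)).trans (le_mul_of_one_le_right
        (abs_nonneg M) (Real.one_le_exp (mul_nonneg hL0.le p.2.2.1.1))))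
    (fun b hb h => by
      have h1 : ∀ t z, 0 ≤ t → z ∈ Icc (0 : ℝ) 1 → t + c.phi z ≤ S →
          |e₁ t z| ≤ b * Real.exp (L * z) := fun t z ht hz hS =>
        (le_max_left _ _).trans (h ⟨(t, z), ht, hz, hS⟩)
      have h2 : ∀ t z, 0 ≤ t → z ∈ Icc (0 : ℝ) 1 → t + c.phi z ≤ S →
          |e₂ t z| ≤ b * Real.exp (L * z) := fun t z ht hz hS =>
        (le_max_right _ _).trans (h ⟨(t, z), ht, hz, hS⟩)
      have hin : ∀ z ∈ Icc (0 : ℝ) 1, c.phi z ≤ S →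
          |e₂ 0 z| ≤ 2 * Ck * b / L * Real.exp (L * z) := fun z hz hS => by
        rw [hinit z hz hS]
        refine abs_integral_exp_le hL0 hz.1 (by positivity) fun ζ hζ => ?_
        have hζ1 : ζ ∈ Icc (0 : ℝ) 1 := ⟨hζ.1, hζ.2.trans hz.2⟩
        have hζS : 0 + c.phi ζ ≤ S := by
          rw [zero_add]; exact (c.strictMono_phi.monotone hζ.2).trans hS
        refine (abs_add_le _ _).trans ?_
        rw [abs_mul, abs_mul]
        have m1 := mul_le_mul (hk 0 z hz ζ hζ) (h1 0 ζ le_rfl hζ1 hζS) (abs_nonneg _) hCk0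
        have m2 := mul_le_mul (hk 1 z hz ζ hζ) (h2 0 ζ le_rfl hζ1 hζS) (abs_nonneg _) hCk0
        linarith
      rintro ⟨⟨t, z⟩, ht, hz, hS⟩
      simp only at ht hz hS ⊢
      refine max_le ?_ ?_
      · rw [h₁ t ht z hz hS, abs_neg]
        refine (abs_integral_exp_le (C := C * b) hL0 hz.1 (by positivity) fun ζ hζ => ?_).trans
          (hfin hb)
        have hζ1 : ζ ∈ Icc (0 : ℝ) 1 := ⟨hζ.1, hζ.2.trans hz.2⟩
        have hm := c.strictMono_phi.monotone hζ.2
        rw [mul_div_right_comm, abs_mul, mul_assoc]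
        refine mul_le_mul ((hCβ ζ hζ1).trans (by simp only [hC]; linarith))
          (h2 _ _ (by linarith) hζ1 (by linarith)) (abs_nonneg _) hC0
      -- The characteristic of the second component, followed back, reaches either `z = 0`, where
      -- `e₂` vanishes, or the initial time, where `hin` bounds it. The starting point is `z₀`.
      · have hz0 : ∃ z₀ ∈ Icc 0 z, 0 ≤ t - d.phi z + d.phi z₀ ∧
            |e₂ (t - d.phi z + d.phi z₀) z₀| ≤ 2 * Ck * b / L * Real.exp (L * z) := by
          rcases le_total (d.phi z) t with hle | hle
          · refine ⟨0, ⟨le_rfl, hz.1⟩, by simpa using hle, ?_⟩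
            have h3 := c.phi_nonneg hz.1
            have h4 := d.phi_nonneg hz.1
            rw [h₂₀ _ (by simpa using hle) (by simp; linarith), abs_zero]
            positivity
          · have hmem : d.psi (d.phi z - t) ∈ Icc 0 z :=
              ⟨d.psi_nonneg (by linarith), d.psi_le_iff.2 (by linarith)⟩
            refine ⟨d.psi (d.phi z - t), hmem, by rw [d.phi_psi]; linarith, ?_⟩
            rw [d.phi_psi, sub_add_sub_cancel, sub_self]
            refine (hin _ ⟨hmem.1, hmem.2.trans hz.2⟩ ?_).trans ?_
            · have := c.strictMono_phi.monotone hmem.2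
              linarith
            · exact mul_le_mul_of_nonneg_left (Real.exp_le_exp.2
                (mul_le_mul_of_nonneg_left hmem.2 hL0.le)) (by positivity)
        obtain ⟨z₀, hz₀, ht₀, hb₀⟩ := hz0
        have hcz := c.phi_nonneg hz.1
        have e := h₂ (t - d.phi z + d.phi z₀) ht₀ z₀ ⟨hz₀.1, hz₀.2.trans hz.2⟩ z ⟨hz₀.2, hz.2⟩
          (by linarith)
        have e' : t - d.phi z + d.phi z₀ + d.phi z - d.phi z₀ = t := by ring
        rw [e'] at e
        rw [e]
        have hint : |∫ ζ in z₀..z, ω ζ * e₁ (t - d.phi z + d.phi z₀ + d.phi ζ - d.phi z₀) ζ /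
            d.l ζ| ≤ Cω * b / L * Real.exp (L * z) := by
          -- The integrand is extended by zero to `[0, z]`, so that the weighted estimate for
          -- integrals from `0` applies.
          have := integral_ite_lt (f := fun ζ =>
            ω ζ * e₁ (t - d.phi z + d.phi z₀ + d.phi ζ - d.phi z₀) ζ / d.l ζ) hz₀.1 hz₀.2
          rw [← this]
          refine abs_integral_exp_le hL0 hz.1 (by positivity) fun ζ hζ => ?_
          have hζ1 : ζ ∈ Icc (0 : ℝ) 1 := ⟨hζ.1, hζ.2.trans hz.2⟩
          split_ifs with hlt
          · rw [mul_div_right_comm, abs_mul, mul_assoc]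
            have m1 := d.strictMono_phi.monotone hζ.2
            have m2 := c.strictMono_phi.monotone hζ.2
            have m3 := d.strictMono_phi.monotone hlt.le
            exact mul_le_mul (hCω ζ hζ1) (h1 _ _ (by linarith) hζ1 (by linarith))
              (abs_nonneg _) hCω0
          · rw [abs_zero]; positivity
        refine ((abs_add_le _ _).trans (add_le_add hb₀ hint)).trans (le_trans ?_ (hfin hb))
        rw [← add_mul, ← add_div, ← add_mul]
        gcongr
        simp only [hC]
        linarith)
  intro t ht z hz hS
  have := key ⟨(t, z), ht, hz, hS⟩
  exact ⟨abs_nonpos_iff.1 ((le_max_left _ _).trans this),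
    abs_nonpos_iff.1 ((le_max_right _ _).trans this)⟩

end ScaledTransport

/-! ### One trajectory on `[-τ₂, ∞)` behind the canonical states. -/

section History
open MeasureTheory

theorem LocBddOn.exists_extension {f : ℝ → ℝ} {a b : ℝ} (hf : LocBddOn f a b) :
    ∃ (g : ℝ → ℝ) (M : ℝ), Measurable g ∧ (∀ x, |g x| ≤ M) ∧ EqOn f g (Icc a b) := by
  obtain ⟨g, hg, e⟩ := hf
  obtain ⟨M, hM⟩ := hg.bdd (Icc a b) isCompact_Icc
  refine ⟨(Icc a b).indicator g, |M|, hg.meas.indicator measurableSet_Icc, fun x => ?_,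
    fun x hx => by rw [e hx, indicator_of_mem hx]⟩
  by_cases hx : x ∈ Icc a b
  · rw [indicator_of_mem hx]; exact (hM x hx).trans (le_abs_self M)
  · rw [indicator_of_notMem hx, abs_zero]; exact abs_nonneg _

theorem continuousOn_Ici_of_Icc {E : Type*} [TopologicalSpace E] {f : ℝ → E} {a : ℝ}
    (h : ∀ T, ContinuousOn f (Icc a T)) : ContinuousOn f (Ici a) := fun x hx =>
  (h (x + 1) x ⟨hx, by linarith⟩).mono_of_mem_nhdsWithin <| by
    rw [← Ici_inter_Iic]
    exact inter_mem_nhdsWithin _ (Iic_mem_nhds (by linarith))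

namespace PDEODESystem

variable {n : ℕ} {P : PDEODESystem n} {K : ℝ → ℝ → Matrix (Fin 2) (Fin 2) ℝ}

theorem tau1_pos : 0 < P.tau1 := by
  rw [tau1_eq, ← (P.speed 0).phi_zero]
  exact (P.speed 0).strictMono_phi zero_lt_one

/-- Outside `[a, b]` the boundary values are replaced by zero, which makes them bounded on the whole
line; the strip solution is afterwards used only where its boundary values come from the interval.
-/
theorem IsTrajectory.exists_strip {ξ : ℝ → Fin n → ℝ} {v : ℝ → ℝ} {a b : ℝ}
    (h : P.IsTrajectory ξ v a b) : ∃ v₁ v₂ X₁ X₂, P.StripSolution v₁ v₂ X₁ X₂ ∧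
      EqOn v v₁ (Icc a b) ∧ EqOn (fun τ => P.q0 * v τ + P.c ⬝ᵥ ξ τ) v₂ (Icc a b) := by
  obtain ⟨v₁, M₁, m₁, b₁, e₁⟩ := h.locBdd.exists_extension
  obtain ⟨v₂, M₂, m₂, b₂, e₂⟩ := ((h.locBdd.const_mul P.q0).add
    (.of_continuousOn (continuousOn_dotProduct P.c h.cont))).exists_extension
  obtain ⟨X₁, X₂, hX⟩ := exists_isStripSolution (P.speed 0) (P.speed 1)
    (P.continuous_coupling 0 1) (P.continuous_coupling 1 0) m₁ m₂ (M := max M₁ M₂)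
    fun t => ⟨(b₁ t).trans (le_max_left _ _), (b₂ t).trans (le_max_right _ _)⟩
  exact ⟨v₁, v₂, X₁, X₂, hX, e₁, e₂⟩

/-- The backstepping transformation maps the solution on the strip to the parametrization. -/
theorem StripSolution.sub_volterra (hK : P.IsKernel K) (hq : P.q0 ≠ 0) {v₁ v₂ : ℝ → ℝ}
    {X₁ X₂ : ℝ × ℝ → ℝ} (hX : P.StripSolution v₁ v₂ X₁ X₂) {ξ : ℝ → Fin n → ℝ} {v : ℝ → ℝ}
    {a b : ℝ} (h₁ : EqOn v v₁ (Icc a b))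
    (h₂ : EqOn (fun τ => P.q0 * v τ + P.c ⬝ᵥ ξ τ) v₂ (Icc a b)) {t z : ℝ}
    (hz : z ∈ Icc (0 : ℝ) 1) (i : Fin 2)
    (hwin : ∀ τ ∈ Icc 0 (P.phi i z), t + (if i = 0 then τ else -τ) ∈ Icc a b) :
    ![X₁ (t, z), X₂ (t, z)] i - volterra K (fun z => ![X₁ (t, z), X₂ (t, z)]) z i =
      P.parX K (fun τ => ξ (t + τ)) (fun τ => v (t + τ)) z i := by
  have hphi : ∀ ζ ∈ uIcc 0 z, P.phi i z - P.phi i ζ ∈ Icc 0 (P.phi i z) := fun ζ hζ => by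
    rw [uIcc_of_le hz.1] at hζ
    have hζ' : ζ ∈ Icc (0 : ℝ) 1 := ⟨hζ.1, hζ.2.trans hz.2⟩
    exact ⟨sub_nonneg.2 ((strictMonoOn_phi i).monotoneOn hζ' hz hζ.2),
      sub_le_self _ (P.phi_mem i hζ').1⟩
  have hz' : P.phi i z ∈ Icc 0 (P.phi i z) := ⟨(P.phi_mem i hz).1, le_rfl⟩
  have hd : ∀ s ∈ Icc a b, v₂ s - P.q0 * v₁ s = P.c ⬝ᵥ ξ s := fun s hs => by
    rw [← h₁ hs, ← h₂ hs]; ring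
  fin_cases i
  · have h := hK.backstepping₀ hX t hz
    have e := integral_source (P := P) (K := K) 0 (fun σ => P.c ⬝ᵥ ξ (t + σ)) hz
    simp only [Fin.zero_eta, if_true] at hphi hwin hz'
    simp only [Fin.zero_eta, Matrix.cons_val_zero, parX, volterra, Matrix.mulVec, dotProduct,
      Fin.sum_univ_two, Matrix.cons_val_one] at h ⊢
    simp only [dotProduct] at e
    rw [h, ← e, h₁ (hwin _ hz')]
    congr 1
    refine intervalIntegral.integral_congr fun ζ hζ => ?_
    have := hd _ (hwin _ (hphi ζ hζ))
    rw [dotProduct] at this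
    simp only [← this, add_sub_assoc]
  · have h := hK.backstepping₁ hq hX t hz
    have e := integral_source (P := P) (K := K) 1 (fun σ => P.c ⬝ᵥ ξ (t + -σ)) hz
    simp only [Fin.mk_one, one_ne_zero, if_false] at hphi hwin hz'
    simp only [Fin.mk_one, Matrix.cons_val_zero, parX, volterra, Matrix.mulVec,
      Matrix.cons_val_one] at h ⊢
    have hv := h₂ (hwin _ hz')
    simp only at hv
    rw [hv, ← e]
    simp only [dotProduct, Fin.sum_univ_two, Matrix.cons_val_zero, Matrix.cons_val_one]
    rw [h, sub_eq_add_neg t]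
    congr 1
    refine intervalIntegral.integral_congr fun ζ hζ => ?_
    have := hd _ (hwin _ (hphi ζ hζ))
    rw [dotProduct, neg_sub, ← add_sub_assoc, ← sub_add_eq_add_sub, sub_eq_add_neg t] at this
    simp only [neg_sub, ← this, ← add_sub_assoc, ← sub_add_eq_add_sub, sub_eq_add_neg t]

variable (P) in
/-- `(ξ, v)` is a trajectory on `[-τ₂, ∞)` from which the states `(η, η_{n+1})` originate. -/
structure IsHistory (ξ : ℝ → Fin n → ℝ) (v : ℝ → ℝ) (η : ℝ → Fin n → ℝ) (ηd : ℝ → ℝ → ℝ) :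
    Prop where
  traj : ∀ T, P.IsTrajectory ξ v (-P.tau2) T
  xi_eq : ∀ t, 0 ≤ t → EqOn (P.xiPar (η t) (ηd t)) (fun τ => ξ (t + τ)) (Icc (-P.tau2) P.tau1)
  v_eq : ∀ t, 0 ≤ t → EqOn (P.x10Par (η t) (ηd t)) (fun τ => v (t + τ)) (Icc (-P.tau2) P.tau1)

namespace IsHistory

variable {ξ : ℝ → Fin n → ℝ} {v : ℝ → ℝ} {η : ℝ → Fin n → ℝ} {ηd : ℝ → ℝ → ℝ}

theorem etad_eq (h : P.IsHistory ξ v η ηd) {t τ : ℝ} (ht : 0 ≤ t)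
    (hτ : τ ∈ Icc (-P.tau2) P.tau1) :
    ηd t τ = v (t + τ) + (P.h ᵥ* P.F ^ n) ⬝ᵥ ξ (t + τ) := by
  have h1 := h.v_eq t ht hτ
  have h2 := h.xi_eq t ht hτ
  simp only at h1 h2
  rw [← h1, ← h2, x10Par, sub_add_cancel]

theorem eta_eq (h : P.IsHistory ξ v η ηd) (hc : P.Controllable) {t : ℝ} (ht : 0 ≤ t) :
    η t = P.Tc *ᵥ ξ (t - P.tau2) := by
  have h2 := h.xi_eq t ht left_mem_window
  simp only [← sub_eq_add_neg] at h2
  rw [← h2, hc.Tc_mulVec_xiPar, yDer_left]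

theorem continuousOn (h : P.IsHistory ξ v η ηd) : ContinuousOn ξ (Ici (-P.tau2)) :=
  continuousOn_Ici_of_Icc fun T => (h.traj T).cont

theorem isHCCFSolution (h : P.IsHistory ξ v η ηd) (hc : P.Controllable)
    {a : Fin (n + 1) → ℝ} {ad : ℝ → ℝ} {ubar : ℝ → ℝ}
    (hpc : ∀ t, 0 ≤ t → P.IsHCCFState (η t) (ηd t))
    (hbc : ∀ t, 0 ≤ t → ηd t P.tau1 =
      -(∫ τ in (-P.tau2)..P.tau1, ad τ * ηd t τ) - ∑ i : Fin n, a i.castSucc * η t i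
        - a (Fin.last n) * ηd t (-P.tau2) + ubar t) : P.IsHCCFSolution a ad η ηd ubar where
  eta_continuousOn := by
    have h1 : ContinuousOn (fun t => ξ (t - P.tau2)) (Ici 0) :=
      h.continuousOn.comp (by fun_prop) fun t ht => by
        have : 0 ≤ t := ht
        simp only [mem_Ici]
        linarith
    exact continuousOn_pi.2 fun i => (continuousOn_mulVec P.Tc h1 i).congr fun t ht =>
      congrFun (h.eta_eq hc ht) i
  pc := hpc
  chain t ht i := by
    have h1 := (h.traj (t - P.tau2)).chain hc (s := -P.tau2) (t := t - P.tau2)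
      ⟨le_rfl, by linarith⟩ ⟨by linarith, le_rfl⟩ i
    have h0 := h.eta_eq hc le_rfl
    rw [zero_sub] at h0
    rw [← h.eta_eq hc ht, ← h0] at h1
    rw [h1]
    congr 1
    have h2 := intervalIntegral.integral_comp_sub_right (a := 0) (b := t) (fun r =>
      chainNext (P.Tc *ᵥ ξ r) (v r + (P.h ᵥ* P.F ^ n) ⬝ᵥ ξ r) i) P.tau2
    rw [zero_sub] at h2
    rw [← h2]
    refine intervalIntegral.integral_congr fun s hs => ?_
    rw [uIcc_of_le ht] at hs
    rw [← h.eta_eq hc hs.1, sub_eq_add_neg, ← h.etad_eq hs.1 left_mem_window]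
    rfl
  transport t ht s hs τ hτ hτs := by
    rw [h.etad_eq (add_nonneg ht hs) ⟨hτ, by linarith⟩, h.etad_eq ht ⟨by linarith, hτs⟩,
      add_assoc, add_comm s τ]
  bc := hbc

end IsHistory

/-- The canonical form has a history. -/
theorem IsHCCFSolution.exists_history (hc : P.Controllable) {a : Fin (n + 1) → ℝ} {ad : ℝ → ℝ}
    {η : ℝ → Fin n → ℝ} {ηd : ℝ → ℝ → ℝ} {ubar : ℝ → ℝ}
    (h : P.IsHCCFSolution a ad η ηd ubar) : ∃ ξ v, P.IsHistory ξ v η ηd := by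
  -- By transport every profile value eventually arrives at the left end of the window. The trace
  -- there collects all profiles in one function of `t + τ`.
  set Y : ℝ → ℝ := fun r => ηd (r + P.tau2) (-P.tau2) with hY
  have hY' : ∀ t, 0 ≤ t → ∀ τ ∈ Icc (-P.tau2) P.tau1, ηd t τ = Y (t + τ) := fun t ht τ hτ => by
    have := h.transport t ht (τ + P.tau2) (by linarith [hτ.1]) (-P.tau2) le_rfl
      (by linarith [hτ.2])
    simp only [hY]
    rw [add_assoc, this]
    congr 1
    ring
  have hδ : 0 < P.tau1 + P.tau2 := by linarith [P.tau1_pos, P.tau2_nonneg]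
  have hwin : ∀ t, 0 ≤ t → LocBddOn Y (t - P.tau2) (t + P.tau1) := fun t ht => by
    have := ((LocBddOn.of_piecewise (h.pc t ht)).congr
      (fun τ hτ => (hY' t ht τ hτ).symm)).comp_add (-t)
    simp only [add_neg_cancel_left, sub_neg_eq_add] at this
    rwa [← sub_eq_neg_add, add_comm P.tau1] at this
  -- Consecutive windows of length `τ₁ + τ₂` are attached end to end; this length is positive, so
  -- they cover any bounded interval.
  have hsteps : ∀ k : ℕ, LocBddOn Y (-P.tau2) (k * (P.tau1 + P.tau2) + P.tau1) := fun k => by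
    induction k with
    | zero => simpa using hwin 0 le_rfl
    | succ k ih =>
      have := hwin ((k + 1) * (P.tau1 + P.tau2)) (by positivity)
      have e : ((k : ℝ) + 1) * (P.tau1 + P.tau2) - P.tau2 = k * (P.tau1 + P.tau2) + P.tau1 := by
        ring
      rw [e] at this
      push_cast
      exact ih.glue this
  have lY : ∀ T, LocBddOn Y (-P.tau2) T := fun T => by
    obtain ⟨k, hk⟩ := Archimedean.arch T hδ
    rw [nsmul_eq_mul] at hk
    exact (hsteps k).mono le_rfl (by linarith [P.tau1_pos])
  have traj : ∀ T, P.IsTrajectory (P.xiPar (η 0) Y) (P.x10Par (η 0) Y) (-P.tau2) T := fun T =>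
    isTrajectory_xiPar hc (lY T)
  -- The chain component of the state evolves as Taylor's formula does, driven by the same input
  -- with delay `τ₂`.
  have hη : ∀ t, 0 ≤ t → η t = P.yDer (η 0) Y (t - P.tau2) := fun t ht => by
    have hchain : ∀ r ∈ Icc (-P.tau2) (t - P.tau2), ∀ i, η (r + P.tau2) i =
        η (-P.tau2 + P.tau2) i + ∫ s in (-P.tau2)..r, chainNext (η (s + P.tau2)) (Y s) i :=
      fun r hr i => by
        rw [neg_add_cancel, h.chain (r + P.tau2) (by linarith [hr.1]) i]
        congr 1
        have h2 := intervalIntegral.integral_comp_add_right (a := -P.tau2) (b := r) (fun s =>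
          chainNext (η s) (ηd s (-P.tau2)) i) P.tau2
        rw [neg_add_cancel] at h2
        exact h2.symm
    have := chain_unique (Y := fun r => η (r + P.tau2)) (Y' := P.yDer (η 0) Y) (w := Y) (w' := Y)
      (by simp only [yDer_left, neg_add_cancel]) (fun _ _ => rfl) hchain
      (fun r hr i => by
        rw [yDer_left]; exact yDer_chain_of_locBddOn (lY (t - P.tau2)) hr i)
      (t - P.tau2) ⟨by linarith, le_rfl⟩
    simpa using this
  have key : ∀ t, 0 ≤ t → ∀ τ ∈ Icc (-P.tau2) P.tau1,
      P.xiPar (η t) (ηd t) τ = P.xiPar (η 0) Y (t + τ) ∧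
      P.x10Par (η t) (ηd t) τ = P.x10Par (η 0) Y (t + τ) := fun t ht τ hτ => by
    have hs := ((traj (t + P.tau1)).shift t).mono (a' := -P.tau2) (b' := P.tau1) (by linarith)
      (by linarith)
    refine hs.xiPar_eq hc ?_ (fun σ hσ => ?_) hτ
    · rw [hc.Tc_mulVec_xiPar, ← sub_eq_add_neg, hη t ht]
    · rw [hY' t ht σ hσ, x10Par, sub_add_cancel]
  exact ⟨_, _, traj, fun t ht τ hτ => (key t ht τ hτ).1, fun t ht τ hτ => (key t ht τ hτ).2⟩

end PDEODESystem

end History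

/-! ### From a history to a solution of the system. -/

section Equivalence
open MeasureTheory

namespace PDEODESystem

variable {n : ℕ} {P : PDEODESystem n} {K : ℝ → ℝ → Matrix (Fin 2) (Fin 2) ℝ}

/-- Measurable, locally bounded functions of `(t, z) ∈ [0, ∞) × [0, 1]`. -/
structure IsLocBddProfile (x : ℝ → ℝ → Fin 2 → ℝ) : Prop where
  measurable : ∀ i, Measurable fun p : Icc (0 : ℝ) 1 × Ici (0 : ℝ) => x p.2 p.1 i
  locally_bounded : ∀ T : ℝ, ∃ M : ℝ, ∀ t ∈ Icc 0 T, ∀ z ∈ Icc (0 : ℝ) 1, ∀ i, |x t z i| ≤ M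

/-- Clamping the curve to `t ≥ 0` and `[0, 1]` makes the trace a globally defined measurable
function without changing it on the interval in question. -/
theorem IsLocBddProfile.locBddOn {x : ℝ → ℝ → Fin 2 → ℝ} (hx : IsLocBddProfile x) {s ρ : ℝ → ℝ}
    (hs : Continuous s) (hρ : Continuous ρ) {a b : ℝ} (hs0 : ∀ ζ ∈ Icc a b, 0 ≤ s ζ)
    (hρ1 : ∀ ζ ∈ Icc a b, ρ ζ ∈ Icc (0 : ℝ) 1) (i : Fin 2) :
    LocBddOn (fun ζ => x (s ζ) (ρ ζ) i) a b := by
  refine ⟨fun ζ => x (max (s ζ) 0) (clampUnit (ρ ζ)) i, ⟨?_, fun C hC => ?_⟩, fun ζ hζ => ?_⟩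
  · exact (hx.measurable i).comp (f := fun ζ => ((⟨clampUnit (ρ ζ), clampUnit_mem _⟩ : Icc (0 : ℝ) 1),
      (⟨max (s ζ) 0, mem_Ici.2 (le_max_right _ _)⟩ : Ici (0 : ℝ))))
      (Measurable.prodMk ((by fun_prop : Continuous fun ζ => clampUnit (ρ ζ)).measurable.subtype_mk)
        ((by fun_prop : Continuous fun ζ => max (s ζ) 0).measurable.subtype_mk))
  · obtain ⟨B, hB⟩ := hC.exists_bound_of_continuousOn hs.continuousOn
    obtain ⟨M, hM⟩ := hx.locally_bounded |B|
    exact ⟨M, fun ζ hζ => hM _ ⟨le_max_right (s ζ) 0, max_le ((le_abs_self _).trans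
      ((hB ζ hζ).trans (le_abs_self B))) (abs_nonneg B)⟩ _ (clampUnit_mem _) i⟩
  · simp only [max_eq_left (hs0 ζ hζ), clampUnit_eq (hρ1 ζ hζ)]

theorem locBddOn_along₀ {x : ℝ → ℝ → Fin 2 → ℝ} (hx : IsLocBddProfile x) {t z' : ℝ} (ht : 0 ≤ t)
    (hz' : z' ∈ Icc (0 : ℝ) 1) (i : Fin 2) :
    LocBddOn (fun ζ => x (t + (P.phi 0 z' - P.phi 0 ζ)) ζ i) 0 z' := by
  have hm : ∀ ζ ∈ Icc 0 z', ζ ∈ Icc (0 : ℝ) 1 := fun ζ hζ => ⟨hζ.1, hζ.2.trans hz'.2⟩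
  have hle : ∀ ζ ∈ Icc 0 z', P.phi 0 ζ ≤ P.phi 0 z' := fun ζ hζ =>
    (strictMonoOn_phi 0).monotoneOn (hm ζ hζ) hz' hζ.2
  refine (hx.locBddOn (s := fun ζ => t + (P.phi 0 z' - (P.speed 0).phi ζ)) (ρ := fun ζ => ζ)
    ?_ continuous_id (fun ζ hζ => ?_) hm i).congr fun ζ hζ => ?_
  · have := (P.speed 0).continuous_phi
    fun_prop
  · rw [P.speed_phi 0 (hm ζ hζ)]; linarith [hle ζ hζ]
  · simp only [P.speed_phi 0 (hm ζ hζ)]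

theorem locBddOn_along₁ {x : ℝ → ℝ → Fin 2 → ℝ} (hx : IsLocBddProfile x) {t z : ℝ} (ht : 0 ≤ t)
    (hz : z ∈ Icc (0 : ℝ) 1) (i : Fin 2) :
    LocBddOn (fun ζ => x (t + (P.phi 1 ζ - P.phi 1 z)) ζ i) z 1 := by
  have hm : ∀ ζ ∈ Icc z 1, ζ ∈ Icc (0 : ℝ) 1 := fun ζ hζ => ⟨hz.1.trans hζ.1, hζ.2⟩
  have hle : ∀ ζ ∈ Icc z 1, P.phi 1 z ≤ P.phi 1 ζ := fun ζ hζ =>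
    (strictMonoOn_phi 1).monotoneOn hz (hm ζ hζ) hζ.1
  refine (hx.locBddOn (s := fun ζ => t + ((P.speed 1).phi ζ - P.phi 1 z)) (ρ := fun ζ => ζ)
    ?_ continuous_id (fun ζ hζ => ?_) hm i).congr fun ζ hζ => ?_
  · have := (P.speed 1).continuous_phi
    fun_prop
  · rw [P.speed_phi 1 (hm ζ hζ)]; linarith [hle ζ hζ]
  · simp only [P.speed_phi 1 (hm ζ hζ)]

/-- The equivalence concerns a whole characteristic rather than one pair of end points, because the
integrating factor needs the equation at all intermediate points. -/
theorem transport_iff₀ {x : ℝ → ℝ → Fin 2 → ℝ} (hx : IsLocBddProfile x) {t z' : ℝ} (ht : 0 ≤ t)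
    (hz' : z' ∈ Icc (0 : ℝ) 1) :
    (∀ z ∈ Icc 0 z', x (t + (P.phi 0 z' - P.phi 0 z)) z 0 = x t z' 0 +
      ∫ ζ in z..z', (P.A ζ *ᵥ x (t + (P.phi 0 z' - P.phi 0 ζ)) ζ) 0 / P.lam 0 ζ) ↔
    ∀ z ∈ Icc 0 z', P.scaled (x (t + (P.phi 0 z' - P.phi 0 z))) z 0 = P.scaled (x t) z' 0 +
      ∫ ζ in z..z', P.coupling 0 1 ζ * P.scaled (x (t + (P.phi 0 z' - P.phi 0 ζ))) ζ 1 /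
        (P.speed 0).l ζ := by
  have h := scaledRow_iff₀ (P := P) (X := fun ζ => x (t + (P.phi 0 z' - P.phi 0 ζ)) ζ) hz'
    (locBddOn_along₀ hx ht hz')
  have e : ∀ y, P.scaled (fun ζ => x (t + (P.phi 0 z' - P.phi 0 ζ)) ζ) y =
      P.scaled (x (t + (P.phi 0 z' - P.phi 0 y))) y := fun y => scaled_congr rfl
  simp only [e, sub_self, add_zero] at h
  exact h

theorem transport_iff₁ {x : ℝ → ℝ → Fin 2 → ℝ} (hx : IsLocBddProfile x) {t z : ℝ} (ht : 0 ≤ t)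
    (hz : z ∈ Icc (0 : ℝ) 1) :
    (∀ z' ∈ Icc z 1, x (t + (P.phi 1 z' - P.phi 1 z)) z' 1 = x t z 1 +
      ∫ ζ in z..z', (P.A ζ *ᵥ x (t + (P.phi 1 ζ - P.phi 1 z)) ζ) 1 / P.lam 1 ζ) ↔
    ∀ z' ∈ Icc z 1, P.scaled (x (t + (P.phi 1 z' - P.phi 1 z))) z' 1 = P.scaled (x t) z 1 +
      ∫ ζ in z..z', P.coupling 1 0 ζ * P.scaled (x (t + (P.phi 1 ζ - P.phi 1 z))) ζ 0 /
        (P.speed 1).l ζ := by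
  have h := scaledRow_iff₁ (P := P) (X := fun ζ => x (t + (P.phi 1 ζ - P.phi 1 z)) ζ) hz
    (locBddOn_along₁ hx ht hz)
  have e : ∀ y, P.scaled (fun ζ => x (t + (P.phi 1 ζ - P.phi 1 z)) ζ) y =
      P.scaled (x (t + (P.phi 1 y - P.phi 1 z))) y := fun y => scaled_congr rfl
  simp only [e, sub_self, add_zero] at h
  exact h

theorem locBddOn_strip {v₁ v₂ : ℝ → ℝ} {X₁ X₂ : ℝ × ℝ → ℝ} (hX : P.StripSolution v₁ v₂ X₁ X₂)
    (t : ℝ) (i : Fin 2) : LocBddOn (fun z => ![X₁ (t, z), X₂ (t, z)] i) 0 1 := by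
  fin_cases i
  · exact .of_locBdd (hX.locBdd₁.comp (k := fun z => (t, z)) (by fun_prop))
  · exact .of_locBdd (hX.locBdd₂.comp (k := fun z => (t, z)) (by fun_prop))

variable (P) in
/-- On every bounded time interval, `x̃` is the solution on the strip that is generated by the
trajectory `(ξ, v)`. -/
def FollowsStrip (ξ : ℝ → Fin n → ℝ) (v : ℝ → ℝ) (x : ℝ → ℝ → Fin 2 → ℝ) : Prop :=
  ∀ T : ℝ, ∃ v₁ v₂ X₁ X₂, P.StripSolution v₁ v₂ X₁ X₂ ∧ EqOn v v₁ (Icc (-P.tau2) (T + P.tau1)) ∧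
    EqOn (fun τ => P.q0 * v τ + P.c ⬝ᵥ ξ τ) v₂ (Icc (-P.tau2) (T + P.tau1)) ∧
    ∀ t ∈ Icc 0 T, ∀ z ∈ Icc (0 : ℝ) 1, P.scaled (x t) z = ![X₁ (t, z), X₂ (t, z)]

theorem strip_window {t T : ℝ} (ht : t ∈ Icc 0 T) {z : ℝ} (hz : z ∈ Icc (0 : ℝ) 1) (i : Fin 2) :
    ∀ τ ∈ Icc 0 (P.phi i z),
      t + (if i = 0 then τ else -τ) ∈ Icc (-P.tau2) (T + P.tau1) := fun τ hτ => by
  have h1 : P.phi i z ≤ P.phi i 1 := (P.phi_mem i hz).2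
  have h2 := P.tau1_nonneg
  have h3 := P.tau2_nonneg
  fin_cases i
  · have : P.phi 0 1 = P.tau1 := rfl
    simp only [Fin.zero_eta] at h1 hτ
    simp only [Fin.zero_eta, if_true]
    exact ⟨by linarith [ht.1, hτ.1], by linarith [ht.2, hτ.2]⟩
  · have : P.phi 1 1 = P.tau2 := rfl
    simp only [Fin.mk_one] at h1 hτ
    simp only [Fin.mk_one, one_ne_zero, if_false]
    exact ⟨by linarith [ht.1, hτ.2], by linarith [ht.2, hτ.1]⟩

/-- The scaled profile and the strip solution have the same image `parX` under the backstepping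
transformation, which is injective. -/
theorem IsHistory.followsStrip (hK : P.IsKernel K) (hq : P.q0 ≠ 0) {ξ : ℝ → Fin n → ℝ}
    {v : ℝ → ℝ} {ξx : ℝ → Fin n → ℝ} {x : ℝ → ℝ → Fin 2 → ℝ} {η : ℝ → Fin n → ℝ}
    {ηd : ℝ → ℝ → ℝ} (h : P.IsHistory ξ v η ηd)
    (hC : ∀ t, 0 ≤ t → P.Corresponds K (ξx t) (x t) (η t) (ηd t)) : P.FollowsStrip ξ v x := by
  intro T
  obtain ⟨v₁, v₂, X₁, X₂, hX, e₁, e₂⟩ := (h.traj (T + P.tau1)).exists_strip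
  refine ⟨v₁, v₂, X₁, X₂, hX, e₁, e₂, fun t ht => ?_⟩
  refine hK.eqOn_of_sub_volterra_eq (locBddOn_scaled (hC t ht.1).isState.pc)
    (fun i => locBddOn_strip hX t i) fun z hz => ?_
  rw [← xbar_eq, (hC t ht.1).xbar_eq z hz, xbarPar_eq _ _ hz,
    parX_congr (h.xi_eq t ht.1) (h.v_eq t ht.1) hz]
  funext i
  exact (hX.sub_volterra hK hq e₁ e₂ hz i (strip_window ht hz i)).symm

/-- The correspondence constrains each time separately and says nothing of joint measurability in
`(z, t)`; this is inherited from the strip solutions. -/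
theorem FollowsStrip.isLocBddProfile {ξ : ℝ → Fin n → ℝ} {v : ℝ → ℝ} {x : ℝ → ℝ → Fin 2 → ℝ}
    (h : P.FollowsStrip ξ v x) : IsLocBddProfile x := by
  choose v₁ v₂ X₁ X₂ hX e₁ e₂ hx using h
  set E : Fin 2 → ℝ → ℝ := fun i z => if i = 0 then Real.exp (-P.alpha 0 (clampUnit z)) else
    Real.exp (P.alpha 1 (clampUnit z)) with hE
  have hEc : ∀ i, Continuous (E i) := fun i => by
    have h1 : ∀ i, Continuous fun z => P.alpha i (clampUnit z) := fun i =>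
      (P.continuousOn_alpha i).comp_continuous continuous_clampUnit clampUnit_mem
    have h10 := h1 0
    have h11 := h1 1
    fin_cases i
    · simp only [hE, Fin.zero_eta, if_true]; fun_prop
    · simp only [hE, Fin.mk_one, one_ne_zero, if_false]; fun_prop
  have hunscale : ∀ T, ∀ t ∈ Icc 0 T, ∀ z ∈ Icc (0 : ℝ) 1, ∀ i,
      x t z i = E i z * ![X₁ T (t, z), X₂ T (t, z)] i := fun T t ht z hz i => by
    rw [← hx T t ht z hz]
    fin_cases i <;> simp [hE, scaled, clampUnit_eq hz, ← mul_assoc, ← Real.exp_add]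
  constructor
  · intro i
    -- The strip solution depends on the time horizon `k`. For each fixed point the sequence is
    -- constant once `k` exceeds the time.
    refine measurable_of_tendsto_metrizable (f := fun (k : ℕ) (p : Icc (0 : ℝ) 1 × Ici (0 : ℝ)) =>
      E i p.1 * ![X₁ k ((p.2 : ℝ), (p.1 : ℝ)), X₂ k ((p.2 : ℝ), (p.1 : ℝ))] i) (fun k => ?_)
      (tendsto_pi_nhds.2 fun p => ?_)
    · have mp : Measurable fun p : Icc (0 : ℝ) 1 × Ici (0 : ℝ) => ((p.2 : ℝ), (p.1 : ℝ)) := by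
        fun_prop
      have m : Measurable fun p : Icc (0 : ℝ) 1 × Ici (0 : ℝ) =>
          ![X₁ k ((p.2 : ℝ), (p.1 : ℝ)), X₂ k ((p.2 : ℝ), (p.1 : ℝ))] i := by
        fin_cases i
        · exact (hX k).meas₁.comp mp
        · exact (hX k).meas₂.comp mp
      exact ((hEc i).measurable.comp (measurable_subtype_coe.comp measurable_fst)).mul m
    · refine tendsto_const_nhds.congr' ?_
      filter_upwards [eventually_ge_atTop ⌈(p.2 : ℝ)⌉₊] with k hk
      exact hunscale k p.2 ⟨p.2.2, (Nat.le_ceil _).trans (Nat.cast_le.2 hk)⟩ p.1 p.1.2 i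
  · intro T
    obtain ⟨C, hC⟩ := (hX T).bdd
    have hb : ∀ i, ∃ B, ∀ z ∈ Icc (0 : ℝ) 1, ‖E i z‖ ≤ B := fun i =>
      isCompact_Icc.exists_bound_of_continuousOn (hEc i).continuousOn
    choose B hB using hb
    have hB0 : ∀ i, 0 ≤ B i := fun i => (norm_nonneg _).trans (hB i 0 ⟨le_rfl, zero_le_one⟩)
    have hC0 : 0 ≤ C := (abs_nonneg _).trans (hC 0).1
    refine ⟨(B 0 + B 1) * C, fun t ht z hz i => ?_⟩
    rw [hunscale T t ht z hz i, abs_mul]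
    refine mul_le_mul ((hB i z hz).trans ?_) ?_ (abs_nonneg _) (add_nonneg (hB0 0) (hB0 1))
    · fin_cases i
      · exact le_add_of_nonneg_right (hB0 1)
      · exact le_add_of_nonneg_left (hB0 0)
    · fin_cases i
      · exact (hC _).1
      · exact (hC _).2

/-- Both points lie on one characteristic and so refer to the same boundary value at `z = 0`;
subtracting their integral equations leaves the part between them. -/
theorem StripSolution.transport₀ {v₁ v₂ : ℝ → ℝ} {X₁ X₂ : ℝ × ℝ → ℝ}
    (hX : P.StripSolution v₁ v₂ X₁ X₂) (t : ℝ) {z z' : ℝ} (hz : z ∈ Icc (0 : ℝ) 1)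
    (hz' : z' ∈ Icc (0 : ℝ) 1) :
    X₁ (t + (P.phi 0 z' - P.phi 0 z), z) = X₁ (t, z') +
      ∫ ζ in z..z', P.coupling 0 1 ζ * X₂ (t + (P.phi 0 z' - P.phi 0 ζ), ζ) /
        (P.speed 0).l ζ := by
  have e1 := hX.eq₁ (t + (P.phi 0 z' - P.phi 0 z)) z hz
  have e2 := hX.eq₁ t z' hz'
  have l : LocBdd fun ζ => P.coupling 0 1 ζ *
      X₂ (t + (P.speed 0).phi z' - (P.speed 0).phi ζ, ζ) / (P.speed 0).l ζ := by
    have := (P.speed 0).continuous_phi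
    simp only [mul_div_right_comm]
    exact (LocBdd.of_continuous ((P.continuous_coupling 0 1).div (P.speed 0).continuous_l
      (P.speed 0).ne_zero)).mul (hX.locBdd₂.comp (by fun_prop))
  have h := intervalIntegral.integral_add_adjacent_intervals (l.intervalIntegrable 0 z)
    (l.intervalIntegrable z z')
  rw [← P.speed_phi 0 hz, ← P.speed_phi 0 hz'] at e1
  have e4 : t + ((P.speed 0).phi z' - (P.speed 0).phi z) + (P.speed 0).phi z =
      t + (P.speed 0).phi z' := by ring
  rw [e4] at e1
  have e3 : ∫ ζ in z..z', P.coupling 0 1 ζ * X₂ (t + (P.phi 0 z' - P.phi 0 ζ), ζ) /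
      (P.speed 0).l ζ = ∫ ζ in z..z', P.coupling 0 1 ζ *
      X₂ (t + (P.speed 0).phi z' - (P.speed 0).phi ζ, ζ) / (P.speed 0).l ζ := by
    refine intervalIntegral.integral_congr fun ζ hζ => ?_
    have : t + (P.phi 0 z' - P.phi 0 ζ) = t + (P.speed 0).phi z' - (P.speed 0).phi ζ := by
      rw [P.speed_phi 0 (uIcc_subset_Icc hz hz' hζ), P.speed_phi 0 hz']; ring
    simp only [this]
  rw [e3, ← P.speed_phi 0 hz, ← P.speed_phi 0 hz', e1, e2, ← h]
  ring

theorem StripSolution.transport₁ {v₁ v₂ : ℝ → ℝ} {X₁ X₂ : ℝ × ℝ → ℝ}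
    (hX : P.StripSolution v₁ v₂ X₁ X₂) (t : ℝ) {z z' : ℝ} (hz : z ∈ Icc (0 : ℝ) 1)
    (hz' : z' ∈ Icc (0 : ℝ) 1) :
    X₂ (t + (P.phi 1 z' - P.phi 1 z), z') = X₂ (t, z) +
      ∫ ζ in z..z', P.coupling 1 0 ζ * X₁ (t + (P.phi 1 ζ - P.phi 1 z), ζ) /
        (P.speed 1).l ζ := by
  have e1 := hX.eq₂ (t + (P.phi 1 z' - P.phi 1 z)) z' hz'
  have e2 := hX.eq₂ t z hz
  have l : LocBdd fun ζ => P.coupling 1 0 ζ *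
      X₁ (t - (P.speed 1).phi z + (P.speed 1).phi ζ, ζ) / (P.speed 1).l ζ := by
    have := (P.speed 1).continuous_phi
    simp only [mul_div_right_comm]
    exact (LocBdd.of_continuous ((P.continuous_coupling 1 0).div (P.speed 1).continuous_l
      (P.speed 1).ne_zero)).mul (hX.locBdd₁.comp (by fun_prop))
  have h := intervalIntegral.integral_add_adjacent_intervals (l.intervalIntegrable 0 z)
    (l.intervalIntegrable z z')
  rw [← P.speed_phi 1 hz, ← P.speed_phi 1 hz'] at e1
  have e4 : t + ((P.speed 1).phi z' - (P.speed 1).phi z) - (P.speed 1).phi z' =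
      t - (P.speed 1).phi z := by ring
  rw [e4] at e1
  have e3 : ∫ ζ in z..z', P.coupling 1 0 ζ * X₁ (t + (P.phi 1 ζ - P.phi 1 z), ζ) /
      (P.speed 1).l ζ = ∫ ζ in z..z', P.coupling 1 0 ζ *
      X₁ (t - (P.speed 1).phi z + (P.speed 1).phi ζ, ζ) / (P.speed 1).l ζ := by
    refine intervalIntegral.integral_congr fun ζ hζ => ?_
    have : t + (P.phi 1 ζ - P.phi 1 z) = t - (P.speed 1).phi z + (P.speed 1).phi ζ := by
      rw [P.speed_phi 1 (uIcc_subset_Icc hz hz' hζ), P.speed_phi 1 hz]; ring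
    simp only [this]
  rw [e3, ← P.speed_phi 1 hz, ← P.speed_phi 1 hz', e1, e2, ← h]
  ring

theorem FollowsStrip.transport₀ {ξ : ℝ → Fin n → ℝ} {v : ℝ → ℝ} {x : ℝ → ℝ → Fin 2 → ℝ}
    (h : P.FollowsStrip ξ v x) {t z z' : ℝ} (ht : 0 ≤ t) (hz : 0 ≤ z) (hzz : z ≤ z')
    (hz' : z' ≤ 1) : x (t + (P.phi 0 z' - P.phi 0 z)) z 0 = x t z' 0 +
      ∫ ζ in z..z', (P.A ζ *ᵥ x (t + (P.phi 0 z' - P.phi 0 ζ)) ζ) 0 / P.lam 0 ζ := by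
  have hz'm : z' ∈ Icc (0 : ℝ) 1 := ⟨hz.trans hzz, hz'⟩
  refine (transport_iff₀ h.isLocBddProfile ht hz'm).2 (fun z hz => ?_) z ⟨hz, hzz⟩
  obtain ⟨v₁, v₂, X₁, X₂, hX, -, -, hx⟩ := h (t + P.phi 0 z')
  have hm : ∀ ζ ∈ Icc 0 z', ζ ∈ Icc (0 : ℝ) 1 := fun ζ hζ => ⟨hζ.1, hζ.2.trans hz'⟩
  have hτ : ∀ ζ ∈ Icc 0 z', t + (P.phi 0 z' - P.phi 0 ζ) ∈ Icc 0 (t + P.phi 0 z') := fun ζ hζ =>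
    ⟨by linarith [(strictMonoOn_phi (P := P) 0).monotoneOn (hm ζ hζ) hz'm hζ.2],
      by linarith [(P.phi_mem 0 (hm ζ hζ)).1]⟩
  rw [hx _ (hτ z hz) z (hm z hz), hx t ⟨ht, by linarith [(P.phi_mem 0 hz'm).1]⟩ z' hz'm]
  simp only [Matrix.cons_val_zero]
  rw [hX.transport₀ t (hm z hz) hz'm]
  congr 1
  refine intervalIntegral.integral_congr fun ζ hζ => ?_
  rw [uIcc_of_le hz.2] at hζ
  have hζ' : ζ ∈ Icc 0 z' := ⟨hz.1.trans hζ.1, hζ.2⟩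
  simp only [hx _ (hτ ζ hζ') ζ (hm ζ hζ'), Matrix.cons_val_one, Matrix.cons_val_zero]

theorem FollowsStrip.transport₁ {ξ : ℝ → Fin n → ℝ} {v : ℝ → ℝ} {x : ℝ → ℝ → Fin 2 → ℝ}
    (h : P.FollowsStrip ξ v x) {t z z' : ℝ} (ht : 0 ≤ t) (hz : 0 ≤ z) (hzz : z ≤ z')
    (hz' : z' ≤ 1) : x (t + (P.phi 1 z' - P.phi 1 z)) z' 1 = x t z 1 +
      ∫ ζ in z..z', (P.A ζ *ᵥ x (t + (P.phi 1 ζ - P.phi 1 z)) ζ) 1 / P.lam 1 ζ := by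
  have hzm : z ∈ Icc (0 : ℝ) 1 := ⟨hz, hzz.trans hz'⟩
  refine (transport_iff₁ h.isLocBddProfile ht hzm).2 (fun z' hz' => ?_) z' ⟨hzz, hz'⟩
  obtain ⟨v₁, v₂, X₁, X₂, hX, -, -, hx⟩ := h (t + P.phi 1 1)
  have hm : ∀ ζ ∈ Icc z 1, ζ ∈ Icc (0 : ℝ) 1 := fun ζ hζ => ⟨hz.trans hζ.1, hζ.2⟩
  have hτ : ∀ ζ ∈ Icc z 1, t + (P.phi 1 ζ - P.phi 1 z) ∈ Icc 0 (t + P.phi 1 1) := fun ζ hζ =>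
    ⟨by linarith [(strictMonoOn_phi (P := P) 1).monotoneOn hzm (hm ζ hζ) hζ.1],
      by linarith [(P.phi_mem 1 (hm ζ hζ)).2, (P.phi_mem 1 hzm).1]⟩
  have hz1 : z' ∈ Icc z 1 := hz'
  rw [hx _ (hτ z' hz1) z' (hm z' hz1), hx t ⟨ht, by linarith [(P.phi_mem 1 hzm).1,
    (P.phi_mem 1 hzm).2]⟩ z hzm]
  simp only [Matrix.cons_val_one, Matrix.cons_val_zero]
  rw [hX.transport₁ t hzm (hm z' hz1)]
  congr 1
  refine intervalIntegral.integral_congr fun ζ hζ => ?_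
  rw [uIcc_of_le hz1.1] at hζ
  have hζ' : ζ ∈ Icc z 1 := ⟨hζ.1, hζ.2.trans hz1.2⟩
  simp only [hx _ (hτ ζ hζ') ζ (hm ζ hζ'), Matrix.cons_val_zero]

section

variable {ξx : ℝ → Fin n → ℝ} {x : ℝ → ℝ → Fin 2 → ℝ} {η : ℝ → Fin n → ℝ} {ηd : ℝ → ℝ → ℝ}

theorem Corresponds.x_zero {ξ₀ : Fin n → ℝ} {x₀ : ℝ → Fin 2 → ℝ} {η₀ : Fin n → ℝ} {ηd₀ : ℝ → ℝ}
    (h : P.Corresponds K ξ₀ x₀ η₀ ηd₀) : x₀ 0 0 = P.x10Par η₀ ηd₀ 0 := by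
  have h0 : (0 : ℝ) ∈ Icc (0 : ℝ) 1 := ⟨le_rfl, zero_le_one⟩
  have := congrFun (h.xbar_eq 0 h0) 0
  rw [xbar_zero, xbarPar_eq _ _ h0, parX_zero] at this
  simpa using this

theorem IsHistory.xi_eq_of_corresponds {ξ : ℝ → Fin n → ℝ} {v : ℝ → ℝ}
    (h : P.IsHistory ξ v η ηd) (hC : ∀ t, 0 ≤ t → P.Corresponds K (ξx t) (x t) (η t) (ηd t))
    {t : ℝ} (ht : 0 ≤ t) : ξx t = ξ t := by
  rw [(hC t ht).xi_eq, h.xi_eq t ht zero_mem_window]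
  simp only [add_zero]

theorem IsHistory.v_eq_of_corresponds {ξ : ℝ → Fin n → ℝ} {v : ℝ → ℝ}
    (h : P.IsHistory ξ v η ηd) (hC : ∀ t, 0 ≤ t → P.Corresponds K (ξx t) (x t) (η t) (ηd t))
    {t : ℝ} (ht : 0 ≤ t) : x t 0 0 = v t := by
  rw [(hC t ht).x_zero, h.v_eq t ht zero_mem_window]
  simp only [add_zero]

/-- The transport equations come from the strip solution and the ODE from the trajectory; the
condition at `z = 0` is part of admissibility. Only the controlled boundary remains as a hypothesis.
-/
theorem IsHistory.isSolution (hK : P.IsKernel K) (hq : P.q0 ≠ 0) {ξ : ℝ → Fin n → ℝ} {v : ℝ → ℝ}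
    (h : P.IsHistory ξ v η ηd) (hC : ∀ t, 0 ≤ t → P.Corresponds K (ξx t) (x t) (η t) (ηd t))
    {u : ℝ → ℝ} (hbc : ∀ t, 0 ≤ t → x t 1 0 = P.q1 * x t 1 1 + u t) :
    P.IsSolution ξx x u := by
  have hs := h.followsStrip hK hq hC
  refine ⟨?_, fun t ht => (hC t ht).isState.pc, hs.isLocBddProfile.measurable,
    hs.isLocBddProfile.locally_bounded, fun t ht i => ?_, fun t ht => (hC t ht).isState.bc0,
    fun t ht z z' => hs.transport₀ ht, fun t ht z z' => hs.transport₁ ht, hbc⟩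
  · exact (h.continuousOn.mono (Ici_subset_Ici.2 (zero_mem_window (P := P)).1)).congr
      fun t ht => h.xi_eq_of_corresponds hC ht
  · rw [h.xi_eq_of_corresponds hC ht, h.xi_eq_of_corresponds hC le_rfl,
      (h.traj t).eq_add_integral ⟨(zero_mem_window (P := P)).1, ht⟩
        ⟨by linarith [(zero_mem_window (P := P)).1], le_rfl⟩]
    congr 1
    refine intervalIntegral.integral_congr fun s hs => ?_
    rw [uIcc_of_le ht] at hs
    simp only [h.xi_eq_of_corresponds hC hs.1, h.v_eq_of_corresponds hC hs.1]

end

end PDEODESystem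

end Equivalence

/-! ### From a solution of the system to a history. -/

section SolutionHistory
open MeasureTheory

namespace PDEODESystem

variable {n : ℕ} {P : PDEODESystem n} {K : ℝ → ℝ → Matrix (Fin 2) (Fin 2) ℝ}

theorem IsLocBddProfile.scaled {x : ℝ → ℝ → Fin 2 → ℝ} (hx : IsLocBddProfile x) :
    IsLocBddProfile fun t => P.scaled (x t) := by
  set E : Fin 2 → ℝ → ℝ := fun i z => if i = 0 then Real.exp (P.alpha 0 (clampUnit z)) else
    Real.exp (-P.alpha 1 (clampUnit z)) with hE
  have hEc : ∀ i, Continuous (E i) := fun i => by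
    have h1 : ∀ i, Continuous fun z => P.alpha i (clampUnit z) := fun i =>
      (P.continuousOn_alpha i).comp_continuous continuous_clampUnit clampUnit_mem
    have h10 := h1 0
    have h11 := h1 1
    fin_cases i
    · simp only [hE, Fin.zero_eta, if_true]; fun_prop
    · simp only [hE, Fin.mk_one, one_ne_zero, if_false]; fun_prop
  have hs : ∀ t, ∀ z ∈ Icc (0 : ℝ) 1, ∀ i, P.scaled (x t) z i = E i z * x t z i :=
    fun t z hz i => by
      fin_cases i <;> simp [hE, PDEODESystem.scaled, clampUnit_eq hz]
  constructor
  · intro i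
    have : (fun p : Icc (0 : ℝ) 1 × Ici (0 : ℝ) => P.scaled (x p.2) p.1 i) =
        fun p => E i p.1 * x p.2 p.1 i := funext fun p => hs p.2 p.1 p.1.2 i
    rw [this]
    exact ((hEc i).measurable.comp (measurable_subtype_coe.comp measurable_fst)).mul
      (hx.measurable i)
  · intro T
    obtain ⟨M, hM⟩ := hx.locally_bounded T
    have hb : ∀ i, ∃ B, ∀ z ∈ Icc (0 : ℝ) 1, ‖E i z‖ ≤ B := fun i =>
      isCompact_Icc.exists_bound_of_continuousOn (hEc i).continuousOn
    choose B hB using hb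
    have hB0 : ∀ i, 0 ≤ B i := fun i => (norm_nonneg _).trans (hB i 0 ⟨le_rfl, zero_le_one⟩)
    refine ⟨(B 0 + B 1) * |M|, fun t ht z hz i => ?_⟩
    rw [hs t z hz i, abs_mul]
    refine mul_le_mul ((hB i z hz).trans ?_) ((hM t ht z hz i).trans (le_abs_self M))
      (abs_nonneg _) (add_nonneg (hB0 0) (hB0 1))
    fin_cases i
    · exact le_add_of_nonneg_right (hB0 1)
    · exact le_add_of_nonneg_left (hB0 0)

/-- The second component of `x̄` depends only on the past half of the window, which is all that is
known of the trajectory from the initial state before the solution is used. -/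
theorem parX_one_congr {ξ ξ' : ℝ → Fin n → ℝ} {v v' : ℝ → ℝ}
    (hξ : EqOn ξ ξ' (Icc (-P.tau2) 0)) (hv : EqOn v v' (Icc (-P.tau2) 0)) {z : ℝ}
    (hz : z ∈ Icc (0 : ℝ) 1) : P.parX K ξ v z 1 = P.parX K ξ' v' z 1 := by
  have h1 := P.phi_mem 1 hz
  have hw : ∀ r ∈ Icc 0 (P.phi 1 1), -r ∈ Icc (-P.tau2) 0 := fun r hr =>
    ⟨neg_le_neg hr.2, neg_nonpos.2 hr.1⟩
  have e1 := memory_congr (m := P.impulse K 1) (w := fun σ => P.c ⬝ᵥ ξ (-σ))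
    (w' := fun σ => P.c ⬝ᵥ ξ' (-σ)) h1.1
    fun σ hσ => by simp only [hξ (hw σ ⟨hσ.1, hσ.2.trans h1.2⟩)]
  simp only [parX, Matrix.cons_val_one, Matrix.cons_val_zero, e1, hv (hw _ h1), hξ (hw _ h1)]

theorem StripSolution.bdry {v₁ v₂ : ℝ → ℝ} {X₁ X₂ : ℝ × ℝ → ℝ}
    (hX : P.StripSolution v₁ v₂ X₁ X₂) (t : ℝ) : X₁ (t, 0) = v₁ t ∧ X₂ (t, 0) = v₂ t := by
  have h0 : (0 : ℝ) ∈ Icc (0 : ℝ) 1 := ⟨le_rfl, zero_le_one⟩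
  have h1 := hX.eq₁ t 0 h0
  have h2 := hX.eq₂ t 0 h0
  simp only [Speed.phi_zero, add_zero, sub_zero, intervalIntegral.integral_same] at h1 h2
  exact ⟨h1, h2⟩

theorem phi_zero_right (i : Fin 2) : P.phi i 0 = 0 := by simp [phi]

section

variable {ξx : ℝ → Fin n → ℝ} {x : ℝ → ℝ → Fin 2 → ℝ} {u : ℝ → ℝ}

theorem IsSolution.isLocBddProfile (h : P.IsSolution ξx x u) : IsLocBddProfile x :=
  ⟨h.measurable, h.locally_bounded⟩

theorem locBddOn_div_speed (i j k : Fin 2) (a b : ℝ) :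
    LocBddOn (fun ζ => P.coupling i j ζ / (P.speed k).l ζ) a b :=
  .of_locBdd (.of_continuous ((P.continuous_coupling i j).div (P.speed k).continuous_l
    (P.speed k).ne_zero))

/-- A solution of the system follows the solution on the strip that is generated by its boundary
values, extended to negative times in accordance with the initial profile. -/
theorem IsSolution.followsStrip (hK : P.IsKernel K) (hq : P.q0 ≠ 0) (h : P.IsSolution ξx x u)
    {ξ : ℝ → Fin n → ℝ} {v : ℝ → ℝ} (ht : ∀ T, P.IsTrajectory ξ v (-P.tau2) T)
    (hξ : ∀ t, 0 ≤ t → ξ t = ξx t) (hv : ∀ t, 0 ≤ t → v t = x t 0 0)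
    (hinit : ∀ z ∈ Icc (0 : ℝ) 1, P.xbar K (x 0) z 1 = P.parX K ξ v z 1) :
    P.FollowsStrip ξ v x := by
  intro T
  obtain ⟨v₁, v₂, X₁, X₂, hX, e₁, e₂⟩ := (ht (T + P.tau1)).exists_strip
  refine ⟨v₁, v₂, X₁, X₂, hX, e₁, e₂, ?_⟩
  rcases lt_or_ge T 0 with hT | hT
  · exact fun t ht => absurd (ht.1.trans ht.2) (not_le.2 hT)
  have hp := h.isLocBddProfile
  have hps := hp.scaled (P := P)
  have h01 : (0 : ℝ) ∈ Icc (0 : ℝ) 1 := ⟨le_rfl, zero_le_one⟩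
  have hXp : ∀ T, ∃ M, ∀ t ∈ Icc 0 T, ∀ z ∈ Icc (0 : ℝ) 1, ∀ i, |P.scaled (x t) z i| ≤ M :=
    hps.locally_bounded
  obtain ⟨M, hM⟩ := hXp (T + P.tau1)
  obtain ⟨C, hC⟩ := hX.bdd
  have hk : ∀ i : Fin 2, ∃ B, ∀ z ∈ Icc (0 : ℝ) 1, ∀ ζ ∈ Icc 0 z, |K z ζ 1 i| ≤ B := fun i => by
    obtain ⟨B, hB⟩ := (isCompact_Icc.prod isCompact_Icc).exists_bound_of_continuousOn
      (s := Icc (0 : ℝ) 1 ×ˢ Icc (0 : ℝ) 1) (hK.continuous_ext 1 i).continuousOn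
    refine ⟨B, fun z hz ζ hζ => ?_⟩
    have := hB (z, ζ) ⟨hz, hζ.1, hζ.2.trans hz.2⟩
    rwa [Goursat.toTriangle_eq hζ.1 hζ.2 hz.2] at this
  choose B hB using hk
  have hX' : ∀ t, ∀ i, LocBddOn (fun z => ![X₁ (t, z), X₂ (t, z)] i) 0 1 := locBddOn_strip hX
  -- Applied to the difference of the scaled profile and the strip solution. With `S = T + τ₁` the
  -- domain of dependence contains all of `[0, T] × [0, 1]`, and no boundary condition at `z = 1` is
  -- required.
  have key := eq_zero_of_transport (P.speed 0) (P.speed 1) (P.continuous_coupling 0 1)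
    (P.continuous_coupling 1 0) (k := fun i z ζ => K z ζ 1 i) (Ck := max (B 0) (B 1))
    (fun i z hz ζ hζ => (hB i z hz ζ hζ).trans (by
      fin_cases i
      · exact le_max_left _ _
      · exact le_max_right _ _))
    (e₁ := fun t z => P.scaled (x t) z 0 - X₁ (t, z))
    (e₂ := fun t z => P.scaled (x t) z 1 - X₂ (t, z)) (S := T + P.tau1) (M := M + C)
    (fun t ht htS z hz => ⟨(abs_sub _ _).trans (add_le_add (hM t ⟨ht, htS⟩ z hz 0) (hC _).1),
      (abs_sub _ _).trans (add_le_add (hM t ⟨ht, htS⟩ z hz 1) (hC _).2)⟩)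
    (fun t ht z hz htS => ?_) (fun t ht z hz z' hz' htS => ?_) (fun t ht htS => ?_)
    (fun z hz _ => ?_)
  · intro t ht z hz
    have hle := (P.phi_mem 0 hz).2
    have htau : P.phi 0 1 = P.tau1 := rfl
    have := key t ht.1 z hz (by rw [P.speed_phi 0 hz]; linarith [ht.2])
    funext i
    fin_cases i
    · exact sub_eq_zero.1 this.1
    · exact sub_eq_zero.1 this.2
  · rw [P.speed_phi 0 hz] at htS
    have hφ := (P.phi_mem 0 hz).1
    have a1 := (transport_iff₀ (P := P) hp ht hz).1
      (fun ζ hζ => h.pde1 t ht ζ z hζ.1 hζ.2 hz.2) 0 ⟨le_rfl, hz.1⟩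
    have a2 := hX.transport₀ t h01 hz
    rw [phi_zero_right, sub_zero] at a1 a2
    rw [scaled_zero, ← hv _ (by linarith), e₁ ⟨by linarith [P.tau2_nonneg], htS⟩,
      ← (hX.bdry _).1, a2] at a1
    have i1 : IntervalIntegrable (fun ζ => P.coupling 0 1 ζ *
        P.scaled (x (t + (P.phi 0 z - P.phi 0 ζ))) ζ 1 / (P.speed 0).l ζ) volume 0 z := by
      simp only [mul_div_right_comm]
      exact ((locBddOn_div_speed 0 1 0 0 z).mul (locBddOn_along₀ hps ht hz 1)).intervalIntegrable
        ⟨le_rfl, hz.1⟩ ⟨hz.1, le_rfl⟩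
    have i2 : IntervalIntegrable (fun ζ => P.coupling 0 1 ζ *
        X₂ (t + (P.phi 0 z - P.phi 0 ζ), ζ) / (P.speed 0).l ζ) volume 0 z := by
      simp only [mul_div_right_comm]
      have := (P.speed 0).continuous_phi
      refine ((locBddOn_div_speed 0 1 0 0 z).mul ((LocBddOn.of_locBdd (hX.locBdd₂.comp
        (k := fun ζ => (t + (P.phi 0 z - (P.speed 0).phi ζ), ζ)) (by fun_prop))).congr
        fun ζ hζ => ?_)).intervalIntegrable ⟨le_rfl, hz.1⟩ ⟨hz.1, le_rfl⟩
      simp only [P.speed_phi 0 ⟨hζ.1, hζ.2.trans hz.2⟩]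
    have e : ∫ ζ in (0 : ℝ)..z, P.coupling 0 1 ζ *
        (P.scaled (x (t + (P.speed 0).phi z - (P.speed 0).phi ζ)) ζ 1 -
          X₂ (t + (P.speed 0).phi z - (P.speed 0).phi ζ, ζ)) / (P.speed 0).l ζ =
        ∫ ζ in (0 : ℝ)..z, (P.coupling 0 1 ζ *
        P.scaled (x (t + (P.phi 0 z - P.phi 0 ζ))) ζ 1 / (P.speed 0).l ζ - P.coupling 0 1 ζ *
        X₂ (t + (P.phi 0 z - P.phi 0 ζ), ζ) / (P.speed 0).l ζ) := by
      refine intervalIntegral.integral_congr fun ζ hζ => ?_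
      simp only [P.speed_phi 0 hz, P.speed_phi 0 (uIcc_zero_subset_unit hz hζ), add_sub_assoc]
      ring
    rw [e, intervalIntegral.integral_sub i1 i2]
    linarith
  · have hz1 : z' ∈ Icc (0 : ℝ) 1 := ⟨hz.1.trans hz'.1, hz'.2⟩
    have a1 := (transport_iff₁ (P := P) hp ht hz).1
      (fun ζ hζ => h.pde2 t ht z ζ hz.1 hζ.1 hζ.2) z' hz'
    have a2 := hX.transport₁ t hz hz1
    have i1 : IntervalIntegrable (fun ζ => P.coupling 1 0 ζ *
        P.scaled (x (t + (P.phi 1 ζ - P.phi 1 z))) ζ 0 / (P.speed 1).l ζ) volume z z' := by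
      simp only [mul_div_right_comm]
      exact ((locBddOn_div_speed 1 0 1 z 1).mul (locBddOn_along₁ hps ht hz 0)).intervalIntegrable
        ⟨le_rfl, hz.2⟩ hz'
    have i2 : IntervalIntegrable (fun ζ => P.coupling 1 0 ζ *
        X₁ (t + (P.phi 1 ζ - P.phi 1 z), ζ) / (P.speed 1).l ζ) volume z z' := by
      simp only [mul_div_right_comm]
      have := (P.speed 1).continuous_phi
      refine ((locBddOn_div_speed 1 0 1 z 1).mul ((LocBddOn.of_locBdd (hX.locBdd₁.comp
        (k := fun ζ => (t + ((P.speed 1).phi ζ - P.phi 1 z), ζ)) (by fun_prop))).congr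
        fun ζ hζ => ?_)).intervalIntegrable ⟨le_rfl, hz.2⟩ hz'
      simp only [P.speed_phi 1 ⟨hz.1.trans hζ.1, hζ.2⟩]
    have e : ∫ ζ in z..z', P.coupling 1 0 ζ *
        (P.scaled (x (t + (P.speed 1).phi ζ - (P.speed 1).phi z)) ζ 0 -
          X₁ (t + (P.speed 1).phi ζ - (P.speed 1).phi z, ζ)) / (P.speed 1).l ζ =
        ∫ ζ in z..z', (P.coupling 1 0 ζ *
        P.scaled (x (t + (P.phi 1 ζ - P.phi 1 z))) ζ 0 / (P.speed 1).l ζ - P.coupling 1 0 ζ *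
        X₁ (t + (P.phi 1 ζ - P.phi 1 z), ζ) / (P.speed 1).l ζ) := by
      refine intervalIntegral.integral_congr fun ζ hζ => ?_
      simp only [P.speed_phi 1 hz, P.speed_phi 1 (uIcc_subset_Icc hz hz1 hζ), add_sub_assoc]
      ring
    rw [e, intervalIntegral.integral_sub i1 i2, P.speed_phi 1 hz, P.speed_phi 1 hz1,
      add_sub_assoc, a1, a2]
    ring
  · have hmem : t ∈ Icc (-P.tau2) (T + P.tau1) := ⟨by linarith [P.tau2_nonneg], htS⟩
    have := e₂ hmem
    simp only at this
    rw [(hX.bdry t).2, ← this, scaled_zero, h.bc0 t ht, hv t ht, hξ t ht, sub_self]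
  -- At time `0` only the second components of the transformed profiles are known to agree. Hence
  -- the second component of the difference is a Volterra integral of both components, which is the
  -- initial condition required.
  · have b1 := hX.sub_volterra hK hq e₁ e₂ (t := 0) hz 1
      (strip_window ⟨le_rfl, hT⟩ hz 1)
    simp only [zero_add] at b1
    have b2 := hinit z hz
    rw [xbar_eq, Pi.sub_apply, ← b1] at b2
    have b3 := congrFun (hK.volterra_sub (X := P.scaled (x 0))
      (X' := fun z => ![X₁ (0, z), X₂ (0, z)]) (locBddOn_scaled (h.pc 0 le_rfl)) (hX' 0) hz) 1
    have b4 : volterra K (fun z => P.scaled (x 0) z - ![X₁ (0, z), X₂ (0, z)]) z 1 =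
        ∫ ζ in (0 : ℝ)..z, (K z ζ 1 0 * (P.scaled (x 0) ζ 0 - X₁ (0, ζ)) +
          K z ζ 1 1 * (P.scaled (x 0) ζ 1 - X₂ (0, ζ))) :=
      intervalIntegral.integral_congr fun ζ _ => by
        simp only [Matrix.mulVec, dotProduct, Fin.sum_univ_two, Pi.sub_apply,
          Matrix.cons_val_zero, Matrix.cons_val_one]
    simp only [Pi.sub_apply, Matrix.cons_val_one, Matrix.cons_val_zero] at b2 b3 ⊢
    rw [← b4, b3]
    linarith

/-- The system has a history. -/
theorem IsSolution.exists_history (hc : P.Controllable) (hK : P.IsKernel K) (hq : P.q0 ≠ 0)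
    (h : P.IsSolution ξx x u) {η : ℝ → Fin n → ℝ} {ηd : ℝ → ℝ → ℝ}
    (hC : ∀ t, 0 ≤ t → P.Corresponds K (ξx t) (x t) (η t) (ηd t)) :
    ∃ ξ v, P.IsHistory ξ v η ηd := by
  have h00 := hC 0 le_rfl
  have ht0 := h00.isHCCFState.isTrajectory hc
  -- For negative times the trajectory encoded in the initial canonical state, afterwards the
  -- boundary values of the solution; the correspondence at `t = 0` makes them fit.
  set ξ : ℝ → Fin n → ℝ := fun τ => if 0 ≤ τ then ξx τ else P.xiPar (η 0) (ηd 0) τ with hξ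
  set v : ℝ → ℝ := fun τ => if 0 ≤ τ then x τ 0 0 else P.x10Par (η 0) (ηd 0) τ with hv
  have ξp : ∀ τ, 0 ≤ τ → ξ τ = ξx τ := fun τ h => if_pos h
  have vp : ∀ τ, 0 ≤ τ → v τ = x τ 0 0 := fun τ h => if_pos h
  have ξm : ∀ τ, τ ≤ 0 → ξ τ = P.xiPar (η 0) (ηd 0) τ := fun τ h => by
    rcases h.lt_or_eq with h | rfl
    · exact if_neg (not_le.2 h)
    · rw [ξp 0 le_rfl, h00.xi_eq]
  have vm : ∀ τ, τ ≤ 0 → v τ = P.x10Par (η 0) (ηd 0) τ := fun τ h => by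
    rcases h.lt_or_eq with h | rfl
    · exact if_neg (not_le.2 h)
    · rw [vp 0 le_rfl, h00.x_zero]
  have hw0 := (zero_mem_window (P := P)).1
  have htm := ht0.mono (a' := -P.tau2) (b' := 0) le_rfl P.tau1_nonneg
  have traj0 : ∀ T, 0 ≤ T → P.IsTrajectory ξ v (-P.tau2) T := fun T hT => by
    refine .of_base ⟨hw0, hT⟩ ?_ (.glue (b := 0) ?_ ?_) fun τ hτ i => ?_
    · rw [← Icc_union_Icc_eq_Icc hw0 hT]
      exact (htm.cont.congr fun τ hτ => ξm τ hτ.2).union_of_isClosed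
        ((h.xi_continuousOn.mono fun τ hτ => hτ.1).congr fun τ hτ => ξp τ hτ.1)
        isClosed_Icc isClosed_Icc
    · exact htm.locBdd.congr fun τ hτ => vm τ hτ.2
    · exact (h.isLocBddProfile.locBddOn continuous_id continuous_const
        (fun ζ hζ => hζ.1) (fun _ _ => ⟨le_rfl, zero_le_one⟩) 0).congr fun τ hτ => vp τ hτ.1
    · rcases le_total 0 τ with h0 | h0
      · rw [ξp τ h0, ξp 0 le_rfl, h.ode τ h0]
        congr 1
        refine intervalIntegral.integral_congr fun s hs => ?_
        rw [uIcc_of_le h0] at hs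
        simp only [ξp s hs.1, vp s hs.1]
      · rw [ξm τ h0, ξm 0 le_rfl, htm.eq_add_integral ⟨hw0, le_rfl⟩ ⟨hτ.1, h0⟩]
        congr 1
        refine intervalIntegral.integral_congr fun s hs => ?_
        rw [uIcc_of_ge h0] at hs
        simp only [ξm s hs.2, vm s hs.2]
  have traj : ∀ T, P.IsTrajectory ξ v (-P.tau2) T := fun T =>
    (traj0 (max T 0) (le_max_right _ _)).mono le_rfl (le_max_left _ _)
  have hs := h.followsStrip hK hq traj ξp vp fun z hz => by
    rw [h00.xbar_eq z hz, xbarPar_eq _ _ hz]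
    exact parX_one_congr (fun τ hτ => (ξm τ hτ.2).symm) (fun τ hτ => (vm τ hτ.2).symm) hz
  -- The shifted history and the trajectory encoded in the canonical state at time `t` have the same
  -- `ξ` and the same profile `x̄` at that time, so they agree on the whole window.
  have key : ∀ t, 0 ≤ t →
      EqOn (P.xiPar (η t) (ηd t)) (fun τ => ξ (t + τ)) (Icc (-P.tau2) P.tau1) ∧
      EqOn (P.x10Par (η t) (ηd t)) (fun τ => v (t + τ)) (Icc (-P.tau2) P.tau1) := fun t ht => by
    have htr := ((traj (t + P.tau1)).shift t).mono (a' := -P.tau2) (b' := P.tau1)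
      (by linarith) (by linarith)
    refine ((hC t ht).isHCCFState.isTrajectory hc).unique hK hq htr ?_ fun z hz => ?_
    · rw [← (hC t ht).xi_eq, add_zero, ξp t ht]
    · obtain ⟨v₁, v₂, X₁, X₂, hX, e₁, e₂, hx⟩ := hs t
      have htt : t ∈ Icc 0 t := ⟨ht, le_rfl⟩
      rw [← xbarPar_eq _ _ hz, ← (hC t ht).xbar_eq z hz, xbar_eq, hx t htt z hz,
        volterra_congr hz.1 fun ζ hζ => hx t htt ζ ⟨hζ.1, hζ.2.trans hz.2⟩]
      funext i
      exact hX.sub_volterra hK hq e₁ e₂ hz i (strip_window htt hz i)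
  exact ⟨ξ, v, traj, fun t ht => (key t ht).1, fun t ht => (key t ht).2⟩

end

end PDEODESystem

end SolutionHistory

/-! ### The canonical state as derivatives of the flat output. -/

section FlatState
open MeasureTheory

/-- Continuity of the integrand is needed only at the point considered, so this also reaches the top
derivative, whose values are merely piecewise continuous. -/
theorem hasDerivWithinAt_Ici_of_primitive {F g : ℝ → ℝ} (hg : ∀ T, LocBddOn g 0 T)
    (hF : ∀ t, 0 ≤ t → F t = F 0 + ∫ s in (0 : ℝ)..t, g s) {t : ℝ} (ht : 0 ≤ t)
    (hc : ContinuousWithinAt g (Ici 0) t) : HasDerivWithinAt F (g t) (Ici 0) t := by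
  obtain ⟨f, hf, e⟩ := hg (t + 1)
  have htm : t ∈ Icc 0 (t + 1) := ⟨ht, by linarith⟩
  have : Fact (t ∈ Icc 0 (t + 1)) := ⟨htm⟩
  have hcf : ContinuousWithinAt f (Icc 0 (t + 1)) t :=
    (hc.mono Icc_subset_Ici_self).congr (fun s hs => (e hs).symm) (e htm).symm
  have h1 := (intervalIntegral.integral_hasDerivWithinAt_right (s := Icc 0 (t + 1))
    (t := Icc 0 (t + 1)) (hf.intervalIntegrable 0 t)
    (hf.meas.stronglyMeasurable.stronglyMeasurableAtFilter) hcf).const_add (F 0)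
  have h2 : HasDerivWithinAt F (g t) (Icc 0 (t + 1)) t := by
    rw [e htm]
    have key : ∀ s ∈ Icc 0 (t + 1), F s = F 0 + ∫ r in (0 : ℝ)..s, f r := fun s hs => by
      rw [hF s hs.1]
      congr 1
      refine intervalIntegral.integral_congr fun r hr => ?_
      rw [uIcc_of_le hs.1] at hr
      exact e ⟨hr.1, hr.2.trans hs.2⟩
    exact h1.congr key (key t htm)
  exact h2.mono_of_mem_nhdsWithin (by
    rw [← Ici_inter_Iic]
    exact inter_mem_nhdsWithin _ (Iic_mem_nhds (by linarith)))

namespace PDEODESystem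

variable {n : ℕ} {P : PDEODESystem n} {K : ℝ → ℝ → Matrix (Fin 2) (Fin 2) ℝ}
  {ξ : ℝ → Fin n → ℝ} {v : ℝ → ℝ} {η : ℝ → Fin n → ℝ} {ηd : ℝ → ℝ → ℝ}

variable (P) in
/-- The candidate `hᵀ F^k ξ` for the `k`-th derivative of the flat output. -/
noncomputable def flatDer (ξ : ℝ → Fin n → ℝ) (k : ℕ) (t : ℝ) : ℝ := (P.h ᵥ* P.F ^ k) ⬝ᵥ ξ t

theorem IsHistory.flatDer_eq (h : P.IsHistory ξ v η ηd) (hc : P.Controllable) {k : ℕ}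
    (hk : k < n) {t : ℝ} (ht : 0 ≤ t) : P.flatDer ξ k t = P.flatDer ξ k 0 +
      ∫ s in (0 : ℝ)..t, if k + 1 < n then P.flatDer ξ (k + 1) s else v s + P.flatDer ξ n s := by
  have h0 := (zero_mem_window (P := P)).1
  have := (h.traj t).chain hc (s := 0) (t := t) ⟨h0, ht⟩ ⟨h0.trans ht, le_rfl⟩ ⟨k, hk⟩
  exact this

theorem IsHistory.continuousOn_flatDer (h : P.IsHistory ξ v η ηd) (k : ℕ) :
    ContinuousOn (P.flatDer ξ k) (Ici 0) :=
  (continuousOn_dotProduct _ h.continuousOn).mono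
    (Ici_subset_Ici.2 (zero_mem_window (P := P)).1)

theorem IsHistory.hasDerivWithinAt_flatDer (h : P.IsHistory ξ v η ηd) (hc : P.Controllable)
    {k : ℕ} (hk : k + 1 < n) {t : ℝ} (ht : 0 ≤ t) :
    HasDerivWithinAt (P.flatDer ξ k) (P.flatDer ξ (k + 1) t) (Ici 0) t :=
  hasDerivWithinAt_Ici_of_primitive
    (fun _ => .of_continuousOn ((h.continuousOn_flatDer (k + 1)).mono Icc_subset_Ici_self))
    (fun t ht => by simpa only [hk, if_true] using h.flatDer_eq hc (k := k) (by omega) ht) ht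
    (h.continuousOn_flatDer (k + 1) t ht)

/-- Each coordinate of the chain is the derivative of the preceding one, and all `n` of them are
continuous; only the input that follows the last may jump. -/
theorem IsHistory.contDiffOn_flatDer (h : P.IsHistory ξ v η ηd) (hc : P.Controllable) (i : ℕ) :
    ∀ k, k + i < n → ContDiffOn ℝ i (P.flatDer ξ k) (Ici 0) := by
  induction i with
  | zero => exact fun k _ => contDiffOn_zero.2 (h.continuousOn_flatDer k)
  | succ i ih =>
    intro k hk
    push_cast
    rw [contDiffOn_succ_iff_derivWithin (uniqueDiffOn_Ici 0)]
    refine ⟨fun t ht => (h.hasDerivWithinAt_flatDer hc (by omega) ht).differentiableWithinAt,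
      fun hω => absurd hω (by simp), (ih (k + 1) (by omega)).congr fun t ht => ?_⟩
    exact (h.hasDerivWithinAt_flatDer hc (by omega) ht).derivWithin (uniqueDiffOn_Ici 0 t ht)

theorem IsHistory.iteratedDerivWithin_eq (h : P.IsHistory ξ v η ηd) (hc : P.Controllable)
    {y : ℝ → ℝ} (hy : EqOn y (P.flatDer ξ 0) (Ici 0)) (k : ℕ) (hk : k < n) :
    EqOn (iteratedDerivWithin k y (Ici 0)) (P.flatDer ξ k) (Ici 0) := by
  induction k with
  | zero => simpa only [iteratedDerivWithin_zero] using hy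
  | succ k ih =>
    intro t ht
    have ih' := ih (by omega)
    rw [iteratedDerivWithin_succ, derivWithin_congr ih' (ih' ht)]
    exact (h.hasDerivWithinAt_flatDer hc hk ht).derivWithin (uniqueDiffOn_Ici 0 t ht)

/-- The states of the canonical form are given by the flat output. -/
theorem IsHistory.isFlatState (hc : P.Controllable) (h : P.IsHistory ξ v η ηd)
    {ξx : ℝ → Fin n → ℝ} {x : ℝ → ℝ → Fin 2 → ℝ}
    (hC : ∀ t, 0 ≤ t → P.Corresponds K (ξx t) (x t) (η t) (ηd t)) :
    P.IsFlatState (P.flatOutput ξx x) η ηd := by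
  have hy : 0 < n → EqOn (P.flatOutput ξx x) (P.flatDer ξ 0) (Ici 0) := fun hn t ht => by
    rw [flatOutput, if_neg hn.ne', h.xi_eq_of_corresponds hC ht, flatDer, pow_zero,
      Matrix.vecMul_one]
  refine ⟨fun i hi => (h.contDiffOn_flatDer hc i 0 (by omega)).congr (hy (by omega)),
    fun t ht i => ?_, fun t ht => ?_⟩
  · have ht0 : 0 ≤ t := P.tau2_nonneg.trans ht
    rw [h.eta_eq hc ht0, h.iteratedDerivWithin_eq hc (hy (Nat.zero_lt_of_lt i.isLt)) i i.isLt
      (sub_nonneg.2 ht)]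
    rfl
  · obtain ⟨⟨S, hS, hcont⟩, -, -⟩ := (hC t ht).isHCCFState
    -- The exceptional points are the discontinuities of the profile and the two ends of the window,
    -- where continuity is one-sided only.
    refine (hS.union (toFinite {-P.tau2, P.tau1})).subset fun τ hτ => ?_
    by_contra hτS
    obtain ⟨hτw, hτ0, hτn⟩ := hτ
    refine hτn ?_
    simp only [mem_union, mem_insert_iff, mem_singleton_iff, not_or] at hτS
    obtain ⟨hτS, hl, hr⟩ := hτS
    have hval := h.etad_eq ht hτw
    -- Without an ODE the flat output is `x₁(0,·)` itself, and the profile agrees with it at every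
    -- point.
    rcases Nat.eq_zero_or_pos n with rfl | hn
    · refine ⟨fun h => absurd h (lt_irrefl _), ?_⟩
      rw [iteratedDerivWithin_zero, flatOutput, if_pos rfl, h.v_eq_of_corresponds hC hτ0, hval]
      simp [dotProduct]
    · obtain ⟨m, rfl⟩ := Nat.exists_eq_add_of_le' hn
      have hwc : ContinuousWithinAt (fun r => v r + P.flatDer ξ (m + 1) r) (Ici 0) (t + τ) := by
        have hlt : -P.tau2 < τ := lt_of_le_of_ne hτw.1 (Ne.symm hl)
        have hgt : τ < P.tau1 := lt_of_le_of_ne hτw.2 hr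
        have h1 : ContinuousAt (ηd t) τ :=
          (hcont τ ⟨hτw, hτS⟩).continuousAt (Icc_mem_nhds hlt hgt)
        have h2 : ContinuousAt (fun r => ηd t (r - t)) (t + τ) :=
          ContinuousAt.comp (f := fun r => r - t) (by simpa using h1) (by fun_prop)
        refine (h2.congr ?_).continuousWithinAt
        filter_upwards [Icc_mem_nhds (show t + -P.tau2 < t + τ by linarith)
          (show t + τ < t + P.tau1 by linarith)] with r hr
        rw [h.etad_eq ht (τ := r - t) ⟨by linarith [hr.1], by linarith [hr.2]⟩,
          add_sub_cancel]
        rfl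
      have hlb : ∀ T, LocBddOn (fun r => v r + P.flatDer ξ (m + 1) r) 0 T := fun T =>
        ((h.traj T).locBdd.mono (zero_mem_window (P := P)).1 le_rfl).add
          (.of_continuousOn ((h.continuousOn_flatDer (m + 1)).mono Icc_subset_Ici_self))
      have hd := hasDerivWithinAt_Ici_of_primitive (F := P.flatDer ξ m) hlb
        (fun t ht => by
          simpa only [lt_irrefl, if_false] using h.flatDer_eq hc (Nat.lt_succ_self m) ht) hτ0 hwc
      have he := h.iteratedDerivWithin_eq hc (hy hn) m (Nat.lt_succ_self m)
      refine ⟨fun _ => ?_, ?_⟩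
      · rw [Nat.add_sub_cancel]
        exact (hd.congr he (he hτ0)).differentiableWithinAt
      · rw [iteratedDerivWithin_succ, derivWithin_congr he (he hτ0),
          hd.derivWithin (uniqueDiffOn_Ici 0 _ hτ0), hval]
        rfl

end PDEODESystem

end FlatState

/-! ### The equivalence assembled. -/

theorem lemma2 {n : ℕ} (P : PDEODESystem n) (hA1 : P.Controllable) (hA2 : P.q0 ≠ 0) :
    (∃ K, P.IsKernel K) ∧
    ∀ K, P.IsKernel K →
      P.CorrespondsBijectively K ∧
      ∃ (a : Fin (n + 1) → ℝ) (ad : ℝ → ℝ), ContinuousOn ad (Icc (-P.tau2) P.tau1) ∧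
        ∀ (ξ : ℝ → Fin n → ℝ) (x : ℝ → ℝ → Fin 2 → ℝ) (u : ℝ → ℝ)
          (η : ℝ → Fin n → ℝ) (ηd : ℝ → ℝ → ℝ) (ubar : ℝ → ℝ),
          (∀ t, 0 ≤ t → P.Corresponds K (ξ t) (x t) (η t) (ηd t)) →
          (∀ t, 0 ≤ t → ubar t = P.inputTransform K (x t) (u t)) →
          (P.IsSolution ξ x u ↔ P.IsHCCFSolution a ad η ηd ubar) ∧
          (P.IsSolution ξ x u → P.IsFlatState (P.flatOutput ξ x) η ηd) := by
  refine ⟨P.exists_isKernel hA2, fun K hK =>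
    ⟨PDEODESystem.correspondsBijectively hA1 hA2 hK, ?_⟩⟩
  obtain ⟨a, ad, had, hbc⟩ := hK.exists_coefficients
  refine ⟨a, ad, had, fun ξ x u η ηd ubar hC hu => ⟨⟨fun hS => ?_, fun hH => ?_⟩, fun hS => ?_⟩⟩
  -- Either set of equations produces a history, from which the other follows; `hbc` exchanges the
  -- boundary conditions at the controlled end for each time separately.
  · obtain ⟨ξ', v, h⟩ := hS.exists_history hA1 hK hA2 hC
    refine h.isHCCFSolution hA1 (fun t ht => (hC t ht).isHCCFState) fun t ht => ?_
    rw [hu t ht]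
    exact (hbc _ _ _ _ (u t) (hC t ht)).1 (hS.bc1 t ht)
  · obtain ⟨ξ', v, h⟩ := hH.exists_history hA1
    refine h.isSolution hK hA2 hC fun t ht => (hbc _ _ _ _ (u t) (hC t ht)).2 ?_
    rw [← hu t ht]
    exact hH.bc t ht
  · obtain ⟨ξ', v, h⟩ := hS.exists_history hA1 hK hA2 hC
    exact h.isFlatState hA1 hC
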